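/- Let $N\ge 1$ be an integer, let $\Delta\in\mathbb Z$ be a fundamental discriminant (possibly $1$) and let $r\in\mathbb Z$ satisfy $\Delta\equiv r^2 \pmod{4N}$. On real trace-zero $2\times2$ matrices put $Q(\lambda)=N\det\lambda$ and $(\lambda,\mu)=-N\,\mathrm{tr}(\lambda\mu)$, and let $$L=\left\{\begin{pmatrix} b&-a/N\\ c&-b\end{pmatrix}: a,b,c\in\mathbb Z\right\},\qquad L'=\left\{\begin{pmatrix} b/2N&-a/N\\ c&-b/2N\end{pmatrix}: a,b,c\in\mathbb Z\right\}.$$ Put $Q_\Delta=Q/|\Delta|$, and let $\pi:L'/\Delta L\to L'/L$ be the projection. For $\delta=\begin{pmatrix} b/2N&-a/N\\ c&-b/2N\end{pmatrix}\in L'$ let $\chi_\Delta(\delta)=\left(\frac{\Delta}{n}\right)$ (Kronecker symbol) if $\Delta\mid b^2-4Nac$, $(b^2-4Nac)/\Delta$ is a square modulo $4N$ and $\gcd(a,b,c,\Delta)=1$, where $n$ is any integer prime to $\Delta$ represented by one of the forms $[N_1a,b,N_2c]$ with $N_1N_2=N$, $N_1,N_2>0$; otherwise let $\chi_\Delta(\delta)=0$.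 The value $\chi_\Delta(\delta)$ depends only on $\delta$ modulo $\Delta L$. For $z=x+iy\in\mathbb H$ put $\lambda(z)=\frac1{\sqrt N\,y}\begin{pmatrix}-x&|z|^2\\-1&x\end{pmatrix}$, $R(\lambda,z)=\tfrac12(\lambda,\lambda(z))^2-(\lambda,\lambda)$, $\omega=\frac i2\frac{dz\wedge d\bar z}{y^2}$, and $$\varphi^0_\Delta(\lambda,z)=\Big(\tfrac1{|\Delta|}(\lambda,\lambda(z))^2-\tfrac1{2\pi}\Big)e^{-2\pi R(\lambda,z)/|\Delta|}\,\omega .$$ For $\tau=u+iv\in\mathbb H$, $\delta\in L'/\Delta L$ and $h\in L'/L$ define $$\Theta_\delta(\tau,z)=\sum_{\lambda\in\Delta L+\delta}e^{2\pi iQ_\Delta(\lambda)\tau}\varphi^0_\Delta(\sqrt v\,\lambda,z),\qquad \Theta_{\Delta,r,h}(\tau,z)=\sum_{\substack{\delta\in L'/\Delta L,\ \pi(\delta)=rh\\ Q_\Delta(\delta)\equiv\mathrm{sgn}(\Delta)Q(h)\ (\mathbb Z)}}\chi_\Delta(\delta)\,\Theta_\delta(\tau,z),$$ and $\Theta_{\Delta,r}=\sum_{h\in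 L'/L}\Theta_{\Delta,r,h}\,\mathfrak e_h$, the twisted Kudla–Millson theta function. Let $\mathrm{Mp}_2(\mathbb Z)$ be the group of pairs $(\gamma,\phi)$ with $\gamma=\begin{pmatrix}a&b\\c&d\end{pmatrix}\in\mathrm{SL}_2(\mathbb Z)$ and $\phi:\mathbb H\to\mathbb C$ holomorphic with $\phi(\tau)^2=c\tau+d$. Let $\rho$ be the Weil representation of $\mathrm{Mp}_2(\mathbb Z)$ on $\mathbb C[L'/L]$, determined on the generators $T=\left(\begin{pmatrix}1&1\\0&1\end{pmatrix},1\right)$ and $S=\left(\begin{pmatrix}0&-1\\1&0\end{pmatrix},\sqrt\tau\right)$ (principal branch) by $$\rho(T)\mathfrak e_\delta=e^{2\pi iQ(\delta)}\mathfrak e_\delta,\qquad \rho(S)\mathfrak e_\delta=\frac{\sqrt i}{\sqrt{|L'/L|}}\sum_{\delta'\in L'/L}e^{-2\pi i(\delta',\delta)}\mathfrak e_{\delta'} .$$ Put $\widetilde\rho=\rho$ if $\Delta>0$ and $\widetilde\rho=\bar\rho$ if $\Delta<0$. **Proposition.** All the series $\Theta_\delta(\tau,z)$ converge absolutely. The function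 $\Theta_{\Delta,r}(\tau,z)$ (that is, its coefficient with respect to $\omega$) is $C^\infty$ on $\mathbb H\times\mathbb H$, and: 1. In $\tau$ it is a non-holomorphic $\mathbb C[L'/L]$-valued modular form of weight $3/2$ for $\widetilde\rho$: for all $(\gamma,\phi)\in\mathrm{Mp}_2(\mathbb Z)$ and $\tau,z\in\mathbb H$, $\ \Theta_{\Delta,r}(\gamma\tau,z)=\phi(\tau)^{3}\,\widetilde\rho(\gamma,\phi)\,\Theta_{\Delta,r}(\tau,z)$. 2. In $z$ it is a non-holomorphic automorphic form of weight $0$ for $\Gamma_0(N)$: for all $\gamma\in\Gamma_0(N)$ and $\tau,z\in\mathbb H$, $\ \Theta_{\Delta,r}(\tau,\gamma z)=\Theta_{\Delta,r}(\tau,z)$. This holds for the coefficient of $\omega$, and equivalently for the two-form under pullback by $\gamma$. Here "non-holomorphic" means "not necessarily holomorphic". -/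

import Mathlib

open Complex
open UpperHalfPlane hiding I
open scoped MatrixGroups ComplexConjugate Real ContDiff Manifold

namespace TwistedKM

/-- The factor of automorphy `c τ + d`. -/
noncomputable def autFactor (g : SL(2, ℤ)) (τ : ℍ) : ℂ := (g 1 0 : ℂ) * τ + (g 1 1 : ℂ)

theorem coe_smul_eq (g : SL(2, ℤ)) (τ : ℍ) :
    ((g • τ : ℍ) : ℂ) = ((g 0 0 : ℂ) * τ + (g 0 1 : ℂ)) / autFactor g τ := by
  rw [UpperHalfPlane.coe_specialLinearGroup_apply]
  simp [autFactor]

theorem autFactor_ne_zero (g : SL(2, ℤ)) (τ : ℍ) : autFactor g τ ≠ 0 := by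
  have := UpperHalfPlane.denom_ne_zero (g : GL (Fin 2) ℝ) τ
  simpa [autFactor, UpperHalfPlane.denom] using this

theorem det_eq (g : SL(2, ℤ)) : (g 0 0 : ℂ) * g 1 1 - (g 0 1 : ℂ) * g 1 0 = 1 := by
  have h := g.det_coe
  rw [Matrix.det_fin_two] at h
  exact_mod_cast h

theorem autFactor_mul (g h : SL(2, ℤ)) (τ : ℍ) :
    autFactor (g * h) τ = autFactor g (h • τ) * autFactor h τ := by
  have h0 := autFactor_ne_zero h τ
  rw [autFactor, autFactor, coe_smul_eq]
  field_simp
  simp only [Matrix.SpecialLinearGroup.coe_mul, Matrix.mul_apply, Fin.sum_univ_two, autFactor]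
  push_cast
  ring

theorem autFactor_one (τ : ℍ) : autFactor 1 τ = 1 := by simp [autFactor]

/-- The integral metaplectic group: pairs of a matrix in `SL₂(ℤ)` and a holomorphic square root
of its factor of automorphy. -/
@[ext] structure Mp2Z where
  mat : SL(2, ℤ)
  fac : ℍ → ℂ
  holo : MDifferentiable 𝓘(ℂ) 𝓘(ℂ) fac
  sq : ∀ τ, fac τ ^ 2 = autFactor mat τ

theorem Mp2Z.fac_ne_zero (g : Mp2Z) (τ : ℍ) : g.fac τ ≠ 0 := by
  intro h
  have := g.sq τ
  rw [h] at this
  exact autFactor_ne_zero g.mat τ (by rw [← this]; simp)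

theorem mdifferentiable_sl (g : SL(2, ℤ)) :
    MDifferentiable 𝓘(ℂ) 𝓘(ℂ) (fun τ : ℍ => g • τ) := by
  have := UpperHalfPlane.mdifferentiable_smul (g := (g : GL (Fin 2) ℝ)) (by simp)
  exact this

noncomputable instance : Mul Mp2Z where
  mul g h :=
    { mat := g.mat * h.mat
      fac := fun τ => g.fac (h.mat • τ) * h.fac τ
      holo := (g.holo.comp (mdifferentiable_sl h.mat)).mul h.holo
      sq := fun τ => by rw [mul_pow, g.sq, h.sq, autFactor_mul] }

noncomputable instance : One Mp2Z where
  one := { mat := 1, fac := fun _ => 1, holo := mdifferentiable_const,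
           sq := fun τ => by simp [autFactor_one] }

noncomputable instance : Inv Mp2Z where
  inv g :=
    { mat := g.mat⁻¹
      fac := fun τ => (g.fac (g.mat⁻¹ • τ))⁻¹
      holo := by
        have h := g.holo.comp (mdifferentiable_sl g.mat⁻¹)
        intro τ
        exact (differentiableAt_inv (g.fac_ne_zero (g.mat⁻¹ • τ))).mdifferentiableAt.comp τ (h τ)
      sq := fun τ => by
        rw [inv_pow, g.sq]
        have h := autFactor_mul g.mat g.mat⁻¹ τ
        rw [mul_inv_cancel, autFactor_one] at h
        exact (eq_inv_of_mul_eq_one_right h.symm).symm }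

theorem Mp2Z.mat_mul (g h : Mp2Z) : (g * h).mat = g.mat * h.mat := rfl
theorem Mp2Z.fac_mul (g h : Mp2Z) (τ : ℍ) : (g * h).fac τ = g.fac (h.mat • τ) * h.fac τ := rfl
theorem Mp2Z.mat_one : (1 : Mp2Z).mat = 1 := rfl
theorem Mp2Z.fac_one (τ : ℍ) : (1 : Mp2Z).fac τ = 1 := rfl
theorem Mp2Z.mat_inv (g : Mp2Z) : (g⁻¹).mat = g.mat⁻¹ := rfl
theorem Mp2Z.fac_inv (g : Mp2Z) (τ : ℍ) : (g⁻¹).fac τ = (g.fac (g.mat⁻¹ • τ))⁻¹ := rfl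

noncomputable instance : Group Mp2Z where
  mul_assoc a b c := by
    ext1
    · simp only [Mp2Z.mat_mul, mul_assoc]
    · funext τ; simp only [Mp2Z.fac_mul, Mp2Z.mat_mul, mul_smul, mul_assoc]
  one_mul a := by
    ext1
    · simp only [Mp2Z.mat_mul, Mp2Z.mat_one, one_mul]
    · funext τ; simp only [Mp2Z.fac_mul, Mp2Z.fac_one, one_mul]
  mul_one a := by
    ext1
    · simp only [Mp2Z.mat_mul, Mp2Z.mat_one, mul_one]
    · funext τ; simp only [Mp2Z.fac_mul, Mp2Z.fac_one, Mp2Z.mat_one, one_smul, mul_one]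
  inv_mul_cancel a := by
    ext1
    · simp only [Mp2Z.mat_mul, Mp2Z.mat_inv, Mp2Z.mat_one, inv_mul_cancel]
    · funext τ
      simp only [Mp2Z.fac_mul, Mp2Z.fac_inv, Mp2Z.fac_one, inv_smul_smul]
      exact inv_mul_cancel₀ (a.fac_ne_zero τ)

/-- The generator `S`, with the principal branch of the square root of `τ`. -/
noncomputable def Mp2Z.S : Mp2Z where
  mat := ModularGroup.S
  fac := fun τ => (τ : ℂ) ^ (1 / 2 : ℂ)
  holo := by
    rw [UpperHalfPlane.mdifferentiable_iff]
    intro z hz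
    have hz' : 0 < z.im := hz
    have h1 : DifferentiableAt ℂ (fun w : ℂ => w ^ (1 / 2 : ℂ)) z :=
      differentiableAt_id.cpow_const (Or.inr (by simpa using hz'.ne'))
    refine (h1.congr_of_eventuallyEq ?_).differentiableWithinAt
    filter_upwards [(isOpen_lt continuous_const Complex.continuous_im).mem_nhds hz'] with w hw
    simp [UpperHalfPlane.ofComplex_apply_of_im_pos hw]
  sq := fun τ => by
    have : ((τ : ℂ) ^ (1 / 2 : ℂ)) ^ 2 = τ := by
      rw [← Complex.cpow_nat_mul]; simp
    rw [this]; simp [autFactor, ModularGroup.S]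

/-- The generator `T`. -/
noncomputable def Mp2Z.T : Mp2Z where
  mat := ModularGroup.T
  fac := fun _ => 1
  holo := mdifferentiable_const
  sq := fun τ => by simp [autFactor, ModularGroup.T]

theorem Mp2Z.S_sq_fac (τ : ℍ) : (S * S).fac τ = I := by
  change (((ModularGroup.S • τ : ℍ) : ℂ)) ^ (1 / 2 : ℂ) * (τ : ℂ) ^ (1 / 2 : ℂ) = I
  have hτ : (τ : ℂ) ≠ 0 := τ.ne_zero
  have h1 : ((ModularGroup.S • τ : ℍ) : ℂ) = -(τ : ℂ)⁻¹ := by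
    rw [coe_smul_eq]; simp [autFactor, ModularGroup.S, neg_div]
  have him : 0 < (τ : ℂ).im := τ.im_pos
  have harg : (τ : ℂ).arg ≠ π := by
    intro h; rw [Complex.arg_eq_pi_iff] at h; linarith [h.2]
  have hlog : Complex.log (-(τ : ℂ)⁻¹) = π * I - Complex.log τ := by
    have him' : ((τ : ℂ)⁻¹).im < 0 := by
      rw [Complex.inv_im]
      exact div_neg_of_neg_of_pos (by linarith) (Complex.normSq_pos.mpr hτ)
    have h2 : Complex.log (-(τ : ℂ)⁻¹) = Complex.log (τ : ℂ)⁻¹ + π * I := by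
      apply Complex.ext
      · simp [Complex.log_re]
      · simp [Complex.log_im, Complex.arg_neg_eq_arg_add_pi_of_im_neg him']
    rw [h2, Complex.log_inv _ harg]; ring
  rw [h1, Complex.cpow_def_of_ne_zero (neg_ne_zero.mpr (inv_ne_zero hτ)),
    Complex.cpow_def_of_ne_zero hτ, ← Complex.exp_add, hlog]
  rw [show ((π * I - Complex.log τ) * (1 / 2) + Complex.log τ * (1 / 2) : ℂ) = π / 2 * I by ring]
  exact Complex.exp_pi_div_two_mul_I

theorem Mp2Z.closure_eq_top : Subgroup.closure {Mp2Z.S, Mp2Z.T} = ⊤ := by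
  rw [eq_top_iff]
  intro g _
  set H := Subgroup.closure {Mp2Z.S, Mp2Z.T}
  have hS : Mp2Z.S ∈ H := Subgroup.subset_closure (by simp)
  have hT : Mp2Z.T ∈ H := Subgroup.subset_closure (by simp)
  let p : Mp2Z →* SL(2, ℤ) := { toFun := Mp2Z.mat, map_one' := rfl, map_mul' := fun _ _ => rfl }
  have hp : H.map p = ⊤ := by
    rw [eq_top_iff, ← SpecialLinearGroup.SL2Z_generators, Subgroup.closure_le]
    rintro x (rfl | rfl)
    · exact ⟨_, hS, rfl⟩
    · exact ⟨_, hT, rfl⟩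
  obtain ⟨g0, hg0, hmat⟩ : g.mat ∈ H.map p := by rw [hp]; trivial
  have hmat : g0.mat = g.mat := hmat
  have hZ : (S * S * (S * S)).mat = 1 := by
    change ModularGroup.S * ModularGroup.S * (ModularGroup.S * ModularGroup.S) = 1
    decide
  have hZf : ∀ τ, (S * S * (S * S)).fac τ = -1 := by
    intro τ
    rw [Mp2Z.fac_mul, S_sq_fac, S_sq_fac]; simp
  have hc : Continuous (fun τ => g.fac τ / g0.fac τ) :=
    g.holo.continuous.div g0.holo.continuous g0.fac_ne_zero
  have hpre : IsPreconnected (Set.univ : Set ℍ) := isPreconnected_univ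
  have hsq : Set.EqOn ((fun τ => g.fac τ / g0.fac τ) ^ 2) ((fun _ => (1 : ℂ)) ^ 2) Set.univ := by
    intro τ _
    have := g0.fac_ne_zero τ
    simp only [Pi.pow_apply, div_pow, g.sq, g0.sq, hmat, one_pow]
    exact div_self (autFactor_ne_zero _ _)
  rcases hpre.eq_or_eq_neg_of_sq_eq hc.continuousOn continuousOn_const hsq (by simp) with h | h
  · have : g = g0 := by
      ext1
      · exact hmat.symm
      · funext τ
        exact (div_eq_one_iff_eq (g0.fac_ne_zero τ)).mp (h (Set.mem_univ τ))
    rwa [this]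
  · have : g = S * S * (S * S) * g0 := by
      ext1
      · rw [Mp2Z.mat_mul, hZ, one_mul, hmat]
      · funext τ
        have := h (Set.mem_univ τ)
        rw [Mp2Z.fac_mul, hZf]
        simp only [Pi.neg_apply] at this
        rwa [div_eq_iff (g0.fac_ne_zero τ)] at this
    rw [this]
    exact H.mul_mem (H.mul_mem (H.mul_mem hS hS) (H.mul_mem hS hS)) hg0


/-! ### Auxiliary Jacobi theta functions -/

/-- `∑_{n ≡ k (M)} e(n² τ / 2M + n w)`. -/
noncomputable def jTheta (M : ℕ) (k : ℤ) (τ w : ℂ) : ℂ :=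
  cexp (π * I * k ^ 2 * τ / M + 2 * π * I * k * w) * jacobiTheta₂ (M * w + k * τ) (M * τ)

theorem jTheta_T (N : ℕ) [NeZero N] (k : ℤ) (τ w : ℂ) :
    jTheta (2 * N) k (τ + 1) w = cexp (π * I * k ^ 2 / (2 * N : ℕ)) * jTheta (2 * N) k τ w := by
  have hN : (N : ℂ) ≠ 0 := by exact_mod_cast NeZero.ne N
  unfold jTheta
  have h1 : jacobiTheta₂ ((2 * N : ℕ) * w + k * (τ + 1)) ((2 * N : ℕ) * (τ + 1)) =
      jacobiTheta₂ ((2 * N : ℕ) * w + k * τ) ((2 * N : ℕ) * τ) := by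
    unfold jacobiTheta₂
    refine tsum_congr fun n => ?_
    unfold jacobiTheta₂_term
    rw [Complex.exp_eq_exp_iff_exists_int]
    refine ⟨n * k + n ^ 2 * N, ?_⟩
    push_cast; ring
  rw [h1, ← mul_assoc, ← Complex.exp_add]
  congr 2
  push_cast; field_simp; ring

theorem jTheta_shift (M : ℕ) [NeZero M] (k : ℤ) (τ w : ℂ) (t : ℤ) :
    jTheta M k τ (w + t / M) = cexp (2 * π * I * k * t / M) * jTheta M k τ w := by
  have hM : (M : ℂ) ≠ 0 := by exact_mod_cast NeZero.ne M
  unfold jTheta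
  have h1 : jacobiTheta₂ (M * (w + t / M) + k * τ) (M * τ) =
      jacobiTheta₂ (M * w + k * τ) (M * τ) := by
    unfold jacobiTheta₂
    refine tsum_congr fun n => ?_
    unfold jacobiTheta₂_term
    rw [Complex.exp_eq_exp_iff_exists_int]
    refine ⟨n * t, ?_⟩
    push_cast; field_simp; ring
  rw [h1, ← mul_assoc, ← Complex.exp_add]
  congr 2
  field_simp; ring

theorem jTheta_I_ne_zero (M : ℕ) [NeZero M] (k : ℤ) : jTheta M k I 0 ≠ 0 := by
  unfold jTheta
  refine mul_ne_zero (Complex.exp_ne_zero _) ?_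
  have hM : (0 : ℝ) < M := by exact_mod_cast Nat.pos_of_ne_zero (NeZero.ne M)
  have him : 0 < ((M : ℂ) * I).im := by simpa using hM
  have hs := hasSum_jacobiTheta₂_term ((M : ℂ) * 0 + k * I) him
  have hr : ∀ n : ℤ, jacobiTheta₂_term n ((M : ℂ) * 0 + k * I) (M * I) =
      ((Real.exp (-(2 * π * n * k) - π * n ^ 2 * M) : ℝ) : ℂ) := by
    intro n
    unfold jacobiTheta₂_term
    rw [Complex.ofReal_exp]
    congr 1
    push_cast
    linear_combination (2 * π * n * k + π * n ^ 2 * M) * Complex.I_mul_I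
  simp only [hr] at hs
  have hsum : Summable (fun n : ℤ => Real.exp (-(2 * π * n * k) - π * n ^ 2 * M)) :=
    Complex.summable_ofReal.mp hs.summable
  rw [← hs.tsum_eq, ← Complex.ofReal_tsum]
  have := hsum.tsum_pos (fun _ => (Real.exp_pos _).le) 0 (Real.exp_pos _)
  exact_mod_cast this.ne'

theorem jacobiTheta₂_split (M : ℕ) [NeZero M] (t : ℤ) {τ : ℂ} (hτ : 0 < τ.im) (w : ℂ) :
    jacobiTheta₂ (w + t / M) (τ / M) =
      ∑ k : Fin M, cexp (2 * π * I * t * (k : ℕ) / M) * jTheta M (k : ℕ) τ w := by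
  have hM : (M : ℂ) ≠ 0 := by exact_mod_cast NeZero.ne M
  have hM0 : (0 : ℝ) < M := by exact_mod_cast Nat.pos_of_ne_zero (NeZero.ne M)
  have him : 0 < (τ / M).im := by
    rw [← Complex.ofReal_natCast, Complex.div_ofReal_im]; positivity
  have hs := hasSum_jacobiTheta₂_term (w + t / M) him
  have hs2 := ((Int.divModEquiv M).symm.hasSum_iff).mpr hs
  have hs3 := ((Equiv.prodComm (Fin M) ℤ).hasSum_iff).mpr hs2
  have him2 : 0 < ((M : ℂ) * τ).im := by
    rw [← Complex.ofReal_natCast, Complex.im_ofReal_mul]; positivity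
  refine (hs3.prod_fiberwise (g := fun k : Fin M =>
    cexp (2 * π * I * t * (k : ℕ) / M) * jTheta M (k : ℕ) τ w) ?_).unique (hasSum_fintype _)
  intro k
  have := (hasSum_jacobiTheta₂_term ((M : ℂ) * w + ((k : ℕ) : ℤ) * τ) him2).mul_left
    (cexp (2 * π * I * t * (k : ℕ) / M) * cexp (π * I * ((k : ℕ) : ℤ) ^ 2 * τ / M + 2 * π * I * ((k : ℕ) : ℤ) * w))
  unfold jTheta
  rw [← mul_assoc]
  refine Eq.subst (motive := fun f => HasSum f _) (funext fun n => Eq.symm ?_) this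
  change jacobiTheta₂_term (n * M + ((k : ℕ) : ℤ)) _ _ = _
  unfold jacobiTheta₂_term
  rw [← Complex.exp_add, ← Complex.exp_add, Complex.exp_eq_exp_iff_exists_int]
  refine ⟨n * t, ?_⟩
  push_cast
  field_simp
  ring

theorem jTheta_S (M : ℕ) [NeZero M] (j : ℤ) {τ : ℂ} (hτ : 0 < τ.im) (w : ℂ) :
    jTheta M j (-1 / τ) (w / τ) = (-I * (τ / M)) ^ (1 / 2 : ℂ) * cexp (π * I * M * w ^ 2 / τ) *
      ∑ k : Fin M, cexp (-2 * π * I * j * (k : ℕ) / M) * jTheta M (k : ℕ) τ w := by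
  have hM : (M : ℂ) ≠ 0 := by exact_mod_cast NeZero.ne M
  have h0 : τ ≠ 0 := by rintro rfl; simp at hτ
  have hsp := jacobiTheta₂_split M (-j) hτ w
  have hfe := jacobiTheta₂_functional_equation (w + (-j : ℤ) / M) (τ / M)
  have hne : (-I * (τ / M)) ^ (1 / 2 : ℂ) ≠ 0 := by
    rw [Complex.cpow_def_of_ne_zero (by simp [h0, hM])]
    exact Complex.exp_ne_zero _
  have e1 : ∀ k : Fin M, cexp (2 * π * I * (-j : ℤ) * (k : ℕ) / M) =
      cexp (-2 * π * I * j * (k : ℕ) / M) := by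
    intro k; congr 1; push_cast; ring
  simp only [e1] at hsp
  rw [← hsp, hfe]
  unfold jTheta
  have a1 : (M : ℂ) * (w / τ) + j * (-1 / τ) = (w + (-j : ℤ) / M) / (τ / M) := by
    push_cast; field_simp
  have a2 : (M : ℂ) * (-1 / τ) = -1 / (τ / M) := by field_simp
  rw [a1, a2]
  have : cexp (π * I * j ^ 2 * (-1 / τ) / M + 2 * π * I * j * (w / τ)) =
      cexp (π * I * M * w ^ 2 / τ) * cexp (-π * I * (w + (-j : ℤ) / M) ^ 2 / (τ / M)) := by
    rw [← Complex.exp_add]; congr 1; push_cast; field_simp; ring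
  rw [this]
  linear_combination (-(cexp (π * I * M * w ^ 2 / τ) *
    cexp (-π * I * (w + (-j : ℤ) / M) ^ 2 / (τ / M)) *
    jacobiTheta₂ ((w + (-j : ℤ) / M) / (τ / M)) (-1 / (τ / M)))) * mul_one_div_cancel hne

/-- `A` describes how the vector of the theta functions transforms under `g`. -/
def JTransforms (M : ℕ) (g : Mp2Z) (A : Matrix (Fin M) (Fin M) ℂ) : Prop :=
  ∀ (τ : ℍ) (w : ℂ) (j : Fin M),
    jTheta M (j : ℕ) ((g.mat • τ : ℍ) : ℂ) (w / autFactor g.mat τ) =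
      g.fac τ * cexp (π * I * M * (g.mat 1 0 : ℤ) * w ^ 2 / autFactor g.mat τ) *
        ∑ k : Fin M, A j k * jTheta M (k : ℕ) τ w

theorem JTransforms.one (M : ℕ) : JTransforms M 1 1 := by
  intro τ w j
  simp [Mp2Z.mat_one, Mp2Z.fac_one, autFactor_one, Matrix.one_apply]

theorem JTransforms.mul {M : ℕ} {g g' : Mp2Z} {A A' : Matrix (Fin M) (Fin M) ℂ}
    (h : JTransforms M g A) (h' : JTransforms M g' A') : JTransforms M (g * g') (A * A') := by
  intro τ w j
  have h1 := h (g'.mat • τ) (w / autFactor g'.mat τ) j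
  have e1 := autFactor_ne_zero g'.mat τ
  have e2 := autFactor_ne_zero g.mat (g'.mat • τ)
  rw [Mp2Z.mat_mul, mul_smul, autFactor_mul, Mp2Z.fac_mul, mul_comm (autFactor g.mat _),
    ← div_div, h1]
  simp only [h' τ w, Matrix.mul_apply, Finset.sum_mul, Finset.mul_sum]
  rw [Finset.sum_comm]
  refine Finset.sum_congr rfl fun k _ => Finset.sum_congr rfl fun l _ => ?_
  have key : π * I * M * (g.mat 1 0 : ℤ) * (w / autFactor g'.mat τ) ^ 2 /
        autFactor g.mat (g'.mat • τ) + π * I * M * (g'.mat 1 0 : ℤ) * w ^ 2 / autFactor g'.mat τ =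
      π * I * M * ((g.mat * g'.mat) 1 0 : ℤ) * w ^ 2 /
        (autFactor g'.mat τ * autFactor g.mat (g'.mat • τ)) := by
    have e3 : (g.mat 1 0 : ℂ) + g'.mat 1 0 * autFactor g'.mat τ * autFactor g.mat (g'.mat • τ) =
        ((g.mat * g'.mat) 1 0 : ℤ) * autFactor g'.mat τ := by
      have hd := det_eq g'.mat
      have : autFactor g'.mat τ * autFactor g.mat (g'.mat • τ) =
          g.mat 1 0 * (g'.mat 0 0 * τ + g'.mat 0 1) + g.mat 1 1 * autFactor g'.mat τ := by
        rw [autFactor.eq_def g.mat, coe_smul_eq]; field_simp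
      rw [mul_assoc, this]
      simp only [Matrix.SpecialLinearGroup.coe_mul, Matrix.mul_apply, Fin.sum_univ_two, autFactor]
      push_cast
      linear_combination (-(g.mat 1 0 : ℂ)) * hd
    field_simp
    linear_combination (M * w ^ 2 : ℂ) * e3
  rw [← key, Complex.exp_add]
  ring

theorem JTransforms.inv {M : ℕ} {g : Mp2Z} {A B : Matrix (Fin M) (Fin M) ℂ}
    (h : JTransforms M g A) (hBA : B * A = 1) : JTransforms M g⁻¹ B := by
  intro τ w j
  set σ : ℍ := g.mat⁻¹ • τ with hσ
  have hτ : g.mat • σ = τ := by simp [hσ]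
  have e1 := autFactor_ne_zero g.mat σ
  have e2 : autFactor g.mat⁻¹ τ = (autFactor g.mat σ)⁻¹ := by
    have := autFactor_mul g.mat g.mat⁻¹ τ
    rw [mul_inv_cancel, autFactor_one, ← hσ] at this
    exact (eq_inv_of_mul_eq_one_right this.symm)
  have h1 : ∀ k : Fin M, _ := h σ (w * autFactor g.mat σ)
  simp only [hτ, mul_div_cancel_right₀ _ e1] at h1
  have e4 : ((g⁻¹).mat 1 0 : ℤ) = -(g.mat 1 0 : ℤ) := by
    rw [Mp2Z.mat_inv, Matrix.SpecialLinearGroup.SL2_inv_expl]; simp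
  rw [Mp2Z.fac_inv, e4]
  simp only [Mp2Z.mat_inv, ← hσ, e2, h1, div_inv_eq_mul]
  have hk : ∀ x : Fin M → ℂ, ∑ k, B j k * ∑ l, A k l * x l = x j := by
    intro x
    have : B.mulVec (A.mulVec x) j = x j := by rw [Matrix.mulVec_mulVec, hBA, Matrix.one_mulVec]
    simpa [Matrix.mulVec, dotProduct] using this
  have hpull : ∀ (c : ℂ) (y : Fin M → ℂ), ∑ k, B j k * (c * y k) = c * ∑ k, B j k * y k := by
    intro c y; rw [Finset.mul_sum]; exact Finset.sum_congr rfl fun k _ => by ring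
  rw [hpull, hk]
  have hexp : cexp (π * I * M * ((-(g.mat 1 0) : ℤ) : ℂ) * w ^ 2 * autFactor g.mat σ) *
      cexp (π * I * M * (g.mat 1 0 : ℤ) * (w * autFactor g.mat σ) ^ 2 / autFactor g.mat σ) = 1 := by
    rw [← Complex.exp_add, Complex.exp_eq_one_iff]
    refine ⟨0, ?_⟩
    push_cast; field_simp; ring
  have hf := g.fac_ne_zero σ
  have hf' : (g.fac σ)⁻¹ * g.fac σ = 1 := inv_mul_cancel₀ hf
  linear_combination (-jTheta M (j : ℕ) σ (w * autFactor g.mat σ)) * hexp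
    - (cexp (π * I * M * ((-(g.mat 1 0) : ℤ) : ℂ) * w ^ 2 * autFactor g.mat σ) *
      cexp (π * I * M * (g.mat 1 0 : ℤ) * (w * autFactor g.mat σ) ^ 2 / autFactor g.mat σ)) *
      jTheta M (j : ℕ) σ (w * autFactor g.mat σ) * hf'

theorem jTheta_linearIndependent (M : ℕ) [NeZero M] (B : Fin M → ℂ)
    (h : ∀ w : ℂ, ∑ k : Fin M, B k * jTheta M (k : ℕ) I w = 0) : B = 0 := by
  have hM : (M : ℂ) ≠ 0 := by exact_mod_cast NeZero.ne M
  let e : ZMod M ≃ Fin M :=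
    { toFun := fun x => ⟨x.val, ZMod.val_lt x⟩
      invFun := fun k => ((k : ℕ) : ZMod M)
      left_inv := fun x => by simp
      right_inv := fun k => by ext; simp [ZMod.val_natCast_of_lt k.2] }
  let Φ : ZMod M → ℂ := fun x => B (e x) * jTheta M ((e x : Fin M) : ℕ) I 0
  have hΦ : ZMod.dft Φ = 0 := by
    funext t
    rw [ZMod.dft_apply]
    have h1 := h (0 + (-(t.val : ℤ) : ℤ) / M)
    rw [← e.sum_comp] at h1
    rw [Pi.zero_apply, ← h1]
    refine Finset.sum_congr rfl fun x _ => ?_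
    have hx : x = (((e x : Fin M) : ℕ) : ZMod M) := by
      simp [e]
    have hst : ZMod.stdAddChar (-(x * t)) =
        cexp (2 * π * I * (((e x : Fin M) : ℕ) : ℤ) * ((-(t.val : ℤ) : ℤ) : ℂ) / M) := by
      have : -(x * t) = ((-(((e x : Fin M) : ℕ) : ℤ) * (t.val : ℤ) : ℤ) : ZMod M) := by
        push_cast
        rw [← hx, ZMod.natCast_zmod_val]; ring
      rw [this, ZMod.stdAddChar_coe]
      congr 1; push_cast; ring
    rw [jTheta_shift, hst, smul_eq_mul]
    ring
  have hΦ0 : Φ = 0 := by simpa using hΦ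
  funext k
  have := congrFun hΦ0 (e.symm k)
  simp only [Φ, Equiv.apply_symm_apply, Pi.zero_apply, mul_eq_zero] at this
  exact this.resolve_right (jTheta_I_ne_zero M _)

theorem JTransforms.unique {M : ℕ} [NeZero M] {g : Mp2Z} {A A' : Matrix (Fin M) (Fin M) ℂ}
    (h : JTransforms M g A) (h' : JTransforms M g A') : A = A' := by
  funext j
  have : A j - A' j = 0 := by
    apply jTheta_linearIndependent M
    intro w
    have h1 := (h UpperHalfPlane.I w j).symm.trans (h' UpperHalfPlane.I w j)
    have h2 := mul_left_cancel₀
      (mul_ne_zero (g.fac_ne_zero UpperHalfPlane.I) (Complex.exp_ne_zero _)) h1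
    simp only [UpperHalfPlane.coe_I] at h2
    simp only [Pi.sub_apply, sub_mul, Finset.sum_sub_distrib, h2, sub_self]
  exact sub_eq_zero.mp this

/-- The matrix of `T` on the theta functions. -/
noncomputable def jT (M : ℕ) : Matrix (Fin M) (Fin M) ℂ :=
  Matrix.diagonal fun k => cexp (π * I * (k : ℕ) ^ 2 / M)

/-- The matrix of `S` on the theta functions. -/
noncomputable def jS (M : ℕ) : Matrix (Fin M) (Fin M) ℂ :=
  Matrix.of fun j k => cexp (-(π * I / 4)) / (Real.sqrt M : ℂ) *
    cexp (-2 * π * I * (j : ℕ) * (k : ℕ) / M)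

theorem JTransforms_T (N : ℕ) [NeZero N] : JTransforms (2 * N) Mp2Z.T (jT (2 * N)) := by
  intro τ w j
  have h1 : ((Mp2Z.T.mat • τ : ℍ) : ℂ) = τ + 1 := by
    rw [coe_smul_eq]; simp [autFactor, Mp2Z.T, ModularGroup.T]
  have h2 : autFactor Mp2Z.T.mat τ = 1 := by simp [autFactor, Mp2Z.T, ModularGroup.T]
  have h3 : (Mp2Z.T.mat 1 0 : ℤ) = 0 := by simp [Mp2Z.T, ModularGroup.T]
  rw [h1, h2, h3, div_one, jTheta_T]
  simp [jT, Matrix.diagonal_apply, Mp2Z.T]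

theorem sqrt_factor (M : ℕ) [NeZero M] (τ : ℍ) :
    (-I * ((τ : ℂ) / M)) ^ (1 / 2 : ℂ) =
      (τ : ℂ) ^ (1 / 2 : ℂ) * (cexp (-(π * I / 4)) / (Real.sqrt M : ℂ)) := by
  have hM0 : (0 : ℝ) < M := by exact_mod_cast Nat.pos_of_ne_zero (NeZero.ne M)
  have hτ : (τ : ℂ) ≠ 0 := τ.ne_zero
  have him : 0 < (τ : ℂ).im := τ.im_pos
  have e1 : -I * ((τ : ℂ) / M) = ((M : ℝ)⁻¹ : ℝ) * (-I * τ) := by push_cast; ring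
  have hne : -I * (τ : ℂ) ≠ 0 := mul_ne_zero (by simp) hτ
  have hr : (0 : ℝ) < (M : ℝ)⁻¹ := inv_pos.mpr hM0
  have harg : (-I).arg + (τ : ℂ).arg ∈ Set.Ioc (-π) π := by
    have h0 : 0 ≤ (τ : ℂ).arg := Complex.arg_nonneg_iff.mpr him.le
    have h1 := Complex.arg_le_pi (τ : ℂ)
    rw [Complex.arg_neg_I]
    constructor <;> linarith [Real.pi_pos]
  have hlog : Complex.log (((M : ℝ)⁻¹ : ℝ) * (-I * τ)) =
      (-Real.log M : ℝ) + (-(π / 2) * I + Complex.log τ) := by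
    rw [Complex.log_ofReal_mul hr hne, Complex.log_mul (by simp) hτ harg, Complex.log_neg_I,
      Real.log_inv]
  have hs : (Real.sqrt M : ℂ) = cexp ((Real.log M : ℝ) / 2) := by
    rw [Real.sqrt_eq_rpow, Real.rpow_def_of_pos hM0, Complex.ofReal_exp]
    congr 1; push_cast; ring
  rw [e1, Complex.cpow_def_of_ne_zero (mul_ne_zero (by exact_mod_cast hr.ne') hne), hlog,
    Complex.cpow_def_of_ne_zero hτ, hs, ← Complex.exp_sub, ← Complex.exp_add]
  congr 1
  push_cast; ring

theorem JTransforms_S (M : ℕ) [NeZero M] : JTransforms M Mp2Z.S (jS M) := by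
  intro τ w j
  have h2 : autFactor Mp2Z.S.mat τ = τ := by simp [autFactor, Mp2Z.S, ModularGroup.S]
  have h1 : ((Mp2Z.S.mat • τ : ℍ) : ℂ) = -1 / τ := by
    rw [coe_smul_eq, h2]; simp [Mp2Z.S, ModularGroup.S]
  have h3 : (Mp2Z.S.mat 1 0 : ℤ) = 1 := by simp [Mp2Z.S, ModularGroup.S]
  rw [h1, h2, h3, jTheta_S M _ τ.im_pos, sqrt_factor]
  simp only [jS, Matrix.of_apply, Finset.mul_sum, Mp2Z.S]
  refine Finset.sum_congr rfl fun k _ => ?_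
  push_cast
  ring_nf

theorem Mp2Z.S_pow_eight : (Mp2Z.S) ^ 8 = 1 := by
  have h4 : (Mp2Z.S * Mp2Z.S * (Mp2Z.S * Mp2Z.S)).mat = 1 := by
    change ModularGroup.S * ModularGroup.S * (ModularGroup.S * ModularGroup.S) = 1
    decide
  have hZf : ∀ τ, (S * S * (S * S)).fac τ = -1 := by
    intro τ
    rw [Mp2Z.fac_mul, S_sq_fac, S_sq_fac]; simp
  have : S ^ 8 = (S * S * (S * S)) * (S * S * (S * S)) := by
    simp only [pow_succ, pow_zero, one_mul, mul_assoc]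
  rw [this]
  ext1
  · rw [Mp2Z.mat_mul, h4]; simp [Mp2Z.mat_one]
  · funext τ
    rw [Mp2Z.fac_mul, hZf, hZf, Mp2Z.fac_one]; norm_num

theorem exists_JTransforms (N : ℕ) [NeZero N] (g : Mp2Z) : ∃ A, JTransforms (2 * N) g A := by
  have hg : g ∈ Subgroup.closure {Mp2Z.S, Mp2Z.T} := by rw [Mp2Z.closure_eq_top]; trivial
  have hpow : ∀ n : ℕ, JTransforms (2 * N) (Mp2Z.S ^ n) (jS (2 * N) ^ n) := by
    intro n
    induction n with
    | zero => simpa using JTransforms.one (2 * N)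
    | succ n ih => rw [pow_succ, pow_succ]; exact ih.mul (JTransforms_S _)
  have hSinv : ∃ A, JTransforms (2 * N) Mp2Z.S⁻¹ A := by
    have : Mp2Z.S⁻¹ = Mp2Z.S ^ 7 := by
      rw [inv_eq_iff_mul_eq_one, ← pow_succ']; exact Mp2Z.S_pow_eight
    rw [this]; exact ⟨_, hpow 7⟩
  have hTinv : ∃ A, JTransforms (2 * N) Mp2Z.T⁻¹ A := by
    refine ⟨Matrix.diagonal fun k => (cexp (π * I * (k : ℕ) ^ 2 / (2 * N : ℕ)))⁻¹,
      (JTransforms_T N).inv ?_⟩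
    rw [jT, Matrix.diagonal_mul_diagonal]
    simp [Complex.exp_ne_zero]
  rw [← Subgroup.mem_toSubmonoid, Subgroup.closure_toSubmonoid] at hg
  induction hg using Submonoid.closure_induction with
  | mem x hx =>
    rcases hx with (rfl | rfl) | hx
    · exact ⟨_, JTransforms_S _⟩
    · exact ⟨_, JTransforms_T N⟩
    · rcases hx with h | h
      · rw [← inv_inv x, h]; exact hSinv
      · rw [← inv_inv x, Set.mem_singleton_iff.mp h]; exact hTinv
  | one => exact ⟨_, JTransforms.one _⟩
  | mul x y _ _ hx hy =>
    obtain ⟨A, hA⟩ := hx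
    obtain ⟨B, hB⟩ := hy
    exact ⟨_, hA.mul hB⟩

theorem exists_jRep (N : ℕ) [NeZero N] :
    ∃ ρ : Mp2Z →* Matrix (Fin (2 * N)) (Fin (2 * N)) ℂ,
      ρ Mp2Z.T = jT (2 * N) ∧ ρ Mp2Z.S = jS (2 * N) := by
  choose ρ hρ using exists_JTransforms N
  exact ⟨{ toFun := ρ
           map_one' := (hρ 1).unique (JTransforms.one _)
           map_mul' := fun g h => (hρ _).unique ((hρ g).mul (hρ h)) },
    (hρ _).unique (JTransforms_T N), (hρ _).unique (JTransforms_S _)⟩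

/-! ### The quadratic space and its lattices -/

/-- The quadratic form `Q(λ) = N det λ` on trace zero matrices. -/
noncomputable def quadForm (N : ℕ) (l : Matrix (Fin 2) (Fin 2) ℝ) : ℝ := N * l.det

/-- The bilinear form `(λ, μ) = -N tr(λ μ)`. -/
noncomputable def bilForm (N : ℕ) (l m : Matrix (Fin 2) (Fin 2) ℝ) : ℝ := -(N * (l * m).trace)

/-- The matrix `(b/2N, -a/N; c, -b/2N)`, which corresponds to the binary form `[a, b, Nc]`. -/
noncomputable def dualVec (N : ℕ) (a b c : ℤ) : Matrix (Fin 2) (Fin 2) ℝ :=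
  !![(b : ℝ) / (2 * N), -(a : ℝ) / N; (c : ℝ), -((b : ℝ) / (2 * N))]

/-- The dual lattice `L'`. -/
noncomputable def dualLattice (N : ℕ) : AddSubgroup (Matrix (Fin 2) (Fin 2) ℝ) where
  carrier := {l | ∃ a b c : ℤ, l = dualVec N a b c}
  zero_mem' := ⟨0, 0, 0, by ext i j; fin_cases i <;> fin_cases j <;> simp [dualVec]⟩
  add_mem' := by
    rintro _ _ ⟨a, b, c, rfl⟩ ⟨a', b', c', rfl⟩
    refine ⟨a + a', b + b', c + c', ?_⟩
    ext i j; fin_cases i <;> fin_cases j <;> simp [dualVec] <;> ring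
  neg_mem' := by
    rintro _ ⟨a, b, c, rfl⟩
    refine ⟨-a, -b, -c, ?_⟩
    ext i j; fin_cases i <;> fin_cases j <;> simp [dualVec] <;> ring

/-- The lattice `L = {(b, -a/N; c, -b)}`, inside its dual. -/
noncomputable def lattice (N : ℕ) : AddSubgroup (dualLattice N) where
  carrier := {l | ∃ a b c : ℤ,
    (l : Matrix (Fin 2) (Fin 2) ℝ) = !![(b : ℝ), -(a : ℝ) / N; (c : ℝ), -(b : ℝ)]}
  zero_mem' := ⟨0, 0, 0, by ext i j; fin_cases i <;> fin_cases j <;> simp⟩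
  add_mem' := by
    rintro x y ⟨a, b, c, h⟩ ⟨a', b', c', h'⟩
    refine ⟨a + a', b + b', c + c', ?_⟩
    rw [AddSubgroup.coe_add, h, h']
    ext i j; fin_cases i <;> fin_cases j <;> simp <;> ring
  neg_mem' := by
    rintro x ⟨a, b, c, h⟩
    refine ⟨-a, -b, -c, ?_⟩
    rw [AddSubgroup.coe_neg, h]
    ext i j; fin_cases i <;> fin_cases j <;> simp <;> ring

/-- The rescaled lattice `Δ L`, inside `L'`. -/
noncomputable def scaledLattice (N : ℕ) (Δ : ℤ) : AddSubgroup (dualLattice N) :=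
  (lattice N).map (zsmulAddGroupHom Δ)

/-- The discriminant group `L' / Δ L`. -/
abbrev DiscGroup (N : ℕ) (Δ : ℤ) : Type := dualLattice N ⧸ scaledLattice N Δ

/-- The discriminant group `L' / L`. -/
abbrev BaseGroup (N : ℕ) : Type := DiscGroup N 1

/-- A representative in `L'` of a class. -/
noncomputable def discRep {N : ℕ} {Δ : ℤ} (δ : DiscGroup N Δ) : dualLattice N := Quotient.out δ

theorem mk_discRep {N : ℕ} {Δ : ℤ} (δ : DiscGroup N Δ) :
    (QuotientAddGroup.mk (discRep δ) : DiscGroup N Δ) = δ := Quotient.out_eq _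

theorem scaledLattice_one (N : ℕ) : scaledLattice N 1 = lattice N := by
  ext x; simp [scaledLattice]

theorem scaledLattice_le (N : ℕ) (Δ : ℤ) : scaledLattice N Δ ≤ scaledLattice N 1 := by
  rw [scaledLattice_one]
  rintro _ ⟨y, hy, rfl⟩
  exact (lattice N).zsmul_mem hy Δ

/-- The canonical projection `L' / Δ L → L' / L`. -/
noncomputable def discProj (N : ℕ) (Δ : ℤ) : DiscGroup N Δ →+ BaseGroup N :=
  QuotientAddGroup.map _ _ (AddMonoidHom.id _) (scaledLattice_le N Δ)

/-- The element of `L'` with coordinates `a, b, c`. -/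
noncomputable def dualElt (N : ℕ) (a b c : ℤ) : dualLattice N := ⟨dualVec N a b c, a, b, c, rfl⟩

theorem dualElt_surj (N : ℕ) (l : dualLattice N) : ∃ a b c, l = dualElt N a b c := by
  obtain ⟨_, a, b, c, rfl⟩ := l
  exact ⟨a, b, c, rfl⟩

theorem dualElt_sub (N : ℕ) (a b c a' b' c' : ℤ) :
    dualElt N a b c - dualElt N a' b' c' = dualElt N (a - a') (b - b') (c - c') := by
  apply Subtype.ext
  simp only [dualElt, AddSubgroup.coe_sub]
  ext i j; fin_cases i <;> fin_cases j <;> simp [dualVec] <;> ring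

theorem dualElt_mem_scaledLattice {N : ℕ} [NeZero N] {Δ a b c : ℤ} :
    dualElt N a b c ∈ scaledLattice N Δ ↔ Δ ∣ a ∧ 2 * N * Δ ∣ b ∧ Δ ∣ c := by
  have hN : (N : ℝ) ≠ 0 := by exact_mod_cast NeZero.ne N
  constructor
  · rintro ⟨y, ⟨a', b', c', hy⟩, h⟩
    have h' : (Δ : ℝ) • (y : Matrix (Fin 2) (Fin 2) ℝ) = dualVec N a b c := by
      have := congrArg Subtype.val h
      simp only [zsmulAddGroupHom_apply, AddSubgroup.coe_zsmul] at this
      rw [← Int.cast_smul_eq_zsmul ℝ] at this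
      exact this
    rw [hy] at h'
    have h00 := congrFun (congrFun h' 0) 0
    have h01 := congrFun (congrFun h' 0) 1
    have h10 := congrFun (congrFun h' 1) 0
    simp [dualVec] at h00 h01 h10
    refine ⟨⟨a', ?_⟩, ⟨b', ?_⟩, ⟨c', ?_⟩⟩
    · field_simp at h01
      have : (a : ℝ) = Δ * a' := by linarith
      exact_mod_cast this
    · field_simp at h00
      have : (b : ℝ) = 2 * N * Δ * b' := by linarith
      exact_mod_cast this
    · exact_mod_cast h10.symm
  · rintro ⟨⟨a', rfl⟩, ⟨b', rfl⟩, ⟨c', rfl⟩⟩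
    refine ⟨dualElt N a' (2 * N * b') c', ⟨a', b', c', ?_⟩, ?_⟩
    · ext i j; fin_cases i <;> fin_cases j <;> simp [dualElt, dualVec] <;> field_simp
    · apply Subtype.ext
      simp only [zsmulAddGroupHom_apply, AddSubgroup.coe_zsmul]
      rw [← Int.cast_smul_eq_zsmul ℝ]
      ext i j; fin_cases i <;> fin_cases j <;> simp [dualElt, dualVec] <;> field_simp

theorem discGroup_mk_eq {N : ℕ} [NeZero N] {Δ a b c a' b' c' : ℤ} :
    (QuotientAddGroup.mk (dualElt N a b c) : DiscGroup N Δ) =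
      QuotientAddGroup.mk (dualElt N a' b' c') ↔
    Δ ∣ a' - a ∧ 2 * N * Δ ∣ b' - b ∧ Δ ∣ c' - c := by
  rw [QuotientAddGroup.eq, neg_add_eq_sub, dualElt_sub, dualElt_mem_scaledLattice]

theorem discGroup_finite (N : ℕ) [NeZero N] {Δ : ℤ} (hΔ : Δ ≠ 0) : Finite (DiscGroup N Δ) := by
  have hN : (N : ℤ) ≠ 0 := by exact_mod_cast NeZero.ne N
  have hm : 2 * N * Δ ≠ 0 := mul_ne_zero (mul_ne_zero two_ne_zero hN) hΔ
  let s : Set (ℤ × ℤ × ℤ) := Set.Icc 0 |Δ| ×ˢ Set.Icc 0 |2 * N * Δ| ×ˢ Set.Icc 0 |Δ|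
  have hs : Finite s :=
    ((Set.finite_Icc _ _).prod ((Set.finite_Icc _ _).prod (Set.finite_Icc _ _))).to_subtype
  refine Finite.of_surjective
    (fun x : s => (QuotientAddGroup.mk (dualElt N x.1.1 x.1.2.1 x.1.2.2) : DiscGroup N Δ)) ?_
  intro δ
  obtain ⟨l, rfl⟩ := QuotientAddGroup.mk_surjective δ
  obtain ⟨a, b, c, rfl⟩ := dualElt_surj N l
  refine ⟨⟨(a % Δ, b % (2 * N * Δ), c % Δ),
    ⟨Int.emod_nonneg _ hΔ, (Int.emod_lt_abs _ hΔ).le⟩,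
    ⟨Int.emod_nonneg _ hm, (Int.emod_lt_abs _ hm).le⟩,
    ⟨Int.emod_nonneg _ hΔ, (Int.emod_lt_abs _ hΔ).le⟩⟩, ?_⟩
  rw [discGroup_mk_eq]
  exact ⟨Int.dvd_self_sub_emod, Int.dvd_self_sub_emod, Int.dvd_self_sub_emod⟩

noncomputable instance (N : ℕ) [NeZero N] : Fintype (BaseGroup N) :=
  @Fintype.ofFinite _ (discGroup_finite N one_ne_zero)

noncomputable instance (N : ℕ) : DecidableEq (BaseGroup N) := Classical.decEq _

/-! ### The Weil representation -/

/-- `e(x) = exp(2πix)`. -/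
noncomputable def expe (x : ℝ) : ℂ := cexp (2 * π * I * x)

theorem expe_congr {x y : ℝ} (h : ∃ n : ℤ, x - y = n) : expe x = expe y := by
  obtain ⟨n, hn⟩ := h
  rw [expe, expe, Complex.exp_eq_exp_iff_exists_int]
  refine ⟨n, ?_⟩
  have : (x : ℂ) = y + n := by
    have : x = y + n := by linarith
    exact_mod_cast congrArg (fun t : ℝ => (t : ℂ)) this
  rw [this]; ring

theorem conj_expe (x : ℝ) : conj (expe x) = expe (-x) := by
  rw [expe, expe, ← Complex.exp_conj]
  congr 1
  simp [Complex.conj_ofNat]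

theorem quadForm_dualVec (N : ℕ) [NeZero N] (a b c : ℤ) :
    quadForm N (dualVec N a b c) = a * c - b ^ 2 / (4 * N) := by
  have hN : (N : ℝ) ≠ 0 := by exact_mod_cast NeZero.ne N
  simp [quadForm, dualVec, Matrix.det_fin_two]
  field_simp; ring

theorem bilForm_dualVec (N : ℕ) [NeZero N] (a b c a' b' c' : ℤ) :
    bilForm N (dualVec N a b c) (dualVec N a' b' c') =
      a * c' + c * a' - b * b' / (2 * N) := by
  have hN : (N : ℝ) ≠ 0 := by exact_mod_cast NeZero.ne N
  simp [bilForm, dualVec, Matrix.trace_fin_two]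
  field_simp; ring

/-- The identification of `L' / L` with `ℤ / 2N`. -/
theorem baseIndex_bijective (N : ℕ) [NeZero N] : Function.Bijective
    (fun k : Fin (2 * N) => (QuotientAddGroup.mk (dualElt N 0 (k : ℕ) 0) : BaseGroup N)) := by
  have hN : (0 : ℤ) < 2 * N := by have := NeZero.pos N; omega
  constructor
  · intro j k h
    have := (discGroup_mk_eq.mp h).2.1
    rw [mul_one] at this
    have hj : ((j : ℕ) : ℤ) < 2 * N := by exact_mod_cast j.2
    have hk : ((k : ℕ) : ℤ) < 2 * N := by exact_mod_cast k.2
    have := Int.eq_zero_of_abs_lt_dvd this (by rw [abs_lt]; constructor <;> omega)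
    ext; omega
  · intro δ
    obtain ⟨l, rfl⟩ := QuotientAddGroup.mk_surjective δ
    obtain ⟨a, b, c, rfl⟩ := dualElt_surj N l
    have h0 := Int.emod_nonneg b hN.ne'
    have h1 := Int.emod_lt_of_pos b hN
    refine ⟨⟨(b % (2 * N)).toNat, by omega⟩, ?_⟩
    dsimp only
    rw [discGroup_mk_eq]
    refine ⟨one_dvd _, ?_, one_dvd _⟩
    rw [mul_one, Int.toNat_of_nonneg h0]
    exact Int.dvd_self_sub_emod

noncomputable def baseEquiv (N : ℕ) [NeZero N] : Fin (2 * N) ≃ BaseGroup N :=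
  Equiv.ofBijective _ (baseIndex_bijective N)

theorem baseEquiv_out (N : ℕ) [NeZero N] (k : Fin (2 * N)) : ∃ a c n : ℤ,
    discRep (baseEquiv N k) = dualElt N a ((k : ℕ) + 2 * N * n) c := by
  obtain ⟨a, b, c, h⟩ := dualElt_surj N (discRep (baseEquiv N k))
  have h1 : (QuotientAddGroup.mk (dualElt N a b c) : BaseGroup N) = baseEquiv N k := by
    rw [← h]; exact mk_discRep _
  have h2 : (QuotientAddGroup.mk (dualElt N a b c) : BaseGroup N) =
    QuotientAddGroup.mk (dualElt N 0 (k : ℕ) 0) := h1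
  obtain ⟨n, hn⟩ := (discGroup_mk_eq.mp h2).2.1
  refine ⟨a, c, -n, ?_⟩
  rw [h]; congr 1; linarith

theorem card_baseGroup (N : ℕ) [NeZero N] : Nat.card (BaseGroup N) = 2 * N := by
  rw [← Nat.card_congr (baseEquiv N), Nat.card_fin]

theorem exists_weilRep (N : ℕ) [NeZero N] :
    ∃ ρ : Mp2Z →* Matrix (BaseGroup N) (BaseGroup N) ℂ,
      (ρ Mp2Z.T = Matrix.diagonal fun δ : BaseGroup N => expe (quadForm N (discRep δ))) ∧
      (ρ Mp2Z.S = Matrix.of fun δ' δ : BaseGroup N =>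
        cexp (π * I / 4) / (Real.sqrt (Nat.card (BaseGroup N)) : ℂ) *
          expe (-bilForm N (discRep δ') (discRep δ))) := by
  have hN : (N : ℝ) ≠ 0 := by exact_mod_cast NeZero.ne N
  have hNC : (N : ℂ) ≠ 0 := by exact_mod_cast NeZero.ne N
  obtain ⟨ρ, hT, hS⟩ := exists_jRep N
  let E := Matrix.reindexAlgEquiv ℂ ℂ (baseEquiv N)
  refine ⟨((E : _ ≃* _).toMonoidHom.comp
    ((starRingEnd ℂ).mapMatrix : Matrix (Fin (2 * N)) (Fin (2 * N)) ℂ →+* _).toMonoidHom).comp ρ,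
    ?_, ?_⟩
  · ext x y
    obtain ⟨j, rfl⟩ := (baseEquiv N).surjective x
    obtain ⟨k, rfl⟩ := (baseEquiv N).surjective y
    have h1 : (conj ((ρ Mp2Z.T) j k) : ℂ) = Matrix.diagonal (fun δ : BaseGroup N =>
        expe (quadForm N (discRep δ))) (baseEquiv N j) (baseEquiv N k) := by
      rw [hT, jT, Matrix.diagonal_apply, Matrix.diagonal_apply]
      by_cases hjk : j = k
      · subst hjk
        rw [if_pos rfl, if_pos rfl]
        obtain ⟨a, c, n, h⟩ := baseEquiv_out N j
        have e1 : cexp (π * I * ((j : ℕ) : ℂ) ^ 2 / (2 * N : ℕ)) =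
            expe (((j : ℕ) : ℝ) ^ 2 / (4 * N)) := by
          rw [expe]; congr 1; push_cast; field_simp; norm_num
        rw [e1, conj_expe, h]
        apply expe_congr
        change ∃ m : ℤ, _ - quadForm N (dualVec N _ _ _) = m
        rw [quadForm_dualVec]
        refine ⟨-(a * c) + (j : ℕ) * n + N * n ^ 2, ?_⟩
        push_cast; field_simp; ring
      · rw [if_neg hjk, if_neg (fun h => hjk ((baseEquiv N).injective h)), map_zero]
    change conj ((ρ _) ((baseEquiv N).symm _) ((baseEquiv N).symm _)) = _
    rw [Equiv.symm_apply_apply, Equiv.symm_apply_apply]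
    exact h1
  · ext x y
    obtain ⟨j, rfl⟩ := (baseEquiv N).surjective x
    obtain ⟨k, rfl⟩ := (baseEquiv N).surjective y
    obtain ⟨a, c, n, h⟩ := baseEquiv_out N j
    obtain ⟨a', c', n', h'⟩ := baseEquiv_out N k
    have h1 : (conj ((ρ Mp2Z.S) j k) : ℂ) =
        cexp (π * I / 4) / (Real.sqrt (Nat.card (BaseGroup N)) : ℂ) *
          expe (-bilForm N (discRep (baseEquiv N j))
            (discRep (baseEquiv N k))) := by
      rw [hS, jS, Matrix.of_apply, card_baseGroup]
      have e1 : cexp (-2 * π * I * ((j : ℕ) : ℂ) * ((k : ℕ) : ℂ) / (2 * N : ℕ)) =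
          expe (-(((j : ℕ) : ℝ) * ((k : ℕ) : ℝ) / (2 * N))) := by
        rw [expe]; congr 1; push_cast; field_simp
      have e2 : cexp (-(π * I / 4)) = expe (-(1 / 8)) := by
        rw [expe]; congr 1; push_cast; ring
      have e3 : cexp (π * I / 4) = expe (1 / 8) := by
        rw [expe]; congr 1; push_cast; ring
      rw [e1, e2, e3, map_mul, map_div₀, conj_expe, conj_expe, Complex.conj_ofReal, neg_neg,
        neg_neg, h, h']
      congr 1
      apply expe_congr
      change ∃ m : ℤ, _ - -bilForm N (dualVec N _ _ _) (dualVec N _ _ _) = m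
      rw [bilForm_dualVec]
      refine ⟨a * c' + c * a' - (j : ℕ) * n' - (k : ℕ) * n - 2 * N * n * n', ?_⟩
      push_cast; field_simp; ring
    change conj ((ρ _) ((baseEquiv N).symm _) ((baseEquiv N).symm _)) = _
    rw [Equiv.symm_apply_apply, Equiv.symm_apply_apply]
    exact h1

/-- The Weil representation `ρ` of `Mp₂(ℤ)` on `ℂ[L'/L]`, as matrices in the standard basis: the
homomorphism with the prescribed values on the generators `T` and `S`, where `√i = e^{πi/4}`. -/
noncomputable def weilRep (N : ℕ) [NeZero N] : Mp2Z →* Matrix (BaseGroup N) (BaseGroup N) ℂ :=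
  Classical.choose (exists_weilRep N)

theorem weilRep_T (N : ℕ) [NeZero N] : weilRep N Mp2Z.T =
    Matrix.diagonal fun δ : BaseGroup N => expe (quadForm N (discRep δ)) :=
  (Classical.choose_spec (exists_weilRep N)).1

theorem weilRep_S (N : ℕ) [NeZero N] : weilRep N Mp2Z.S = Matrix.of fun δ' δ : BaseGroup N =>
    cexp (π * I / 4) / (Real.sqrt (Nat.card (BaseGroup N)) : ℂ) *
      expe (-bilForm N (discRep δ') (discRep δ)) :=
  (Classical.choose_spec (exists_weilRep N)).2

/-- The Weil representation is determined by its values on `S` and `T`. -/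
theorem weilRep_unique (N : ℕ) [NeZero N] (ρ : Mp2Z →* Matrix (BaseGroup N) (BaseGroup N) ℂ)
    (hS : ρ Mp2Z.S = weilRep N Mp2Z.S) (hT : ρ Mp2Z.T = weilRep N Mp2Z.T) : ρ = weilRep N := by
  refine MonoidHom.eq_of_eqOn_dense Mp2Z.closure_eq_top ?_
  rintro x (rfl | rfl)
  · exact hS
  · exact hT

/-- The representation `ρ̃`: it is `ρ` for `Δ > 0` and the complex conjugate `ρ̄` for `Δ < 0`. -/
noncomputable def weilRepTilde (N : ℕ) [NeZero N] (Δ : ℤ) :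
    Mp2Z →* Matrix (BaseGroup N) (BaseGroup N) ℂ :=
  if 0 < Δ then weilRep N
  else ((starRingEnd ℂ).mapMatrix : Matrix (BaseGroup N) (BaseGroup N) ℂ →+*
    Matrix (BaseGroup N) (BaseGroup N) ℂ).toMonoidHom.comp (weilRep N)

/-- The space `A_{k,ρ}` of functions `f : ℍ → ℂ[L'/L]` with
`f(γτ) = φ(τ)^{2k} ρ(γ,φ) f(τ)` for all `(γ,φ) ∈ Mp₂(ℤ)`; the argument `twoK` is `2k`. -/
def IsModularOfWeight {N : ℕ} [NeZero N] (twoK : ℤ)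
    (ρ : Mp2Z →* Matrix (BaseGroup N) (BaseGroup N) ℂ) (f : ℍ → BaseGroup N → ℂ) : Prop :=
  ∀ (g : Mp2Z) (τ : ℍ), f (g.mat • τ) = g.fac τ ^ twoK • (ρ g).mulVec (f τ)

/-! ### The genus character -/

/-- Fundamental discriminants, with `1` included. -/
def IsFundamentalDiscriminant (Δ : ℤ) : Prop :=
  (Δ % 4 = 1 ∧ Squarefree Δ) ∨
    ∃ m : ℤ, Δ = 4 * m ∧ (m % 4 = 2 ∨ m % 4 = 3) ∧ Squarefree m

/-- The Kronecker symbol `(Δ / n)` for all integers `n`. -/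
def kroneckerSymbol (Δ n : ℤ) : ℤ :=
  if n = 0 then (if Δ = 1 ∨ Δ = -1 then 1 else 0)
  else (if n < 0 ∧ Δ < 0 then -1 else 1) * ZMod.χ₈ (Δ : ZMod 8) ^ padicValNat 2 n.natAbs *
    jacobiSym Δ (n.natAbs / 2 ^ padicValNat 2 n.natAbs)

/-- `n` is represented by one of the forms `[N₁a, b, N₂c]` with `N = N₁N₂`, `N₁, N₂ > 0`. -/
def IsRepresented (N : ℕ) (a b c n : ℤ) : Prop :=
  ∃ N₁ N₂ : ℕ, N₁ * N₂ = N ∧ ∃ x y : ℤ, n = N₁ * a * x ^ 2 + b * x * y + N₂ * c * y ^ 2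

open Classical in
/-- The generalized genus character `χ_Δ([a, b, Nc])`: the value is `(Δ / n)` for any `n` prime to
`Δ` that is represented by one of the forms `[N₁a, b, N₂c]` with `N₁N₂ = N`. -/
noncomputable def genusCharForm (N : ℕ) (Δ a b c : ℤ) : ℤ :=
  if Δ ∣ b ^ 2 - 4 * N * a * c ∧
      IsSquare (((b ^ 2 - 4 * N * a * c) / Δ : ℤ) : ZMod (4 * N)) ∧
      Int.gcd (Int.gcd a b) (Int.gcd c Δ) = 1 then
    kroneckerSymbol Δ (Classical.epsilon fun n : ℤ => IsRepresented N a b c n ∧ IsCoprime n Δ)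
  else 0

/-- The genus character on `L'`; for `λ = (b/2N, -a/N; c, -b/2N)` the three integer parts
below are the integers `a`, `b`, `c`. -/
noncomputable def genusChar (N : ℕ) (Δ : ℤ) (l : Matrix (Fin 2) (Fin 2) ℝ) : ℤ :=
  genusCharForm N Δ ⌊-(N * l 0 1)⌋ ⌊2 * N * l 0 0⌋ ⌊l 1 0⌋

theorem genusChar_dualVec (N : ℕ) [NeZero N] (Δ a b c : ℤ) :
    genusChar N Δ (dualVec N a b c) = genusCharForm N Δ a b c := by
  have hN : (N : ℝ) ≠ 0 := by exact_mod_cast NeZero.ne N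
  have h1 : -((N : ℝ) * dualVec N a b c 0 1) = a := by simp [dualVec]; field_simp
  have h2 : 2 * (N : ℝ) * dualVec N a b c 0 0 = b := by simp [dualVec]; field_simp
  have h3 : dualVec N a b c 1 0 = c := by simp [dualVec]
  rw [genusChar, h1, h2, h3, Int.floor_intCast, Int.floor_intCast, Int.floor_intCast]

/-! ### The twisted Kudla-Millson theta function -/

/-- The form `Q_Δ = Q / |Δ|`. -/
noncomputable def quadFormScaled (N : ℕ) (Δ : ℤ) (l : Matrix (Fin 2) (Fin 2) ℝ) : ℝ :=
  quadForm N l / |(Δ : ℝ)|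

open Classical in
/-- The element `ψ_{Δ,r}(𝔢_h)` of `ℂ[L'/ΔL]`: the sum of `χ_Δ(δ) 𝔢_δ` over all `δ` with `π(δ) = rh`
and `Q_Δ(δ) ≡ sgn(Δ) Q(h)` modulo `ℤ`. -/
noncomputable def twistMap (N : ℕ) (Δ r : ℤ) (h : BaseGroup N) : DiscGroup N Δ → ℂ := fun δ =>
  if discProj N Δ δ = r • h ∧
      ∃ k : ℤ, quadFormScaled N Δ (discRep δ) - Δ.sign * quadForm N (discRep h) = k then
    (genusChar N Δ (discRep δ) : ℂ)
  else 0

/-- The standard scalar product on `ℂ[L'/ΔL]`, conjugate-linear in the second variable. -/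
noncomputable def discInner {N : ℕ} {Δ : ℤ} (f g : DiscGroup N Δ → ℂ) : ℂ :=
  ∑ᶠ δ, f δ * conj (g δ)

/-- The generator `λ(z)` of the positive line attached to `z`. -/
noncomputable def lambdaOf (N : ℕ) (z : ℍ) : Matrix (Fin 2) (Fin 2) ℝ :=
  (1 / (Real.sqrt N * z.im)) • !![-z.re, Complex.normSq z; -1, z.re]

/-- `R(λ, z) = (λ, λ(z))² / 2 - (λ, λ)`. -/
noncomputable def kmR (N : ℕ) (l : Matrix (Fin 2) (Fin 2) ℝ) (z : ℍ) : ℝ :=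
  bilForm N l (lambdaOf N z) ^ 2 / 2 - bilForm N l l

/-- The coefficient of `ω = (i/2) dz ∧ dz̄ / y²` in the Schwartz form `φ⁰_Δ(λ, z)`. -/
noncomputable def phiZero (N : ℕ) (Δ : ℤ) (l : Matrix (Fin 2) (Fin 2) ℝ) (z : ℍ) : ℝ :=
  (1 / |(Δ : ℝ)| * bilForm N l (lambdaOf N z) ^ 2 - 1 / (2 * π)) *
    Real.exp (-2 * π * kmR N l z / |(Δ : ℝ)|)

/-- The coefficient of `ω` in `φ(λ, τ, z) = e(Q_Δ(λ) τ) φ⁰_Δ(√v λ, z)`, with `v = Im τ`. -/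
noncomputable def phi (N : ℕ) (Δ : ℤ) (l : Matrix (Fin 2) (Fin 2) ℝ) (τ z : ℍ) : ℂ :=
  cexp (2 * π * I * quadFormScaled N Δ l * τ) * (phiZero N Δ (Real.sqrt τ.im • l) z : ℂ)

/-- The coset `ΔL + δ`. -/
def discCoset {N : ℕ} {Δ : ℤ} (δ : DiscGroup N Δ) : Set (dualLattice N) :=
  {l | (QuotientAddGroup.mk l : DiscGroup N Δ) = δ}

/-- The coefficient of `ω` in the theta series `Θ_δ(τ, z)`. -/
noncomputable def thetaDelta (N : ℕ) (Δ : ℤ) (δ : DiscGroup N Δ) (τ z : ℍ) : ℂ :=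
  ∑' l : discCoset δ, phi N Δ (l : dualLattice N) τ z

/-- The coefficient of `ω` in the twisted theta function `Θ_{Δ,r}(τ, z)`, with components
`Θ_{Δ,r,h} = ⟨ψ_{Δ,r}(𝔢_h), conj(Θ)⟩`. -/
noncomputable def twistedTheta (N : ℕ) (Δ r : ℤ) (τ z : ℍ) : BaseGroup N → ℂ := fun h =>
  discInner (twistMap N Δ r h) (fun δ => conj (thetaDelta N Δ δ τ z))

/-- The invariant two-form `ω = (i/2) dz ∧ dz̄ / y²` at `z`, on the tangent vectors `u`, `w`. -/
noncomputable def omegaForm (z : ℍ) (u w : ℂ) : ℂ :=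
  I / 2 * (u * conj w - w * conj u) / (z.im : ℂ) ^ 2

/-- The `ℂ[L'/L]`-valued two-form `Θ_{Δ,r}(τ, z)` in the variable `z`. -/
noncomputable def twistedThetaForm (N : ℕ) (Δ r : ℤ) (τ z : ℍ) (u w : ℂ) : BaseGroup N → ℂ :=
  fun h => twistedTheta N Δ r τ z h * omegaForm z u w

end TwistedKM

namespace TwistedKM

/-! ### The Kronecker symbol of a fundamental discriminant -/

/-! Put M = |Δ| and write Δ = r² − 4Nk. In the coordinates (a, b, c) ∈ ℤ³ of L', the h-th component
of the theta function is the sum of a Gaussian kernel against a weight that depends only on a and c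
modulo M and on b modulo 2NM. Modularity therefore splits into the finite Fourier transform of the
weight, which is arithmetic, and Poisson summation for the kernel, which is analysis.

Arithmetic. The condition π(δ) = rh says b = rh + 2Nt, and then b² − 4Nac = Δh² − 4N(ac − q(t, h)),
where q(t, h) = Nt² + rth + kh² has discriminant Δ. The condition on Q_Δ(δ) thus says that the
binary hermitian form with diagonal a, c and off-diagonal entry (t, h), over the quadratic order
ℤ[ω] with ω² = rω − Nk, has determinant 0 modulo Δ. The product of two values of a degenerate form
is a norm (`hermVal_mul`), and norms prime to Δ have trivial character (`char_eq_one_of_norm`, a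
descent in which inert primes cancel in squares). So the character at a represented unit is well
defined, and it is the generalized genus character (`hermChar_eq_genusCharForm`,
`twistMap_eq_twistWeight`).

This function on (ℤ/M)⁴ is invariant under unipotent changes of basis and transforms by χ under unit
scalars. Its Fourier transform inherits both properties, which determines it up to one constant on
the image of the support under the Gram map (`hermFourier_support`). Parseval shows that this image
already carries all the energy, so the transform vanishes elsewhere (`hermFourier_vanish`); no local
computation of the transform at the primes dividing Δ is needed. The constant is a binary Gauss sum
(`hermFourier_one_eq`). It reduces to one-variable Gauss sums (`sum_stdAddChar_binForm`), and these
come from the relation TSTST = S in the metaplectic group, acting on Jacobi theta functions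
(`sum_exp_sq`). The outcome is `weightFourier_twistWeight`: the transform of the weight of one
component is the combination of the weights of all components prescribed by the Weil representation.

Analysis. Poisson summation in a alone turns the kernel into one (`kapKer`) on which τ ↦ −1/τ acts
by rotating the outer coordinates, up to Poisson summation in b (`tsum_kmKer_fst`,
`tsum_kapKer_mid`). Undoing the first step gives `kmSeries_inversion`: inversion replaces a periodic
weight by its Fourier transform. With the arithmetic this is the law under S; the law under T is a
congruence, and S and T generate. Invariance under Γ₀(N) holds because the group permutes the
coordinates compatibly with both the kernel and the genus character. Convergence and smoothness
follow by viewing the series as exponentials of linear forms in the coefficients of a quadratic form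
with negative definite real part; such series may be differentiated termwise without limit. -/

open scoped NumberTheorySymbols in
-- The sign of d and the sign in quadratic reciprocity combine into one that depends on d only
-- modulo 4, so that negative d needs no separate treatment.
theorem jacobiSym_odd_reciprocity {d : ℤ} (hd : d % 2 = 1) {w : ℕ} (hw : Odd w) :
    J(d | w) = ZMod.χ₄ (w : ZMod 4) ^ (if d % 4 = 1 then 0 else 1) * J(w | d.natAbs) := by
  have hdn : Odd d.natAbs := by rw [Int.natAbs_odd, Int.odd_iff]; exact hd
  have hrec := jacobiSym.quadratic_reciprocity' hdn hw
  have hw4 := (Nat.odd_mod_four_iff.mp (Nat.odd_iff.mp hw))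
  have hχ1 : ZMod.χ₄ (w : ZMod 4) = if w % 4 = 1 then 1 else -1 := by
    rcases hw4 with h | h
    · rw [ZMod.χ₄_nat_one_mod_four h, if_pos h]
    · rw [ZMod.χ₄_nat_three_mod_four h, if_neg (by omega)]
  have hq : qrSign w d.natAbs = if w % 4 = 1 then 1 else ZMod.χ₄ (d.natAbs : ZMod 4) := by
    rw [qrSign, hχ1]
    split_ifs
    · exact jacobiSym.one_left _
    · exact jacobiSym.at_neg_one hdn
  have hχd : ZMod.χ₄ (d.natAbs : ZMod 4) = if d.natAbs % 4 = 1 then 1 else -1 := by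
    rcases Nat.odd_mod_four_iff.mp (Nat.odd_iff.mp hdn) with h | h
    · rw [ZMod.χ₄_nat_one_mod_four h, if_pos h]
    · rw [ZMod.χ₄_nat_three_mod_four h, if_neg (by omega)]
  rcases Int.natAbs_eq d with h | h
  · have e1 : J(d | w) = J((d.natAbs : ℤ) | w) := by rw [← h]
    rw [e1, hrec, hq, hχd, hχ1]
    have : d % 4 = 1 ↔ d.natAbs % 4 = 1 := by omega
    simp only [this]
    split_ifs <;> simp
  · have e1 : J(d | w) = J(-(d.natAbs : ℤ) | w) := by rw [← h]
    rw [e1, jacobiSym.neg _ hw, hrec, hq, hχd, hχ1]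
    have : d % 4 = 1 ↔ ¬ d.natAbs % 4 = 1 := by omega
    simp only [this]
    split_ifs <;> simp

/-- The quadratic character `n ↦ χ₄(n)^i χ₈(n)^e (n / |d|)` attached to the odd part `d` of a
fundamental discriminant. -/
noncomputable def oddPartChar (d : ℤ) (e : ℕ) (n : ℤ) : ℤ :=
  ZMod.χ₄ (n : ZMod 4) ^ (if d % 4 = 1 then 0 else 1) * ZMod.χ₈ (n : ZMod 8) ^ e *
    jacobiSym n d.natAbs

theorem oddPartChar_mul (d : ℤ) (e : ℕ) (n n' : ℤ) :
    oddPartChar d e (n * n') = oddPartChar d e n * oddPartChar d e n' := by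
  simp only [oddPartChar, Int.cast_mul, map_mul, mul_pow, jacobiSym.mul_left]
  ring

theorem oddPartChar_one (d : ℤ) (e : ℕ) : oddPartChar d e 1 = 1 := by
  simp [oddPartChar, jacobiSym.one_left]

/-- The parity of the character matches the sign convention of the Kronecker symbol at negative n.
-/
theorem oddPartChar_neg_one {d : ℤ} (hd : d % 2 = 1) (e : ℕ) :
    oddPartChar d e (-1) = if d < 0 then -1 else 1 := by
  have hdn : Odd d.natAbs := by rw [Int.natAbs_odd, Int.odd_iff]; exact hd
  have h4 : ZMod.χ₄ ((-1 : ℤ) : ZMod 4) = -1 := by decide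
  have h8 : ZMod.χ₈ ((-1 : ℤ) : ZMod 8) = 1 := by decide
  rw [oddPartChar, h4, h8, jacobiSym.at_neg_one hdn]
  rcases Nat.odd_mod_four_iff.mp (Nat.odd_iff.mp hdn) with h | h
  · rw [ZMod.χ₄_nat_one_mod_four h]
    rcases lt_or_ge d 0 with h0 | h0
    · rw [if_neg (by omega), if_pos h0]; simp
    · rw [if_pos (by omega), if_neg (by omega)]; simp
  · rw [ZMod.χ₄_nat_three_mod_four h]
    rcases lt_or_ge d 0 with h0 | h0
    · rw [if_pos (by omega), if_pos h0]; simp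
    · rw [if_neg (by omega), if_neg (by omega)]; simp

theorem IsFundamentalDiscriminant.exists_oddPart {Δ : ℤ} (hΔ : IsFundamentalDiscriminant Δ) :
    ∃ d : ℤ, Squarefree d ∧ d % 2 = 1 ∧
      ((Δ = d ∧ d % 4 = 1) ∨ (Δ = 4 * d ∧ d % 4 = 3) ∨ Δ = 8 * d) := by
  rcases hΔ with ⟨h1, h2⟩ | ⟨m, rfl, h1 | h1, h2⟩
  · exact ⟨Δ, h2, by omega, Or.inl ⟨rfl, h1⟩⟩
  · refine ⟨m / 2, h2.squarefree_of_dvd ⟨2, by omega⟩, by omega, Or.inr (Or.inr (by omega))⟩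
  · exact ⟨m, h2, by omega, Or.inr (Or.inl ⟨rfl, h1⟩)⟩

theorem IsFundamentalDiscriminant.ne_zero {Δ : ℤ} (hΔ : IsFundamentalDiscriminant Δ) : Δ ≠ 0 := by
  obtain ⟨d, -, h, h'⟩ := hΔ.exists_oddPart
  omega

theorem kroneckerSymbol_odd {Δ n : ℤ} (hn : n % 2 = 1) : kroneckerSymbol Δ n =
    (if n < 0 ∧ Δ < 0 then -1 else 1) * jacobiSym Δ n.natAbs := by
  have h2 : padicValNat 2 n.natAbs = 0 := padicValNat.eq_zero_of_not_dvd (by omega)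
  rw [kroneckerSymbol, if_neg (by omega), h2]
  simp

/-- Reciprocity is applied factor by factor. For odd Δ the symbol at 2 is χ₈(Δ) = (2 / |Δ|), so the
powers of 2 in n are reversed as well; for even Δ coprimality makes n odd, and the factors 4 or 8 of
Δ contribute nothing or χ₈(n). -/
theorem kroneckerSymbol_eq_oddPartChar {Δ d : ℤ} (hd : d % 2 = 1)
    (h : (Δ = d ∧ d % 4 = 1) ∨ (Δ = 4 * d ∧ d % 4 = 3) ∨ Δ = 8 * d) {n : ℤ}
    (hn : IsCoprime n Δ) :
    kroneckerSymbol Δ n = oddPartChar d (if Δ = 8 * d then 1 else 0) n := by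
  have hd0 : d ≠ 0 := by rintro rfl; simp at hd
  have hdn : Odd d.natAbs := by rw [Int.natAbs_odd, Int.odd_iff]; exact hd
  have hsgn : Δ < 0 ↔ d < 0 := by omega
  have hfac : ∀ e : ℕ, oddPartChar d e n =
      (if n < 0 ∧ Δ < 0 then -1 else 1) * oddPartChar d e n.natAbs := by
    intro e
    rcases lt_or_ge n 0 with h0 | h0
    · have : n = -1 * (n.natAbs : ℤ) := by omega
      conv_lhs => rw [this]
      rw [oddPartChar_mul, oddPartChar_neg_one hd]
      simp only [h0, hsgn, true_and]
    · rw [if_neg (by omega), one_mul, Int.natAbs_of_nonneg h0]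
  by_cases hcase : Δ = d ∧ d % 4 = 1
  · obtain ⟨rfl, h4⟩ := hcase
    rw [if_neg (by omega), hfac]
    by_cases hn0 : n = 0
    · subst hn0
      have : Δ = 1 ∨ Δ = -1 := by
        rw [isCoprime_zero_left] at hn
        exact Int.isUnit_iff.mp hn
      rcases this with rfl | rfl
      · simp [kroneckerSymbol, oddPartChar]
      · omega
    · rw [kroneckerSymbol, if_neg hn0, mul_assoc]
      congr 1
      set v := padicValNat 2 n.natAbs
      set w := n.natAbs / 2 ^ v with hw
      have hnw : n.natAbs = 2 ^ v * w := (Nat.mul_div_cancel' pow_padicValNat_dvd).symm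
      have hwodd : Odd w := by
        rw [Nat.odd_iff]
        by_contra hcon
        have h2 : 2 ∣ w := by omega
        have : 2 ^ (v + 1) ∣ n.natAbs := by
          rw [hnw, pow_succ]; exact Nat.mul_dvd_mul_left _ h2
        exact pow_succ_padicValNat_not_dvd (by omega) this
      have e1 : oddPartChar Δ 0 (n.natAbs : ℤ) = jacobiSym 2 Δ.natAbs ^ v * jacobiSym w Δ.natAbs := by
        rw [oddPartChar, if_pos h4, pow_zero, pow_zero, one_mul, one_mul, hnw]
        push_cast
        rw [jacobiSym.mul_left, jacobiSym.pow_left]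
      have h8 : ZMod.χ₈ (Δ : ZMod 8) = jacobiSym 2 Δ.natAbs := by
        rw [jacobiSym.at_two hdn]
        rcases Int.natAbs_eq Δ with h | h
        · conv_lhs => rw [h]
          simp
        · conv_lhs => rw [h]
          have : ∀ x : ZMod 8, ZMod.χ₈ (-x) = ZMod.χ₈ x := by decide
          rw [Int.cast_neg, this, Int.cast_natCast]
      rw [e1, h8, jacobiSym_odd_reciprocity hd hwodd, if_pos h4, pow_zero, one_mul]
  · have hnodd : n % 2 = 1 := by
      have h2 : ¬ (2 : ℤ) ∣ n := by
        intro h2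
        have : IsUnit (2 : ℤ) := hn.isUnit_of_dvd' h2 (by omega)
        rw [Int.isUnit_iff] at this; omega
      omega
    have hwodd : Odd n.natAbs := by rw [Int.natAbs_odd, Int.odd_iff]; exact hnodd
    rw [kroneckerSymbol_odd hnodd, hfac]
    congr 1
    have hrec := jacobiSym_odd_reciprocity hd hwodd
    by_cases h8 : Δ = 8 * d
    · rw [if_pos h8, h8, show 8 * d = 4 * (2 * d) by ring, jacobiSym.mul_left,
        jacobiSym.at_four hwodd, jacobiSym.mul_left, jacobiSym.at_two hwodd, hrec, oddPartChar,
        Int.cast_natCast, Int.cast_natCast]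
      ring
    · obtain ⟨h4, -⟩ : Δ = 4 * d ∧ d % 4 = 3 := by tauto
      rw [if_neg h8, h4, jacobiSym.mul_left, jacobiSym.at_four hwodd, hrec, oddPartChar,
        Int.cast_natCast]
      ring

theorem oddPartChar_congr {Δ d : ℤ} (hd2 : d % 2 = 1)
    (h : (Δ = d ∧ d % 4 = 1) ∨ (Δ = 4 * d ∧ d % 4 = 3) ∨ Δ = 8 * d) {n n' : ℤ}
    (hnn : Δ ∣ n - n') : oddPartChar d (if Δ = 8 * d then 1 else 0) n =
      oddPartChar d (if Δ = 8 * d then 1 else 0) n' := by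
  have hd : d ∣ n - n' := by
    refine dvd_trans ?_ hnn
    rcases h with ⟨rfl, -⟩ | ⟨rfl, -⟩ | rfl
    · exact dvd_rfl
    · exact dvd_mul_left _ _
    · exact dvd_mul_left _ _
  have hJ : jacobiSym n d.natAbs = jacobiSym n' d.natAbs := by
    apply jacobiSym.mod_left'
    apply Int.ModEq.symm
    rw [Int.modEq_iff_dvd]
    exact Int.natAbs_dvd.mpr hd
  have h4 : Δ ≠ d → (n : ZMod 4) = n' := by
    intro hne
    rw [← sub_eq_zero, ← Int.cast_sub, ZMod.intCast_zmod_eq_zero_iff_dvd]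
    refine dvd_trans ?_ hnn
    rcases h with ⟨rfl, -⟩ | ⟨rfl, -⟩ | rfl
    · exact absurd rfl hne
    · exact dvd_mul_right _ _
    · exact ⟨2 * d, by push_cast; ring⟩
  have h8 : Δ = 8 * d → (n : ZMod 8) = n' := by
    rintro rfl
    rw [← sub_eq_zero, ← Int.cast_sub, ZMod.intCast_zmod_eq_zero_iff_dvd]
    exact dvd_trans (dvd_mul_right _ _) hnn
  rw [oddPartChar, oddPartChar, hJ]
  congr 2
  · split_ifs with h1
    · simp
    · have hne : Δ ≠ d := by omega
      rw [h4 hne]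
  · split_ifs with h1
    · rw [h8 h1]
    · simp

/-- A common prime of n and Δ either divides d, where the Jacobi symbol vanishes, or is 2, and then
χ₄ or χ₈ is present and vanishes. -/
theorem oddPartChar_eq_zero {Δ d : ℤ} (hd : d % 2 = 1)
    (h : (Δ = d ∧ d % 4 = 1) ∨ (Δ = 4 * d ∧ d % 4 = 3) ∨ Δ = 8 * d) {n : ℤ}
    (hn : ¬ IsCoprime n Δ) : oddPartChar d (if Δ = 8 * d then 1 else 0) n = 0 := by
  by_cases hnd : IsCoprime n d
  · have hn2 : (2 : ℤ) ∣ n := by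
      by_contra h2
      apply hn
      have hc2 : IsCoprime n 2 := by
        rw [Int.isCoprime_iff_gcd_eq_one, Int.gcd_comm]
        rcases (Nat.dvd_prime Nat.prime_two).mp (Int.gcd_dvd_natAbs_left 2 n) with h | h
        · exact h
        · have := Int.gcd_dvd_right 2 n
          rw [h] at this
          exact absurd this h2
      rcases h with ⟨rfl, -⟩ | ⟨rfl, -⟩ | rfl
      · exact hnd
      · exact IsCoprime.mul_right (by rw [show (4 : ℤ) = 2 * 2 by norm_num]; exact hc2.mul_right hc2) hnd
      · exact IsCoprime.mul_right (by
          rw [show (8 : ℤ) = 2 * (2 * 2) by norm_num]; exact hc2.mul_right (hc2.mul_right hc2)) hnd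
    obtain ⟨t, rfl⟩ := hn2
    have e4 : ZMod.χ₄ ((2 * t : ℤ) : ZMod 4) = 0 := by
      have : ∀ x : ZMod 4, ZMod.χ₄ (2 * x) = 0 := by decide
      push_cast; exact this _
    have e8 : ZMod.χ₈ ((2 * t : ℤ) : ZMod 8) = 0 := by
      have : ∀ x : ZMod 8, ZMod.χ₈ (2 * x) = 0 := by decide
      push_cast; exact this _
    rw [oddPartChar]
    rcases h with ⟨rfl, -⟩ | ⟨rfl, h4⟩ | rfl
    · exact absurd hnd hn
    · rw [if_neg (by omega : ¬ d % 4 = 1), pow_one, e4]; simp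
    · rw [if_pos rfl, pow_one, e8]; simp
  · have : jacobiSym n d.natAbs = 0 := by
      rw [jacobiSym.eq_zero_iff]
      refine ⟨by omega, fun hg => hnd ?_⟩
      rw [Int.isCoprime_iff_gcd_eq_one]
      rw [← hg, Int.gcd_eq_natAbs, Int.gcd_eq_natAbs, Int.natAbs_natCast]
    rw [oddPartChar, this, mul_zero]

theorem isUnit_intCast_zmod_natAbs {Δ n : ℤ} : IsUnit (n : ZMod Δ.natAbs) ↔ IsCoprime n Δ := by
  rw [ZMod.coe_int_isUnit_iff_isCoprime, Int.isCoprime_iff_gcd_eq_one,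
    Int.isCoprime_iff_gcd_eq_one, Int.gcd_comm, Int.gcd_eq_natAbs, Int.gcd_eq_natAbs,
    Int.natAbs_natCast]

theorem exists_not_legendre_one (p : ℕ) [Fact p.Prime] (hp : p ≠ 2) :
    ∃ g : ℤ, jacobiSym g p = -1 := by
  obtain ⟨a, ha⟩ := quadraticChar_exists_neg_one (F := ZMod p) (by rwa [ZMod.ringChar_zmod_n])
  refine ⟨a.val, ?_⟩
  rw [← jacobiSym.legendreSym.to_jacobiSym, legendreSym]
  simpa using ha

/-- The character `n ↦ (Δ / n)` modulo `|Δ|`; it is primitive. -/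
theorem IsFundamentalDiscriminant.exists_char {Δ : ℤ} (hΔ : IsFundamentalDiscriminant Δ) :
    ∃ χ : MulChar (ZMod Δ.natAbs) ℤ,
      (∀ n : ℤ, IsCoprime n Δ → χ (n : ZMod Δ.natAbs) = kroneckerSymbol Δ n) ∧
      ∀ c : ZMod Δ.natAbs, ¬ IsUnit c → ∃ u : (ZMod Δ.natAbs)ˣ, u * c = c ∧ χ u = -1 := by
  obtain ⟨d, hsq, hd, h⟩ := hΔ.exists_oddPart
  have : NeZero Δ.natAbs := ⟨by have := hΔ.ne_zero; omega⟩
  set e := if Δ = 8 * d then 1 else 0 with he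
  have hcongr : ∀ n : ℤ, oddPartChar d e ((n : ZMod Δ.natAbs).val) = oddPartChar d e n := by
    intro n
    apply oddPartChar_congr hd h
    rw [← Int.natAbs_dvd, ← ZMod.intCast_zmod_eq_zero_iff_dvd]
    simp
  let χ : MulChar (ZMod Δ.natAbs) ℤ :=
    { toFun := fun x => oddPartChar d e (x.val : ℤ)
      map_one' := by
        have := hcongr 1
        rw [Int.cast_one] at this
        rw [this, oddPartChar_one]
      map_mul' := fun x y => by
        rw [← oddPartChar_mul, ← hcongr ((x.val : ℤ) * y.val)]
        simp
      map_nonunit' := fun x hx => by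
        apply oddPartChar_eq_zero hd h
        rw [← isUnit_intCast_zmod_natAbs]
        simpa using hx }
  have hχ : ∀ n : ℤ, χ (n : ZMod Δ.natAbs) = oddPartChar d e n := hcongr
  refine ⟨χ, fun n hn => ?_, fun c hc => ?_⟩
  · rw [hχ, kroneckerSymbol_eq_oddPartChar hd h hn]
  · suffices hs : ∃ u : ℤ, Δ ∣ (u - 1) * c.val ∧ oddPartChar d e u = -1 by
      obtain ⟨u, hu1, hu2⟩ := hs
      have hu : IsUnit (u : ZMod Δ.natAbs) := by
        by_contra hcon
        rw [isUnit_intCast_zmod_natAbs] at hcon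
        rw [oddPartChar_eq_zero hd h hcon] at hu2
        omega
      refine ⟨hu.unit, ?_, ?_⟩
      · have h0 : (((u - 1) * c.val : ℤ) : ZMod Δ.natAbs) = 0 := by
          rw [ZMod.intCast_zmod_eq_zero_iff_dvd]; exact Int.natAbs_dvd.mpr hu1
        rw [IsUnit.unit_spec]
        rw [Int.cast_mul, Int.cast_sub, Int.cast_one, Int.cast_natCast,
          ZMod.natCast_zmod_val] at h0
        linear_combination h0
      · rw [IsUnit.unit_spec, hχ, hu2]
    have hnc : ¬ (c.val).Coprime Δ.natAbs := by
      rw [← ZMod.isUnit_iff_coprime]; simpa using hc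
    -- For a common prime p of c and Δ it is enough that u ≡ 1 modulo Δ/p and χ(u) = −1, since then
    -- Δ divides (u − 1)c. Existence of such u is primitivity at p.
    obtain ⟨p, hp, hpc, hpΔ⟩ := Nat.Prime.not_coprime_iff_dvd.mp hnc
    have : Fact p.Prime := ⟨hp⟩
    obtain ⟨c', hc'⟩ := hpc
    rw [hc']
    have hpΔ' : (p : ℤ) ∣ Δ := Int.natCast_dvd.mpr hpΔ
    by_cases hp2 : p = 2
    · subst hp2
      have hodd : IsCoprime (8 : ℤ) d := by
        rw [show (8 : ℤ) = 2 ^ 3 by norm_num]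
        apply IsCoprime.pow_left
        rw [Int.prime_two.coprime_iff_not_dvd]
        omega
      rcases h with ⟨h1, -⟩ | ⟨h1, h4⟩ | h1
      · exfalso; omega
      · obtain ⟨x, y, hxy⟩ := hodd
        -- Since 8x + dy = 1, this u is 1 modulo d and 3 modulo 4, so only χ₄ sees it.
        have hu : ∀ u : ℤ, u = 1 + 2 * (y * d) → Δ ∣ (u - 1) * ((2 * c' : ℕ) : ℤ) ∧
            oddPartChar d e u = -1 := by
          rintro u hu
          refine ⟨⟨y * c', by rw [h1, hu]; push_cast; ring⟩, ?_⟩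
          have e0 : e = 0 := by rw [he, if_neg (by omega)]
          have e1 : (u : ZMod 4) = 3 := by
            have : u = 3 + 4 * (-(4 * x)) := by rw [hu]; linear_combination 2 * hxy
            rw [this]; push_cast
            rw [show (4 : ZMod 4) = 0 by decide]; ring
          have e2 : jacobiSym u d.natAbs = 1 := by
            rw [← jacobiSym.one_left d.natAbs]
            apply jacobiSym.mod_left'
            apply Int.ModEq.symm
            rw [Int.modEq_iff_dvd, hu]
            exact Int.natAbs_dvd.mpr ⟨2 * y, by ring⟩
          rw [oddPartChar, e0, if_neg (by omega), e1, e2, pow_zero]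
          decide
        exact ⟨_, hu _ rfl⟩
      · obtain ⟨x, y, hxy⟩ := hodd
        -- Now u is 1 modulo d, 1 modulo 4 and 5 modulo 8, so only χ₈ sees it.
        have hu : ∀ u : ℤ, u = 1 + 4 * (y * d) → Δ ∣ (u - 1) * ((2 * c' : ℕ) : ℤ) ∧
            oddPartChar d e u = -1 := by
          rintro u hu
          refine ⟨⟨y * c', by rw [h1, hu]; push_cast; ring⟩, ?_⟩
          have e0 : e = 1 := by rw [he, if_pos h1]
          have e1 : (u : ZMod 8) = 5 := by
            have : u = 5 + 8 * (-(4 * x)) := by rw [hu]; linear_combination 4 * hxy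
            rw [this]; push_cast
            rw [show (8 : ZMod 8) = 0 by decide]; ring
          have e1' : (u : ZMod 4) = 1 := by
            have : u = 1 + 4 * (y * d) := hu
            rw [this]; push_cast
            rw [show (4 : ZMod 4) = 0 by decide]; ring
          have e2 : jacobiSym u d.natAbs = 1 := by
            rw [← jacobiSym.one_left d.natAbs]
            apply jacobiSym.mod_left'
            apply Int.ModEq.symm
            rw [Int.modEq_iff_dvd, hu]
            exact Int.natAbs_dvd.mpr ⟨4 * y, by ring⟩
          rw [oddPartChar, e0, e1, e1', e2]
          simp only [map_one, one_pow, pow_one, one_mul, mul_one]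
          decide
        exact ⟨_, hu _ rfl⟩
    · have hpodd : ¬ (p : ℤ) ∣ 8 := by
        intro h8
        have h8' : p ∣ 2 ^ 3 := by exact_mod_cast h8
        exact hp2 ((Nat.prime_dvd_prime_iff_eq hp Nat.prime_two).mp (hp.dvd_of_dvd_pow h8'))
      have hpp : Prime (p : ℤ) := Nat.prime_iff_prime_int.mp hp
      have hpd : (p : ℤ) ∣ d := by
        rcases h with ⟨rfl, -⟩ | ⟨rfl, -⟩ | rfl
        · exact hpΔ'
        · exact (hpp.dvd_mul.mp hpΔ').resolve_left (fun h => hpodd (h.mul_left 2))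
        · exact (hpp.dvd_mul.mp hpΔ').resolve_left hpodd
      obtain ⟨d', rfl⟩ := hpd
      have hpd' : ¬ (p : ℤ) ∣ d' := by
        rintro ⟨t, rfl⟩
        have := hsq p ⟨t, by ring⟩
        exact hpp.not_isUnit this
      obtain ⟨g, hg⟩ := exists_not_legendre_one p hp2
      have hcop : IsCoprime (p : ℤ) (8 * d') :=
        hpp.coprime_iff_not_dvd.mpr fun hcon =>
          (hpp.dvd_mul.mp hcon).elim hpodd hpd'
      obtain ⟨x, y, hxy⟩ := hcop
      -- Since px + 8d'y = 1, this is g modulo p and 1 modulo 8d', where g is a nonresidue modulo p.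
      refine ⟨1 + (g - 1) * (y * (8 * d')), ?_, ?_⟩
      · have : (p : ℤ) * d' * 8 ∣ (1 + (g - 1) * (y * (8 * d')) - 1) * ((p * c' : ℕ) : ℤ) :=
          ⟨(g - 1) * y * c', by push_cast; ring⟩
        refine dvd_trans ?_ this
        rcases h with ⟨h1, -⟩ | ⟨h1, -⟩ | h1 <;> rw [h1]
        · exact dvd_mul_right _ _
        · exact ⟨2, by ring⟩
        · exact ⟨1, by ring⟩
      · have d'0 : d'.natAbs ≠ 0 := by
          rintro h0
          rw [Int.natAbs_eq_zero] at h0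
          exact hpd' (h0 ▸ dvd_zero _)
        have e4 : ((1 + (g - 1) * (y * (8 * d')) : ℤ) : ZMod 4) = 1 := by
          push_cast; rw [show (8 : ZMod 4) = 0 by decide]; ring
        have e8 : ((1 + (g - 1) * (y * (8 * d')) : ℤ) : ZMod 8) = 1 := by
          push_cast; rw [show (8 : ZMod 8) = 0 by decide]; ring
        have ep : jacobiSym (1 + (g - 1) * (y * (8 * d'))) p = -1 := by
          rw [← hg]
          apply jacobiSym.mod_left'
          apply Int.ModEq.symm
          rw [Int.modEq_iff_dvd]
          exact ⟨-((g - 1) * x), by linear_combination (g - 1) * hxy⟩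
        have ed : jacobiSym (1 + (g - 1) * (y * (8 * d'))) d'.natAbs = 1 := by
          refine (jacobiSym.mod_left' ?_).trans (jacobiSym.one_left d'.natAbs)
          apply Int.ModEq.symm
          rw [Int.modEq_iff_dvd]
          exact Int.natAbs_dvd.mpr ⟨(g - 1) * y * 8, by ring⟩
        rw [oddPartChar, e4, e8, Int.natAbs_mul, Int.natAbs_natCast,
          jacobiSym.mul_right' _ hp.ne_zero d'0, ep, ed]
        simp

/-! ### Inert primes, and the character on norms -/

theorem kroneckerSymbol_prime_eq_neg_one {Δ : ℤ} (hΔ : IsFundamentalDiscriminant Δ) {l : ℕ}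
    (hl : l.Prime) (h : kroneckerSymbol Δ l = -1) :
    (l ≠ 2 ∧ jacobiSym Δ l = -1) ∨ (l = 2 ∧ Δ % 8 = 5) := by
  by_cases hl2 : l = 2
  · refine Or.inr ⟨hl2, ?_⟩
    subst hl2
    have h2 : kroneckerSymbol Δ (2 : ℕ) = ZMod.χ₈ (Δ : ZMod 8) := by
      rw [kroneckerSymbol]
      simp
    rw [h2, ZMod.χ₈_int_eq_if_mod_eight] at h
    obtain ⟨d, -, hd, h'⟩ := hΔ.exists_oddPart
    split_ifs at h <;> omega
  · refine Or.inl ⟨hl2, ?_⟩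
    have : (l : ℤ) % 2 = 1 := by
      have := hl.eq_two_or_odd
      omega
    rw [kroneckerSymbol_odd this] at h
    rw [if_neg (by omega), one_mul, Int.natAbs_natCast] at h
    exact h

/-- If `4 e u` is a norm from the quadratic order of discriminant `Δ`, where no prime divisor of `e`
is inert, then `(Δ / u) = 1`. -/
theorem char_eq_one_of_norm_aux {Δ : ℤ} (hΔ : IsFundamentalDiscriminant Δ)
    (χ : MulChar (ZMod Δ.natAbs) ℤ)
    (hχ : ∀ n : ℤ, IsCoprime n Δ → χ (n : ZMod Δ.natAbs) = kroneckerSymbol Δ n) (u : ℕ) :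
    0 < u → IsCoprime (u : ℤ) Δ → ∀ (e : ℕ) (A B : ℤ),
      (∀ l : ℕ, l.Prime → l ∣ e → χ ((l : ℤ) : ZMod Δ.natAbs) ≠ -1) →
      4 * e * u = A ^ 2 - Δ * B ^ 2 → χ ((u : ℤ) : ZMod Δ.natAbs) = 1 := by
  induction u using Nat.strong_induction_on with
  | _ u ih =>
    intro hu hcop e A B he hAB
    by_cases hu1 : u = 1
    · subst hu1; simp
    obtain ⟨l, hl, u', rfl⟩ := Nat.exists_prime_and_dvd hu1
    have : Fact l.Prime := ⟨hl⟩
    have hl1 : 1 < l := hl.one_lt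
    have hu' : 0 < u' := Nat.pos_of_mul_pos_left hu
    have hlt : u' < l * u' := by nlinarith
    push_cast at hcop hAB
    have hlc : IsCoprime (l : ℤ) Δ := hcop.of_mul_left_left
    have huc : IsCoprime (u' : ℤ) Δ := hcop.of_mul_left_right
    have hlu : IsUnit (χ ((l : ℤ) : ZMod Δ.natAbs)) :=
      (isUnit_intCast_zmod_natAbs.mpr hlc).map χ
    -- A prime l of u with χ(l) = 1 is moved into e, which keeps e free of primes with value −1. If
    -- χ(l) = −1, then l is inert, so it divides A and B, and a factor l² cancels.
    rcases Int.isUnit_iff.mp hlu with h1 | h1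
    · have := ih u' hlt hu' huc (e * l) A B (fun l' hl' hd => by
        rcases (Nat.Prime.dvd_mul hl').mp hd with h | h
        · exact he l' hl' h
        · rw [(Nat.prime_dvd_prime_iff_eq hl' hl).mp h, h1]; decide) (by
          push_cast; linear_combination hAB)
      push_cast at this h1 ⊢
      rw [map_mul, h1, this, one_mul]
    · have hle : ¬ l ∣ e := fun h => he l hl h h1
      have hk := kroneckerSymbol_prime_eq_neg_one hΔ hl (by rw [← hχ _ hlc, h1])
      -- it suffices to divide by `l²`
      have hred : ∀ A' B' : ℤ, 4 * e * (l * u') = (l : ℤ) ^ 2 * (A' ^ 2 - Δ * B' ^ 2) →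
          (l : ℤ) ∣ u' → χ (((l * u' : ℕ) : ℤ) : ZMod Δ.natAbs) = 1 := by
        rintro A' B' h2 ⟨t, ht⟩
        lift t to ℕ using by
          by_contra hcon
          have : (l : ℤ) * t < 0 := mul_neg_of_pos_of_neg (by exact_mod_cast hl.pos) (by omega)
          omega
        have ht' : u' = l * t := by exact_mod_cast ht
        subst ht'
        have htpos : 0 < t := Nat.pos_of_mul_pos_left hu'
        push_cast at huc h2
        have hl0 : ((l : ℤ) ^ 2) ≠ 0 := pow_ne_zero _ (by exact_mod_cast hl.ne_zero)
        have := ih t (by nlinarith) htpos huc.of_mul_left_right e A' B' he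
          (mul_left_cancel₀ hl0 (by linear_combination h2))
        push_cast at this h1 ⊢
        rw [map_mul, map_mul, h1, this]; norm_num
      rcases hk with ⟨hl2, hJ⟩ | ⟨rfl, h5⟩
      · have hdvd : (l : ℤ) ∣ A ^ 2 - Δ * B ^ 2 := ⟨4 * e * u', by linear_combination -hAB⟩
        obtain ⟨⟨A', rfl⟩, ⟨B', rfl⟩⟩ := jacobiSym.prime_dvd_of_eq_neg_one hJ hdvd
        refine hred A' B' (by linear_combination hAB) ?_
        have hpp : Prime (l : ℤ) := Nat.prime_iff_prime_int.mp hl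
        have h3 : (l : ℤ) ∣ 4 * e * u' := by
          refine ⟨A' ^ 2 - Δ * B' ^ 2, ?_⟩
          have hl0 : (l : ℤ) ≠ 0 := by exact_mod_cast hl.ne_zero
          exact mul_left_cancel₀ hl0 (by linear_combination hAB)
        rcases hpp.dvd_mul.mp h3 with h | h
        · exfalso
          rcases hpp.dvd_mul.mp h with h | h
          · have h4 : l ∣ 2 ^ 2 := by exact_mod_cast h
            exact hl2 ((Nat.prime_dvd_prime_iff_eq hl Nat.prime_two).mp (hl.dvd_of_dvd_pow h4))
          · exact hle (by exact_mod_cast h)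
        · exact h
      · push_cast at hAB hred ⊢
        have h8 : (8 : ℤ) ∣ A ^ 2 - Δ * B ^ 2 := ⟨e * u', by linear_combination -hAB⟩
        obtain ⟨t, ht⟩ : ∃ t, Δ = 8 * t + 5 := ⟨Δ / 8, by omega⟩
        have hsq : ∀ x : ℤ, x % 2 = 1 → ∃ y, x ^ 2 = 8 * y + 1 := by
          intro x hx
          obtain ⟨w, rfl⟩ : ∃ w, x = 2 * w + 1 := ⟨x / 2, by omega⟩
          obtain ⟨y, hy⟩ : (2 : ℤ) ∣ w * (w + 1) := by
            rcases Int.even_or_odd w with h | h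
            · exact h.two_dvd.mul_right _
            · exact (h.add_one).two_dvd.mul_left _
          exact ⟨y, by linear_combination 4 * hy⟩
        have hev : ∀ x : ℤ, x % 2 = 0 → ∃ y, x ^ 2 = 4 * y := by
          intro x hx
          obtain ⟨w, rfl⟩ : ∃ w, x = 2 * w := ⟨x / 2, by omega⟩
          exact ⟨w ^ 2, by ring⟩
        obtain ⟨z, hz⟩ := h8
        -- As Δ ≡ 5 modulo 8, X² − ΔY² is even only if X and Y have the same parity. It is then
        -- divisible by 4, and the quotient is odd when both are odd. This replaces the residue
        -- symbol argument at l = 2.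
        have h4 : ∀ X Y Z : ℤ, X ^ 2 - Δ * Y ^ 2 = 2 * Z →
            ∃ Z', Z = 2 * Z' ∧ (X % 2 = 1 → Z' % 2 = 0 → False) := by
          intro X Y Z hZ
          rw [ht] at hZ
          rcases Int.emod_two_eq_zero_or_one X with hX | hX <;>
            rcases Int.emod_two_eq_zero_or_one Y with hY | hY
          · obtain ⟨x, hx⟩ := hev X hX
            obtain ⟨y, hy⟩ := hev Y hY
            exact ⟨x - (8 * t + 5) * y, by
              rw [hx, hy] at hZ; linarith, by omega⟩
          · obtain ⟨x, hx⟩ := hev X hX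
            obtain ⟨y, hy⟩ := hsq Y hY
            rw [hx, hy] at hZ
            ring_nf at hZ
            omega
          · obtain ⟨x, hx⟩ := hsq X hX
            obtain ⟨y, hy⟩ := hev Y hY
            rw [hx, hy] at hZ
            ring_nf at hZ
            omega
          · obtain ⟨x, hx⟩ := hsq X hX
            obtain ⟨y, hy⟩ := hsq Y hY
            refine ⟨2 * x - 16 * t * y - 10 * y - 2 * t - 1, ?_, fun _ h0 => ?_⟩
            · rw [hx, hy] at hZ; linarith
            · generalize t * y = w at *
              have : 16 * t * y = 16 * (t * y) := by ring
              omega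
        obtain ⟨Z', hZ', hX⟩ := h4 A B (4 * z) (by linear_combination hz)
        have hA : A % 2 = 0 := by
          by_contra hcon
          exact hX (by omega) (by omega)
        have hB : B % 2 = 0 := by
          by_contra hcon
          obtain ⟨x, hx⟩ := hev A hA
          obtain ⟨y, hy⟩ := hsq B (by omega)
          rw [hx, hy, ht] at hz
          ring_nf at hz
          omega
        obtain ⟨A', rfl⟩ : ∃ w, A = 2 * w := ⟨A / 2, by omega⟩
        obtain ⟨B', rfl⟩ : ∃ w, B = 2 * w := ⟨B / 2, by omega⟩
        refine hred A' B' (by linear_combination hAB) ?_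
        obtain ⟨W, hW, -⟩ := h4 A' B' (e * u') (by linarith)
        have h2 : (2 : ℤ) ∣ e * u' := ⟨W, hW⟩
        exact (Int.prime_two.dvd_mul.mp h2).resolve_left fun h => hle (by exact_mod_cast h)

/-- Reduction to positive u: replacing A by A + 2eΔ²j changes u by a multiple of Δ, and the new u is
positive for j large. -/
theorem char_eq_one_of_norm {Δ : ℤ} (hΔ : IsFundamentalDiscriminant Δ)
    (χ : MulChar (ZMod Δ.natAbs) ℤ)
    (hχ : ∀ n : ℤ, IsCoprime n Δ → χ (n : ZMod Δ.natAbs) = kroneckerSymbol Δ n)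
    {u : ℤ} (hu : IsCoprime u Δ) {e : ℕ} (he0 : 0 < e) {A B : ℤ}
    (he : ∀ l : ℕ, l.Prime → l ∣ e → χ ((l : ℤ) : ZMod Δ.natAbs) ≠ -1)
    (hAB : 4 * e * u = A ^ 2 - Δ * B ^ 2) : χ (u : ZMod Δ.natAbs) = 1 := by
  have hΔ0 := hΔ.ne_zero
  set j : ℤ := |A| + |u| + 1
  set X : ℤ := A + 2 * e * Δ * (Δ * j)
  set w : ℤ := u + Δ * (A * (Δ * j) + e * Δ * (Δ * j) ^ 2) with hw
  have hpos : 0 < w := by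
    have h1 : 1 ≤ Δ ^ 2 := by have := sq_pos_of_ne_zero hΔ0; omega
    have h2 : (1 : ℤ) ≤ e := by exact_mod_cast he0
    have h3 : w = u + Δ ^ 2 * j * (A + e * Δ ^ 2 * j) := by rw [hw]; ring
    have hj1 : 1 ≤ j := by have := abs_nonneg A; have := abs_nonneg u; omega
    have h4 : (1 : ℤ) ≤ e * Δ ^ 2 := by nlinarith
    have h5 : j ≤ e * Δ ^ 2 * j := by nlinarith
    have h6 : |u| + 1 ≤ A + e * Δ ^ 2 * j := by have := neg_abs_le A; omega
    have h7 : 1 ≤ Δ ^ 2 * j := by nlinarith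
    have h8 : |u| + 1 ≤ Δ ^ 2 * j * (A + e * Δ ^ 2 * j) := by
      have := abs_nonneg u; nlinarith
    have := neg_abs_le u
    omega
  have hwu : (w : ZMod Δ.natAbs) = u := by
    rw [← sub_eq_zero, ← Int.cast_sub, ZMod.intCast_zmod_eq_zero_iff_dvd]
    exact Int.natAbs_dvd.mpr ⟨A * (Δ * j) + e * Δ * (Δ * j) ^ 2, by rw [hw]; ring⟩
  have hwc : IsCoprime w Δ := by
    rw [← isUnit_intCast_zmod_natAbs, hwu, isUnit_intCast_zmod_natAbs]; exact hu
  have hwn : ((w.natAbs : ℕ) : ℤ) = w := by omega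
  rw [← hwu, ← hwn]
  refine char_eq_one_of_norm_aux hΔ χ hχ w.natAbs (by omega) (by rwa [hwn]) e X B he ?_
  rw [hwn, hw]
  linear_combination hAB

/-- The primes dividing `N` are not inert if `Δ` is a square modulo `4N`. -/
theorem char_prime_ne_neg_one {Δ r k : ℤ} (hΔ : IsFundamentalDiscriminant Δ)
    (χ : MulChar (ZMod Δ.natAbs) ℤ)
    (hχ : ∀ n : ℤ, IsCoprime n Δ → χ (n : ZMod Δ.natAbs) = kroneckerSymbol Δ n) {N : ℕ}
    (hr : Δ = r ^ 2 - 4 * N * k) {l : ℕ} (hl : l.Prime) (hlN : l ∣ N) :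
    χ ((l : ℤ) : ZMod Δ.natAbs) ≠ -1 := by
  have : Fact l.Prime := ⟨hl⟩
  intro h
  have hc : IsCoprime (l : ℤ) Δ := by
    by_contra hcon
    rw [← isUnit_intCast_zmod_natAbs] at hcon
    rw [χ.map_nonunit hcon] at h
    omega
  rw [hχ _ hc] at h
  obtain ⟨N', rfl⟩ := hlN
  rcases kroneckerSymbol_prime_eq_neg_one hΔ hl h with ⟨-, hJ⟩ | ⟨rfl, h5⟩
  · have hm : jacobiSym Δ l = jacobiSym (r ^ 2) l := by
      apply jacobiSym.mod_left'
      apply Int.ModEq.symm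
      rw [Int.modEq_iff_dvd, hr]
      exact ⟨-(4 * N' * k), by push_cast; ring⟩
    rw [hm, jacobiSym.pow_left] at hJ
    nlinarith [sq_nonneg (jacobiSym r l)]
  · push_cast at hr
    have h8 : Δ = r ^ 2 - 8 * (N' * k) := by rw [hr]; ring
    rcases Int.even_or_odd r with ⟨s, rfl⟩ | ⟨s, rfl⟩
    · have : Δ = 4 * s ^ 2 - 8 * (N' * k) := by rw [h8]; ring
      omega
    · obtain ⟨y, hy⟩ : (2 : ℤ) ∣ s * (s + 1) := by
        rcases Int.even_or_odd s with h | h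
        · exact h.two_dvd.mul_right _
        · exact (h.add_one).two_dvd.mul_left _
      have : Δ = 8 * y + 1 - 8 * (N' * k) := by rw [h8]; linear_combination 4 * hy
      omega

/-- Quadratic forms of fundamental discriminant are primitive. -/
theorem IsFundamentalDiscriminant.not_dvd_both {Δ r e f : ℤ} (hΔ : IsFundamentalDiscriminant Δ)
    (h : Δ = r ^ 2 - 4 * e * f) {p : ℕ} (hp : p.Prime) (hpΔ : (p : ℤ) ∣ Δ) (he : (p : ℤ) ∣ e) :
    ¬ (p : ℤ) ∣ f := by
  rintro ⟨f', rfl⟩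
  obtain ⟨e', rfl⟩ := he
  have hpp : Prime (p : ℤ) := Nat.prime_iff_prime_int.mp hp
  have hpr : (p : ℤ) ∣ r := by
    have : (p : ℤ) ∣ r ^ 2 := by
      have h2 : r ^ 2 = Δ + p * (4 * e' * (p * f')) := by rw [h]; ring
      rw [h2]; exact dvd_add hpΔ (dvd_mul_right _ _)
    exact hpp.dvd_of_dvd_pow this
  obtain ⟨r', rfl⟩ := hpr
  rcases hΔ with ⟨h1, h2⟩ | ⟨m, hm, h1, h2⟩
  · exact hpp.not_isUnit (h2 p ⟨r' ^ 2 - 4 * e' * f', by rw [h]; ring⟩)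
  · by_cases hp2 : p = 2
    · subst hp2
      push_cast at h
      have : m = r' ^ 2 - 4 * (e' * f') := by linarith
      rcases Int.even_or_odd r' with ⟨s, rfl⟩ | ⟨s, rfl⟩
      · have : m = 4 * (s ^ 2) - 4 * (e' * f') := by rw [this]; ring
        omega
      · have : m = 4 * (s ^ 2 + s) + 1 - 4 * (e' * f') := by rw [this]; ring
        omega
    · have hcop : IsCoprime ((p : ℤ) * p) 4 := by
        have h4 : IsCoprime (p : ℤ) 2 := by
          rw [hpp.coprime_iff_not_dvd]
          intro hcon
          have : p ∣ 2 := by exact_mod_cast hcon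
          exact hp2 ((Nat.prime_dvd_prime_iff_eq hp Nat.prime_two).mp this)
        rw [show (4 : ℤ) = 2 * 2 by norm_num]
        exact (h4.mul_right h4).mul_left (h4.mul_right h4)
      have hdv : (p : ℤ) * p ∣ m * 4 := ⟨r' ^ 2 - 4 * e' * f', by rw [mul_comm m, ← hm, h]; ring⟩
      exact hpp.not_isUnit (h2 p (hcop.dvd_of_dvd_mul_right hdv))

/-! ### Binary hermitian forms over a quadratic order

The ring `R[ω]` with `ω² = r ω - N k` acts on the module `P` of pairs `(t, h) ↔ N t + h ω`, which
carries the quadratic form `N t² + r t h + k h²`. -/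

section Hermitian

variable {R : Type*} [CommRing R] (N r k : R)

/-- The form `N t² + r t h + k h²` of discriminant `r² - 4 N k`. -/
def binForm (x : R × R) : R := N * x.1 ^ 2 + r * x.1 * x.2 + k * x.2 ^ 2

/-- The polar form of `binForm`. -/
def binPolar (x y : R × R) : R :=
  2 * N * x.1 * y.1 + r * (x.1 * y.2 + x.2 * y.1) + 2 * k * x.2 * y.2

/-- The norm form of `R[ω]`. -/
def ordNorm (s : R × R) : R := s.1 ^ 2 + r * s.1 * s.2 + N * k * s.2 ^ 2

/-- A pair s stands for s.1 + s.2 ω, and the conjugate of ω is r − ω. -/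
def ordConj (s : R × R) : R × R := (s.1 + r * s.2, -s.2)

def ordMul (s s' : R × R) : R × R :=
  (s.1 * s'.1 - N * k * s.2 * s'.2, s.1 * s'.2 + s.2 * s'.1 + r * s.2 * s'.2)

/-- The action of `R[ω]` on `P`. -/
def ordAct (s x : R × R) : R × R :=
  (s.1 * x.1 - k * s.2 * x.2, s.1 * x.2 + s.2 * (N * x.1 + r * x.2))

/-- The `R[ω]`-valued hermitian pairing on `P`. -/
def ordPair (x y : R × R) : R × R :=
  (N * x.1 * y.1 + r * x.1 * y.2 + k * x.2 * y.2, x.2 * y.1 - x.1 * y.2)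

/-- The value at `v = (s, w)` of the binary hermitian form with coefficients `δ = ((a, c), x)`. -/
def hermVal (δ v : (R × R) × (R × R)) : R :=
  δ.1.1 * ordNorm N r k v.1 + binPolar N r k δ.2 (ordAct N r k v.1 v.2) +
    δ.1.2 * binForm N r k v.2

/-- The determinant of a binary hermitian form. -/
def hermDet (δ : (R × R) × (R × R)) : R := δ.1.1 * δ.1.2 - binForm N r k δ.2

/-- The polarization of a binary hermitian form. -/
def hermPol (δ v v' : (R × R) × (R × R)) : R × R :=
  δ.1.1 • ordMul N r k (ordConj r v.1) v'.1 +
    ordMul N r k (ordConj r v.1) (ordPair N r k δ.2 v'.2) +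
    ordMul N r k v'.1 (ordConj r (ordPair N r k δ.2 v.2)) + δ.1.2 • ordPair N r k v.2 v'.2

/-- The Cauchy–Schwarz identity for hermitian forms: the product of two values minus the norm of the
pairing is the determinant of the form times the "norm" of the determinant of the two vectors,
measured by `binForm` because one coordinate lives in P. For a degenerate form a product of two
values is therefore a norm. -/
theorem hermVal_mul (δ v v' : (R × R) × (R × R)) :
    hermVal N r k δ v * hermVal N r k δ v' = ordNorm N r k (hermPol N r k δ v v') +
      hermDet N r k δ * binForm N r k
        (ordAct N r k (ordConj r v.1) v'.2 - ordAct N r k (ordConj r v'.1) v.2) := by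
  simp only [hermVal, hermPol, hermDet, ordNorm, ordConj, ordMul, ordAct, ordPair, binForm,
    binPolar, Prod.fst_add, Prod.snd_add, Prod.fst_sub, Prod.snd_sub, Prod.smul_fst,
    Prod.smul_snd, smul_eq_mul]
  ring

/-- The unipotent transformation `a ↦ a + (x, w) + c q(w)`, `x ↦ x + c w`. -/
def unipUpper (w : R × R) (δ : (R × R) × (R × R)) : (R × R) × (R × R) :=
  ((δ.1.1 + binPolar N r k δ.2 w + δ.1.2 * binForm N r k w, δ.1.2), δ.2 + δ.1.2 • w)

/-- The unipotent transformation `c ↦ c + (x, w) + a q(w)`, `x ↦ x + a w`. -/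
def unipLower (w : R × R) (δ : (R × R) × (R × R)) : (R × R) × (R × R) :=
  ((δ.1.1, δ.1.2 + binPolar N r k δ.2 w + δ.1.1 * binForm N r k w), δ.2 + δ.1.1 • w)

theorem unipUpper_neg (w : R × R) (δ : (R × R) × (R × R)) :
    unipUpper N r k (-w) (unipUpper N r k w δ) = δ := by
  ext <;> simp only [unipUpper, binPolar, binForm, Prod.fst_add, Prod.snd_add, Prod.smul_fst,
    Prod.smul_snd, smul_eq_mul, Prod.fst_neg, Prod.snd_neg] <;> ring

theorem unipLower_neg (w : R × R) (δ : (R × R) × (R × R)) :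
    unipLower N r k (-w) (unipLower N r k w δ) = δ := by
  ext <;> simp only [unipLower, binPolar, binForm, Prod.fst_add, Prod.snd_add, Prod.smul_fst,
    Prod.smul_snd, smul_eq_mul, Prod.fst_neg, Prod.snd_neg] <;> ring

/-- The unipotent acts on forms through a shear of the vector v, so the set of represented values
does not change. -/
theorem hermVal_unipUpper (w : R × R) (δ v : (R × R) × (R × R)) :
    hermVal N r k (unipUpper N r k w δ) v =
      hermVal N r k δ (v.1, v.2 + ordAct N r k (ordConj r v.1) w) := by
  simp only [hermVal, unipUpper, ordNorm, ordConj, ordAct, binForm, binPolar, Prod.fst_add,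
    Prod.snd_add, Prod.smul_fst, Prod.smul_snd, smul_eq_mul]
  ring

theorem hermVal_unipLower (w : R × R) (δ v : (R × R) × (R × R)) :
    hermVal N r k (unipLower N r k w δ) v =
      hermVal N r k δ (v.1 + ordPair N r k w v.2, v.2) := by
  simp only [hermVal, unipLower, ordNorm, ordPair, ordAct, binForm, binPolar, Prod.fst_add,
    Prod.snd_add, Prod.smul_fst, Prod.smul_snd, smul_eq_mul]
  ring

theorem hermDet_unipUpper (w : R × R) (δ : (R × R) × (R × R)) :
    hermDet N r k (unipUpper N r k w δ) = hermDet N r k δ := by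
  simp only [hermDet, unipUpper, binForm, binPolar, Prod.fst_add, Prod.snd_add, Prod.smul_fst,
    Prod.smul_snd, smul_eq_mul]
  ring

theorem hermDet_unipLower (w : R × R) (δ : (R × R) × (R × R)) :
    hermDet N r k (unipLower N r k w δ) = hermDet N r k δ := by
  simp only [hermDet, unipLower, binForm, binPolar, Prod.fst_add, Prod.snd_add, Prod.smul_fst,
    Prod.smul_snd, smul_eq_mul]
  ring

theorem hermVal_smul (u : R) (δ v : (R × R) × (R × R)) :
    hermVal N r k (u • δ) v = u * hermVal N r k δ v := by
  simp only [hermVal, binPolar, Prod.smul_fst, Prod.smul_snd, smul_eq_mul]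
  ring

theorem hermDet_smul (u : R) (δ : (R × R) × (R × R)) :
    hermDet N r k (u • δ) = u ^ 2 * hermDet N r k δ := by
  simp only [hermDet, binForm, Prod.smul_fst, Prod.smul_snd, smul_eq_mul]
  ring

open Classical in
/-- The genus character of a degenerate binary hermitian form: the value of `χ` at any unit
represented by the form. -/
noncomputable def hermChar (χ : MulChar R ℤ) (δ : (R × R) × (R × R)) : ℤ :=
  if h : hermDet N r k δ = 0 ∧ ∃ v, IsUnit (hermVal N r k δ v) then
    χ (hermVal N r k δ h.2.choose) else 0

variable {N r k} {χ : MulChar R ℤ}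

/-! ### The genus character of a degenerate hermitian form and its symmetries -/

theorem mulChar_int_eq_of_mul {x y : R} (hx : IsUnit x) (h : χ (x * y) = 1) : χ x = χ y := by
  rw [map_mul] at h
  rcases Int.isUnit_iff.mp (hx.map χ) with h1 | h1 <;> rw [h1] at h ⊢ <;> omega

/-- Independence of the chosen value: two represented units multiply to a norm, where χ is 1, and χ
takes only the values ±1 on units. -/
theorem hermChar_eq (hnorm : ∀ s, IsUnit (ordNorm N r k s) → χ (ordNorm N r k s) = 1)
    {δ v : (R × R) × (R × R)} (h0 : hermDet N r k δ = 0) (hv : IsUnit (hermVal N r k δ v)) :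
    hermChar N r k χ δ = χ (hermVal N r k δ v) := by
  have h : hermDet N r k δ = 0 ∧ ∃ v, IsUnit (hermVal N r k δ v) := ⟨h0, v, hv⟩
  rw [hermChar, dif_pos h]
  have h1 := h.2.choose_spec
  generalize h.2.choose = v₀ at h1 ⊢
  refine mulChar_int_eq_of_mul h1 ?_
  have h2 := hermVal_mul N r k δ v₀ v
  rw [h0, zero_mul, add_zero] at h2
  rw [h2]
  exact hnorm _ (h2 ▸ h1.mul hv)

theorem hermChar_ne_zero {δ : (R × R) × (R × R)} (h : hermChar N r k χ δ ≠ 0) :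
    hermDet N r k δ = 0 ∧ ∃ v, IsUnit (hermVal N r k δ v) := by
  by_contra hcon
  rw [hermChar, dif_neg hcon] at h
  exact h rfl

/-- Only the set of represented values and the vanishing of the determinant enter the definition, so
every symmetry below reduces to comparing these. -/
theorem hermChar_eq_of_forall (hnorm : ∀ s, IsUnit (ordNorm N r k s) → χ (ordNorm N r k s) = 1)
    {δ δ' : (R × R) × (R × R)} {u : R} (hu : IsUnit u)
    (h0 : hermDet N r k δ = 0 ↔ hermDet N r k δ' = 0)
    (h1 : ∀ v, ∃ v', hermVal N r k δ v = u * hermVal N r k δ' v')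
    (h2 : ∀ v', ∃ v, hermVal N r k δ v = u * hermVal N r k δ' v') :
    hermChar N r k χ δ = χ u * hermChar N r k χ δ' := by
  by_cases h : hermDet N r k δ = 0 ∧ ∃ v, IsUnit (hermVal N r k δ v)
  · obtain ⟨h3, v, hv⟩ := h
    obtain ⟨v', hv'⟩ := h1 v
    rw [hermChar_eq hnorm h3 hv, hermChar_eq hnorm (h0.mp h3) (v := v'), hv', map_mul]
    rw [hv'] at hv
    exact isUnit_of_mul_isUnit_right hv
  · have h' : ¬ (hermDet N r k δ' = 0 ∧ ∃ v, IsUnit (hermVal N r k δ' v)) := by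
      rintro ⟨h3, v', hv'⟩
      obtain ⟨v, hv⟩ := h2 v'
      exact h ⟨h0.mpr h3, v, hv ▸ hu.mul hv'⟩
    rw [hermChar, dif_neg h, hermChar, dif_neg h', mul_zero]

theorem hermChar_unipUpper (hnorm : ∀ s, IsUnit (ordNorm N r k s) → χ (ordNorm N r k s) = 1)
    (w : R × R) (δ : (R × R) × (R × R)) :
    hermChar N r k χ (unipUpper N r k w δ) = hermChar N r k χ δ := by
  have := hermChar_eq_of_forall hnorm (δ := unipUpper N r k w δ) (δ' := δ) isUnit_one
    (by rw [hermDet_unipUpper]) (fun v => ⟨_, by rw [hermVal_unipUpper, one_mul]⟩)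
    (fun v => ⟨(v.1, v.2 - ordAct N r k (ordConj r v.1) w), by
      rw [hermVal_unipUpper, one_mul]; simp⟩)
  rwa [map_one, one_mul] at this

theorem hermChar_unipLower (hnorm : ∀ s, IsUnit (ordNorm N r k s) → χ (ordNorm N r k s) = 1)
    (w : R × R) (δ : (R × R) × (R × R)) :
    hermChar N r k χ (unipLower N r k w δ) = hermChar N r k χ δ := by
  have := hermChar_eq_of_forall hnorm (δ := unipLower N r k w δ) (δ' := δ) isUnit_one
    (by rw [hermDet_unipLower]) (fun v => ⟨_, by rw [hermVal_unipLower, one_mul]⟩)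
    (fun v => ⟨(v.1 - ordPair N r k w v.2, v.2), by
      rw [hermVal_unipLower, one_mul]; simp⟩)
  rwa [map_one, one_mul] at this

theorem hermChar_smul (hnorm : ∀ s, IsUnit (ordNorm N r k s) → χ (ordNorm N r k s) = 1)
    {u : R} (hu : IsUnit u) (δ : (R × R) × (R × R)) :
    hermChar N r k χ (u • δ) = χ u * hermChar N r k χ δ :=
  hermChar_eq_of_forall hnorm hu (by
    rw [hermDet_smul]
    exact ⟨fun h => (hu.pow 2).mul_right_eq_zero.mp h, fun h => by rw [h, mul_zero]⟩)
    (fun v => ⟨v, hermVal_smul N r k u δ v⟩) (fun v => ⟨v, hermVal_smul N r k u δ v⟩)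

end Hermitian

/-! ### Parseval's formula -/

/-- Orthogonality of the characters y ↦ e(p(x, y)/M); these are distinct for distinct x as soon as p
is nondegenerate on the left. -/
theorem parseval_zmod {M : ℕ} [NeZero M] {G : Type*} [AddCommGroup G] [Fintype G]
    (p : G →+ G →+ ZMod M) (hp : ∀ x, (∀ y, p x y = 0) → x = 0) (F : G → ℂ) :
    ∑ y, Complex.normSq (∑ x, F x * ZMod.stdAddChar (p x y)) =
      Fintype.card G * ∑ x, Complex.normSq (F x) := by
  classical
  have hinj := ZMod.injective_stdAddChar (N := M)
  have horth : ∀ x x' : G, ∑ y, ZMod.stdAddChar (p x y) * conj (ZMod.stdAddChar (p x' y)) =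
      if x = x' then (Fintype.card G : ℂ) else 0 := by
    intro x x'
    have h1 : ∀ y, ZMod.stdAddChar (p x y) * conj (ZMod.stdAddChar (p x' y)) =
        (ZMod.stdAddChar (N := M)).compAddMonoidHom (p (x - x')) y := by
      intro y
      rw [← AddChar.map_neg_eq_conj, ← AddChar.map_add_eq_mul]
      simp [sub_eq_add_neg]
    simp only [h1]
    rw [AddChar.sum_eq_ite]
    congr 1
    rw [eq_iff_iff]
    constructor
    · intro h
      rw [← sub_eq_zero]
      refine hp _ fun y => hinj ?_
      have := DFunLike.congr_fun h y
      simpa using this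
    · rintro rfl
      ext y
      simp
  have key : ((∑ y, Complex.normSq (∑ x, F x * ZMod.stdAddChar (p x y)) : ℝ) : ℂ) =
      ((Fintype.card G * ∑ x, Complex.normSq (F x) : ℝ) : ℂ) := by
    push_cast
    simp only [Complex.normSq_eq_conj_mul_self, map_sum, map_mul, Finset.sum_mul_sum]
    rw [Finset.sum_comm, Finset.mul_sum]
    refine Finset.sum_congr rfl fun x' _ => ?_
    rw [Finset.sum_comm]
    have : ∀ x : G, ∑ y, conj (F x') * conj (ZMod.stdAddChar (p x' y)) *
        (F x * ZMod.stdAddChar (p x y)) = conj (F x') * F x *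
          if x = x' then (Fintype.card G : ℂ) else 0 := by
      intro x
      rw [← horth, Finset.mul_sum]
      exact Finset.sum_congr rfl fun y _ => by ring
    simp only [this]
    rw [Finset.sum_eq_single x']
    · simp; ring
    · intro b _ hb; simp [hb]
    · simp
  exact_mod_cast key

/-! ### The Fourier transform of the genus character -/

section Fourier

variable {M : ℕ} (N r k : ZMod M)

/-- The pairing `-(a c' + c a') + t β + h γ`. -/
def hermPairing : ((ZMod M × ZMod M) × (ZMod M × ZMod M)) →+
    ((ZMod M × ZMod M) × (ZMod M × ZMod M)) →+ ZMod M :=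
  AddMonoidHom.mk' (fun δ => AddMonoidHom.mk'
    (fun y => -(δ.1.1 * y.1.2 + δ.1.2 * y.1.1) + (δ.2.1 * y.2.1 + δ.2.2 * y.2.2))
    (fun y y' => by simp only [Prod.fst_add, Prod.snd_add]; ring))
    (fun δ δ' => AddMonoidHom.ext fun y => by
      simp only [AddMonoidHom.mk'_apply, AddMonoidHom.add_apply, Prod.fst_add, Prod.snd_add]
      ring)

theorem hermPairing_apply (δ y : (ZMod M × ZMod M) × (ZMod M × ZMod M)) : hermPairing δ y =
    -(δ.1.1 * y.1.2 + δ.1.2 * y.1.1) + (δ.2.1 * y.2.1 + δ.2.2 * y.2.2) := rfl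

theorem hermPairing_nondegenerate (δ : (ZMod M × ZMod M) × (ZMod M × ZMod M))
    (h : ∀ y, hermPairing δ y = 0) : δ = 0 := by
  have h1 := h ((0, 1), 0)
  have h2 := h ((1, 0), 0)
  have h3 := h (0, (1, 0))
  have h4 := h (0, (0, 1))
  simp [hermPairing_apply] at h1 h2 h3 h4
  ext <;> simp [h1, h2, h3, h4]

/-- The Gram matrix of `binForm`. -/
def gramMap : (ZMod M × ZMod M) →+ (ZMod M × ZMod M) :=
  AddMonoidHom.mk' (fun x => (2 * N * x.1 + r * x.2, r * x.1 + 2 * k * x.2))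
    (fun x y => by ext <;> simp only [Prod.fst_add, Prod.snd_add] <;> ring)

theorem gramMap_apply (x : ZMod M × ZMod M) :
    gramMap N r k x = (2 * N * x.1 + r * x.2, r * x.1 + 2 * k * x.2) := rfl

variable [NeZero M] (χ : MulChar (ZMod M) ℤ)

/-- The Fourier transform of the genus character. -/
noncomputable def hermFourier (y : (ZMod M × ZMod M) × (ZMod M × ZMod M)) : ℂ :=
  ∑ δ, (hermChar N r k χ δ : ℂ) * ZMod.stdAddChar (hermPairing δ y)

variable {N r k χ}

/-- After transport by the Gram map in the second component, the pairing is minus the polar form of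
the determinant. Unipotents preserve the determinant, hence act as isometries, and the sum is
reindexed. -/
theorem hermFourier_unipUpper
    (hnorm : ∀ s, IsUnit (ordNorm N r k s) → χ (ordNorm N r k s) = 1) (w : ZMod M × ZMod M)
    (δ' : (ZMod M × ZMod M) × (ZMod M × ZMod M)) :
    hermFourier N r k χ ((unipUpper N r k w δ').1, gramMap N r k (unipUpper N r k w δ').2) =
      hermFourier N r k χ (δ'.1, gramMap N r k δ'.2) := by
  let e : ((ZMod M × ZMod M) × (ZMod M × ZMod M)) ≃ ((ZMod M × ZMod M) × (ZMod M × ZMod M)) :=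
    { toFun := unipUpper N r k w
      invFun := unipUpper N r k (-w)
      left_inv := unipUpper_neg N r k w
      right_inv := fun δ => by simpa using unipUpper_neg N r k (-w) δ }
  rw [hermFourier, ← e.sum_comp]
  refine Finset.sum_congr rfl fun δ _ => ?_
  change (hermChar N r k χ (unipUpper N r k w δ) : ℂ) * _ = _
  rw [hermChar_unipUpper hnorm]
  congr 2
  simp only [hermPairing_apply, gramMap_apply, unipUpper, binForm, binPolar, e, Equiv.coe_fn_mk,
    Prod.fst_add, Prod.snd_add, Prod.smul_fst, Prod.smul_snd, smul_eq_mul]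
  ring

theorem hermFourier_unipLower
    (hnorm : ∀ s, IsUnit (ordNorm N r k s) → χ (ordNorm N r k s) = 1) (w : ZMod M × ZMod M)
    (δ' : (ZMod M × ZMod M) × (ZMod M × ZMod M)) :
    hermFourier N r k χ ((unipLower N r k w δ').1, gramMap N r k (unipLower N r k w δ').2) =
      hermFourier N r k χ (δ'.1, gramMap N r k δ'.2) := by
  let e : ((ZMod M × ZMod M) × (ZMod M × ZMod M)) ≃ ((ZMod M × ZMod M) × (ZMod M × ZMod M)) :=
    { toFun := unipLower N r k w
      invFun := unipLower N r k (-w)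
      left_inv := unipLower_neg N r k w
      right_inv := fun δ => by simpa using unipLower_neg N r k (-w) δ }
  rw [hermFourier, ← e.sum_comp]
  refine Finset.sum_congr rfl fun δ _ => ?_
  change (hermChar N r k χ (unipLower N r k w δ) : ℂ) * _ = _
  rw [hermChar_unipLower hnorm]
  congr 2
  simp only [hermPairing_apply, gramMap_apply, unipLower, binForm, binPolar, e, Equiv.coe_fn_mk,
    Prod.fst_add, Prod.snd_add, Prod.smul_fst, Prod.smul_snd, smul_eq_mul]
  ring

/-- Multiplication by a unit. -/
def unitSmulEquiv (u : (ZMod M)ˣ) : ((ZMod M × ZMod M) × (ZMod M × ZMod M)) ≃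
    ((ZMod M × ZMod M) × (ZMod M × ZMod M)) where
  toFun δ := (u : ZMod M) • δ
  invFun δ := ((u⁻¹ : (ZMod M)ˣ) : ZMod M) • δ
  left_inv δ := by
    change ((u⁻¹ : (ZMod M)ˣ) : ZMod M) • ((u : ZMod M) • δ) = δ
    rw [smul_smul]; simp
  right_inv δ := by
    change (u : ZMod M) • (((u⁻¹ : (ZMod M)ˣ) : ZMod M) • δ) = δ
    rw [smul_smul]; simp

theorem hermFourier_smul
    (hnorm : ∀ s, IsUnit (ordNorm N r k s) → χ (ordNorm N r k s) = 1) (u : (ZMod M)ˣ)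
    (y : (ZMod M × ZMod M) × (ZMod M × ZMod M)) :
    hermFourier N r k χ ((u : ZMod M) • y) = (χ u : ℂ) * hermFourier N r k χ y := by
  rw [hermFourier]
  conv_rhs => rw [hermFourier, ← (unitSmulEquiv u).sum_comp, Finset.mul_sum]
  refine Finset.sum_congr rfl fun δ _ => ?_
  change _ = _ * (((hermChar N r k χ ((u : ZMod M) • δ) : ℤ) : ℂ) *
    ZMod.stdAddChar (hermPairing ((u : ZMod M) • δ) y))
  have h1 : hermPairing ((u : ZMod M) • δ) y = hermPairing δ ((u : ZMod M) • y) := by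
    simp only [hermPairing_apply, Prod.smul_fst, Prod.smul_snd, smul_eq_mul]; ring
  have h2 : χ u * χ u = 1 := by
    rcases Int.isUnit_iff.mp (u.isUnit.map χ) with h | h <;> rw [h] <;> rfl
  have h2' : (χ u : ℂ) * χ u = 1 := by exact_mod_cast h2
  rw [h1, hermChar_smul hnorm u.isUnit, Int.cast_mul]
  linear_combination (-((hermChar N r k χ δ : ℂ) *
    ZMod.stdAddChar (hermPairing δ ((u : ZMod M) • y)))) * h2'

/-- The value of the Fourier transform on the line through `((1, 0), 0)`. -/
theorem hermFourier_line (hprim : ∀ c : ZMod M, ¬ IsUnit c →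
      ∃ u : (ZMod M)ˣ, u * c = c ∧ χ u = -1)
    (hnorm : ∀ s, IsUnit (ordNorm N r k s) → χ (ordNorm N r k s) = 1) (a : ZMod M) :
    hermFourier N r k χ ((a, 0), 0) = χ a * hermFourier N r k χ ((1, 0), 0) := by
  by_cases ha : IsUnit a
  · have := hermFourier_smul hnorm ha.unit ((1, 0), 0)
    simpa using this
  · obtain ⟨u, hu, hχ⟩ := hprim a ha
    have := hermFourier_smul hnorm u ((a, 0), 0)
    rw [show (u : ZMod M) • (((a, 0), 0) : (ZMod M × ZMod M) × (ZMod M × ZMod M)) =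
      ((a, 0), 0) by ext <;> simp [hu], hχ] at this
    rw [χ.map_nonunit ha]
    push_cast at this ⊢
    linear_combination this / 2

/-- For c = 1 each x admits exactly one degenerate form, a = q(x), and its character is 1 because it
represents values of q; unit c follows by scaling. For a nonunit c, primitivity gives a unit that
fixes c and changes the sign of the sum. -/
theorem sum_hermChar_row (hprim : ∀ c : ZMod M, ¬ IsUnit c →
      ∃ u : (ZMod M)ˣ, u * c = c ∧ χ u = -1)
    (hnorm : ∀ s, IsUnit (ordNorm N r k s) → χ (ordNorm N r k s) = 1)
    (hrep : ∃ w, IsUnit (binForm N r k w))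
    (hval : ∀ w, IsUnit (binForm N r k w) → χ (binForm N r k w) = 1) (c : ZMod M) :
    ∑ a, ∑ x, hermChar N r k χ ((a, c), x) = M ^ 2 * χ c := by
  have hscale : ∀ (u : (ZMod M)ˣ) (c : ZMod M),
      ∑ a, ∑ x, hermChar N r k χ ((a, u * c), x) =
        χ u * ∑ a, ∑ x, hermChar N r k χ ((a, c), x) := by
    intro u c
    let e₁ : ZMod M ≃ ZMod M := u.mulLeft
    let e₂ : ZMod M × ZMod M ≃ ZMod M × ZMod M := Equiv.prodCongr e₁ e₁
    rw [← e₁.sum_comp, Finset.mul_sum]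
    refine Finset.sum_congr rfl fun a _ => ?_
    rw [← e₂.sum_comp, Finset.mul_sum]
    exact Finset.sum_congr rfl fun x _ => hermChar_smul hnorm u.isUnit ((a, c), x)
  by_cases hc : IsUnit c
  · have h1 : ∀ x : ZMod M × ZMod M, ∑ a, hermChar N r k χ ((a, 1), x) = 1 := by
      intro x
      rw [Finset.sum_eq_single (binForm N r k x)]
      · obtain ⟨w, hw⟩ := hrep
        have h2 : hermVal N r k ((binForm N r k x, 1), x) (0, w) = binForm N r k w := by
          simp [hermVal, ordNorm, ordAct, binPolar]
        rw [hermChar_eq hnorm (v := (0, w)) (by simp [hermDet]) (by rwa [h2]), h2, hval w hw]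
      · intro a _ ha
        by_contra hcon
        have := (hermChar_ne_zero hcon).1
        simp only [hermDet, mul_one] at this
        exact ha (sub_eq_zero.mp this)
      · simp
    have := hscale hc.unit 1
    rw [mul_one, IsUnit.unit_spec] at this
    rw [this, Finset.sum_comm, Finset.sum_congr rfl fun x _ => h1 x]
    simp [ZMod.card]
    ring
  · obtain ⟨u, hu, hχ⟩ := hprim c hc
    have := hscale u c
    rw [hu, hχ] at this
    rw [χ.map_nonunit hc]
    linarith

/-- Parseval in one variable. The row sums c ↦ M²χ(c) have transform a ↦ χ(a)C, where C is the
sought value, so |C|² Σ|χ|² = M · M⁴ Σ|χ|². -/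
theorem normSq_hermFourier_one (hprim : ∀ c : ZMod M, ¬ IsUnit c →
      ∃ u : (ZMod M)ˣ, u * c = c ∧ χ u = -1)
    (hnorm : ∀ s, IsUnit (ordNorm N r k s) → χ (ordNorm N r k s) = 1)
    (hrep : ∃ w, IsUnit (binForm N r k w))
    (hval : ∀ w, IsUnit (binForm N r k w) → χ (binForm N r k w) = 1) :
    Complex.normSq (hermFourier N r k χ ((1, 0), 0)) = (M : ℝ) ^ 5 := by
  -- The pairing of ((b, c), x) with ((a, 0), 0) is −ca.
  let p : ZMod M →+ ZMod M →+ ZMod M := -AddMonoidHom.mul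
  have hp : ∀ x, (∀ y, p x y = 0) → x = 0 := by
    intro x h
    have := h 1
    simpa [p] using this
  have hpars := parseval_zmod p hp (fun c => ((M : ℂ) ^ 2 * χ c))
  have h1 : ∀ a : ZMod M, ∑ c, (M : ℂ) ^ 2 * χ c * ZMod.stdAddChar (p c a) =
      χ a * hermFourier N r k χ ((1, 0), 0) := by
    intro a
    rw [← hermFourier_line hprim hnorm, hermFourier, Fintype.sum_prod_type, Fintype.sum_prod_type,
      Finset.sum_comm]
    refine Finset.sum_congr rfl fun c _ => ?_
    have h2 := congrArg (Int.cast : ℤ → ℂ) (sum_hermChar_row hprim hnorm hrep hval c)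
    push_cast at h2
    rw [← h2, Finset.sum_mul]
    refine Finset.sum_congr rfl fun b _ => ?_
    rw [Finset.sum_mul]
    refine Finset.sum_congr rfl fun x _ => ?_
    simp [hermPairing_apply, p]
  simp only [h1, Complex.normSq_mul] at hpars
  rw [← Finset.sum_mul, ← Finset.mul_sum, ZMod.card] at hpars
  have hpos : 0 < ∑ c : ZMod M, Complex.normSq (χ c) := by
    refine Finset.sum_pos' (fun c _ => Complex.normSq_nonneg _) ⟨1, Finset.mem_univ _, ?_⟩
    simp
  have h3 : Complex.normSq ((M : ℂ) ^ 2) = (M : ℝ) ^ 4 := by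
    rw [map_pow, Complex.normSq_natCast]; ring
  rw [h3] at hpars
  apply mul_left_cancel₀ hpos.ne'
  rw [hpars]
  ring

/-- A degenerate form with nonzero character is moved by two unipotents to ((a, 0), 0) with a a
unit: the first makes the corner a unit, the second clears x, and the vanishing determinant then
clears c. On that line `hermFourier_line` applies. -/
theorem hermFourier_support (hnorm : ∀ s, IsUnit (ordNorm N r k s) → χ (ordNorm N r k s) = 1)
    (hprim : ∀ c : ZMod M, ¬ IsUnit c → ∃ u : (ZMod M)ˣ, u * c = c ∧ χ u = -1)
    (htrans : ∀ δ, hermChar N r k χ δ ≠ 0 → ∃ w, IsUnit (unipUpper N r k w δ).1.1)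
    {δ : (ZMod M × ZMod M) × (ZMod M × ZMod M)} (hδ : hermChar N r k χ δ ≠ 0) :
    hermFourier N r k χ (δ.1, gramMap N r k δ.2) =
      hermChar N r k χ δ * hermFourier N r k χ ((1, 0), 0) := by
  obtain ⟨w, hw⟩ := htrans δ hδ
  rw [← hermFourier_unipUpper hnorm w, ← hermChar_unipUpper hnorm w δ]
  rw [← hermChar_unipUpper hnorm w] at hδ
  generalize unipUpper N r k w δ = δ at *
  -- The choice w' = −a⁻¹x makes x + aw' vanish.
  set w' : ZMod M × ZMod M := (-((hw.unit⁻¹ : (ZMod M)ˣ) : ZMod M)) • δ.2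
  rw [← hermFourier_unipLower hnorm w', ← hermChar_unipLower hnorm w' δ]
  rw [← hermChar_unipLower hnorm w'] at hδ
  have h1 : (unipLower N r k w' δ).2 = 0 := by
    have : δ.1.1 * ((hw.unit⁻¹ : (ZMod M)ˣ) : ZMod M) = 1 := hw.mul_val_inv
    simp only [unipLower, w']
    rw [smul_smul, mul_neg, this]
    simp
  have h2 : (unipLower N r k w' δ).1.1 = δ.1.1 := rfl
  generalize unipLower N r k w' δ = δ' at *
  obtain ⟨⟨a, c⟩, x⟩ := δ'
  simp only at h1 h2
  subst h1
  rw [← h2] at hw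
  have h3 := (hermChar_ne_zero hδ).1
  simp only [hermDet, binForm] at h3
  have hc : c = 0 := by
    apply hw.mul_right_eq_zero.mp
    simpa using h3
  subst hc
  have h4 : hermVal N r k ((a, 0), 0) ((1, 0), 0) = a := by
    simp [hermVal, ordNorm, binPolar, binForm]
  rw [hermChar_eq hnorm (v := ((1, 0), 0)) (by simp [hermDet, binForm]) (by rwa [h4]), h4]
  simp only [map_zero]
  exact hermFourier_line hprim hnorm a

/-- An energy count. By Parseval the transform has total energy M⁴ · #S, where S is the support of
the character. Each point of S maps to a point where the energy is M⁵, and at most M points of S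
share an image, so the image alone carries at least M⁴ · #S. A nonzero value outside the image would
exceed the total. -/
theorem hermFourier_vanish (hnorm : ∀ s, IsUnit (ordNorm N r k s) → χ (ordNorm N r k s) = 1)
    (hprim : ∀ c : ZMod M, ¬ IsUnit c → ∃ u : (ZMod M)ˣ, u * c = c ∧ χ u = -1)
    (hrep : ∃ w, IsUnit (binForm N r k w))
    (hval : ∀ w, IsUnit (binForm N r k w) → χ (binForm N r k w) = 1)
    (htrans : ∀ δ, hermChar N r k χ δ ≠ 0 → ∃ w, IsUnit (unipUpper N r k w δ).1.1)
    (hker : Nat.card (gramMap N r k).ker ≤ M)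
    {y : (ZMod M × ZMod M) × (ZMod M × ZMod M)} (hy : hermFourier N r k χ y ≠ 0) :
    ∃ δ, hermChar N r k χ δ ≠ 0 ∧ y = (δ.1, gramMap N r k δ.2) := by
  classical
  by_contra hcon
  push Not at hcon
  have hM : (0 : ℝ) < M := by exact_mod_cast NeZero.pos M
  set f := hermFourier N r k χ
  set J : ((ZMod M × ZMod M) × (ZMod M × ZMod M)) → ((ZMod M × ZMod M) × (ZMod M × ZMod M)) :=
    fun δ => (δ.1, gramMap N r k δ.2)
  set S := Finset.univ.filter fun δ : (ZMod M × ZMod M) × (ZMod M × ZMod M) =>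
    hermChar N r k χ δ ≠ 0 with hS
  have hsq : ∀ δ ∈ S, Complex.normSq (hermChar N r k χ δ : ℂ) = 1 := by
    intro δ hδ
    have hδ' : hermChar N r k χ δ ≠ 0 := (Finset.mem_filter.mp hδ).2
    obtain ⟨h0, v, hv⟩ := hermChar_ne_zero hδ'
    rw [hermChar_eq hnorm h0 hv]
    rcases Int.isUnit_iff.mp (hv.map χ) with h | h <;> rw [h] <;> simp
  have hpars := parseval_zmod hermPairing hermPairing_nondegenerate
    (fun δ => (hermChar N r k χ δ : ℂ))
  have hcard : Fintype.card ((ZMod M × ZMod M) × (ZMod M × ZMod M)) = M ^ 4 := by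
    simp [Fintype.card_prod, ZMod.card]; ring
  have htot : ∑ δ, Complex.normSq (hermChar N r k χ δ : ℂ) = S.card := by
    rw [← Finset.sum_filter_add_sum_filter_not _ (fun δ => hermChar N r k χ δ ≠ 0), ← hS,
      Finset.sum_congr rfl hsq]
    rw [Finset.sum_eq_zero (s := Finset.univ.filter fun δ => ¬ hermChar N r k χ δ ≠ 0)]
    · simp
    · intro δ hδ
      have := (Finset.mem_filter.mp hδ).2
      push Not at this
      rw [this]; simp
  rw [hcard, htot] at hpars
  have h1 : ∑ δ ∈ S, Complex.normSq (f (J δ)) = M ^ 5 * S.card := by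
    rw [Finset.sum_congr rfl (g := fun _ => (M : ℝ) ^ 5)]
    · simp; ring
    · intro δ hδ
      have hδ' : hermChar N r k χ δ ≠ 0 := (Finset.mem_filter.mp hδ).2
      change Complex.normSq (hermFourier N r k χ (δ.1, gramMap N r k δ.2)) = _
      rw [hermFourier_support hnorm hprim htrans hδ', Complex.normSq_mul, hsq δ hδ, one_mul,
        normSq_hermFourier_one hprim hnorm hrep hval]
  -- The fibres of J are contained in cosets of the kernel of the Gram map, hence the factor M.
  have h2 : ∑ δ ∈ S, Complex.normSq (f (J δ)) ≤
      M * ∑ z ∈ S.image J, Complex.normSq (f z) := by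
    rw [← Finset.sum_fiberwise_of_maps_to (g := J) (t := S.image J)
      (fun δ hδ => Finset.mem_image_of_mem J hδ), Finset.mul_sum]
    refine Finset.sum_le_sum fun z hz => ?_
    obtain ⟨δ₀, hδ₀, rfl⟩ := Finset.mem_image.mp hz
    rw [Finset.sum_congr rfl (g := fun _ => Complex.normSq (f (J δ₀)))]
    · rw [Finset.sum_const, nsmul_eq_mul]
      refine mul_le_mul_of_nonneg_right ?_ (Complex.normSq_nonneg _)
      have h3 : (S.filter fun δ => J δ = J δ₀).card ≤ Nat.card (gramMap N r k).ker := by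
        rw [Nat.card_eq_fintype_card, Fintype.card_subtype]
        refine Finset.card_le_card_of_injOn (fun δ => δ.2 - δ₀.2) ?_ ?_
        · intro δ hδ
          have h := (Finset.mem_filter.mp hδ).2
          have h' : gramMap N r k δ.2 = gramMap N r k δ₀.2 := congrArg Prod.snd h
          simp [AddMonoidHom.mem_ker, h']
        · intro δ hδ δ' hδ' h
          have h1 : J δ = J δ₀ := (Finset.mem_filter.mp (Finset.mem_coe.mp hδ)).2
          have e1 : δ.1 = δ₀.1 := (Prod.ext_iff.mp h1).1
          have h2 : J δ' = J δ₀ := (Finset.mem_filter.mp (Finset.mem_coe.mp hδ')).2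
          have e2 : δ'.1 = δ₀.1 := (Prod.ext_iff.mp h2).1
          exact Prod.ext (e1.trans e2.symm) (sub_left_injective h)
      exact_mod_cast h3.trans hker
    · intro δ hδ
      rw [(Finset.mem_filter.mp hδ).2]
  have h4 : ∑ z ∈ S.image J, Complex.normSq (f z) < ∑ z, Complex.normSq (f z) := by
    refine Finset.sum_lt_sum_of_subset (Finset.subset_univ _) (Finset.mem_univ y) ?_
      (Complex.normSq_pos.mpr hy) (fun _ _ _ => Complex.normSq_nonneg _)
    intro hcon'
    obtain ⟨δ, hδ, h⟩ := Finset.mem_image.mp hcon'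
    exact hcon δ (Finset.mem_filter.mp hδ).2 h.symm
  have h5 : ∑ z, Complex.normSq (f z) = M ^ 4 * S.card := by
    push_cast at hpars
    exact hpars
  rw [h1] at h2
  rw [h5] at h4
  have h6 : (M : ℝ) * ∑ z ∈ S.image J, Complex.normSq (f z) < M * (M ^ 4 * S.card) :=
    mul_lt_mul_of_pos_left h4 hM
  have h7 : (M : ℝ) * (M ^ 4 * S.card) = M ^ 5 * S.card := by ring
  linarith

/-- The constant in the functional equation, as a quadratic Gauss sum. -/
theorem hermFourier_one_eq (hnorm : ∀ s, IsUnit (ordNorm N r k s) → χ (ordNorm N r k s) = 1)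
    (hprim : ∀ c : ZMod M, ¬ IsUnit c → ∃ u : (ZMod M)ˣ, u * c = c ∧ χ u = -1)
    (hrep : ∃ w, IsUnit (binForm N r k w))
    (hval : ∀ w, IsUnit (binForm N r k w) → χ (binForm N r k w) = 1)
    (htrans : ∀ δ, hermChar N r k χ δ ≠ 0 → ∃ w, IsUnit (unipUpper N r k w δ).1.1)
    (hker : Nat.card (gramMap N r k).ker ≤ M)
    (hrad : ∀ x, gramMap N r k x = 0 → binForm N r k x = 0) :
    hermFourier N r k χ ((1, 0), 0) = M * ∑ x, ZMod.stdAddChar (-binForm N r k x) := by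
  obtain ⟨w, hw⟩ := hrep
  have h01 : ∀ x : ZMod M × ZMod M, hermChar N r k χ ((binForm N r k x, 1), x) = 1 := by
    intro x
    have h2 : hermVal N r k ((binForm N r k x, 1), x) (0, w) = binForm N r k w := by
      simp [hermVal, ordNorm, ordAct, binPolar]
    rw [hermChar_eq hnorm (v := (0, w)) (by simp [hermDet]) (by rwa [h2]), h2, hval w hw]
  -- Only a = 0 contributes: a nonzero transform at ((a, 1), 0) comes from a degenerate form ((a,
  -- 1), x) with x in the radical, where q(x) = 0, and then the determinant is a.
  have hsum : ∑ a, hermFourier N r k χ ((a, 1), 0) * ZMod.stdAddChar a =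
      hermFourier N r k χ ((1, 0), 0) := by
    rw [Finset.sum_eq_single 0]
    · have h0 : hermChar N r k χ ((0, 1), 0) = 1 := by simpa [binForm] using h01 0
      have := hermFourier_support hnorm hprim htrans (δ := ((0, 1), 0)) (by rw [h0]; decide)
      rw [h0] at this
      simpa using this
    · intro a _ ha
      by_cases hf : hermFourier N r k χ ((a, 1), 0) = 0
      · rw [hf, zero_mul]
      · obtain ⟨δ, hδ, hy⟩ := hermFourier_vanish hnorm hprim ⟨w, hw⟩ hval htrans hker hf
        exfalso
        have h1 : δ.1 = (a, 1) := (congrArg Prod.fst hy).symm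
        have h2 : gramMap N r k δ.2 = 0 := (congrArg Prod.snd hy).symm
        have h3 := (hermChar_ne_zero hδ).1
        rw [hermDet, h1, hrad _ h2] at h3
        exact ha (by simpa using h3)
    · simp
  rw [← hsum]
  simp only [hermFourier, Finset.sum_mul]
  rw [Finset.sum_comm]
  -- Summing over a first instead imposes c = 1. The remaining degenerate forms are ((q(x), 1), x),
  -- all of character 1, which leaves the Gauss sum of −q.
  have hinner : ∀ δ : (ZMod M × ZMod M) × (ZMod M × ZMod M),
      ∑ a, (hermChar N r k χ δ : ℂ) * ZMod.stdAddChar (hermPairing δ ((a, 1), 0)) *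
        ZMod.stdAddChar a = if δ.1.2 = 1 then
          M * ((hermChar N r k χ δ : ℂ) * ZMod.stdAddChar (-δ.1.1)) else 0 := by
    intro δ
    have h1 : ∀ a : ZMod M, (hermChar N r k χ δ : ℂ) *
        ZMod.stdAddChar (hermPairing δ ((a, 1), 0)) * ZMod.stdAddChar a =
        (hermChar N r k χ δ : ℂ) * ZMod.stdAddChar (-δ.1.1) *
          ZMod.stdAddChar ((1 - δ.1.2) * a) := by
      intro a
      rw [mul_assoc, mul_assoc, ← AddChar.map_add_eq_mul, ← AddChar.map_add_eq_mul]
      congr 2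
      simp only [hermPairing_apply, Prod.fst_zero, Prod.snd_zero]
      ring
    simp only [h1]
    rw [← Finset.mul_sum]
    have h2 := AddChar.sum_mulShift (1 - δ.1.2) (ZMod.isPrimitive_stdAddChar M)
    have h3 : ∑ a : ZMod M, (ZMod.stdAddChar ((1 - δ.1.2) * a) : ℂ) =
        if δ.1.2 = 1 then (M : ℂ) else 0 := by
      have h4 : (1 - δ.1.2 = 0) = (δ.1.2 = 1) := by
        rw [sub_eq_zero, eq_iff_iff, eq_comm]
      simp only [mul_comm (1 - δ.1.2)]
      rw [h2, ZMod.card]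
      simp only [h4]
      split_ifs <;> simp
    rw [h3]
    split_ifs <;> ring
  simp only [hinner]
  rw [Fintype.sum_prod_type, Fintype.sum_prod_type, Finset.sum_comm]
  rw [Finset.sum_eq_single 1]
  · simp only [if_true]
    rw [Finset.sum_comm, Finset.mul_sum]
    refine Finset.sum_congr rfl fun x _ => ?_
    rw [Finset.sum_eq_single (binForm N r k x)]
    · rw [h01]; simp
    · intro a _ ha
      have : hermChar N r k χ ((a, 1), x) = 0 := by
        by_contra hcon
        have := (hermChar_ne_zero hcon).1
        simp only [hermDet, mul_one] at this
        exact ha (sub_eq_zero.mp this)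
      rw [this]; simp
    · simp
  · intro c _ hc
    simp [hc]
  · simp

end Fourier

/-! ### The genus character of a fundamental discriminant -/

/-- Take x to be the product of the primes of D that do not divide A. Modulo such a prime the value
is A; modulo the other primes of D both A and B vanish, and C and x are units. -/
theorem exists_isCoprime_quadratic {D A B C : ℤ} (hD : D ≠ 0)
    (h : ∀ p : ℕ, p.Prime → (p : ℤ) ∣ D → (p : ℤ) ∣ A → (p : ℤ) ∣ B ∧ ¬ (p : ℤ) ∣ C) :
    ∃ x : ℤ, IsCoprime (A + B * x + C * x ^ 2) D := by
  classical
  set S : Finset ℕ := D.natAbs.primeFactors.filter fun p : ℕ => ¬ (p : ℤ) ∣ A with hS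
  have hdvd : ∀ p : ℕ, p.Prime → (p : ℤ) ∣ D → ((p : ℤ) ∣ ((S.prod id : ℕ) : ℤ) ↔ ¬ (p : ℤ) ∣ A) := by
    intro p hp hpD
    rw [Int.natCast_dvd_natCast]
    constructor
    · intro hd
      obtain ⟨q, hq, hpq⟩ := (hp.prime.dvd_finsetProd_iff _).mp hd
      rw [hS, Finset.mem_filter] at hq
      rw [(Nat.prime_dvd_prime_iff_eq hp (Nat.prime_of_mem_primeFactors hq.1)).mp hpq]
      exact hq.2
    · intro hA
      refine Finset.dvd_prod_of_mem id (Finset.mem_filter.mpr ⟨?_, hA⟩)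
      exact Nat.mem_primeFactors.mpr ⟨hp, Int.natCast_dvd.mp hpD, Int.natAbs_ne_zero.mpr hD⟩
  refine ⟨((S.prod id : ℕ) : ℤ), ?_⟩
  generalize ((S.prod id : ℕ) : ℤ) = x at hdvd
  rw [Int.isCoprime_iff_gcd_eq_one]
  by_contra hne
  obtain ⟨p, hp, hpd⟩ := Nat.exists_prime_and_dvd hne
  have hpi : Prime (p : ℤ) := Nat.prime_iff_prime_int.mp hp
  have h1 : (p : ℤ) ∣ A + B * x + C * x ^ 2 :=
    (Int.natCast_dvd_natCast.mpr hpd).trans (Int.gcd_dvd_left ..)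
  have h2 : (p : ℤ) ∣ D := (Int.natCast_dvd_natCast.mpr hpd).trans (Int.gcd_dvd_right ..)
  by_cases hA : (p : ℤ) ∣ A
  · obtain ⟨hB, hC⟩ := h p hp h2 hA
    have h3 : (p : ℤ) ∣ C * x ^ 2 := by
      have := dvd_sub (dvd_sub h1 hA) (dvd_mul_of_dvd_left hB x)
      rwa [show A + B * x + C * x ^ 2 - A - B * x = C * x ^ 2 by ring] at this
    rcases hpi.dvd_or_dvd h3 with h4 | h4
    · exact hC h4
    · exact ((hdvd p hp h2).mp (hpi.dvd_of_dvd_pow h4)) hA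
  · have hx := (hdvd p hp h2).mpr hA
    apply hA
    have h3 : (p : ℤ) ∣ B * x + C * x ^ 2 :=
      dvd_add (dvd_mul_of_dvd_right hx _) (dvd_mul_of_dvd_right (dvd_pow hx two_ne_zero) _)
    have := dvd_sub h1 h3
    rwa [show A + B * x + C * x ^ 2 - (B * x + C * x ^ 2) = A by ring] at this

theorem intCast_zmod_natAbs_eq_zero {Δ a : ℤ} : (a : ZMod Δ.natAbs) = 0 ↔ Δ ∣ a := by
  rw [ZMod.intCast_zmod_eq_zero_iff_dvd, Int.natAbs_dvd]

theorem discr_eq_zero {N Δ r k : ℤ} (h : Δ = r ^ 2 - 4 * N * k) :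
    (r : ZMod Δ.natAbs) ^ 2 - 4 * (N : ZMod Δ.natAbs) * k = 0 := by
  have := intCast_zmod_natAbs_eq_zero.mpr (dvd_of_eq h)
  push_cast at this
  exact this

theorem exists_intCast_pair {M : ℕ} (x : ZMod M × ZMod M) :
    ∃ a b : ℤ, x = ((a : ZMod M), (b : ZMod M)) := by
  obtain ⟨a, ha⟩ := ZMod.intCast_surjective x.1
  obtain ⟨b, hb⟩ := ZMod.intCast_surjective x.2
  exact ⟨a, b, by rw [ha, hb]⟩

section Discharge

variable {N : ℕ} [NeZero N] {Δ r k : ℤ} {χ : MulChar (ZMod Δ.natAbs) ℤ}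

/-- Four times the norm form is (2a + rb)² − Δb², so the descent applies with e = 1. -/
theorem hermChar_norm_one (hΔ : IsFundamentalDiscriminant Δ)
    (hχ : ∀ n, IsCoprime n Δ → χ (n : ZMod Δ.natAbs) = kroneckerSymbol Δ n)
    (h : Δ = r ^ 2 - 4 * N * k) (s : ZMod Δ.natAbs × ZMod Δ.natAbs)
    (hs : IsUnit (ordNorm (N : ZMod Δ.natAbs) r k s)) :
    χ (ordNorm (N : ZMod Δ.natAbs) r k s) = 1 := by
  obtain ⟨a, b, rfl⟩ := exists_intCast_pair s
  have h1 : ordNorm (N : ZMod Δ.natAbs) r k (a, b) = ((a ^ 2 + r * a * b + N * k * b ^ 2 : ℤ) :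
      ZMod Δ.natAbs) := by simp [ordNorm]
  rw [h1] at hs ⊢
  rw [isUnit_intCast_zmod_natAbs] at hs
  refine char_eq_one_of_norm hΔ χ hχ hs one_pos (A := 2 * a + r * b) (B := b) ?_ ?_
  · intro l hl hl1
    exact absurd (Nat.dvd_one.mp hl1) hl.ne_one
  · rw [h]; push_cast; ring

/-- Here 4N q(a, b) = (2Na + rb)² − Δb². This is the descent with e = N, and no prime of N is inert
because Δ is a square modulo 4N. -/
theorem binForm_char_one (hΔ : IsFundamentalDiscriminant Δ)
    (hχ : ∀ n, IsCoprime n Δ → χ (n : ZMod Δ.natAbs) = kroneckerSymbol Δ n)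
    (h : Δ = r ^ 2 - 4 * N * k) (s : ZMod Δ.natAbs × ZMod Δ.natAbs)
    (hs : IsUnit (binForm (N : ZMod Δ.natAbs) r k s)) :
    χ (binForm (N : ZMod Δ.natAbs) r k s) = 1 := by
  obtain ⟨a, b, rfl⟩ := exists_intCast_pair s
  have h1 : binForm (N : ZMod Δ.natAbs) r k (a, b) = ((N * a ^ 2 + r * a * b + k * b ^ 2 : ℤ) :
      ZMod Δ.natAbs) := by simp [binForm]
  rw [h1] at hs ⊢
  rw [isUnit_intCast_zmod_natAbs] at hs
  refine char_eq_one_of_norm hΔ χ hχ hs (NeZero.pos N) (A := 2 * N * a + r * b) (B := b) ?_ ?_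
  · intro l hl hlN
    exact char_prime_ne_neg_one hΔ χ hχ h hl hlN
  · rw [h]; push_cast; ring

theorem exists_isUnit_binForm (hΔ : IsFundamentalDiscriminant Δ) (h : Δ = r ^ 2 - 4 * N * k) :
    ∃ w, IsUnit (binForm (N : ZMod Δ.natAbs) r k w) := by
  obtain ⟨x, hx⟩ := exists_isCoprime_quadratic (D := Δ) (A := N) (B := r) (C := k) hΔ.ne_zero (by
    intro p hp hpD hpN
    refine ⟨?_, hΔ.not_dvd_both h hp hpD hpN⟩
    refine (Nat.prime_iff_prime_int.mp hp).dvd_of_dvd_pow (n := 2) ?_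
    rw [show r ^ 2 = Δ + N * (4 * k) by rw [h]; ring]
    exact dvd_add hpD (dvd_mul_of_dvd_left hpN _))
  refine ⟨(1, x), ?_⟩
  rw [show binForm (N : ZMod Δ.natAbs) r k (1, (x : ZMod Δ.natAbs)) =
    ((N + r * x + k * x ^ 2 : ℤ) : ZMod Δ.natAbs) by simp [binForm]]
  exact isUnit_intCast_zmod_natAbs.mpr hx

/-- The defect in Cauchy–Schwarz for a binary form is its discriminant. Modulo Δ it disappears: q
degenerates and the square of the polar form is 4q(x)q(w). -/
theorem binPolar_sq {R : Type*} [CommRing R] (N r k : R) (x w : R × R) :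
    binPolar N r k x w ^ 2 = 4 * binForm N r k x * binForm N r k w +
      (r ^ 2 - 4 * N * k) * (x.1 * w.2 - x.2 * w.1) ^ 2 := by
  simp only [binPolar, binForm]; ring

/-- With q(w) a unit, the corner after the shear by xw is a + Bx + cq(w)x². If a prime p of Δ
divides a, then B² ≡ 4acq(w) gives p ∣ B; and p cannot divide c too, for then every value of the
form would be divisible by p, although a unit is represented. -/
theorem exists_isUnit_unipUpper (hΔ : IsFundamentalDiscriminant Δ) (h : Δ = r ^ 2 - 4 * N * k)
    (δ : (ZMod Δ.natAbs × ZMod Δ.natAbs) × (ZMod Δ.natAbs × ZMod Δ.natAbs))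
    (hδ : hermChar (N : ZMod Δ.natAbs) r k χ δ ≠ 0) :
    ∃ w, IsUnit (unipUpper (N : ZMod Δ.natAbs) r k w δ).1.1 := by
  obtain ⟨h0, v, hv⟩ := hermChar_ne_zero hδ
  obtain ⟨w, hw⟩ := exists_isUnit_binForm (N := N) hΔ h
  obtain ⟨⟨a', c'⟩, x'⟩ := δ
  obtain ⟨a, rfl⟩ := ZMod.intCast_surjective a'
  obtain ⟨c, rfl⟩ := ZMod.intCast_surjective c'
  have hM : (r : ZMod Δ.natAbs) ^ 2 - 4 * N * k = 0 := by
    exact_mod_cast discr_eq_zero h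
  have hpol : ∀ y : ZMod Δ.natAbs × ZMod Δ.natAbs,
      binPolar (N : ZMod Δ.natAbs) r k x' y ^ 2 =
        4 * a * c * binForm (N : ZMod Δ.natAbs) r k y := by
    intro y
    have h1 : (a : ZMod Δ.natAbs) * c = binForm (N : ZMod Δ.natAbs) r k x' := by
      have := h0
      simp only [hermDet] at this
      exact sub_eq_zero.mp this
    rw [binPolar_sq, hM, zero_mul, add_zero, ← h1]; ring
  obtain ⟨q, hq⟩ := ZMod.intCast_surjective (binForm (N : ZMod Δ.natAbs) r k w)
  obtain ⟨B, hB⟩ := ZMod.intCast_surjective (binPolar (N : ZMod Δ.natAbs) r k x' w)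
  -- a congruence modulo `Δ` descends to prime divisors
  have hdesc : ∀ {p : ℕ} {u v e : ℤ}, (p : ℤ) ∣ Δ → ((u ^ 2 : ℤ) : ZMod Δ.natAbs) =
      ((a * v : ℤ) : ZMod Δ.natAbs) → p.Prime → (p : ℤ) ∣ a → (p : ℤ) ∣ u := by
    intro p u v e hpD huv hp hpa
    rw [← sub_eq_zero, ← Int.cast_sub, intCast_zmod_natAbs_eq_zero] at huv
    refine (Nat.prime_iff_prime_int.mp hp).dvd_of_dvd_pow (n := 2) ?_
    have := dvd_add (hpD.trans huv) (dvd_mul_of_dvd_left hpa v)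
    rwa [sub_add_cancel] at this
  obtain ⟨x, hx⟩ := exists_isCoprime_quadratic (D := Δ) (A := a) (B := B) (C := c * q) hΔ.ne_zero (by
    intro p hp hpD hpa
    have hp' := Nat.prime_iff_prime_int.mp hp
    constructor
    · refine hdesc (v := 4 * c * q) (e := 0) hpD ?_ hp hpa
      push_cast
      rw [hB, hpol, hq]; ring
    · intro hcq
      rcases hp'.dvd_or_dvd hcq with hc | hq'
      · obtain ⟨e, he⟩ := ZMod.intCast_surjective
          (binPolar (N : ZMod Δ.natAbs) r k x' (ordAct (N : ZMod Δ.natAbs) r k v.1 v.2))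
        obtain ⟨n, hn⟩ := ZMod.intCast_surjective (ordNorm (N : ZMod Δ.natAbs) r k v.1)
        obtain ⟨m, hm⟩ := ZMod.intCast_surjective (binForm (N : ZMod Δ.natAbs) r k v.2)
        obtain ⟨f, hf⟩ := ZMod.intCast_surjective
          (binForm (N : ZMod Δ.natAbs) r k (ordAct (N : ZMod Δ.natAbs) r k v.1 v.2))
        have hpe : (p : ℤ) ∣ e := by
          refine hdesc (v := 4 * c * f) (e := 0) hpD ?_ hp hpa
          push_cast
          rw [he, hpol, hf]; ring
        rw [hermVal, ← hn, ← hm, ← he] at hv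
        have hv' : IsUnit ((a * n + e + c * m : ℤ) : ZMod Δ.natAbs) := by push_cast; exact hv
        rw [isUnit_intCast_zmod_natAbs] at hv'
        have h1 : (p : ℤ) ∣ a * n + e + c * m :=
          dvd_add (dvd_add (dvd_mul_of_dvd_left hpa _) hpe) (dvd_mul_of_dvd_left hc _)
        exact hp'.not_isUnit (hv'.isUnit_of_dvd' h1 hpD)
      · rw [← hq, isUnit_intCast_zmod_natAbs] at hw
        exact hp'.not_isUnit (hw.isUnit_of_dvd' hq' hpD))
  refine ⟨(x : ZMod Δ.natAbs) • w, ?_⟩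
  have h1 : (unipUpper (N : ZMod Δ.natAbs) r k ((x : ZMod Δ.natAbs) • w)
      (((a : ZMod Δ.natAbs), (c : ZMod Δ.natAbs)), x')).1.1 =
      ((a + B * x + c * q * x ^ 2 : ℤ) : ZMod Δ.natAbs) := by
    push_cast
    rw [hB, hq]
    simp only [unipUpper, binPolar, binForm, Prod.smul_fst, Prod.smul_snd, smul_eq_mul]
    ring
  rw [h1]
  exact isUnit_intCast_zmod_natAbs.mpr hx

/-- Lift x to integers, so that the Gram matrix sends it to Δy. Multiplying by the adjugate and
cancelling Δ, which is minus the Gram determinant, expresses x through y: modulo Δ the kernel is the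
image of the adjugate. -/
theorem gramMap_eq_zero (hΔ : IsFundamentalDiscriminant Δ) (h : Δ = r ^ 2 - 4 * N * k)
    {x : ZMod Δ.natAbs × ZMod Δ.natAbs} (hx : gramMap (N : ZMod Δ.natAbs) r k x = 0) :
    ∃ y : ZMod Δ.natAbs × ZMod Δ.natAbs, x = (r * y.2 - 2 * k * y.1, r * y.1 - 2 * N * y.2) := by
  obtain ⟨t, s, rfl⟩ := exists_intCast_pair x
  rw [gramMap_apply] at hx
  have h1 : ((2 * N * t + r * s : ℤ) : ZMod Δ.natAbs) = 0 := by
    push_cast; exact congrArg Prod.fst hx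
  have h2 : ((r * t + 2 * k * s : ℤ) : ZMod Δ.natAbs) = 0 := by
    push_cast; exact congrArg Prod.snd hx
  obtain ⟨β, hβ⟩ := intCast_zmod_natAbs_eq_zero.mp h1
  obtain ⟨γ, hγ⟩ := intCast_zmod_natAbs_eq_zero.mp h2
  refine ⟨(β, γ), ?_⟩
  have h3 : t = r * γ - 2 * k * β := by
    apply mul_left_cancel₀ hΔ.ne_zero
    linear_combination r * hγ - 2 * k * hβ + t * h
  have h4 : s = r * β - 2 * N * γ := by
    apply mul_left_cancel₀ hΔ.ne_zero
    linear_combination r * hβ - 2 * N * hγ + s * h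
  rw [h3, h4]
  push_cast
  rfl

theorem binForm_eq_zero_of_gramMap (hΔ : IsFundamentalDiscriminant Δ) (h : Δ = r ^ 2 - 4 * N * k)
    (x : ZMod Δ.natAbs × ZMod Δ.natAbs) (hx : gramMap (N : ZMod Δ.natAbs) r k x = 0) :
    binForm (N : ZMod Δ.natAbs) r k x = 0 := by
  obtain ⟨y, rfl⟩ := gramMap_eq_zero hΔ h hx
  have hM : (r : ZMod Δ.natAbs) ^ 2 - 4 * N * k = 0 := by
    exact_mod_cast discr_eq_zero h
  simp only [binForm]
  linear_combination (r * y.1 * y.2 - k * y.1 ^ 2 - N * y.2 ^ 2) * hM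

/-- The adjugate of a symmetric 2 × 2 matrix differs from the matrix itself by swapping coordinates
and signs, so the kernel embeds in the range; the product of their orders is M². -/
theorem card_gramMap_ker_le (hΔ : IsFundamentalDiscriminant Δ) (h : Δ = r ^ 2 - 4 * N * k) :
    Nat.card (gramMap (N : ZMod Δ.natAbs) r k).ker ≤ Δ.natAbs := by
  have : NeZero Δ.natAbs := ⟨Int.natAbs_ne_zero.mpr hΔ.ne_zero⟩
  set g := gramMap (N : ZMod Δ.natAbs) r k with hg
  have h1 : Nat.card g.ker ≤ Nat.card g.range := by
    have hf : ∀ x : g.ker, ((x : ZMod Δ.natAbs × ZMod Δ.natAbs).2,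
        -(x : ZMod Δ.natAbs × ZMod Δ.natAbs).1) ∈ g.range := by
      intro x
      obtain ⟨y, hy⟩ := gramMap_eq_zero (N := N) hΔ h x.2
      rw [hy]
      refine ⟨(-y.2, y.1), ?_⟩
      rw [hg, gramMap_apply]
      ext <;> simp only <;> ring
    refine Nat.card_le_card_of_injective (fun x : g.ker => (⟨_, hf x⟩ : g.range)) ?_
    intro x y hxy
    have := congrArg Subtype.val hxy
    simp only [Prod.mk.injEq, neg_inj] at this
    exact Subtype.ext (Prod.ext this.2 this.1)
  have h2 : Nat.card g.ker * Nat.card g.range = Δ.natAbs * Δ.natAbs := by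
    have e1 := Nat.card_congr (QuotientAddGroup.quotientKerEquivRange g).toEquiv
    rw [← e1, mul_comm, ← AddSubgroup.card_eq_card_quotient_mul_card_addSubgroup]
    simp [Nat.card_eq_fintype_card, ZMod.card]
  by_contra hcon
  push Not at hcon
  have h3 := Nat.mul_lt_mul_of_lt_of_le' hcon (hcon.le.trans h1) (NeZero.pos _)
  omega

end Discharge

/-! ### Sums of periodic functions -/

/-- `e(x / n)`. -/
noncomputable def zexp (n : ℕ) (x : ℤ) : ℂ := cexp (2 * π * I * x / n)

theorem zexp_eq_stdAddChar (n : ℕ) [NeZero n] (x : ℤ) :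
    zexp n x = ZMod.stdAddChar (x : ZMod n) := by
  rw [ZMod.stdAddChar_coe, zexp]

theorem zexp_add (n : ℕ) (x y : ℤ) : zexp n (x + y) = zexp n x * zexp n y := by
  rw [zexp, zexp, zexp, ← Complex.exp_add]; congr 1; push_cast; ring

theorem norm_zexp (M : ℕ) (x : ℤ) : ‖zexp M x‖ = 1 := by
  rw [zexp, Complex.norm_exp]
  have : (2 * π * I * x / M : ℂ) = ((2 * π * x / M : ℝ) : ℂ) * I := by push_cast; ring
  rw [this, Complex.re_ofReal_mul]; simp

theorem zexp_eq_one {n : ℕ} [NeZero n] {x : ℤ} (h : (n : ℤ) ∣ x) : zexp n x = 1 := by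
  rw [zexp_eq_stdAddChar, (ZMod.intCast_zmod_eq_zero_iff_dvd _ _).mpr h, AddChar.map_zero_eq_one]

theorem zexp_congr {n : ℕ} [NeZero n] {x y : ℤ} (h : (n : ℤ) ∣ x - y) : zexp n x = zexp n y := by
  rw [← sub_add_cancel x y, zexp_add, zexp_eq_one h, one_mul]

theorem zexp_mul_left (m n : ℕ) [NeZero m] (x : ℤ) : zexp (m * n) (m * x) = zexp n x := by
  have : (m : ℂ) ≠ 0 := by exact_mod_cast NeZero.ne m
  rw [zexp, zexp]; congr 1; push_cast
  rw [show 2 * π * I * (m * (x : ℂ)) = m * (2 * π * I * x) by ring, mul_div_mul_left _ _ this]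

theorem sum_range_zmod {β : Type*} [AddCommMonoid β] (n : ℕ) [NeZero n] (F : ZMod n → β) :
    ∑ i ∈ Finset.range n, F (i : ZMod n) = ∑ x, F x := by
  refine Finset.sum_nbij' (fun i => (i : ZMod n)) (fun x => x.val) (by simp)
    (fun x _ => Finset.mem_range.mpr (ZMod.val_lt x)) ?_ (by simp) (by simp)
  intro i hi
  exact ZMod.val_natCast_of_lt (Finset.mem_range.mp hi)

theorem sum_zexp_mul (n : ℕ) [NeZero n] (x : ℤ) :
    ∑ i ∈ Finset.range n, zexp n (i * x) = if (n : ℤ) ∣ x then (n : ℂ) else 0 := by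
  have h1 : ∀ i : ℕ, zexp n (i * x) = ZMod.stdAddChar ((i : ZMod n) * (x : ZMod n)) := by
    intro i; rw [zexp_eq_stdAddChar]; push_cast; rfl
  simp only [h1]
  rw [sum_range_zmod n (fun i => (ZMod.stdAddChar (i * (x : ZMod n)) : ℂ)),
    AddChar.sum_mulShift _ (ZMod.isPrimitive_stdAddChar n), ZMod.card]
  simp only [ZMod.intCast_zmod_eq_zero_iff_dvd]
  split_ifs <;> simp

theorem periodic_eq_of_dvd {f : ℤ → ℂ} {n : ℕ} (hf : ∀ x, f (x + n) = f x) {x y : ℤ}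
    (h : (n : ℤ) ∣ x - y) : f x = f y := by
  obtain ⟨m, hm⟩ := h
  have h1 : Function.Periodic f (n : ℤ) := hf
  have := h1.int_mul m y
  rw [← this]; congr 1
  linear_combination hm

theorem sum_range_add {f : ℤ → ℂ} {n : ℕ} [NeZero n] (hf : ∀ x, f (x + n) = f x) (a : ℤ) :
    ∑ i ∈ Finset.range n, f (i + a) = ∑ i ∈ Finset.range n, f i := by
  have h1 : ∀ i : ℕ, f i = (fun x : ZMod n => f x.val) (i : ZMod n) := by
    intro i
    refine periodic_eq_of_dvd hf ?_
    rw [← ZMod.intCast_eq_intCast_iff_dvd_sub]; simp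
  have h2 : ∀ i : ℕ, f (i + a) = (fun x : ZMod n => f x.val) ((i : ZMod n) + (a : ZMod n)) := by
    intro i
    refine periodic_eq_of_dvd hf ?_
    rw [← ZMod.intCast_eq_intCast_iff_dvd_sub]; simp
  rw [Finset.sum_congr rfl fun i _ => h1 i, Finset.sum_congr rfl fun i _ => h2 i,
    sum_range_zmod n (fun x => f x.val),
    sum_range_zmod n (fun x => (fun x : ZMod n => f x.val) (x + (a : ZMod n)))]
  exact Equiv.sum_comp (Equiv.addRight (a : ZMod n)) (fun x : ZMod n => f x.val)

theorem sum_range_mul_eq (f : ℤ → ℂ) (m n : ℕ) :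
    ∑ i ∈ Finset.range (m * n), f i =
      ∑ i ∈ Finset.range m, ∑ j ∈ Finset.range n, f (i + m * j) := by
  rw [mul_comm, Finset.sum_range, ← finProdFinEquiv.sum_comp, Fintype.sum_prod_type,
    Finset.sum_comm, Finset.sum_range]
  refine Finset.sum_congr rfl fun i _ => ?_
  rw [Finset.sum_range]
  refine Finset.sum_congr rfl fun j _ => ?_
  simp

theorem sum_range_mul_periodic {f : ℤ → ℂ} {m : ℕ} (hf : ∀ x, f (x + m) = f x) (n : ℕ) :
    ∑ i ∈ Finset.range (m * n), f i = n * ∑ i ∈ Finset.range m, f i := by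
  rw [sum_range_mul_eq, Finset.mul_sum]
  refine Finset.sum_congr rfl fun i _ => ?_
  rw [Finset.sum_congr rfl (g := fun _ => f i)]
  · simp
  · intro j _
    refine periodic_eq_of_dvd hf ⟨j, by ring⟩

theorem sum_range_ite_dvd {f : ℤ → ℂ} {n : ℕ} [NeZero n] (hf : ∀ x, f (x + n) = f x) (h : ℤ) :
    ∑ i ∈ Finset.range n, (if (n : ℤ) ∣ h - i then f i else 0) = f h := by
  have hn : (0 : ℤ) < n := by exact_mod_cast NeZero.pos n
  have h0 := Int.emod_nonneg h hn.ne'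
  have h1 := Int.emod_lt_of_pos h hn
  have h2 : (((h % n).toNat : ℕ) : ℤ) = h % n := Int.toNat_of_nonneg h0
  rw [Finset.sum_eq_single (h % n).toNat]
  · rw [h2, if_pos Int.dvd_self_sub_emod]
    exact (periodic_eq_of_dvd hf Int.dvd_self_sub_emod).symm
  · intro i hi hne
    rw [if_neg]
    intro hd
    have h3 : (n : ℤ) ∣ h % n - i := by
      have := dvd_sub hd (Int.dvd_self_sub_emod (x := h) (m := n))
      rwa [show h - i - (h - h % n) = h % n - i by ring] at this
    have hi' : (i : ℤ) < n := by exact_mod_cast Finset.mem_range.mp hi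
    have := Int.eq_zero_of_abs_lt_dvd h3 (by rw [abs_lt]; constructor <;> omega)
    omega
  · intro hcon
    exact absurd (Finset.mem_range.mpr (by omega)) hcon

theorem fourier_inversion_range {L R : ℤ → ℂ} {n : ℕ} [NeZero n] (hL : ∀ x, L (x + n) = L x)
    {s : ℤ} (hs : IsUnit s)
    (h : ∀ j : ℤ, ∑ i ∈ Finset.range n, L i * zexp n (-(s * i * j)) = n * R j) (x : ℤ) :
    L x = ∑ j ∈ Finset.range n, zexp n (s * x * j) * R j := by
  have hn : (n : ℂ) ≠ 0 := by exact_mod_cast NeZero.ne n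
  apply mul_left_cancel₀ hn
  rw [Finset.mul_sum]
  have h1 : ∀ j : ℕ, (n : ℂ) * (zexp n (s * x * j) * R j) =
      ∑ i ∈ Finset.range n, L i * zexp n (j * (s * (x - i))) := by
    intro j
    rw [mul_left_comm, ← h, Finset.mul_sum]
    refine Finset.sum_congr rfl fun i _ => ?_
    rw [mul_left_comm, ← zexp_add]
    congr 2; ring
  rw [Finset.sum_congr rfl fun j _ => h1 j, Finset.sum_comm]
  simp only [← Finset.mul_sum, sum_zexp_mul, hs.dvd_mul_left]
  rw [← sum_range_ite_dvd hL x, Finset.mul_sum]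
  refine Finset.sum_congr rfl fun i _ => ?_
  split_ifs <;> ring

/-! ### The quadratic Gauss sum -/

theorem UpperHalfPlane_sqrt_pos {w : ℂ} (hw : 0 < w.im) :
    0 < (w ^ (1 / 2 : ℂ)).re ∧ 0 < (w ^ (1 / 2 : ℂ)).im := by
  have h0 : w ≠ 0 := by rintro rfl; simp at hw
  have h1 : 0 < w.arg := by
    rcases (Complex.arg_nonneg_iff.mpr hw.le).lt_or_eq with h | h
    · exact h
    · exact absurd (Complex.arg_eq_zero_iff.mp h.symm).2 hw.ne'
  have h2 := Complex.arg_le_pi w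
  rw [Complex.cpow_def_of_ne_zero h0]
  have h3 : (Complex.log w * (1 / 2)).im = w.arg / 2 := by
    rw [show (1 / 2 : ℂ) = ((1 / 2 : ℝ) : ℂ) by push_cast; rfl, Complex.im_mul_ofReal,
      Complex.log_im]; ring
  have h4 : w.arg < π := by
    refine lt_of_le_of_ne h2 fun h => ?_
    exact hw.ne' (Complex.arg_eq_pi_iff.mp h).2
  rw [Complex.exp_re, Complex.exp_im, h3]
  exact ⟨mul_pos (Real.exp_pos _) (Real.cos_pos_of_mem_Ioo ⟨by linarith, by linarith⟩),
    mul_pos (Real.exp_pos _) (Real.sin_pos_of_mem_Ioo ⟨by linarith, by linarith⟩)⟩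

/-- The matrices agree, so the two square roots agree up to sign. On the left stands a product of
two principal roots of points of ℍ, each in the open first quadrant, so it has positive imaginary
part, as does the root on the right. -/
theorem Mp2Z.T_S_T_S_T : Mp2Z.T * Mp2Z.S * Mp2Z.T * Mp2Z.S * Mp2Z.T = Mp2Z.S := by
  ext1
  · change ModularGroup.T * ModularGroup.S * ModularGroup.T * ModularGroup.S * ModularGroup.T =
      ModularGroup.S
    decide
  · funext τ
    set g := Mp2Z.T * Mp2Z.S * Mp2Z.T * Mp2Z.S * Mp2Z.T with hg
    have hmat : g.mat = Mp2Z.S.mat := by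
      change ModularGroup.T * ModularGroup.S * ModularGroup.T * ModularGroup.S * ModularGroup.T =
        ModularGroup.S
      decide
    have hsq : g.fac τ ^ 2 = Mp2Z.S.fac τ ^ 2 := by rw [g.sq, Mp2Z.S.sq, hmat]
    have him : 0 < (g.fac τ).im := by
      obtain ⟨τ₁, τ₂, h⟩ : ∃ τ₁ τ₂ : ℍ, g.fac τ = (τ₁ : ℂ) ^ (1 / 2 : ℂ) * (τ₂ : ℂ) ^ (1 / 2 : ℂ) :=
        ⟨_, _, by
          simp only [hg, Mp2Z.fac_mul, Mp2Z.T, Mp2Z.S, one_mul, mul_one]; rfl⟩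
      have h1 := UpperHalfPlane_sqrt_pos τ₁.im_pos
      have h2 := UpperHalfPlane_sqrt_pos τ₂.im_pos
      rw [h, Complex.mul_im]
      exact add_pos (mul_pos h1.1 h2.2) (mul_pos h1.2 h2.1)
    have him' : 0 < (Mp2Z.S.fac τ).im := (UpperHalfPlane_sqrt_pos τ.im_pos).2
    rcases sq_eq_sq_iff_eq_or_eq_neg.mp hsq with h | h
    · exact h
    · rw [h, Complex.neg_im] at him; linarith

theorem Matrix_diagonal_sandwich {n : ℕ} (d : Fin n → ℂ) (A : Matrix (Fin n) (Fin n) ℂ)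
    (i j : Fin n) : (Matrix.diagonal d * A * Matrix.diagonal d * A * Matrix.diagonal d) i j =
      d i * (∑ k, A i k * d k * A k j) * d j := by
  rw [Matrix.mul_diagonal, Matrix.mul_apply, Finset.mul_sum]
  congr 1
  refine Finset.sum_congr rfl fun k _ => ?_
  rw [Matrix.mul_diagonal, Matrix.diagonal_mul]
  ring

/-- The (0, 0) entry of TSTST = S in the representation on Jacobi theta functions: the left side is
the Gauss sum times the square of the normalizing factor of S, the right side is that factor. -/
theorem sum_exp_sq (n : ℕ) [NeZero n] :
    ∑ i ∈ Finset.range (2 * n), zexp (4 * n) ((i : ℤ) ^ 2) =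
      cexp (π * I / 4) * (Real.sqrt (2 * n : ℕ) : ℂ) := by
  obtain ⟨ρ, hT, hS⟩ := exists_jRep n
  have h1 := congrArg ρ Mp2Z.T_S_T_S_T
  simp only [map_mul, hT, hS] at h1
  have hn : (n : ℂ) ≠ 0 := by exact_mod_cast NeZero.ne n
  have hpos : 0 < 2 * n := by have := NeZero.pos n; omega
  have hsq : (0 : ℝ) < (2 * n : ℕ) := by exact_mod_cast hpos
  have hs0 : (Real.sqrt (2 * n : ℕ) : ℂ) ≠ 0 := by exact_mod_cast (Real.sqrt_pos.mpr hsq).ne'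
  have h2 := congrFun (congrFun h1 ⟨0, hpos⟩) ⟨0, hpos⟩
  rw [jT, Matrix_diagonal_sandwich] at h2
  have h3 : ∀ k : Fin (2 * n), jS (2 * n) ⟨0, hpos⟩ k * cexp (π * I * ((k : ℕ) : ℂ) ^ 2 / (2 * n : ℕ)) *
      jS (2 * n) k ⟨0, hpos⟩ = (cexp (-(π * I / 4)) / (Real.sqrt (2 * n : ℕ) : ℂ)) ^ 2 *
        zexp (4 * n) (((k : ℕ) : ℤ) ^ 2) := by
    intro k
    have : cexp (π * I * ((k : ℕ) : ℂ) ^ 2 / (2 * n : ℕ)) = zexp (4 * n) (((k : ℕ) : ℤ) ^ 2) := by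
      rw [zexp]; congr 1; push_cast; field_simp; ring
    rw [this]
    simp [jS]
    ring
  simp only [h3] at h2
  rw [← Finset.mul_sum, ← Finset.sum_range (fun i => zexp (4 * n) ((i : ℤ) ^ 2))] at h2
  have h4 : jS (2 * n) ⟨0, hpos⟩ ⟨0, hpos⟩ =
      cexp (-(π * I / 4)) / (Real.sqrt (2 * n : ℕ) : ℂ) := by simp [jS]
  rw [h4] at h2
  have he : cexp (-(π * I / 4)) ≠ 0 := Complex.exp_ne_zero _
  have he' : cexp (π * I / 4) = (cexp (-(π * I / 4)))⁻¹ := by rw [← Complex.exp_neg, neg_neg]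
  rw [he']
  generalize cexp (-(π * I / 4)) = e at *
  generalize (Real.sqrt (2 * n : ℕ) : ℂ) = q at *
  set S := ∑ i ∈ Finset.range (2 * n), zexp (4 * n) ((i : ℤ) ^ 2)
  norm_num at h2
  have h5 : e / q ≠ 0 := div_ne_zero he hs0
  have h6 : e / q * S = 1 := by
    apply mul_left_cancel₀ h5
    rw [← mul_assoc, ← sq, mul_one]
    exact h2
  field_simp at h6 ⊢
  rw [mul_comm] at h6
  linear_combination h6

theorem zexp_conj (n : ℕ) (x : ℤ) : conj (zexp n x) = zexp n (-x) := by
  rw [zexp, zexp, ← Complex.exp_conj]; congr 1; simp [Complex.conj_ofNat]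

/-- The eighth root of unity `e(s / 8)` for a sign `s`. -/
noncomputable def eighthRoot (s : ℤ) : ℂ := cexp (s * (π * I / 4))

theorem sum_exp_sq_sign (n : ℕ) [NeZero n] {s : ℤ} (hs : IsUnit s) :
    ∑ i ∈ Finset.range (2 * n), zexp (4 * n) (s * (i : ℤ) ^ 2) =
      eighthRoot s * (Real.sqrt (2 * n : ℕ) : ℂ) := by
  rcases Int.isUnit_iff.mp hs with rfl | rfl
  · simp only [one_mul, eighthRoot, Int.cast_one]
    exact sum_exp_sq n
  · have := congrArg conj (sum_exp_sq n)
    rw [map_sum, map_mul, Complex.conj_ofReal, ← Complex.exp_conj] at this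
    simp only [zexp_conj] at this
    simp only [neg_one_mul]
    rw [this, eighthRoot]
    congr 2
    simp [Complex.conj_ofNat]
    ring

/-- Shifted quadratic Gauss sums. -/
theorem sum_exp_sq_shift (n : ℕ) [NeZero n] {s : ℤ} (hs : IsUnit s) (a : ℤ) :
    ∑ i ∈ Finset.range (2 * n), zexp (4 * n) (s * ((i : ℤ) + a) ^ 2) =
      eighthRoot s * (Real.sqrt (2 * n : ℕ) : ℂ) := by
  rw [← sum_exp_sq_sign n hs]
  refine sum_range_add (f := fun x => zexp (4 * n) (s * x ^ 2)) (n := 2 * n) ?_ a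
  intro x
  refine zexp_congr ⟨s * (x + n), ?_⟩
  push_cast; ring

/-- For b = 2Nt + ry one has 4N q(t, y) = b² − Δy², so the binary Gauss sum separates into sums in b
and in y coupled only by b ≡ ry modulo 2N. Additive characters modulo 2N decouple them into two
shifted one-variable sums. -/
theorem sum_stdAddChar_binForm {N : ℕ} [NeZero N] {Δ r k : ℤ} [NeZero Δ.natAbs]
    (h : Δ = r ^ 2 - 4 * N * k) :
    ∑ x, (ZMod.stdAddChar (-binForm (N : ZMod Δ.natAbs) r k x) : ℂ) =
      eighthRoot Δ.sign * eighthRoot (-1) * Δ.natAbs * (Real.sqrt Δ.natAbs : ℂ) := by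
  set M := Δ.natAbs with hM
  have hΔ0 : Δ ≠ 0 := Int.natAbs_ne_zero.mp (NeZero.ne M)
  set s := Δ.sign with hs
  have hsu : IsUnit s := by
    rcases lt_or_gt_of_ne hΔ0 with h | h
    · rw [hs, Int.sign_eq_neg_one_of_neg h]; decide
    · rw [hs, Int.sign_eq_one_of_pos h]; decide
  have hss : s * s = 1 := by
    rcases Int.isUnit_iff.mp hsu with h | h <;> rw [h] <;> rfl
  have hsM : s * M = Δ := by rw [hs, hM]; exact Int.sign_mul_natAbs Δ
  have hsΔ : s * Δ = M := by rw [← hsM, ← mul_assoc, hss, one_mul]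
  have hNC : (N : ℂ) ≠ 0 := by exact_mod_cast NeZero.ne N
  have hMC : (M : ℂ) ≠ 0 := by exact_mod_cast NeZero.ne M
  -- rewrite the sum over `b = 2 N t + r h`
  set F : ℤ → ℂ := fun y => ∑ b ∈ Finset.range (2 * (N * M)),
    if ((2 * N : ℕ) : ℤ) ∣ r * y - b then
      zexp (4 * (N * M)) (-1 * (b : ℤ) ^ 2) * zexp (4 * N) (s * y ^ 2) else 0 with hF
  have hperb : ∀ y x : ℤ, (fun b : ℤ => if ((2 * N : ℕ) : ℤ) ∣ r * y - b then
      zexp (4 * (N * M)) (-1 * (b : ℤ) ^ 2) * zexp (4 * N) (s * y ^ 2) else 0) (x + (2 * (N * M) : ℕ)) =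
      (fun b : ℤ => if ((2 * N : ℕ) : ℤ) ∣ r * y - b then
      zexp (4 * (N * M)) (-1 * (b : ℤ) ^ 2) * zexp (4 * N) (s * y ^ 2) else 0) x := by
    intro y x
    have e1 : ((2 * N : ℕ) : ℤ) ∣ r * y - (x + (2 * (N * M) : ℕ)) ↔ ((2 * N : ℕ) : ℤ) ∣ r * y - x := by
      rw [← sub_sub]
      exact dvd_sub_left ⟨M, by push_cast; ring⟩
    have e2 : zexp (4 * (N * M)) (-1 * (x + (2 * (N * M) : ℕ)) ^ 2) =
        zexp (4 * (N * M)) (-1 * x ^ 2) := zexp_congr ⟨-(x + N * M), by push_cast; ring⟩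
    simp only [e1, e2]
  have hFy : ∀ y : ℤ, F y = ∑ t ∈ Finset.range M,
      zexp M (-(N * (t : ℤ) ^ 2 + r * t * y + k * y ^ 2)) := by
    intro y
    have e0 := sum_range_add (n := 2 * (N * M)) (f := fun b => if ((2 * N : ℕ) : ℤ) ∣ r * y - b then
      zexp (4 * (N * M)) (-1 * b ^ 2) * zexp (4 * N) (s * y ^ 2) else 0) (hperb y) (r * y)
    simp only [hF]
    rw [← e0, show 2 * (N * M) = (2 * N) * M by ring,
      sum_range_mul_eq (fun b => if ((2 * N : ℕ) : ℤ) ∣ r * y - (b + r * y) then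
      zexp (4 * (N * M)) (-1 * (b + r * y) ^ 2) * zexp (4 * N) (s * y ^ 2) else 0)]
    rw [Finset.sum_eq_single 0]
    · refine Finset.sum_congr rfl fun t _ => ?_
      rw [if_pos ⟨-t, by push_cast; ring⟩]
      rw [← zexp_mul_left M (4 * N), show M * (4 * N) = 4 * (N * M) by ring, ← zexp_add,
        ← zexp_mul_left (4 * N) M, show 4 * N * M = 4 * (N * M) by ring]
      congr 1
      push_cast
      linear_combination y ^ 2 * hsM + y ^ 2 * h
    · intro i hi hne
      refine Finset.sum_eq_zero fun j _ => ?_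
      rw [if_neg]
      intro hd
      have h1 : ((2 * N : ℕ) : ℤ) ∣ i := by
        have := dvd_add hd (dvd_mul_right ((2 * N : ℕ) : ℤ) j)
        rw [← dvd_neg]
        convert this using 1; ring
      rw [Int.natCast_dvd_natCast] at h1
      exact hne (Nat.eq_zero_of_dvd_of_lt h1 (Finset.mem_range.mp hi))
    · intro hcon
      exact absurd (Finset.mem_range.mpr (by have := NeZero.pos N; omega)) hcon
  have hFM : ∀ y, F (y + M) = F y := by
    intro y
    rw [hFy, hFy]
    refine Finset.sum_congr rfl fun t _ => ?_
    exact zexp_congr ⟨-(r * t + 2 * k * y + k * M), by ring⟩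
  have hFN : ∀ y, F (y + (2 * N : ℕ)) = F y := by
    intro y
    refine Finset.sum_congr rfl fun b _ => ?_
    have e1 : ((2 * N : ℕ) : ℤ) ∣ r * (y + (2 * N : ℕ)) - b ↔ ((2 * N : ℕ) : ℤ) ∣ r * y - b := by
      rw [show r * (y + (2 * N : ℕ)) - b = r * y - b + r * (2 * N : ℕ) by ring]
      exact dvd_add_left (dvd_mul_left _ _)
    have e2 : zexp (4 * N) (s * (y + (2 * N : ℕ)) ^ 2) = zexp (4 * N) (s * y ^ 2) :=
      zexp_congr ⟨s * (y + N), by push_cast; ring⟩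
    simp only [e1, e2]
  have hsum1 : ∑ x, (ZMod.stdAddChar (-binForm (N : ZMod M) r k x) : ℂ) =
      ∑ y ∈ Finset.range M, F y := by
    rw [Fintype.sum_prod_type, Finset.sum_comm,
      ← sum_range_zmod M (fun y => ∑ x, (ZMod.stdAddChar (-binForm (N : ZMod M) r k (x, y)) : ℂ))]
    refine Finset.sum_congr rfl fun y _ => ?_
    rw [hFy, ← sum_range_zmod M (fun x => (ZMod.stdAddChar
      (-binForm (N : ZMod M) r k (x, (y : ZMod M))) : ℂ))]
    refine Finset.sum_congr rfl fun t _ => ?_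
    rw [zexp_eq_stdAddChar]
    simp [binForm]
  -- F has period M by its expression in t and period 2N by its expression in b, so its means over
  -- both periods agree.
  have hsum2 : (2 * N : ℕ) * ∑ y ∈ Finset.range M, F y =
      M * ∑ y ∈ Finset.range (2 * N), F y := by
    rw [← sum_range_mul_periodic hFM, ← sum_range_mul_periodic hFN, mul_comm]
  have hF2 : (2 * N : ℕ) * ∑ y ∈ Finset.range (2 * N), F y =
      (2 * N : ℕ) * (eighthRoot (-1) * (Real.sqrt (2 * (N * M) : ℕ) : ℂ) *
        (eighthRoot s * (Real.sqrt (2 * N : ℕ) : ℂ))) := by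
    -- The character e(j(ry − b)/2N) that detects the congruence is absorbed by the shifts b + Mj
    -- and y + srj: the extra terms in j² cancel modulo 1 because Δ = r² − 4Nk.
    have e1 : ∀ y : ℕ, (2 * N : ℕ) * F y = ∑ b ∈ Finset.range (2 * (N * M)),
        ∑ j ∈ Finset.range (2 * N), zexp (4 * (N * M)) (-1 * ((b : ℤ) + M * j) ^ 2) *
          zexp (4 * N) (s * (y + s * r * j) ^ 2) := by
      intro y
      rw [hF, Finset.mul_sum]
      refine Finset.sum_congr rfl fun b _ => ?_
      have e2 : ∀ j : ℕ, zexp (4 * (N * M)) (-1 * ((b : ℤ) + M * j) ^ 2) *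
          zexp (4 * N) (s * (y + s * r * j) ^ 2) =
          zexp (4 * (N * M)) (-1 * (b : ℤ) ^ 2) * zexp (4 * N) (s * y ^ 2) *
            zexp (2 * N) (j * (r * y - b)) := by
        intro j
        have e3 : zexp (4 * N) (s * (y + s * r * j) ^ 2) = zexp (4 * (N * M))
            (M * (s * (y + s * r * j) ^ 2)) := by
          rw [← zexp_mul_left M (4 * N), show M * (4 * N) = 4 * (N * M) by ring]
        have e4 : zexp (4 * N) (s * y ^ 2) = zexp (4 * (N * M)) (M * (s * y ^ 2)) := by
          rw [← zexp_mul_left M (4 * N), show M * (4 * N) = 4 * (N * M) by ring]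
        have e5 : zexp (2 * N) (j * (r * y - b)) = zexp (4 * (N * M))
            ((2 * M : ℕ) * (j * (r * y - b))) := by
          rw [← zexp_mul_left (2 * M) (2 * N), show 2 * M * (2 * N) = 4 * (N * M) by ring]
        rw [e3, e4, e5, ← zexp_add, ← zexp_add, ← zexp_add]
        refine zexp_congr ⟨s * k * j ^ 2, ?_⟩
        push_cast
        linear_combination (2 * M * y * r * j + s * M * r ^ 2 * j ^ 2) * hss +
          M * j ^ 2 * hsΔ - M * j ^ 2 * s * h
      simp only [e2, ← Finset.mul_sum, sum_zexp_mul]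
      split_ifs <;> push_cast <;> ring
    rw [Finset.mul_sum, Finset.sum_congr rfl fun y _ => e1 y, Finset.sum_comm]
    rw [Finset.sum_congr rfl fun b _ => Finset.sum_comm, Finset.sum_comm]
    have e6 : ∀ j : ℕ, ∑ b ∈ Finset.range (2 * (N * M)), ∑ y ∈ Finset.range (2 * N),
        zexp (4 * (N * M)) (-1 * ((b : ℤ) + M * j) ^ 2) *
          zexp (4 * N) (s * ((y : ℤ) + s * r * j) ^ 2) =
        eighthRoot (-1) * (Real.sqrt (2 * (N * M) : ℕ) : ℂ) *
        (eighthRoot s * (Real.sqrt (2 * N : ℕ) : ℂ)) := by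
      intro j
      rw [← sum_exp_sq_shift (N * M) (by decide : IsUnit (-1 : ℤ)) (M * j),
        ← sum_exp_sq_shift N hsu (s * r * j), Finset.sum_mul_sum]
    rw [Finset.sum_congr rfl fun j _ => e6 j]
    simp
  have h2N : ((2 * N : ℕ) : ℂ) ≠ 0 := by push_cast; exact mul_ne_zero two_ne_zero hNC
  rw [mul_right_inj' h2N] at hF2
  rw [hsum1]
  apply mul_left_cancel₀ h2N
  rw [hsum2, hF2]
  have hr1 : (Real.sqrt (2 * (N * M) : ℕ) : ℂ) = (Real.sqrt (2 * N : ℕ) : ℂ) * (Real.sqrt M : ℂ) := by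
    rw [← Complex.ofReal_mul, ← Real.sqrt_mul (by positivity)]
    push_cast; ring_nf
  have hr2 : (Real.sqrt (2 * N : ℕ) : ℂ) * (Real.sqrt (2 * N : ℕ) : ℂ) = (2 * N : ℕ) := by
    rw [← Complex.ofReal_mul, Real.mul_self_sqrt (by positivity)]; push_cast; rfl
  rw [hr1]
  linear_combination (M * (eighthRoot (-1) * (Real.sqrt M : ℂ) * eighthRoot s)) * hr2

/-! ### The twisted weight function and its Fourier transform -/

/-- Translating x by a vector of the radical on which q vanishes alters neither the polar form nor
the determinant. -/
theorem hermChar_add_of_gramMap {M : ℕ} {N r k : ZMod M} {χ : MulChar (ZMod M) ℤ}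
    (hnorm : ∀ s, IsUnit (ordNorm N r k s) → χ (ordNorm N r k s) = 1)
    (δ : (ZMod M × ZMod M) × (ZMod M × ZMod M)) {y : ZMod M × ZMod M} (hy : gramMap N r k y = 0)
    (hq : binForm N r k y = 0) : hermChar N r k χ (δ.1, δ.2 + y) = hermChar N r k χ δ := by
  have h1 : 2 * N * y.1 + r * y.2 = 0 := congrArg Prod.fst hy
  have h2 : r * y.1 + 2 * k * y.2 = 0 := congrArg Prod.snd hy
  have hpol : ∀ w, binPolar N r k (δ.2 + y) w = binPolar N r k δ.2 w := by
    intro w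
    simp only [binPolar, Prod.fst_add, Prod.snd_add]
    linear_combination w.1 * h1 + w.2 * h2
  have hval : ∀ v, hermVal N r k (δ.1, δ.2 + y) v = 1 * hermVal N r k δ v := by
    intro v
    simp only [hermVal, hpol, one_mul]
  have := hermChar_eq_of_forall hnorm (δ := (δ.1, δ.2 + y)) (δ' := δ) isUnit_one (by
    have : hermDet N r k (δ.1, δ.2 + y) = hermDet N r k δ := by
      simp only [hermDet, binForm, Prod.fst_add, Prod.snd_add] at hq ⊢
      linear_combination -hq - δ.2.1 * h1 - δ.2.2 * h2
    rw [this]) (fun v => ⟨v, hval v⟩) (fun v => ⟨v, hval v⟩)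
  rwa [map_one, one_mul] at this

/-- The coefficient of `(a, b, c)` in the `h`-th component of the twisted theta function. -/
noncomputable def twistWeight (N : ℕ) {Δ : ℤ} (r k : ℤ) (χ : MulChar (ZMod Δ.natAbs) ℤ)
    (h a b c : ℤ) : ℤ :=
  if ((2 * N : ℕ) : ℤ) ∣ b - r * h then
    hermChar (N : ZMod Δ.natAbs) r k χ
      (((a : ZMod Δ.natAbs), (c : ZMod Δ.natAbs)),
        (((b - r * h) / (2 * N : ℕ) : ℤ) : ZMod Δ.natAbs), (h : ZMod Δ.natAbs)) else 0

section

variable {N : ℕ} [NeZero N] {Δ r k : ℤ} {χ : MulChar (ZMod Δ.natAbs) ℤ}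

theorem two_mul_cast_ne_zero (N : ℕ) [NeZero N] : ((2 * N : ℕ) : ℤ) ≠ 0 := by
  have := NeZero.pos N
  omega

theorem twistWeight_eq {h a b c t : ℤ} (hb : b = r * h + (2 * N : ℕ) * t) :
    twistWeight N r k χ h a b c = hermChar (N : ZMod Δ.natAbs) r k χ
      (((a : ZMod Δ.natAbs), (c : ZMod Δ.natAbs)), (t : ZMod Δ.natAbs), (h : ZMod Δ.natAbs)) := by
  have h1 : b - r * h = (2 * N : ℕ) * t := by rw [hb]; ring
  rw [twistWeight, h1, if_pos (dvd_mul_right _ _), Int.mul_ediv_cancel_left _ (two_mul_cast_ne_zero N)]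

theorem twistWeight_ne_zero {h a b c : ℤ} (hw : twistWeight N r k χ h a b c ≠ 0) :
    ∃ t, b = r * h + (2 * N : ℕ) * t := by
  by_contra hcon
  rw [twistWeight, if_neg] at hw
  · exact hw rfl
  · rintro ⟨t, ht⟩
    exact hcon ⟨t, by rw [← ht]; ring⟩

theorem twistWeight_congr {h a b c a' b' c' : ℤ} (ha : Δ ∣ a - a')
    (hb : 2 * N * Δ ∣ b - b') (hc : Δ ∣ c - c') :
    twistWeight N r k χ h a b c = twistWeight N r k χ h a' b' c' := by
  have ha' : (a : ZMod Δ.natAbs) = a' := by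
    rw [← sub_eq_zero, ← Int.cast_sub, intCast_zmod_natAbs_eq_zero]; exact ha
  have hc' : (c : ZMod Δ.natAbs) = c' := by
    rw [← sub_eq_zero, ← Int.cast_sub, intCast_zmod_natAbs_eq_zero]; exact hc
  obtain ⟨e, he⟩ := hb
  by_cases h1 : ∃ t, b' = r * h + (2 * N : ℕ) * t
  · obtain ⟨t, ht⟩ := h1
    rw [twistWeight_eq ht, twistWeight_eq (t := t + Δ * e) (by
      push_cast at ht ⊢; linear_combination ht + he), ha', hc']
    have : ((t + Δ * e : ℤ) : ZMod Δ.natAbs) = t := by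
      rw [← sub_eq_zero, ← Int.cast_sub, intCast_zmod_natAbs_eq_zero]
      exact ⟨e, by ring⟩
    rw [this]
  · have h2 : twistWeight N r k χ h a' b' c' = 0 := by
      by_contra hcon; exact h1 (twistWeight_ne_zero hcon)
    rw [h2]
    by_contra hcon
    obtain ⟨t, ht⟩ := twistWeight_ne_zero hcon
    exact h1 ⟨t - Δ * e, by push_cast at ht ⊢; linear_combination ht - he⟩

/-- The shift of (t, j) is minus the adjugate of the Gram matrix applied to (β, γ), hence radical
modulo Δ. -/
theorem twistWeight_index (hΔ : IsFundamentalDiscriminant Δ)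
    (hχ : ∀ n, IsCoprime n Δ → χ (n : ZMod Δ.natAbs) = kroneckerSymbol Δ n)
    (h : Δ = r ^ 2 - 4 * N * k) (β γ : ℤ) {j t j' t' a c : ℤ}
    (hj : j' = j + (r * β - 2 * N * γ)) (ht : t' = t + (r * γ - 2 * k * β)) :
    hermChar (N : ZMod Δ.natAbs) r k χ
      (((a : ZMod Δ.natAbs), (c : ZMod Δ.natAbs)), (t' : ZMod Δ.natAbs), (j' : ZMod Δ.natAbs)) =
    hermChar (N : ZMod Δ.natAbs) r k χ
      (((a : ZMod Δ.natAbs), (c : ZMod Δ.natAbs)), (t : ZMod Δ.natAbs), (j : ZMod Δ.natAbs)) := by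
  have hd := discr_eq_zero h
  rw [Int.cast_natCast] at hd
  have hy : gramMap (N : ZMod Δ.natAbs) r k ((r * γ - 2 * k * β : ZMod Δ.natAbs),
      (r * β - 2 * N * γ : ZMod Δ.natAbs)) = 0 := by
    rw [gramMap_apply]
    ext
    · simp only [Prod.fst_zero]; linear_combination (β : ZMod Δ.natAbs) * hd
    · simp only [Prod.snd_zero]; linear_combination (γ : ZMod Δ.natAbs) * hd
  have := hermChar_add_of_gramMap (hermChar_norm_one hΔ hχ h)
    (((a : ZMod Δ.natAbs), (c : ZMod Δ.natAbs)), (t : ZMod Δ.natAbs), (j : ZMod Δ.natAbs)) hy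
    (binForm_eq_zero_of_gramMap hΔ h _ hy)
  rw [← this, hj, ht]
  push_cast
  rfl

/-- The weight depends on the index only through its class in L'/L: j ↦ j + 2N is compensated by t ↦
t − r, and (−r, 2N) is radical modulo Δ. -/
theorem twistWeight_add_index (hΔ : IsFundamentalDiscriminant Δ)
    (hχ : ∀ n, IsCoprime n Δ → χ (n : ZMod Δ.natAbs) = kroneckerSymbol Δ n)
    (h : Δ = r ^ 2 - 4 * N * k) (j a b c : ℤ) :
    twistWeight N r k χ (j + (2 * N : ℕ)) a b c = twistWeight N r k χ j a b c := by
  by_cases h1 : ∃ t, b = r * j + (2 * N : ℕ) * t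
  · obtain ⟨t, ht⟩ := h1
    rw [twistWeight_eq ht, twistWeight_eq (t := t - r) (by rw [ht]; ring)]
    exact twistWeight_index hΔ hχ h 0 (-1) (by push_cast; ring) (by ring)
  · have h2 : twistWeight N r k χ j a b c = 0 := by
      by_contra hcon; exact h1 (twistWeight_ne_zero hcon)
    rw [h2]
    by_contra hcon
    obtain ⟨t, ht⟩ := twistWeight_ne_zero hcon
    exact h1 ⟨t + r, by rw [ht]; ring⟩

/-- The Fourier transform of the weight function. -/
noncomputable def weightFourier (N M : ℕ) (w : ℤ → ℤ → ℤ → ℂ) (a' b' c' : ℤ) : ℂ :=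
  ∑ b ∈ Finset.range (2 * N * M), ∑ a ∈ Finset.range M, ∑ c ∈ Finset.range M,
    w a b c * zexp M (-(a * c' + c * a')) * zexp (2 * N * M) (b * b')

/-- Only b ≡ rj modulo 2N contributes, and b = rj + 2Nt turns the sum over b modulo 2NM into one
over t modulo M. -/
theorem weightFourier_twistWeight_aux [NeZero Δ.natAbs] (j a' b' c' : ℤ) :
    weightFourier N Δ.natAbs (fun a b c => (twistWeight N r k χ j a b c : ℂ)) a' b' c' =
      zexp (2 * N * Δ.natAbs) (r * j * b') * ∑ t : ZMod Δ.natAbs, ∑ a : ZMod Δ.natAbs,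
        ∑ c : ZMod Δ.natAbs, (hermChar (N : ZMod Δ.natAbs) r k χ ((a, c), (t, (j : ZMod Δ.natAbs))) : ℂ) *
          ZMod.stdAddChar (-(a * (c' : ZMod Δ.natAbs) + c * (a' : ZMod Δ.natAbs)) + t * (b' : ZMod Δ.natAbs)) := by
  have hMΔ : (Δ : ℤ) ∣ Δ.natAbs := by exact Int.dvd_natAbs_self
  set f : ℤ → ℂ := fun b => ∑ a ∈ Finset.range Δ.natAbs, ∑ c ∈ Finset.range Δ.natAbs,
    (twistWeight N r k χ j a b c : ℂ) * zexp Δ.natAbs (-(a * c' + c * a')) * zexp (2 * N * Δ.natAbs) (b * b')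
    with hf
  have hper : ∀ x, f (x + (2 * N * Δ.natAbs : ℕ)) = f x := by
    intro x
    refine Finset.sum_congr rfl fun a _ => Finset.sum_congr rfl fun c _ => ?_
    have e1 : zexp (2 * N * Δ.natAbs) ((x + (2 * N * Δ.natAbs : ℕ)) * b') = zexp (2 * N * Δ.natAbs) (x * b') :=
      zexp_congr ⟨b', by ring⟩
    have e2 : twistWeight N r k χ j a (x + (2 * N * Δ.natAbs : ℕ)) c = twistWeight N r k χ j a x c := by
      refine twistWeight_congr (by simp) ?_ (by simp)
      rw [add_sub_cancel_left]
      simp only [Nat.cast_mul, Nat.cast_ofNat]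
      exact mul_dvd_mul_left _ hMΔ
    rw [e1, e2]
  have h1 : weightFourier N Δ.natAbs (fun a b c => (twistWeight N r k χ j a b c : ℂ)) a' b' c' =
      ∑ b ∈ Finset.range (2 * N * Δ.natAbs), f b := rfl
  rw [h1, ← sum_range_add (n := 2 * N * Δ.natAbs) hper (r * j),
    sum_range_mul_eq (fun b => f (b + r * j)), Finset.sum_eq_single 0]
  · rw [← sum_range_zmod Δ.natAbs, Finset.mul_sum]
    refine Finset.sum_congr rfl fun t _ => ?_
    rw [← sum_range_zmod Δ.natAbs, Finset.mul_sum]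
    refine Finset.sum_congr rfl fun a _ => ?_
    rw [← sum_range_zmod Δ.natAbs, Finset.mul_sum]
    refine Finset.sum_congr rfl fun c _ => ?_
    rw [twistWeight_eq (t := t) (by push_cast; ring)]
    have e1 : zexp (2 * N * Δ.natAbs) (((0 : ℕ) + (2 * N : ℕ) * t + r * j) * b') =
        zexp (2 * N * Δ.natAbs) (r * j * b') * zexp Δ.natAbs (t * b') := by
      have : NeZero (2 * N) := ⟨by have := NeZero.pos N; omega⟩
      rw [← zexp_mul_left (2 * N) Δ.natAbs, ← zexp_add]
      congr 1; simp only [Nat.cast_mul, Nat.cast_ofNat]; ring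
    rw [e1, AddChar.map_add_eq_mul, zexp_eq_stdAddChar Δ.natAbs, zexp_eq_stdAddChar Δ.natAbs]
    push_cast
    ring
  · intro i hi hne
    refine Finset.sum_eq_zero fun l _ => Finset.sum_eq_zero fun a _ => Finset.sum_eq_zero fun c _ => ?_
    have : twistWeight N r k χ j a (i + (2 * N : ℕ) * l + r * j) c = 0 := by
      by_contra hcon
      obtain ⟨t, ht⟩ := twistWeight_ne_zero hcon
      have h2 : ((2 * N : ℕ) : ℤ) ∣ i := ⟨t - l, by linear_combination ht⟩
      rw [Int.natCast_dvd_natCast] at h2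
      exact hne (Nat.eq_zero_of_dvd_of_lt h2 (Finset.mem_range.mp hi))
    rw [this]; simp
  · intro hcon
    exact absurd (Finset.mem_range.mpr (by have := NeZero.pos N; omega)) hcon

/-- If b = rj + 2Nt, the relation defining γ says that (b, γ) is the Gram image of (t, j), and
`hermFourier_support` applies. Conversely, where the transform is nonzero, (b, γ) is a Gram image
modulo Δ of some (t, i), and i differs from j by a radical shift, so the weight with index j is
nonzero as well. -/
theorem hermFourier_eq_twistWeight [NeZero Δ.natAbs] (hΔ : IsFundamentalDiscriminant Δ)
    (hχ : ∀ n, IsCoprime n Δ → χ (n : ZMod Δ.natAbs) = kroneckerSymbol Δ n)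
    (hprim : ∀ c : ZMod Δ.natAbs, ¬ IsUnit c → ∃ u : (ZMod Δ.natAbs)ˣ, u * c = c ∧ χ u = -1)
    (h : Δ = r ^ 2 - 4 * N * k) {j a b c γ : ℤ} (hγ : r * b - Δ * j = (2 * N : ℕ) * γ) :
    hermFourier (N : ZMod Δ.natAbs) r k χ (((a : ZMod Δ.natAbs), (c : ZMod Δ.natAbs)),
        ((b : ZMod Δ.natAbs), (γ : ZMod Δ.natAbs))) =
      Δ.natAbs * (eighthRoot Δ.sign * eighthRoot (-1) * Δ.natAbs * (Real.sqrt Δ.natAbs : ℂ)) *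
        twistWeight N r k χ j a b c := by
  have hC := hermFourier_one_eq (hermChar_norm_one hΔ hχ h) hprim (exists_isUnit_binForm hΔ h)
    (binForm_char_one hΔ hχ h) (exists_isUnit_unipUpper hΔ h) (card_gramMap_ker_le hΔ h)
    (binForm_eq_zero_of_gramMap hΔ h)
  rw [sum_stdAddChar_binForm h] at hC
  rw [← hC]
  have hN0 := two_mul_cast_ne_zero N
  by_cases hw : twistWeight N r k χ j a b c = 0
  · rw [hw, Int.cast_zero, mul_zero]
    by_contra hne
    obtain ⟨δ, hδ, hy⟩ := hermFourier_vanish (hermChar_norm_one hΔ hχ h) hprim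
      (exists_isUnit_binForm hΔ h) (binForm_char_one hΔ hχ h) (exists_isUnit_unipUpper hΔ h)
      (card_gramMap_ker_le hΔ h) hne
    obtain ⟨δ₁, δ₂⟩ := δ
    obtain ⟨t, i, rfl⟩ := exists_intCast_pair δ₂
    have h1 : ((a : ZMod Δ.natAbs), (c : ZMod Δ.natAbs)) = δ₁ := congrArg Prod.fst hy
    have h2 := congrArg Prod.snd hy
    rw [← h1] at hδ
    simp only [gramMap_apply] at h2
    have h3 : ((b - (2 * N * t + r * i) : ℤ) : ZMod Δ.natAbs) = 0 := by
      push_cast; rw [sub_eq_zero]; exact congrArg Prod.fst h2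
    have h4 : ((γ - (r * t + 2 * k * i) : ℤ) : ZMod Δ.natAbs) = 0 := by
      push_cast; rw [sub_eq_zero]; exact congrArg Prod.snd h2
    obtain ⟨β', hβ⟩ := intCast_zmod_natAbs_eq_zero.mp h3
    obtain ⟨γ', hγ'⟩ := intCast_zmod_natAbs_eq_zero.mp h4
    push_cast at hγ
    have hj : j = i + (r * β' - 2 * N * γ') := by
      apply mul_left_cancel₀ hΔ.ne_zero
      linear_combination -hγ - i * h + r * hβ - 2 * N * hγ'
    apply hδ
    rw [← twistWeight_index hΔ hχ h β' γ' hj rfl, ← hw]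
    symm
    apply twistWeight_eq
    push_cast
    linear_combination hβ + β' * h - r * hj
  · obtain ⟨t, ht⟩ := twistWeight_ne_zero hw
    rw [twistWeight_eq ht] at hw ⊢
    have h1 := hermFourier_support (hermChar_norm_one hΔ hχ h) hprim
      (exists_isUnit_unipUpper hΔ h) hw
    rw [mul_comm, ← h1]
    congr 2
    rw [gramMap_apply]
    have h3 : γ = r * t + 2 * k * j := by
      apply mul_left_cancel₀ hN0
      push_cast at hγ ht ⊢
      linear_combination -hγ + r * ht - j * h
    rw [h3, ht]
    ext
    · push_cast; ring
    · push_cast; ring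

/-- The finite counterpart of the statement that the twist intertwines the Weil representations of
L'/ΔL and L'/L at S. Inverting the Fourier transform in the index i supplies the missing fourth
variable of `hermFourier`. -/
theorem weightFourier_twistWeight [NeZero Δ.natAbs] (hΔ : IsFundamentalDiscriminant Δ)
    (hχ : ∀ n, IsCoprime n Δ → χ (n : ZMod Δ.natAbs) = kroneckerSymbol Δ n)
    (hprim : ∀ c : ZMod Δ.natAbs, ¬ IsUnit c → ∃ u : (ZMod Δ.natAbs)ˣ, u * c = c ∧ χ u = -1)
    (h : Δ = r ^ 2 - 4 * N * k) (i a' b' c' : ℤ) :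
    weightFourier N Δ.natAbs (fun a b c => (twistWeight N r k χ i a b c : ℂ)) a' b' c' =
      ∑ j ∈ Finset.range (2 * N), zexp (2 * N) (Δ.sign * i * j) *
        (eighthRoot Δ.sign * eighthRoot (-1) * Δ.natAbs * (Real.sqrt Δ.natAbs : ℂ) *
          twistWeight N r k χ j a' b' c') := by
  have : NeZero (2 * N) := ⟨by have := NeZero.pos N; omega⟩
  have hMC : (Δ.natAbs : ℂ) ≠ 0 := by exact_mod_cast NeZero.ne Δ.natAbs
  set s := Δ.sign with hs
  have hsu : IsUnit s := by
    rcases lt_or_gt_of_ne hΔ.ne_zero with h | h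
    · rw [hs, Int.sign_eq_neg_one_of_neg h]; decide
    · rw [hs, Int.sign_eq_one_of_pos h]; decide
  have hsM : s * Δ.natAbs = Δ := by rw [hs]; exact Int.sign_mul_natAbs Δ
  set L : ℤ → ℂ := fun i =>
    weightFourier N Δ.natAbs (fun a b c => (twistWeight N r k χ i a b c : ℂ)) a' b' c' with hL
  have hLper : ∀ x, L (x + (2 * N : ℕ)) = L x := by
    intro x
    simp only [hL, twistWeight_add_index hΔ hχ h]
  set G : ZMod Δ.natAbs → ℂ := fun y => ∑ t : ZMod Δ.natAbs, ∑ a : ZMod Δ.natAbs, ∑ c : ZMod Δ.natAbs,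
    (hermChar (N : ZMod Δ.natAbs) r k χ ((a, c), (t, y)) : ℂ) *
      ZMod.stdAddChar (-(a * (c' : ZMod Δ.natAbs) + c * (a' : ZMod Δ.natAbs)) + t * (b' : ZMod Δ.natAbs)) with hG
  have hLG : ∀ i, L i = zexp (2 * N * Δ.natAbs) (r * i * b') * G i := fun i =>
    weightFourier_twistWeight_aux i a' b' c'
  refine fourier_inversion_range (R := fun j => eighthRoot s * eighthRoot (-1) * Δ.natAbs *
    (Real.sqrt Δ.natAbs : ℂ) * twistWeight N r k χ j a' b' c') hLper hsu (fun j => ?_) i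
  set g : ℤ → ℂ := fun i => L i * zexp (2 * N) (-(s * i * j)) with hg
  have hgper : ∀ x, g (x + (2 * N : ℕ)) = g x := by
    intro x
    simp only [hg, hLper]
    congr 1
    exact zexp_congr ⟨-(s * j), by ring⟩
  have hgM : ∀ x l : ℤ, g (x + Δ.natAbs * l) = g x * zexp (2 * N) (l * (r * b' - Δ * j)) := by
    intro x l
    have e1 : ((x + Δ.natAbs * l : ℤ) : ZMod Δ.natAbs) = (x : ZMod Δ.natAbs) := by
      rw [Int.cast_add, Int.cast_mul, Int.cast_natCast, ZMod.natCast_self, zero_mul, add_zero]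
    simp only [hg, hLG, e1]
    have e2 : zexp (2 * N * Δ.natAbs) (r * (x + Δ.natAbs * l) * b') =
        zexp (2 * N * Δ.natAbs) (r * x * b') * zexp (2 * N) (r * l * b') := by
      rw [← zexp_mul_left Δ.natAbs (2 * N), mul_comm Δ.natAbs (2 * N), ← zexp_add]
      congr 1; ring
    have e3 : zexp (2 * N) (-(s * (x + Δ.natAbs * l) * j)) * zexp (2 * N) (r * l * b') =
        zexp (2 * N) (-(s * x * j)) * zexp (2 * N) (l * (r * b' - Δ * j)) := by
      rw [← zexp_add, ← zexp_add]
      congr 1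
      linear_combination (-(l * j)) * hsM
    rw [e2]
    linear_combination (zexp (2 * N * Δ.natAbs) (r * x * b') * G x) * e3
  -- The sum over i modulo 2N is extended to 2NM terms and split by residues modulo M. The shifts by
  -- multiples of M detect 2N ∣ rb' − Δj, and the residues give the transform on (ℤ/M)⁴.
  apply mul_left_cancel₀ hMC
  rw [← sum_range_mul_periodic hgper Δ.natAbs, mul_comm (2 * N) Δ.natAbs, sum_range_mul_eq]
  simp only [hgM, ← Finset.mul_sum, sum_zexp_mul]
  split_ifs with hd
  · obtain ⟨γ, hγ⟩ := hd
    have h1 := hermFourier_eq_twistWeight hΔ hχ hprim h (a := a') (c := c') hγ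
    have h2 : ∀ i : ℕ, g i = G (i : ZMod Δ.natAbs) * ZMod.stdAddChar ((i : ZMod Δ.natAbs) * (γ : ZMod Δ.natAbs)) := by
      intro i
      simp only [hg, hLG, Int.cast_natCast]
      have e3 : zexp (2 * N * Δ.natAbs) (r * i * b') * zexp (2 * N) (-(s * i * j)) =
          ZMod.stdAddChar ((i : ZMod Δ.natAbs) * (γ : ZMod Δ.natAbs)) := by
        rw [show (i : ZMod Δ.natAbs) * (γ : ZMod Δ.natAbs) = ((i * γ : ℤ) : ZMod Δ.natAbs) by push_cast; rfl,
          ← zexp_eq_stdAddChar, ← zexp_mul_left (2 * N) Δ.natAbs, ← zexp_mul_left Δ.natAbs (2 * N),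
          mul_comm Δ.natAbs (2 * N), ← zexp_add]
        congr 1
        linear_combination (i : ℤ) * hγ - i * j * hsM
      linear_combination (G (i : ZMod Δ.natAbs)) * e3
    have h3 : ∑ i ∈ Finset.range Δ.natAbs, g i = hermFourier (N : ZMod Δ.natAbs) r k χ
        (((a' : ZMod Δ.natAbs), (c' : ZMod Δ.natAbs)), ((b' : ZMod Δ.natAbs), (γ : ZMod Δ.natAbs))) := by
      rw [Finset.sum_congr rfl fun i _ => h2 i,
        sum_range_zmod Δ.natAbs (fun y => G y * ZMod.stdAddChar (y * (γ : ZMod Δ.natAbs))), hermFourier]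
      simp only [hG, Finset.sum_mul]
      rw [Fintype.sum_prod_type, Fintype.sum_prod_type]
      simp only [Fintype.sum_prod_type]
      rw [Finset.sum_comm]
      have e1 : ∀ t : ZMod Δ.natAbs, ∑ y : ZMod Δ.natAbs, ∑ a : ZMod Δ.natAbs, ∑ c : ZMod Δ.natAbs,
          (hermChar (N : ZMod Δ.natAbs) r k χ ((a, c), (t, y)) : ℂ) *
            ZMod.stdAddChar (-(a * (c' : ZMod Δ.natAbs) + c * (a' : ZMod Δ.natAbs)) + t * (b' : ZMod Δ.natAbs)) * ZMod.stdAddChar (y * (γ : ZMod Δ.natAbs)) =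
          ∑ a : ZMod Δ.natAbs, ∑ c : ZMod Δ.natAbs, ∑ y : ZMod Δ.natAbs,
          (hermChar (N : ZMod Δ.natAbs) r k χ ((a, c), (t, y)) : ℂ) * ZMod.stdAddChar
            (hermPairing ((a, c), (t, y)) (((a' : ZMod Δ.natAbs), (c' : ZMod Δ.natAbs)), ((b' : ZMod Δ.natAbs), (γ : ZMod Δ.natAbs)))) := by
        intro t
        rw [Finset.sum_comm]
        refine Finset.sum_congr rfl fun a _ => ?_
        rw [Finset.sum_comm]
        refine Finset.sum_congr rfl fun c _ => Finset.sum_congr rfl fun y _ => ?_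
        rw [mul_assoc, ← AddChar.map_add_eq_mul, hermPairing_apply]
        congr 2
        ring
      rw [Finset.sum_congr rfl fun t _ => e1 t, Finset.sum_comm]
      refine Finset.sum_congr rfl fun a _ => ?_
      rw [Finset.sum_comm]
    rw [← Finset.sum_mul, h3, h1]
    ring
  · have : twistWeight N r k χ j a' b' c' = 0 := by
      by_contra hcon
      obtain ⟨t, ht⟩ := twistWeight_ne_zero hcon
      refine hd ⟨2 * k * j + r * t, ?_⟩
      push_cast at ht ⊢
      linear_combination r * ht - j * h
    rw [this]; simp

end

/-! ### Comparison with the generalized genus character -/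

section

variable {N : ℕ} [NeZero N] {Δ r k : ℤ} {χ : MulChar (ZMod Δ.natAbs) ℤ}

theorem not_dvd_cofactor (hΔ : IsFundamentalDiscriminant Δ) (h : Δ = r ^ 2 - 4 * N * k)
    {N₁ N₂ : ℕ} (hN : N₁ * N₂ = N) {p : ℕ} (hp : p.Prime) (hpΔ : (p : ℤ) ∣ Δ)
    (hp1 : (p : ℤ) ∣ N₁) : ¬ (p : ℤ) ∣ N₂ := by
  intro hp2
  refine hΔ.not_dvd_both (e := N₁) (f := N₂ * k) (r := r) ?_ hp hpΔ hp1
    (dvd_mul_of_dvd_left hp2 _)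
  rw [h, ← hN]; push_cast; ring

/-- The choice N₁ = gcd(N, a) makes [N₁a, b, N₂c] primitive at every p ∣ Δ: if p ∣ N₁a, then p ∣ a
and p ∣ b, so p ∤ c; and p ∤ N₂, since otherwise p would divide both N₁ and N₂, against the
fundamentality of Δ. -/
theorem exists_isRepresented (hΔ : IsFundamentalDiscriminant Δ) (h : Δ = r ^ 2 - 4 * N * k)
    {a b c : ℤ} (hd : Δ ∣ b ^ 2 - 4 * N * a * c)
    (hg : Int.gcd (Int.gcd a b) (Int.gcd c Δ) = 1) :
    ∃ n, IsRepresented N a b c n ∧ IsCoprime n Δ := by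
  have hpr : ∀ p : ℕ, p.Prime → (p : ℤ) ∣ Δ → (p : ℤ) ∣ a → (p : ℤ) ∣ b → ¬ (p : ℤ) ∣ c := by
    intro p hp hpΔ hpa hpb hpc
    have h1 : (p : ℤ) ∣ (Int.gcd (Int.gcd a b) (Int.gcd c Δ) : ℤ) :=
      Int.dvd_coe_gcd (Int.dvd_coe_gcd hpa hpb) (Int.dvd_coe_gcd hpc hpΔ)
    rw [hg] at h1
    exact hp.one_lt.ne' (by exact_mod_cast Int.eq_one_of_dvd_one (by positivity) h1)
  have hN0 : 0 < N := NeZero.pos N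
  set N₁ := Nat.gcd N a.natAbs with hN₁
  obtain ⟨N₂, hN₂⟩ : N₁ ∣ N := Nat.gcd_dvd_left _ _
  have hb : ∀ p : ℕ, p.Prime → (p : ℤ) ∣ Δ → (p : ℤ) ∣ a → (p : ℤ) ∣ b := by
    intro p hp hpΔ hpa
    refine (Nat.prime_iff_prime_int.mp hp).dvd_of_dvd_pow (n := 2) ?_
    have := dvd_add (hpΔ.trans hd) (dvd_mul_of_dvd_left hpa (4 * N * c))
    rwa [show b ^ 2 - 4 * N * a * c + a * (4 * N * c) = b ^ 2 by ring] at this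
  obtain ⟨x, hx⟩ := exists_isCoprime_quadratic (D := Δ) (A := N₁ * a) (B := b) (C := N₂ * c)
    hΔ.ne_zero (by
      intro p hp hpΔ hpA
      have hp' := Nat.prime_iff_prime_int.mp hp
      have hpa : (p : ℤ) ∣ a := by
        rcases hp'.dvd_or_dvd hpA with h1 | h1
        · rw [Int.natCast_dvd_natCast] at h1
          exact Int.natCast_dvd.mpr (h1.trans (Nat.gcd_dvd_right _ _))
        · exact h1
      refine ⟨hb p hp hpΔ hpa, fun hC => ?_⟩
      rcases hp'.dvd_or_dvd hC with h1 | h1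
      · refine not_dvd_cofactor hΔ h hN₂.symm hp hpΔ ?_ h1
        rw [Int.natCast_dvd_natCast] at h1 ⊢
        exact Nat.dvd_gcd (hN₂ ▸ h1.mul_left _) (Int.natCast_dvd.mp hpa)
      · exact hpr p hp hpΔ hpa (hb p hp hpΔ hpa) h1)
  exact ⟨_, ⟨N₁, N₂, hN₂.symm, 1, x, rfl⟩, by convert hx using 1; ring⟩

theorem binPolar_dvd (h : Δ = r ^ 2 - 4 * N * k) {a c : ℤ} {x : ℤ × ℤ}
    (hx : Δ ∣ a * c - binForm (N : ℤ) r k x) (y : ℤ × ℤ) {p : ℕ} (hp : p.Prime)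
    (hpΔ : (p : ℤ) ∣ Δ) (hpa : (p : ℤ) ∣ a) : (p : ℤ) ∣ binPolar (N : ℤ) r k x y := by
  refine (Nat.prime_iff_prime_int.mp hp).dvd_of_dvd_pow (n := 2) ?_
  rw [binPolar_sq, ← h]
  refine dvd_add (dvd_mul_of_dvd_left (dvd_mul_of_dvd_right ?_ _) _) (dvd_mul_of_dvd_left hpΔ _)
  have := dvd_sub (dvd_mul_of_dvd_left hpa c) (hpΔ.trans hx)
  rwa [sub_sub_cancel] at this

/-- The reduction of a pair of integers. -/
def redPair (M : ℕ) (x : ℤ × ℤ) : ZMod M × ZMod M := ((x.1 : ZMod M), (x.2 : ZMod M))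

theorem redPair_surjective (M : ℕ) (x : ZMod M × ZMod M) : ∃ y, x = redPair M y := by
  obtain ⟨a, b, h⟩ := exists_intCast_pair x
  exact ⟨(a, b), h⟩

theorem binForm_redPair (M : ℕ) (N r k : ℤ) (x : ℤ × ℤ) :
    binForm (N : ZMod M) r k (redPair M x) = (binForm N r k x : ℤ) := by
  simp [binForm, redPair]

theorem hermVal_redPair (M : ℕ) (N r k : ℤ) (δ v : (ℤ × ℤ) × (ℤ × ℤ)) :
    hermVal (N : ZMod M) r k (redPair M δ.1, redPair M δ.2) (redPair M v.1, redPair M v.2) =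
      (hermVal N r k δ v : ℤ) := by
  simp [hermVal, ordNorm, ordAct, binPolar, binForm, redPair]

theorem hermDet_redPair (M : ℕ) (N r k : ℤ) (δ : (ℤ × ℤ) × (ℤ × ℤ)) :
    hermDet (N : ZMod M) r k (redPair M δ.1, redPair M δ.2) = (hermDet N r k δ : ℤ) := by
  simp [hermDet, binForm, redPair]

theorem exists_isCoprime_hermVal (hΔ : IsFundamentalDiscriminant Δ) (h : Δ = r ^ 2 - 4 * N * k)
    {a b c : ℤ} {x : ℤ × ℤ} (hx : Δ ∣ a * c - binForm (N : ℤ) r k x)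
    (hd : Δ ∣ b ^ 2 - 4 * N * a * c) (hg : Int.gcd (Int.gcd a b) (Int.gcd c Δ) = 1) :
    ∃ v, IsCoprime (hermVal (N : ℤ) r k ((a, c), x) v) Δ := by
  obtain ⟨w', hw'⟩ := exists_isUnit_binForm (N := N) hΔ h
  obtain ⟨w, rfl⟩ := redPair_surjective _ w'
  have e0 := binForm_redPair Δ.natAbs N r k w
  rw [Int.cast_natCast] at e0
  rw [e0, isUnit_intCast_zmod_natAbs] at hw'
  obtain ⟨l, hl⟩ := exists_isCoprime_quadratic (D := Δ) (A := a) (B := binPolar (N : ℤ) r k x w)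
    (C := c * binForm (N : ℤ) r k w) hΔ.ne_zero (by
      intro p hp hpΔ hpa
      have hp' := Nat.prime_iff_prime_int.mp hp
      refine ⟨binPolar_dvd h hx w hp hpΔ hpa, fun hC => ?_⟩
      rcases hp'.dvd_or_dvd hC with hpc | h1
      · have hpb : (p : ℤ) ∣ b := by
          refine hp'.dvd_of_dvd_pow (n := 2) ?_
          have := dvd_add (hpΔ.trans hd) (dvd_mul_of_dvd_left hpa (4 * N * c))
          rwa [show b ^ 2 - 4 * N * a * c + a * (4 * N * c) = b ^ 2 by ring] at this
        have h1 : (p : ℤ) ∣ (Int.gcd (Int.gcd a b) (Int.gcd c Δ) : ℤ) :=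
          Int.dvd_coe_gcd (Int.dvd_coe_gcd hpa hpb) (Int.dvd_coe_gcd hpc hpΔ)
        rw [hg] at h1
        exact hp.one_lt.ne' (by exact_mod_cast Int.eq_one_of_dvd_one (by positivity) h1)
      · exact hp'.not_isUnit (hw'.isUnit_of_dvd' h1 hpΔ))
  refine ⟨((1, 0), l • w), ?_⟩
  convert hl using 1
  simp only [hermVal, ordNorm, ordAct, binPolar, binForm, Prod.smul_fst, Prod.smul_snd, smul_eq_mul]
  ring

/-- If n is the value of [N₁a, b, N₂c] at (X, Y), the hermitian form takes the value N₁n at ((N₁X,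
0), (Y, 0)). In the product of this with a value H prime to Δ, everything except a norm is divisible
by ΔN₁. So N₁ times an integer congruent to Hn modulo Δ is a norm, and as the primes of N₁ are not
inert, χ(Hn) = 1. Without the gcd condition both sides are 0. -/
theorem hermChar_eq_genusCharForm (hΔ : IsFundamentalDiscriminant Δ)
    (hχ : ∀ n, IsCoprime n Δ → χ (n : ZMod Δ.natAbs) = kroneckerSymbol Δ n)
    (h : Δ = r ^ 2 - 4 * N * k) {a b c i t : ℤ} (hb : b = r * i + 2 * N * t)
    (hx : Δ ∣ a * c - binForm (N : ℤ) r k (t, i)) :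
    hermChar (N : ZMod Δ.natAbs) r k χ
      (((a : ZMod Δ.natAbs), (c : ZMod Δ.natAbs)), (t : ZMod Δ.natAbs), (i : ZMod Δ.natAbs)) =
      genusCharForm N Δ a b c := by
  obtain ⟨m, hm⟩ := hx
  have hdisc : b ^ 2 - 4 * N * a * c = Δ * (i ^ 2 - 4 * N * m) := by
    rw [hb]
    simp only [binForm] at hm
    linear_combination (-4 * N) * hm - i ^ 2 * h
  have hx : Δ ∣ a * c - binForm (N : ℤ) r k (t, i) := ⟨m, hm⟩
  have hd : Δ ∣ b ^ 2 - 4 * N * a * c := ⟨_, hdisc⟩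
  have hsq : IsSquare (((b ^ 2 - 4 * N * a * c) / Δ : ℤ) : ZMod (4 * N)) := by
    rw [hdisc, Int.mul_ediv_cancel_left _ hΔ.ne_zero]
    refine ⟨(i : ZMod (4 * N)), ?_⟩
    have : ((4 * N : ℕ) : ZMod (4 * N)) = 0 := ZMod.natCast_self _
    push_cast at this ⊢
    rw [this]; ring
  have hdet : hermDet (N : ZMod Δ.natAbs) r k (((a : ZMod Δ.natAbs), (c : ZMod Δ.natAbs)),
      (t : ZMod Δ.natAbs), (i : ZMod Δ.natAbs)) = 0 := by
    have h1 := hermDet_redPair Δ.natAbs N r k ((a, c), (t, i))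
    rw [Int.cast_natCast] at h1
    exact h1.trans (intCast_zmod_natAbs_eq_zero.mpr hx)
  have hvalred : ∀ v : (ℤ × ℤ) × (ℤ × ℤ), hermVal (N : ZMod Δ.natAbs) r k
      (((a : ZMod Δ.natAbs), (c : ZMod Δ.natAbs)), (t : ZMod Δ.natAbs), (i : ZMod Δ.natAbs))
      (redPair _ v.1, redPair _ v.2) = (hermVal (N : ℤ) r k ((a, c), (t, i)) v : ℤ) := by
    intro v
    have h1 := hermVal_redPair Δ.natAbs N r k ((a, c), (t, i)) v
    rw [Int.cast_natCast] at h1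
    exact h1
  by_cases hg : Int.gcd (Int.gcd a b) (Int.gcd c Δ) = 1
  · rw [genusCharForm, if_pos ⟨hd, hsq, hg⟩]
    have heps := Classical.epsilon_spec (exists_isRepresented hΔ h hd hg)
    set n := Classical.epsilon fun n : ℤ => IsRepresented N a b c n ∧ IsCoprime n Δ
    obtain ⟨⟨N₁, N₂, hN, X, Y, hn⟩, hcop⟩ := heps
    obtain ⟨v, hv⟩ := exists_isCoprime_hermVal hΔ h hx hd hg
    have hN₁ : 0 < N₁ := Nat.pos_of_ne_zero (by rintro rfl; exact NeZero.ne N (by rw [← hN]; simp))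
    rw [hermChar_eq (hermChar_norm_one hΔ hχ h) hdet (v := (redPair _ v.1, redPair _ v.2))
      (by rw [hvalred, isUnit_intCast_zmod_natAbs]; exact hv), hvalred, ← hχ n hcop]
    refine mulChar_int_eq_of_mul (isUnit_intCast_zmod_natAbs.mpr hv) ?_
    have hmul := hermVal_mul (N : ℤ) r k ((a, c), (t, i)) ((N₁ * X, 0), (Y, 0)) v
    have h1 : hermVal (N : ℤ) r k ((a, c), (t, i)) ((N₁ * X, 0), (Y, 0)) = N₁ * n := by
      have hN' : (N : ℤ) = N₁ * N₂ := by rw [← hN]; push_cast; rfl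
      simp only [hermVal, ordNorm, ordAct, binPolar, binForm]
      rw [hn]
      linear_combination (-(N₁ * X * Y)) * hb + c * Y ^ 2 * hN'
    -- The error term must be divisible by N₁ as well as by Δ, so that N₁ can be kept as the factor
    -- e of the descent.
    obtain ⟨j, hj⟩ : (N₁ : ℤ) ∣ binForm (N : ℤ) r k (ordAct (N : ℤ) r k (ordConj r (N₁ * X, 0)) v.2 -
        ordAct (N : ℤ) r k (ordConj r v.1) (Y, 0)) := by
      have hN' : (N : ℤ) = N₁ * N₂ := by rw [← hN]; push_cast; rfl
      simp only [ordAct, ordConj, binForm, Prod.fst_sub, Prod.snd_sub]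
      rw [hN']
      refine ⟨N₂ * (N₁ * X * v.2.1 - (v.1.1 + r * v.1.2) * Y) ^ 2 +
        r * (N₁ * X * v.2.1 - (v.1.1 + r * v.1.2) * Y) * (X * v.2.2 + v.1.2 * N₂ * Y) +
        k * N₁ * (X * v.2.2 + v.1.2 * N₂ * Y) ^ 2, ?_⟩
      ring
    rw [h1, hj, show hermDet (N : ℤ) r k ((a, c), (t, i)) = Δ * m from hm] at hmul
    set H := hermVal (N : ℤ) r k ((a, c), (t, i)) v
    set g := hermPol (N : ℤ) r k ((a, c), (t, i)) ((N₁ * X, 0), (Y, 0)) v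
    have hu : ((H : ZMod Δ.natAbs)) * (n : ZMod Δ.natAbs) =
        ((H * n - Δ * (m * j) : ℤ) : ZMod Δ.natAbs) := by
      rw [← Int.cast_mul, ← sub_eq_zero, ← Int.cast_sub, intCast_zmod_natAbs_eq_zero]
      exact ⟨m * j, by ring⟩
    have hcop' : IsCoprime (H * n - Δ * (m * j)) Δ := by
      have := (hv.mul_left hcop).add_mul_left_left (-(m * j))
      rwa [show H * n + Δ * (-(m * j)) = H * n - Δ * (m * j) by ring] at this
    rw [hu]
    refine char_eq_one_of_norm hΔ χ hχ hcop' hN₁ (A := 2 * g.1 + r * g.2) (B := g.2) ?_ ?_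
    · intro l hl hlN
      exact char_prime_ne_neg_one hΔ χ hχ h hl (hlN.trans ⟨N₂, hN.symm⟩)
    · simp only [ordNorm] at hmul
      linear_combination 4 * hmul + g.2 ^ 2 * h
  · rw [genusCharForm, if_neg (fun h => hg h.2.2)]
    by_contra hne
    obtain ⟨-, v', hv'⟩ := hermChar_ne_zero hne
    obtain ⟨s, hs⟩ := redPair_surjective _ v'.1
    obtain ⟨w, hw⟩ := redPair_surjective _ v'.2
    have h1 := hvalred (s, w)
    rw [← hs, ← hw] at h1
    rw [show v' = (v'.1, v'.2) from rfl, h1, isUnit_intCast_zmod_natAbs] at hv'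
    obtain ⟨p, hp, hpd⟩ := Nat.exists_prime_and_dvd hg
    have hpd' : (p : ℤ) ∣ (Int.gcd (Int.gcd a b) (Int.gcd c Δ) : ℤ) :=
      Int.natCast_dvd_natCast.mpr hpd
    have hpa : (p : ℤ) ∣ a := (hpd'.trans (Int.gcd_dvd_left ..)).trans (Int.gcd_dvd_left ..)
    have hpc : (p : ℤ) ∣ c := (hpd'.trans (Int.gcd_dvd_right ..)).trans (Int.gcd_dvd_left ..)
    have hpΔ : (p : ℤ) ∣ Δ := (hpd'.trans (Int.gcd_dvd_right ..)).trans (Int.gcd_dvd_right ..)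
    refine (Nat.prime_iff_prime_int.mp hp).not_isUnit (hv'.isUnit_of_dvd' ?_ hpΔ)
    exact dvd_add (dvd_add (dvd_mul_of_dvd_left hpa _) (binPolar_dvd h hx _ hp hpΔ hpa))
      (dvd_mul_of_dvd_left hpc _)

/-! ### The twisting coefficients in coordinates -/

theorem zsmul_dualElt (N : ℕ) (n a b c : ℤ) : n • dualElt N a b c =
    dualElt N (n * a) (n * b) (n * c) := by
  apply Subtype.ext
  simp only [dualElt, AddSubgroup.coe_zsmul]
  rw [← Int.cast_smul_eq_zsmul ℝ]
  ext i j; fin_cases i <;> fin_cases j <;> simp [dualVec] <;> ring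

/-- The projection condition is b = ri + 2Nt, and given it the condition on Q_Δ says exactly that
the determinant vanishes modulo Δ. A chosen representative of the coset may replace (a, b, c) by
`twistWeight_congr`. -/
theorem twistMap_eq_twistWeight (hΔ : IsFundamentalDiscriminant Δ)
    (hχ : ∀ n, IsCoprime n Δ → χ (n : ZMod Δ.natAbs) = kroneckerSymbol Δ n)
    (h : Δ = r ^ 2 - 4 * N * k) {η : BaseGroup N} {a₀ i c₀ : ℤ}
    (hη : discRep η = dualElt N a₀ i c₀) (a b c : ℤ) :
    twistMap N Δ r η (QuotientAddGroup.mk (dualElt N a b c)) =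
      (twistWeight N r k χ i a b c : ℂ) := by
  set δ : DiscGroup N Δ := QuotientAddGroup.mk (dualElt N a b c) with hδ
  obtain ⟨a₁, b₁, c₁, h1⟩ := dualElt_surj N (discRep δ)
  have h2 : (QuotientAddGroup.mk (dualElt N a₁ b₁ c₁) : DiscGroup N Δ) = δ := by
    rw [← h1]; exact mk_discRep δ
  obtain ⟨ha, hb, hc⟩ := discGroup_mk_eq.mp h2
  rw [twistWeight_congr ha hb hc, twistMap]
  have hNR : (N : ℝ) ≠ 0 := by exact_mod_cast NeZero.ne N
  have hΔR : (Δ : ℝ) ≠ 0 := by exact_mod_cast hΔ.ne_zero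
  have hproj : discProj N Δ δ = r • η ↔ ∃ t, b₁ = r * i + (2 * N : ℕ) * t := by
    have e1 : discProj N Δ δ = QuotientAddGroup.mk (dualElt N a₁ b₁ c₁) := by rw [← h2]; rfl
    have e2 : r • η = QuotientAddGroup.mk (dualElt N (r * a₀) (r * i) (r * c₀)) := by
      rw [← zsmul_dualElt, ← hη]
      conv_lhs => rw [← mk_discRep η]
      rfl
    rw [e1, e2, discGroup_mk_eq]
    simp only [one_dvd, true_and, and_true, mul_one]
    constructor
    · rintro ⟨t, ht⟩
      exact ⟨-t, by push_cast; linear_combination -ht⟩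
    · rintro ⟨t, ht⟩
      exact ⟨-t, by push_cast at ht; linear_combination -ht⟩
  by_cases hp : ∃ t, b₁ = r * i + (2 * N : ℕ) * t
  · obtain ⟨t, ht⟩ := hp
    rw [twistWeight_eq ht]
    have hquad : (∃ m : ℤ, quadFormScaled N Δ (discRep δ) - Δ.sign * quadForm N (discRep η) = m) ↔
        Δ ∣ a₁ * c₁ - binForm (N : ℤ) r k (t, i) := by
      have e1 : quadFormScaled N Δ (discRep δ) - Δ.sign * quadForm N (discRep η) =
          (Δ.sign : ℝ) * ((a₁ * c₁ - binForm (N : ℤ) r k (t, i) : ℤ) / Δ - a₀ * c₀) := by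
        rw [h1, hη]
        change quadForm N (dualVec N a₁ b₁ c₁) / _ - _ * quadForm N (dualVec N a₀ i c₀) = _
        rw [quadForm_dualVec, quadForm_dualVec]
        have e2 : (|Δ| : ℝ) = Δ.sign * Δ := by exact_mod_cast (Int.sign_mul_self_eq_abs Δ).symm
        have e3 : (Δ.sign : ℝ) * Δ.sign = 1 := by
          rcases lt_or_gt_of_ne hΔ.ne_zero with h | h
          · rw [Int.sign_eq_neg_one_of_neg h]; norm_num
          · rw [Int.sign_eq_one_of_pos h]; norm_num
        have e4 : (Δ.sign : ℝ) ≠ 0 := left_ne_zero_of_mul_eq_one e3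
        have e5 : (b₁ : ℝ) = r * i + 2 * N * t := by rw [ht]; push_cast; ring
        have e6 : (Δ : ℝ) = r ^ 2 - 4 * N * k := by exact_mod_cast congrArg (Int.cast : ℤ → ℝ) h
        rw [e2, e5]
        have e7 : ((a₁ : ℝ) * c₁ - (r * i + 2 * N * t) ^ 2 / (4 * N)) / (Δ.sign * Δ) =
            Δ.sign * (((a₁ : ℝ) * c₁ - (r * i + 2 * N * t) ^ 2 / (4 * N)) / Δ) := by
          rw [div_eq_iff (mul_ne_zero e4 hΔR), mul_mul_mul_comm, e3, one_mul,
            div_mul_cancel₀ _ hΔR]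
        rw [e7, mul_assoc, ← mul_sub]
        congr 1
        simp only [binForm]
        push_cast
        field_simp
        linear_combination (i : ℝ) ^ 2 * e6
      have hsign : ∀ x : ℝ, (∃ m : ℤ, (Δ.sign : ℝ) * x = m) ↔ ∃ m : ℤ, x = m := by
        intro x
        rcases lt_or_gt_of_ne hΔ.ne_zero with h | h
        · rw [Int.sign_eq_neg_one_of_neg h]
          constructor
          · rintro ⟨m, hm⟩; exact ⟨-m, by push_cast at hm ⊢; linarith⟩
          · rintro ⟨m, hm⟩; exact ⟨-m, by push_cast at hm ⊢; linarith⟩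
        · rw [Int.sign_eq_one_of_pos h]
          constructor
          · rintro ⟨m, hm⟩; exact ⟨m, by push_cast at hm ⊢; linarith⟩
          · rintro ⟨m, hm⟩; exact ⟨m, by push_cast at hm ⊢; linarith⟩
      rw [e1, hsign]
      constructor
      · rintro ⟨m, hm⟩
        refine ⟨m + a₀ * c₀, ?_⟩
        have : ((a₁ * c₁ - binForm (N : ℤ) r k (t, i) : ℤ) : ℝ) = Δ * (m + a₀ * c₀) := by
          rw [← hm]; field_simp; ring
        exact_mod_cast this
      · rintro ⟨m, hm⟩
        refine ⟨m - a₀ * c₀, ?_⟩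
        rw [hm]; push_cast; field_simp
    by_cases hq : Δ ∣ a₁ * c₁ - binForm (N : ℤ) r k (t, i)
    · rw [if_pos ⟨hproj.mpr ⟨t, ht⟩, hquad.mpr hq⟩, h1,
        hermChar_eq_genusCharForm hΔ hχ h (b := b₁) (by rw [ht]; push_cast; ring) hq]
      congr 1
      exact genusChar_dualVec N Δ a₁ b₁ c₁
    · rw [if_neg (fun hh => hq (hquad.mp hh.2))]
      symm
      rw [Int.cast_eq_zero]
      by_contra hne
      have h3 := (hermChar_ne_zero hne).1
      have h4 := hermDet_redPair Δ.natAbs N r k ((a₁, c₁), (t, i))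
      rw [Int.cast_natCast] at h4
      exact hq (intCast_zmod_natAbs_eq_zero.mp (h4.symm.trans h3))
  · rw [if_neg (fun hh => hp (hproj.mp hh.1))]
    symm
    rw [Int.cast_eq_zero]
    by_contra hne
    exact hp (twistWeight_ne_zero hne)

end

/-! ### Series of exponentials of linear forms -/

section ExpSeries

variable {ι V : Type} [NormedAddCommGroup V] [NormedSpace ℂ V] {ℓ : ι → V →L[ℂ] ℂ} {q : ι → ℝ}

/-- The points at which the real parts of the linear forms `ℓ n` tend to `-∞` at least as fast
as a multiple of `-q n`. -/
def expDomain (ℓ : ι → V →L[ℂ] ℂ) (q : ι → ℝ) : Set V :=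
  {C | ∃ ε > 0, ∃ B : ℝ, ∀ n, (ℓ n C).re ≤ B - ε * q n}

/-- Half of the exponential decay absorbs the polynomial growth of the coefficients. -/
theorem norm_exp_smul_le {F : Type} [NormedAddCommGroup F] [NormedSpace ℂ F] {m : ι → F}
    {A ε B : ℝ} {p : ℕ} (hq : ∀ n, 1 ≤ q n) (hm : ∀ n, ‖m n‖ ≤ A * q n ^ p) (hε : 0 < ε) {C : V}
    (hC : ∀ n, (ℓ n C).re ≤ B - ε * q n) (n : ι) :
    ‖cexp (ℓ n C) • m n‖ ≤
      Real.exp B * (A * (p.factorial / (ε / 2) ^ p)) * Real.exp (-(ε / 2) * q n) := by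
  have hq0 : 0 ≤ q n := zero_le_one.trans (hq n)
  have hA : 0 ≤ A := by
    have h1 := (norm_nonneg _).trans (hm n)
    exact nonneg_of_mul_nonneg_left h1 (pow_pos (zero_lt_one.trans_le (hq n)) p)
  have h1 : q n ^ p ≤ p.factorial / (ε / 2) ^ p * Real.exp (ε / 2 * q n) := by
    have := Real.pow_div_factorial_le_exp (ε / 2 * q n) (by positivity) p
    rw [div_le_iff₀ (by positivity), mul_pow] at this
    rw [div_mul_eq_mul_div, le_div_iff₀ (by positivity)]
    linarith
  rw [norm_smul, Complex.norm_exp]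
  have h2 : Real.exp (ℓ n C).re ≤ Real.exp B * Real.exp (-ε * q n) := by
    rw [← Real.exp_add]
    exact Real.exp_le_exp.mpr (by linarith [hC n])
  calc Real.exp (ℓ n C).re * ‖m n‖
      ≤ (Real.exp B * Real.exp (-ε * q n)) *
        (A * (p.factorial / (ε / 2) ^ p * Real.exp (ε / 2 * q n))) :=
        mul_le_mul h2 ((hm n).trans (mul_le_mul_of_nonneg_left h1 hA)) (norm_nonneg _)
          (by positivity)
    _ = Real.exp B * (A * (p.factorial / (ε / 2) ^ p)) *
        (Real.exp (-ε * q n) * Real.exp (ε / 2 * q n)) := by ring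
    _ = _ := by rw [← Real.exp_add]; congr 2; ring

theorem summable_exp_smul (hq : ∀ n, 1 ≤ q n)
    (hsum : ∀ ε > 0, Summable fun n => Real.exp (-ε * q n))
    {F : Type} [NormedAddCommGroup F] [NormedSpace ℂ F] {m : ι → F}
    {A : ℝ} {p : ℕ} (hm : ∀ n, ‖m n‖ ≤ A * q n ^ p) {C : V} (hC : C ∈ expDomain ℓ q) :
    Summable fun n => ‖cexp (ℓ n C) • m n‖ := by
  obtain ⟨ε, hε, B, hB⟩ := hC
  exact Summable.of_nonneg_of_le (fun _ => norm_nonneg _)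
    (norm_exp_smul_le hq hm hε hB) ((hsum _ (half_pos hε)).mul_left _)

/-- The radius is chosen so that moving C inside the ball costs at most half of the decay rate,
uniformly in n. This gives openness and the locally uniform majorant for differentiation. -/
theorem expDomain_ball {K : ℝ} (hq : ∀ n, 1 ≤ q n) (hK : 0 < K) (hℓ : ∀ n, ‖ℓ n‖ ≤ K * q n)
    {C : V} {ε B : ℝ} (hε : 0 < ε) (hB : ∀ n, (ℓ n C).re ≤ B - ε * q n) {C' : V}
    (hC' : C' ∈ Metric.ball C (ε / (2 * K))) (n : ι) :
    (ℓ n C').re ≤ B - ε / 2 * q n := by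
  have hq0 : 0 ≤ q n := zero_le_one.trans (hq n)
  have h1 : (ℓ n C').re ≤ (ℓ n C).re + ‖ℓ n (C' - C)‖ := by
    have := Complex.re_le_norm (ℓ n (C' - C))
    rw [map_sub, Complex.sub_re] at this
    rw [map_sub]
    linarith
  have h2 : ‖ℓ n (C' - C)‖ ≤ K * q n * (ε / (2 * K)) := by
    refine ((ℓ n).le_opNorm _).trans (mul_le_mul (hℓ n) ?_ (norm_nonneg _) (by positivity))
    rw [← dist_eq_norm]
    exact (Metric.mem_ball.mp hC').le
  have h3 : K * q n * (ε / (2 * K)) = ε / 2 * q n := by field_simp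
  linarith [hB n]

theorem isOpen_expDomain {K : ℝ} (hq : ∀ n, 1 ≤ q n) (hK : 0 < K) (hℓ : ∀ n, ‖ℓ n‖ ≤ K * q n) :
    IsOpen (expDomain ℓ q) := by
  rw [Metric.isOpen_iff]
  rintro C ⟨ε, hε, B, hB⟩
  exact ⟨ε / (2 * K), by positivity, fun C' hC' =>
    ⟨ε / 2, half_pos hε, B, expDomain_ball hq hK hℓ hε hB hC'⟩⟩

theorem norm_smulRight_le {F : Type} [NormedAddCommGroup F] [NormedSpace ℂ F] {m : ι → F}
    {A K : ℝ} {p : ℕ} (hq : ∀ n, 1 ≤ q n) (hK : 0 < K) (hℓ : ∀ n, ‖ℓ n‖ ≤ K * q n)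
    (hm : ∀ n, ‖m n‖ ≤ A * q n ^ p) (n : ι) :
    ‖(ℓ n).smulRight (m n)‖ ≤ (K * A) * q n ^ (p + 1) := by
  have hq0 : 0 ≤ q n := zero_le_one.trans (hq n)
  rw [ContinuousLinearMap.norm_smulRight_apply]
  calc ‖ℓ n‖ * ‖m n‖ ≤ (K * q n) * (A * q n ^ p) :=
        mul_le_mul (hℓ n) (hm n) (norm_nonneg _) (by positivity)
    _ = _ := by ring

theorem hasFDerivAt_expSeries (hq : ∀ n, 1 ≤ q n)
    (hsum : ∀ ε > 0, Summable fun n => Real.exp (-ε * q n))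
    {F : Type} [NormedAddCommGroup F] [NormedSpace ℂ F]
    [CompleteSpace F] {m : ι → F} {A K : ℝ} {p : ℕ} (hK : 0 < K) (hℓ : ∀ n, ‖ℓ n‖ ≤ K * q n)
    (hm : ∀ n, ‖m n‖ ≤ A * q n ^ p) {C : V} (hC : C ∈ expDomain ℓ q) :
    HasFDerivAt (fun C => ∑' n, cexp (ℓ n C) • m n)
      (∑' n, cexp (ℓ n C) • (ℓ n).smulRight (m n)) C := by
  obtain ⟨ε, hε, B, hB⟩ := hC
  have hC0 : C ∈ Metric.ball C (ε / (2 * K)) := Metric.mem_ball_self (by positivity)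
  have hm' := norm_smulRight_le hq hK hℓ hm
  refine hasFDerivAt_tsum_of_isPreconnected
    ((hsum (ε / 2 / 2) (by positivity)).mul_left _) Metric.isOpen_ball
    (convex_ball C _).isPreconnected ?_
    (fun n x hx => norm_exp_smul_le hq hm' (half_pos hε) (expDomain_ball hq hK hℓ hε hB hx) n)
    hC0 (summable_exp_smul hq hsum hm ⟨ε, hε, B, hB⟩).of_norm hC0
  intro n x _
  have h1 : HasFDerivAt (fun x => cexp (ℓ n x)) (cexp (ℓ n x) • ℓ n) x :=
    (ℓ n).hasFDerivAt.cexp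
  have h2 := h1.smul_const (m n)
  convert h2 using 1
  ext y
  simp [smul_smul]

/-- The derivative is a series of the same type, with coefficients `(ℓ n).smulRight (m n)` in
another space and one more power of q. Hence the induction must run over all target spaces and all
growth exponents. -/
theorem contDiffOn_expSeries_nat (hq : ∀ n, 1 ≤ q n)
    (hsum : ∀ ε > 0, Summable fun n => Real.exp (-ε * q n))
    {K : ℝ} (hK : 0 < K) (hℓ : ∀ n, ‖ℓ n‖ ≤ K * q n) (d : ℕ) :
    ∀ {F : Type} [NormedAddCommGroup F] [NormedSpace ℂ F] [CompleteSpace F] {m : ι → F}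
      {A : ℝ} {p : ℕ} (_ : ∀ n, ‖m n‖ ≤ A * q n ^ p),
    ContDiffOn ℂ d (fun C => ∑' n, cexp (ℓ n C) • m n) (expDomain ℓ q) := by
  induction d with
  | zero =>
    intro F _ _ _ m A p hm
    rw [Nat.cast_zero, contDiffOn_zero]
    exact fun C hC => (hasFDerivAt_expSeries hq hsum hK hℓ hm hC).continuousAt.continuousWithinAt
  | succ d ih =>
    intro F _ _ _ m A p hm
    rw [Nat.cast_succ, contDiffOn_succ_iff_fderiv_of_isOpen (isOpen_expDomain hq hK hℓ)]
    refine ⟨fun C hC => (hasFDerivAt_expSeries hq hsum hK hℓ hm hC).differentiableAt.differentiableWithinAt,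
      fun h => absurd h (by simp), ?_⟩
    refine (ih (norm_smulRight_le hq hK hℓ hm)).congr fun C hC => ?_
    exact (hasFDerivAt_expSeries hq hsum hK hℓ hm hC).fderiv

theorem contDiffOn_expSeries (hq : ∀ n, 1 ≤ q n)
    (hsum : ∀ ε > 0, Summable fun n => Real.exp (-ε * q n))
    {K : ℝ} (hK : 0 < K) (hℓ : ∀ n, ‖ℓ n‖ ≤ K * q n)
    {F : Type} [NormedAddCommGroup F] [NormedSpace ℂ F] [CompleteSpace F] {m : ι → F}
    {A : ℝ} {p : ℕ} (hm : ∀ n, ‖m n‖ ≤ A * q n ^ p) :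
    ContDiffOn ℂ ∞ (fun C => ∑' n, cexp (ℓ n C) • m n) (expDomain ℓ q) :=
  contDiffOn_infty.mpr fun d => contDiffOn_expSeries_nat hq hsum hK hℓ d hm

end ExpSeries

/-! ### Quadratic exponents -/

section Monomials

variable {ι : Type} {d : ℕ} (mono : ι → Fin d → ℝ)

/-- The linear form `C ↦ ∑ C_i x_i` attached to a vector of monomials. -/
noncomputable def monoForm (n : ι) : (Fin d → ℂ) →L[ℂ] ℂ :=
  ∑ i, (mono n i : ℂ) • ContinuousLinearMap.proj i

theorem monoForm_apply (n : ι) (C : Fin d → ℂ) : monoForm mono n C = ∑ i, mono n i * C i := by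
  simp [monoForm]

theorem norm_monoForm_le {q : ι → ℝ} (hq : ∀ n, 1 ≤ q n) (h : ∀ n i, |mono n i| ≤ q n) (n : ι) :
    ‖monoForm mono n‖ ≤ (d + 1) * q n := by
  have h1 : ∀ i, ‖(mono n i : ℂ) • (ContinuousLinearMap.proj i : (Fin d → ℂ) →L[ℂ] ℂ)‖ ≤ q n := by
    intro i
    rw [norm_smul, Complex.norm_real, Real.norm_eq_abs]
    have h2 : ‖(ContinuousLinearMap.proj i : (Fin d → ℂ) →L[ℂ] ℂ)‖ ≤ 1 :=
      ContinuousLinearMap.opNorm_le_bound _ zero_le_one fun x => by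
        rw [one_mul]; exact norm_le_pi_norm x i
    calc |mono n i| * _ ≤ q n * 1 := mul_le_mul (h n i) h2 (norm_nonneg _)
          (zero_le_one.trans (hq n))
      _ = q n := mul_one _
  calc ‖monoForm mono n‖ ≤ ∑ _i : Fin d, q n := norm_sum_le_of_le _ fun i _ => h1 i
    _ = d * q n := by simp
    _ ≤ (d + 1) * q n := mul_le_mul_of_nonneg_right (by linarith) (zero_le_one.trans (hq n))

end Monomials

theorem summable_exp_neg_sq {ε : ℝ} (hε : 0 < ε) :
    Summable fun n : ℤ => Real.exp (-ε * (n : ℝ) ^ 2) := by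
  have h1 : Summable fun n : ℕ => Real.exp (-ε * (n : ℝ) ^ 2) := by
    refine Summable.of_nonneg_of_le (fun _ => (Real.exp_pos _).le) (fun n => ?_)
      (Real.summable_exp_nat_mul_iff.mpr (neg_lt_zero.mpr hε))
    apply Real.exp_le_exp.mpr
    have : (n : ℝ) ≤ (n : ℝ) ^ 2 := by exact_mod_cast Nat.le_self_pow two_ne_zero n
    nlinarith
  refine Summable.of_nat_of_neg (by simpa using h1) (by simpa using h1)

theorem summable_exp_neg_sq_one {ε : ℝ} (hε : 0 < ε) :
    Summable fun n : ℤ => Real.exp (-ε * (1 + (n : ℝ) ^ 2)) := by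
  refine ((summable_exp_neg_sq hε).mul_left (Real.exp (-ε))).congr fun n => ?_
  rw [← Real.exp_add]; congr 1; ring

theorem summable_exp_neg_sq_three {ε : ℝ} (hε : 0 < ε) :
    Summable fun n : ℤ × ℤ × ℤ =>
      Real.exp (-ε * (1 + (n.1 : ℝ) ^ 2 + (n.2.1 : ℝ) ^ 2 + (n.2.2 : ℝ) ^ 2)) := by
  have h := summable_exp_neg_sq hε
  have h3 := (summable_exp_neg_sq_one hε).mul_of_nonneg (h.mul_of_nonneg h
    (fun _ => (Real.exp_pos _).le) (fun _ => (Real.exp_pos _).le))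
    (fun _ => (Real.exp_pos _).le) (fun _ => by positivity)
  refine h3.congr fun n => ?_
  rw [← Real.exp_add, ← Real.exp_add]; congr 1; ring

/-! ### Poisson summation in one variable -/

theorem tsum_gaussian {σ : ℂ} (hσ : 0 < σ.re) (α ν : ℂ) :
    ∑' m : ℤ, cexp (-π * σ * (m + α) ^ 2 + 2 * π * I * ν * (m + α)) =
      1 / σ ^ (1 / 2 : ℂ) * ∑' n : ℤ, cexp (2 * π * I * n * α - π * (n - ν) ^ 2 / σ) := by
  have hσ0 : σ ≠ 0 := by rintro rfl; simp at hσ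
  have h := Complex.tsum_exp_neg_quadratic hσ (-σ * α + I * ν)
  have h1 : ∀ m : ℤ, cexp (-π * σ * (m + α) ^ 2 + 2 * π * I * ν * (m + α)) =
      cexp (-π * σ * α ^ 2 + 2 * π * I * ν * α) *
        cexp (-π * σ * m ^ 2 + 2 * π * (-σ * α + I * ν) * m) := by
    intro m; rw [← Complex.exp_add]; congr 1; ring
  have h2 : ∀ n : ℤ, cexp (2 * π * I * n * α - π * (n - ν) ^ 2 / σ) =
      cexp (-π * σ * α ^ 2 + 2 * π * I * ν * α) *
        cexp (-π / σ * (n + I * (-σ * α + I * ν)) ^ 2) := by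
    intro n; rw [← Complex.exp_add]; congr 1
    have : I * (-σ * α + I * ν) = -(I * σ * α) - ν := by linear_combination ν * I_mul_I
    rw [this]
    field_simp
    linear_combination (σ ^ 2 * α ^ 2) * I_sq
  simp only [h1, h2, tsum_mul_left]
  rw [h]; ring

/-- The monomials `n², n, 1`. -/
def quadMono (n : ℤ) : Fin 3 → ℝ := ![(n : ℝ) ^ 2, n, 1]

theorem abs_quadMono_le (n : ℤ) (i : Fin 3) : |quadMono n i| ≤ 1 + (n : ℝ) ^ 2 := by
  fin_cases i
  · simp [quadMono]
  · simp only [quadMono]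
    change |(n : ℝ)| ≤ _
    rw [abs_le]; constructor <;> nlinarith [sq_nonneg ((n : ℝ) - 1), sq_nonneg ((n : ℝ) + 1)]
  · simp only [quadMono]
    change |(1 : ℝ)| ≤ _
    rw [abs_one]; nlinarith [sq_nonneg (n : ℝ)]

theorem one_le_one_add_sq (n : ℤ) : (1 : ℝ) ≤ 1 + (n : ℝ) ^ 2 := by nlinarith [sq_nonneg (n : ℝ)]

theorem monoForm_quadMono (n : ℤ) (C : Fin 3 → ℂ) :
    monoForm quadMono n C = n ^ 2 * C 0 + n * C 1 + C 2 := by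
  rw [monoForm_apply, Fin.sum_univ_three]
  simp [quadMono]

theorem mem_expDomain_quadMono {C : Fin 3 → ℂ} (hC : (C 0).re < 0) :
    C ∈ expDomain (monoForm quadMono) (fun n : ℤ => 1 + (n : ℝ) ^ 2) := by
  set ε := -(C 0).re / 2 with hε
  have hε0 : 0 < ε := by rw [hε]; linarith
  refine ⟨ε, hε0, (C 1).re ^ 2 / (4 * ε) + (C 2).re + ε, fun n => ?_⟩
  have h1 : (monoForm quadMono n C).re = (n : ℝ) ^ 2 * (C 0).re + n * (C 1).re + (C 2).re := by
    rw [monoForm_quadMono]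
    have : ((n : ℂ) ^ 2 * C 0) = (((n : ℝ) ^ 2 : ℝ) : ℂ) * C 0 := by push_cast; rfl
    rw [Complex.add_re, Complex.add_re, this, Complex.re_ofReal_mul,
      show (n : ℂ) = ((n : ℝ) : ℂ) by push_cast; rfl, Complex.re_ofReal_mul]
  rw [h1]
  have h2 : (n : ℝ) * (C 1).re ≤ ε * n ^ 2 + (C 1).re ^ 2 / (4 * ε) := by
    rw [← sub_nonneg]
    have : ε * (n : ℝ) ^ 2 + (C 1).re ^ 2 / (4 * ε) - n * (C 1).re =
        ε * (n - (C 1).re / (2 * ε)) ^ 2 := by field_simp; ring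
    rw [this]; positivity
  have h3 : (C 0).re = -2 * ε := by rw [hε]; ring
  rw [h3]; linarith

theorem summable_quadMono {C : Fin 3 → ℂ} (hC : (C 0).re < 0) (D : Fin 3 → ℂ) :
    Summable fun n : ℤ => cexp (n ^ 2 * C 0 + n * C 1 + C 2) * (n ^ 2 * D 0 + n * D 1 + D 2) := by
  have h1 := summable_exp_smul (ℓ := monoForm quadMono) one_le_one_add_sq
    (fun ε hε => summable_exp_neg_sq_one hε) (m := fun n => monoForm quadMono n D)
    (A := (3 + 1) * ‖D‖) (p := 1) (fun n => ?_) (mem_expDomain_quadMono hC)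
  · refine h1.of_norm.congr fun n => ?_
    rw [monoForm_quadMono, monoForm_quadMono, smul_eq_mul]
  · refine ((monoForm quadMono n).le_opNorm D).trans ?_
    rw [pow_one]
    have := norm_monoForm_le quadMono one_le_one_add_sq abs_quadMono_le n
    calc _ ≤ ((3 : ℕ) + 1) * (1 + (n : ℝ) ^ 2) * ‖D‖ :=
          mul_le_mul_of_nonneg_right this (norm_nonneg _)
      _ = _ := by push_cast; ring

theorem hasDerivAt_quadMono {C : ℝ → Fin 3 → ℂ} {C' : Fin 3 → ℂ} {s : ℝ} (hC : (C s 0).re < 0)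
    (h : HasDerivAt C C' s) :
    HasDerivAt (fun s => ∑' n : ℤ, cexp (n ^ 2 * C s 0 + n * C s 1 + C s 2))
      (∑' n : ℤ, cexp (n ^ 2 * C s 0 + n * C s 1 + C s 2) *
        (n ^ 2 * C' 0 + n * C' 1 + C' 2)) s := by
  have hmem := mem_expDomain_quadMono hC
  have hbd := norm_monoForm_le quadMono one_le_one_add_sq abs_quadMono_le
  have hK : (0 : ℝ) < (3 : ℕ) + 1 := by norm_num
  have h1 := hasFDerivAt_expSeries (ℓ := monoForm quadMono) one_le_one_add_sq
    (fun ε hε => summable_exp_neg_sq_one hε) hK hbd (m := fun _ => (1 : ℂ)) (A := 1) (p := 0)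
    (fun n => by simp) hmem
  have h2 := (h1.restrictScalars ℝ).comp_hasDerivAt s h
  have h3 : Summable fun n : ℤ => cexp (monoForm quadMono n (C s)) •
      (monoForm quadMono n).smulRight (1 : ℂ) :=
    (summable_exp_smul (ℓ := monoForm quadMono) one_le_one_add_sq
      (fun ε hε => summable_exp_neg_sq_one hε)
      (norm_smulRight_le one_le_one_add_sq hK hbd (m := fun _ => (1 : ℂ)) (A := 1) (p := 0)
        (fun n => by simp)) hmem).of_norm
  have e1 : (fun s => ∑' n : ℤ, cexp (n ^ 2 * C s 0 + n * C s 1 + C s 2)) =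
      (fun C => ∑' n : ℤ, cexp (monoForm quadMono n C) • (1 : ℂ)) ∘ C := by
    funext s'
    simp [monoForm_quadMono]
  rw [e1]
  refine h2.congr_deriv ?_
  change (∑' n : ℤ, cexp (monoForm quadMono n (C s)) •
      (monoForm quadMono n).smulRight (1 : ℂ)) C' = _
  rw [← ContinuousLinearMap.apply_apply (𝕜 := ℂ) C' (∑' n : ℤ, _), ContinuousLinearMap.map_tsum _ h3]
  refine tsum_congr fun n => ?_
  simp [monoForm_quadMono]

/-- Differentiate Poisson's formula, multiplied by √σ, with respect to σ. The derivative of √σ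
exp(−πσx²) is −(π/√σ)(σx² − 1/2π) exp(−πσx²), which is precisely the Kudla–Millson polynomial; on
the dual side the exponent contributes π(n − ν)²/σ². -/
theorem tsum_sq_gaussian {σ : ℝ} (hσ : 0 < σ) (α ν : ℂ) :
    ∑' m : ℤ, (σ * (m + α) ^ 2 - 1 / (2 * π)) *
        cexp (-π * σ * (m + α) ^ 2 + 2 * π * I * ν * (m + α)) =
      -(1 / (σ * Real.sqrt σ : ℝ)) * ∑' n : ℤ, (n - ν) ^ 2 *
        cexp (2 * π * I * n * α - π * (n - ν) ^ 2 / σ) := by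
  set C : ℝ → Fin 3 → ℂ := fun s => ![-π * s, -2 * π * s * α + 2 * π * I * ν,
    -π * s * α ^ 2 + 2 * π * I * ν * α] with hCdef
  set D : ℝ → Fin 3 → ℂ := fun s => ![-π / s, 2 * π * I * α + 2 * π * ν / s, -π * ν ^ 2 / s] with hDdef
  have hf : ∀ (s : ℝ) (m : ℤ), cexp (-π * s * (m + α) ^ 2 + 2 * π * I * ν * (m + α)) =
      cexp (m ^ 2 * C s 0 + m * C s 1 + C s 2) := by
    intro s m; congr 1; simp [hCdef]; ring
  have hg : ∀ (s : ℝ) (m : ℤ), cexp (2 * π * I * m * α - π * (m - ν) ^ 2 / s) =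
      cexp (m ^ 2 * D s 0 + m * D s 1 + D s 2) := by
    intro s m; congr 1; simp [hDdef]; ring
  have hC0 : (C σ 0).re < 0 := by
    simp only [hCdef, Matrix.cons_val_zero]
    rw [show (-π * σ : ℂ) = ((-π * σ : ℝ) : ℂ) by push_cast; rfl, Complex.ofReal_re]
    nlinarith [mul_pos Real.pi_pos hσ]
  have hD0 : (D σ 0).re < 0 := by
    simp only [hDdef, Matrix.cons_val_zero]
    rw [show (-π / σ : ℂ) = ((-π / σ : ℝ) : ℂ) by push_cast; rfl, Complex.ofReal_re]
    exact div_neg_of_neg_of_pos (neg_lt_zero.mpr Real.pi_pos) hσ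
  have hσC : (σ : ℂ) ≠ 0 := by exact_mod_cast hσ.ne'
  have hid : HasDerivAt (fun s : ℝ => (s : ℂ)) 1 σ := Complex.ofRealCLM.hasDerivAt
  have hinv : HasDerivAt (fun s : ℝ => (s : ℂ)⁻¹) (-((σ : ℂ) ^ 2)⁻¹) σ := by
    exact (hid.fun_inv hσC).congr_deriv (by ring)
  set C' : Fin 3 → ℂ := ![-π, -2 * π * α, -π * α ^ 2]
  set D' : Fin 3 → ℂ := ![π / (σ : ℂ) ^ 2, -2 * π * ν / (σ : ℂ) ^ 2, π * ν ^ 2 / (σ : ℂ) ^ 2]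
  have hdC : HasDerivAt C C' σ := by
    rw [hasDerivAt_pi]
    intro i
    fin_cases i
    · have := hid.const_mul (-π : ℂ)
      simpa [hCdef, C'] using this
    · have := ((hid.const_mul (-2 * π : ℂ)).mul_const α).add_const (2 * π * I * ν)
      simpa [hCdef, C'] using this
    · have := ((hid.const_mul (-π : ℂ)).mul_const (α ^ 2)).add_const (2 * π * I * ν * α)
      simpa [hCdef, C'] using this
  have hdD : HasDerivAt D D' σ := by
    rw [hasDerivAt_pi]
    intro i
    fin_cases i
    · have := hinv.const_mul (-π : ℂ)
      refine HasDerivAt.congr_deriv (f' := -π * (-((σ : ℂ) ^ 2)⁻¹)) ?_ ?_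
      · simpa [hDdef, div_eq_mul_inv] using this
      · change _ = (π / (σ : ℂ) ^ 2 : ℂ); ring
    · have := (hinv.const_mul (2 * π * ν : ℂ)).const_add (2 * π * I * α)
      refine HasDerivAt.congr_deriv (f' := 2 * π * ν * (-((σ : ℂ) ^ 2)⁻¹)) ?_ ?_
      · simpa [hDdef, div_eq_mul_inv] using this
      · change _ = (-2 * π * ν / (σ : ℂ) ^ 2 : ℂ); ring
    · have := hinv.const_mul (-π * ν ^ 2 : ℂ)
      refine HasDerivAt.congr_deriv (f' := -π * ν ^ 2 * (-((σ : ℂ) ^ 2)⁻¹)) ?_ ?_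
      · simpa [hDdef, div_eq_mul_inv] using this
      · change _ = (π * ν ^ 2 / (σ : ℂ) ^ 2 : ℂ); ring
  have hF := hasDerivAt_quadMono hC0 hdC
  have hG := hasDerivAt_quadMono hD0 hdD
  have hsq : HasDerivAt (fun s : ℝ => ((Real.sqrt s : ℝ) : ℂ)) ((1 / (2 * Real.sqrt σ) : ℝ) : ℂ) σ :=
    (Real.hasDerivAt_sqrt hσ.ne').ofReal_comp
  have hprod := hsq.mul hF
  have heq : (fun s : ℝ => ((Real.sqrt s : ℝ) : ℂ) * ∑' n : ℤ, cexp (n ^ 2 * C s 0 + n * C s 1 + C s 2)) =ᶠ[nhds σ]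
      fun s => ∑' n : ℤ, cexp (n ^ 2 * D s 0 + n * D s 1 + D s 2) := by
    filter_upwards [lt_mem_nhds hσ] with s hs
    have h1 := tsum_gaussian (σ := s) (by simpa using hs) α ν
    simp only [hf, hg] at h1
    have h2 : (s : ℂ) ^ (1 / 2 : ℂ) = (Real.sqrt s : ℝ) := by
      rw [Real.sqrt_eq_rpow, Complex.ofReal_cpow hs.le]; push_cast; rfl
    have h3 : ((Real.sqrt s : ℝ) : ℂ) ≠ 0 := by exact_mod_cast (Real.sqrt_pos.mpr hs).ne'
    rw [h1, h2, ← mul_assoc, mul_one_div_cancel h3, one_mul]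
  have huniq := (hprod.congr_of_eventuallyEq heq.symm).unique hG
  have hS := summable_quadMono hC0 ![0, 0, 1]
  have hS' := summable_quadMono hC0 C'
  have hs0 : ((Real.sqrt σ : ℝ) : ℂ) ≠ 0 := by exact_mod_cast (Real.sqrt_pos.mpr hσ).ne'
  have hss : ((Real.sqrt σ : ℝ) : ℂ) * (Real.sqrt σ : ℝ) = σ := by
    rw [← Complex.ofReal_mul, Real.mul_self_sqrt hσ.le]
  have hπ : (π : ℂ) ≠ 0 := by exact_mod_cast Real.pi_ne_zero
  have hL : ∑' m : ℤ, (σ * (m + α) ^ 2 - 1 / (2 * π)) *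
      cexp (-π * σ * (m + α) ^ 2 + 2 * π * I * ν * (m + α)) =
      (-σ / π) * (∑' n : ℤ, cexp (n ^ 2 * C σ 0 + n * C σ 1 + C σ 2) *
        (n ^ 2 * C' 0 + n * C' 1 + C' 2)) -
      1 / (2 * π) * ∑' n : ℤ, cexp (n ^ 2 * C σ 0 + n * C σ 1 + C σ 2) := by
    have hS1 : Summable fun n : ℤ => cexp (n ^ 2 * C σ 0 + n * C σ 1 + C σ 2) := by
      simpa using hS
    rw [← tsum_mul_left, ← tsum_mul_left, ← (hS'.mul_left _).tsum_sub (hS1.mul_left _)]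
    refine tsum_congr fun m => ?_
    rw [hf]
    simp only [C', Matrix.cons_val_zero, Matrix.cons_val_one, Matrix.cons_val]
    field_simp
    ring
  have hR : ∑' n : ℤ, (n - ν) ^ 2 * cexp (2 * π * I * n * α - π * (n - ν) ^ 2 / σ) =
      ((σ : ℂ) ^ 2 / π) * ∑' n : ℤ, cexp (n ^ 2 * D σ 0 + n * D σ 1 + D σ 2) *
        (n ^ 2 * D' 0 + n * D' 1 + D' 2) := by
    rw [← tsum_mul_left]
    refine tsum_congr fun m => ?_
    rw [hg]
    simp only [D', Matrix.cons_val_zero, Matrix.cons_val_one, Matrix.cons_val]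
    field_simp
    ring
  rw [hL, hR, ← huniq]
  push_cast
  generalize (∑' n : ℤ, cexp (n ^ 2 * C σ 0 + n * C σ 1 + C σ 2) *
        (n ^ 2 * C' 0 + n * C' 1 + C' 2)) = X
  generalize (∑' n : ℤ, cexp (n ^ 2 * C σ 0 + n * C σ 1 + C σ 2)) = Y
  generalize ((Real.sqrt σ : ℝ) : ℂ) = ρ at *
  rw [← hss]
  field_simp
  ring

/-! ### Weighted sums -/

theorem tsum_int_residues {f : ℤ → ℂ} (hf : Summable f) (M : ℕ) [NeZero M] :
    ∑' a, f a = ∑ i ∈ Finset.range M, ∑' m : ℤ, f (i + M * m) := by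
  rw [← ((Int.divModEquiv M).trans (Equiv.prodComm ℤ (Fin M))).symm.tsum_eq, Finset.sum_range]
  have hs := (((Int.divModEquiv M).trans (Equiv.prodComm ℤ (Fin M))).symm.summable_iff).mpr hf
  refine hs.tsum_prod.trans ?_
  rw [tsum_fintype]
  refine Finset.sum_congr rfl fun i _ => tsum_congr fun m => ?_
  change f (m * M + i) = f (i + M * m)
  congr 1
  ring

/-- The sum is split into residue classes modulo M, Poisson's formula is applied on each, and the
classes are collected into the finite Fourier transform of w. -/
theorem tsum_periodic_mul {f g w : ℤ → ℂ} {M : ℕ} [NeZero M] {κ : ℂ}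
    (hf : Summable fun a => w a * f a) (hg : Summable g) (hw : ∀ a, w (a + M) = w a)
    (hfg : ∀ i : ℤ, ∑' m : ℤ, f (i + M * m) = κ * ∑' n : ℤ, zexp M (n * i) * g n) :
    ∑' a, w a * f a =
      κ * ∑' n : ℤ, (∑ i ∈ Finset.range M, w i * zexp M (n * i)) * g n := by
  have hsg : ∀ i : ℤ, Summable fun n : ℤ => zexp M (n * i) * g n := by
    intro i
    refine Summable.of_norm (hg.norm.congr fun n => ?_)
    rw [norm_mul, norm_zexp, one_mul]
  rw [tsum_int_residues hf M]
  have h1 : ∀ i : ℕ, ∑' m : ℤ, w (i + M * m) * f (i + M * m) =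
      κ * ∑' n : ℤ, w i * (zexp M (n * i) * g n) := by
    intro i
    rw [tsum_mul_left, mul_left_comm, ← hfg i, ← tsum_mul_left]
    refine tsum_congr fun m => ?_
    rw [periodic_eq_of_dvd hw (x := i + M * m) (y := i) ⟨m, by ring⟩]
  rw [Finset.sum_congr rfl fun i _ => h1 i, ← Finset.mul_sum]
  congr 1
  rw [← Summable.tsum_finsetSum (s := Finset.range M)
    (f := fun (i : ℕ) (n : ℤ) => w i * (zexp M (n * i) * g n)) fun i _ => (hsg i).mul_left _]
  refine tsum_congr fun n => ?_
  rw [Finset.sum_mul]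
  exact Finset.sum_congr rfl fun i _ => by ring

/-! ### Gaussian series in three variables -/

/-- The quadratic monomials in three variables. -/
def triMono (n : ℤ × ℤ × ℤ) : Fin 6 → ℝ :=
  ![(n.1 : ℝ) ^ 2, (n.2.1 : ℝ) ^ 2, (n.2.2 : ℝ) ^ 2, n.1 * n.2.1, n.1 * n.2.2, n.2.1 * n.2.2]

def triSize (n : ℤ × ℤ × ℤ) : ℝ := 1 + (n.1 : ℝ) ^ 2 + (n.2.1 : ℝ) ^ 2 + (n.2.2 : ℝ) ^ 2

theorem one_le_triSize (n : ℤ × ℤ × ℤ) : 1 ≤ triSize n := by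
  have := sq_nonneg (n.1 : ℝ)
  have := sq_nonneg (n.2.1 : ℝ)
  have := sq_nonneg (n.2.2 : ℝ)
  unfold triSize; linarith

theorem abs_triMono_le (n : ℤ × ℤ × ℤ) (i : Fin 6) : |triMono n i| ≤ triSize n := by
  have h1 := sq_nonneg (n.1 : ℝ)
  have h2 := sq_nonneg (n.2.1 : ℝ)
  have h3 := sq_nonneg (n.2.2 : ℝ)
  have key : ∀ x y : ℝ, |x * y| ≤ x ^ 2 + y ^ 2 := by
    intro x y
    rw [abs_le]; constructor <;> nlinarith [sq_nonneg (x + y), sq_nonneg (x - y)]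
  fin_cases i
  · change |(n.1 : ℝ) ^ 2| ≤ _
    rw [abs_of_nonneg h1]; unfold triSize; linarith
  · change |(n.2.1 : ℝ) ^ 2| ≤ _
    rw [abs_of_nonneg h2]; unfold triSize; linarith
  · change |(n.2.2 : ℝ) ^ 2| ≤ _
    rw [abs_of_nonneg h3]; unfold triSize; linarith
  · change |(n.1 : ℝ) * n.2.1| ≤ _
    unfold triSize; linarith [key n.1 n.2.1]
  · change |(n.1 : ℝ) * n.2.2| ≤ _
    unfold triSize; linarith [key n.1 n.2.2]
  · change |(n.2.1 : ℝ) * n.2.2| ≤ _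
    unfold triSize; linarith [key n.2.1 n.2.2]

theorem monoForm_triMono (n : ℤ × ℤ × ℤ) (C : Fin 6 → ℂ) : monoForm triMono n C =
    (n.1 : ℂ) ^ 2 * C 0 + (n.2.1 : ℂ) ^ 2 * C 1 + (n.2.2 : ℂ) ^ 2 * C 2 + n.1 * n.2.1 * C 3 +
      n.1 * n.2.2 * C 4 + n.2.1 * n.2.2 * C 5 := by
  rw [monoForm_apply, Fin.sum_univ_six]
  simp [triMono]

/-- The domain of coefficients with negative definite real part. -/
def triDomain : Set (Fin 6 → ℂ) := expDomain (monoForm triMono) triSize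

/-- A sum of three squares in triangular coordinates with positive weights dominates a²+b²+c², since
the unipotent change of variables is invertible. -/
theorem mem_triDomain {C : Fin 6 → ℂ} {p₁ p₂ p₃ s t u : ℝ} (h₁ : 0 < p₁) (h₂ : 0 < p₂)
    (h₃ : 0 < p₃) (h : ∀ n : ℤ × ℤ × ℤ, (monoForm triMono n C).re ≤
      -(p₁ * (n.1 + s * n.2.1 + t * n.2.2) ^ 2 + p₂ * (n.2.1 + u * n.2.2) ^ 2 +
        p₃ * (n.2.2 : ℝ) ^ 2)) : C ∈ triDomain := by
  set p := min p₁ (min p₂ p₃) with hp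
  have hp0 : 0 < p := lt_min h₁ (lt_min h₂ h₃)
  have hp1 : p ≤ p₁ := min_le_left _ _
  have hp2 : p ≤ p₂ := (min_le_right _ _).trans (min_le_left _ _)
  have hp3 : p ≤ p₃ := (min_le_right _ _).trans (min_le_right _ _)
  -- K bounds the inverse substitution a = X − sY + (su − t)c, b = Y − uc.
  set K := 6 + 3 * s ^ 2 + 3 * (s * u - t) ^ 2 + 2 * u ^ 2 with hK
  have hK0 : 0 < K := by positivity
  refine ⟨p / K, by positivity, p / K, fun n => (h n).trans ?_⟩
  set a : ℝ := (n.1 : ℝ) with ha_def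
  set b : ℝ := (n.2.1 : ℝ) with hb_def
  set c : ℝ := (n.2.2 : ℝ) with hc_def
  have ha : a ^ 2 ≤ 3 * ((a + s * b + t * c) ^ 2 + s ^ 2 * (b + u * c) ^ 2 + (s * u - t) ^ 2 * c ^ 2) := by
    have : a = (a + s * b + t * c) - s * (b + u * c) + (s * u - t) * c := by ring
    generalize a + s * b + t * c = X at *
    generalize b + u * c = Y at *
    rw [this]
    nlinarith [sq_nonneg (X + s * Y), sq_nonneg (X - (s * u - t) * c),
      sq_nonneg (s * Y + (s * u - t) * c)]
  have hb : b ^ 2 ≤ 2 * ((b + u * c) ^ 2 + u ^ 2 * c ^ 2) := by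
    nlinarith [sq_nonneg (b + u * c + u * c)]
  generalize a + s * b + t * c = X at *
  generalize b + u * c = Y at *
  have hS : a ^ 2 + b ^ 2 + c ^ 2 ≤ K * (X ^ 2 + Y ^ 2 + c ^ 2) := by
    rw [hK]
    have e1 := mul_nonneg (sq_nonneg s) (sq_nonneg X)
    have e2 := mul_nonneg (sq_nonneg (s * u - t)) (sq_nonneg X)
    have e3 := mul_nonneg (sq_nonneg u) (sq_nonneg X)
    have e4 := mul_nonneg (sq_nonneg (s * u - t)) (sq_nonneg Y)
    have e5 := mul_nonneg (sq_nonneg u) (sq_nonneg Y)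
    have e6 := mul_nonneg (sq_nonneg s) (sq_nonneg c)
    nlinarith [sq_nonneg X, sq_nonneg Y, sq_nonneg c]
  have h5 : p / K * (a ^ 2 + b ^ 2 + c ^ 2) ≤ p * (X ^ 2 + Y ^ 2 + c ^ 2) := by
    rw [div_mul_eq_mul_div, div_le_iff₀ hK0]
    calc p * (a ^ 2 + b ^ 2 + c ^ 2) ≤ p * (K * (X ^ 2 + Y ^ 2 + c ^ 2)) :=
          mul_le_mul_of_nonneg_left hS hp0.le
      _ = _ := by ring
  have h6 := mul_le_mul_of_nonneg_right hp1 (sq_nonneg X)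
  have h7 := mul_le_mul_of_nonneg_right hp2 (sq_nonneg Y)
  have h8 := mul_le_mul_of_nonneg_right hp3 (sq_nonneg c)
  have h9 : triSize n = 1 + a ^ 2 + b ^ 2 + c ^ 2 := rfl
  rw [h9]
  linarith

theorem norm_monoForm_triMono_le (n : ℤ × ℤ × ℤ) : ‖monoForm triMono n‖ ≤ 7 * triSize n := by
  have := norm_monoForm_le triMono one_le_triSize abs_triMono_le n
  norm_num at this
  exact this

theorem summable_exp_triSize (ε : ℝ) (hε : 0 < ε) :
    Summable fun n : ℤ × ℤ × ℤ => Real.exp (-ε * triSize n) :=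
  summable_exp_neg_sq_three hε

theorem summable_triMono {C : Fin 6 → ℂ} (hC : C ∈ triDomain) {m : ℤ × ℤ × ℤ → ℂ} {A : ℝ} {p : ℕ}
    (hm : ∀ n, ‖m n‖ ≤ A * triSize n ^ p) :
    Summable fun n => m n * cexp (monoForm triMono n C) := by
  refine (summable_exp_smul one_le_triSize summable_exp_triSize hm hC).of_norm.congr fun n => ?_
  rw [smul_eq_mul, mul_comm]

theorem contDiffOn_triMono {m : ℤ × ℤ × ℤ → ℂ} {A : ℝ} {p : ℕ}
    (hm : ∀ n, ‖m n‖ ≤ A * triSize n ^ p) :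
    ContDiffOn ℝ ∞ (fun C => ∑' n, m n * cexp (monoForm triMono n C)) triDomain := by
  refine (contDiffOn_expSeries one_le_triSize summable_exp_triSize (by norm_num : (0 : ℝ) < 7)
    norm_monoForm_triMono_le hm).restrict_scalars ℝ |>.congr fun C _ => ?_
  exact tsum_congr fun n => by rw [smul_eq_mul, mul_comm]

/-! ### The Kudla–Millson kernel in coordinates -/

/-- The linear form `√N y (λ, λ(z))`, up to sign. -/
noncomputable def kmLin (N : ℕ) (z : ℂ) (n : ℤ × ℤ × ℤ) : ℝ :=
  n.1 - n.2.1 * z.re + N * n.2.2 * Complex.normSq z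

/-- Normalized so that `kmScale` times `kmLin` squared is (√v λ, λ(z))² / |Δ|. -/
noncomputable def kmScale (N M : ℕ) (τ z : ℂ) : ℝ := τ.im / (M * N * z.im ^ 2)

/-- The conjugate of τ arises because e(Q_Δ(λ)τ) meets the factor exp(4πvQ_Δ(λ)) that the term −(λ,
λ) of R contributes. -/
noncomputable def kmKer (N M : ℕ) (τ z : ℂ) (n : ℤ × ℤ × ℤ) : ℂ :=
  (kmScale N M τ z * (kmLin N z n : ℂ) ^ 2 - 1 / (2 * π)) *
    cexp (-π * kmScale N M τ z * (kmLin N z n : ℂ) ^ 2 +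
      2 * π * I * conj τ * (n.1 * n.2.2 - (n.2.1 : ℂ) ^ 2 / (4 * N)) / M)

theorem phi_dualElt (N : ℕ) [NeZero N] {Δ : ℤ} (hΔ : Δ ≠ 0) (τ z : ℍ) (n : ℤ × ℤ × ℤ) :
    phi N Δ (dualElt N n.1 n.2.1 n.2.2 : dualLattice N) τ z = kmKer N Δ.natAbs τ z n := by
  have hN : (0 : ℝ) < N := by exact_mod_cast NeZero.pos N
  have hNC : (N : ℂ) ≠ 0 := by exact_mod_cast NeZero.ne N
  have hM0 : (0 : ℝ) < Δ.natAbs := by exact_mod_cast Int.natAbs_pos.mpr hΔ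
  have hM : |(Δ : ℝ)| = (Δ.natAbs : ℝ) := by rw [Nat.cast_natAbs]; push_cast; rfl
  have hsN : 0 < Real.sqrt N := Real.sqrt_pos.mpr hN
  have hy : 0 < z.im := z.im_pos
  have hv : 0 < τ.im := τ.im_pos
  change phi N Δ (dualVec N n.1 n.2.1 n.2.2) τ z = _
  have hb : bilForm N (Real.sqrt τ.im • dualVec N n.1 n.2.1 n.2.2) (lambdaOf N z) =
      -(Real.sqrt τ.im * kmLin N z n / (Real.sqrt N * z.im)) := by
    simp only [bilForm, dualVec, lambdaOf, Matrix.trace_fin_two, kmLin, Matrix.smul_mul,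
      Matrix.mul_smul]
    simp [Matrix.mul_apply, Fin.sum_univ_two]
    field_simp
    ring
  have hbb : bilForm N (Real.sqrt τ.im • dualVec N n.1 n.2.1 n.2.2)
      (Real.sqrt τ.im • dualVec N n.1 n.2.1 n.2.2) =
      τ.im * (2 * (n.1 * n.2.2 - (n.2.1 : ℝ) ^ 2 / (4 * N))) := by
    have h1 := bilForm_dualVec N n.1 n.2.1 n.2.2 n.1 n.2.1 n.2.2
    have h2 : bilForm N (Real.sqrt τ.im • dualVec N n.1 n.2.1 n.2.2)
      (Real.sqrt τ.im • dualVec N n.1 n.2.1 n.2.2) = (Real.sqrt τ.im * Real.sqrt τ.im) *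
        bilForm N (dualVec N n.1 n.2.1 n.2.2) (dualVec N n.1 n.2.1 n.2.2) := by
      simp only [bilForm, Matrix.smul_mul, Matrix.mul_smul, Matrix.trace_smul, smul_eq_mul]
      ring
    rw [h2, h1, Real.mul_self_sqrt hv.le]
    field_simp
    ring
  have hsq : (Real.sqrt τ.im * kmLin N z n / (Real.sqrt N * z.im)) ^ 2 / Δ.natAbs =
      kmScale N Δ.natAbs τ z * kmLin N z n ^ 2 := by
    rw [div_pow, mul_pow, mul_pow, Real.sq_sqrt hv.le, Real.sq_sqrt hN.le, kmScale]
    simp only [coe_im]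
    field_simp
  have e1 : phiZero N Δ (Real.sqrt τ.im • dualVec N n.1 n.2.1 n.2.2) z =
      (kmScale N Δ.natAbs τ z * kmLin N z n ^ 2 - 1 / (2 * π)) *
        Real.exp (-π * (kmScale N Δ.natAbs τ z * kmLin N z n ^ 2) +
          4 * π * τ.im * (n.1 * n.2.2 - (n.2.1 : ℝ) ^ 2 / (4 * N)) / Δ.natAbs) := by
    rw [phiZero, kmR, hb, hbb, hM, neg_sq, ← hsq]
    congr 2
    · ring
    · ring
  rw [phi, e1, kmKer, quadFormScaled, quadForm_dualVec, hM]
  push_cast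
  rw [mul_left_comm, ← Complex.exp_add]
  congr 2
  have hconj : conj (τ : ℂ) = τ - 2 * I * (τ.im : ℂ) := by
    have := Complex.sub_conj (τ : ℂ)
    rw [coe_im] at this
    push_cast at this
    linear_combination -this
  rw [hconj]
  have hMC : (Δ.natAbs : ℂ) ≠ 0 := by exact_mod_cast hM0.ne'
  push_cast
  linear_combination (4 * π * τ.im * (n.1 * n.2.2 - (n.2.1 : ℂ) ^ 2 / (4 * N)) / Δ.natAbs) * I_sq

/-- The coefficients of the quadratic form `kmLin²`. -/
noncomputable def kmSqCoef (N : ℕ) (z : ℂ) : Fin 6 → ℂ :=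
  ![1, (z.re : ℂ) ^ 2, ((N : ℂ) * (Complex.normSq z : ℝ)) ^ 2, -2 * z.re,
    2 * (N * (Complex.normSq z : ℝ)), -2 * z.re * (N * (Complex.normSq z : ℝ))]

theorem monoForm_kmSqCoef (N : ℕ) (z : ℂ) (n : ℤ × ℤ × ℤ) :
    monoForm triMono n (kmSqCoef N z) = (kmLin N z n : ℂ) ^ 2 := by
  rw [monoForm_triMono]
  simp [kmSqCoef, kmLin]
  ring

/-- The coefficients of the exponent of the Kudla–Millson kernel. -/
noncomputable def kmCoef (N M : ℕ) (τ z : ℂ) : Fin 6 → ℂ :=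
  (-π * kmScale N M τ z : ℂ) • kmSqCoef N z +
    (2 * π * I * conj τ / M : ℂ) • ![0, -(1 / (4 * N : ℂ)), 0, 0, 1, 0]

theorem kmKer_eq (N M : ℕ) (τ z : ℂ) (n : ℤ × ℤ × ℤ) : kmKer N M τ z n =
    (kmScale N M τ z * monoForm triMono n (kmSqCoef N z) - 1 / (2 * π)) *
      cexp (monoForm triMono n (kmCoef N M τ z)) := by
  rw [kmKer, kmCoef, map_add, map_smul, map_smul, monoForm_kmSqCoef]
  congr 2
  rw [monoForm_triMono]
  simp
  ring

theorem kmCoef_mem (N M : ℕ) [NeZero N] [NeZero M] {τ z : ℂ} (hτ : 0 < τ.im) (hz : 0 < z.im) :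
    kmCoef N M τ z ∈ triDomain := by
  have hN : (0 : ℝ) < N := by exact_mod_cast NeZero.pos N
  have hM : (0 : ℝ) < M := by exact_mod_cast NeZero.pos M
  -- With X = a − xb + Nx²c one has kmLin = X + Ny²c. Expanding its square, the cross term combines
  -- with −2v(ac − b²/4N) into a square of b − 2Nxc, and a multiple of c² is left.
  refine mem_triDomain (p₁ := π * τ.im / (M * N * z.im ^ 2)) (p₂ := π * τ.im / (2 * N * M))
    (p₃ := π * τ.im * N * z.im ^ 2 / M) (s := -z.re) (t := N * z.re ^ 2) (u := -2 * N * z.re)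
    (by have := Real.pi_pos; positivity) (by have := Real.pi_pos; positivity)
    (by have := Real.pi_pos; positivity) fun n => le_of_eq ?_
  have h1 : monoForm triMono n (kmCoef N M τ z) =
      ((-π * kmScale N M τ z * kmLin N z n ^ 2 : ℝ) : ℂ) +
      ((2 * π * (n.1 * n.2.2 - (n.2.1 : ℝ) ^ 2 / (4 * N)) / M : ℝ) : ℂ) * (I * conj τ) := by
    rw [kmCoef, map_add, map_smul, map_smul, monoForm_kmSqCoef, monoForm_triMono]
    simp
    ring
  rw [h1, Complex.add_re, Complex.ofReal_re, Complex.re_ofReal_mul]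
  have h2 : (I * conj τ).re = τ.im := by simp
  rw [h2, kmScale, kmLin, Complex.normSq_apply]
  field_simp
  ring

theorem norm_monoForm_apply_le (n : ℤ × ℤ × ℤ) (C : Fin 6 → ℂ) :
    ‖monoForm triMono n C‖ ≤ 7 * ‖C‖ * triSize n := by
  refine ((monoForm triMono n).le_opNorm C).trans ?_
  calc _ ≤ 7 * triSize n * ‖C‖ :=
        mul_le_mul_of_nonneg_right (norm_monoForm_triMono_le n) (norm_nonneg _)
    _ = _ := by ring

theorem summable_weight_kmKer (N M : ℕ) [NeZero N] [NeZero M] {τ z : ℂ} (hτ : 0 < τ.im)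
    (hz : 0 < z.im) {w : ℤ × ℤ × ℤ → ℂ} {A : ℝ} (hw : ∀ n, ‖w n‖ ≤ A) :
    Summable fun n => w n * kmKer N M τ z n := by
  have hA : 0 ≤ A := (norm_nonneg _).trans (hw 0)
  have h := summable_triMono (kmCoef_mem N M hτ hz)
    (m := fun n => w n * (kmScale N M τ z * monoForm triMono n (kmSqCoef N z) - 1 / (2 * π)))
    (A := A * (‖(kmScale N M τ z : ℂ)‖ * (7 * ‖kmSqCoef N z‖) + ‖(1 / (2 * π) : ℂ)‖)) (p := 1)
    (fun n => ?_)
  · refine h.congr fun n => ?_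
    rw [kmKer_eq]; ring
  · rw [norm_mul, pow_one, mul_assoc]
    refine mul_le_mul (hw n) ?_ (norm_nonneg _) hA
    refine (norm_sub_le _ _).trans ?_
    rw [norm_mul, add_mul]
    refine add_le_add ?_ (le_mul_of_one_le_right (norm_nonneg _) (one_le_triSize n))
    rw [mul_assoc]
    exact mul_le_mul_of_nonneg_left (norm_monoForm_apply_le n _) (norm_nonneg _)

/-- The polynomial factor is expanded in the monomials of n, with coefficients smooth in (τ, z)
taken out of the sum. What remains is a finite combination of exponential series composed with the
smooth map `kmCoef`. -/
theorem contDiffOn_kmSeries (N M : ℕ) [NeZero N] [NeZero M] {w : ℤ × ℤ × ℤ → ℂ} {A : ℝ}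
    (hw : ∀ n, ‖w n‖ ≤ A) :
    ContDiffOn ℝ ∞ (fun p : ℂ × ℂ => ∑' n, w n * kmKer N M p.1 p.2 n)
      {p : ℂ × ℂ | 0 < p.1.im ∧ 0 < p.2.im} := by
  have hA : 0 ≤ A := (norm_nonneg _).trans (hw 0)
  have hN : (N : ℝ) ≠ 0 := by exact_mod_cast NeZero.ne N
  have hM : (M : ℝ) ≠ 0 := by exact_mod_cast NeZero.ne M
  have hwi : ∀ i n, ‖w n * triMono n i‖ ≤ A * triSize n ^ 1 := by
    intro i n
    rw [norm_mul, pow_one, Complex.norm_real]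
    exact mul_le_mul (hw n) (abs_triMono_le n i) (norm_nonneg _) hA
  have hw0 : ∀ n, ‖w n‖ ≤ A * triSize n ^ 0 := fun n => by simpa using hw n
  set U := {p : ℂ × ℂ | 0 < p.1.im ∧ 0 < p.2.im} with hU
  have him1 : ContDiff ℝ ∞ fun p : ℂ × ℂ => p.1.im := Complex.imCLM.contDiff.comp contDiff_fst
  have him2 : ContDiff ℝ ∞ fun p : ℂ × ℂ => p.2.im := Complex.imCLM.contDiff.comp contDiff_snd
  have hre2 : ContDiff ℝ ∞ fun p : ℂ × ℂ => p.2.re := Complex.reCLM.contDiff.comp contDiff_snd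
  have hconj : ContDiff ℝ ∞ fun p : ℂ × ℂ => conj p.1 :=
    Complex.conjCLE.contDiff.comp contDiff_fst
  have hns : ContDiff ℝ ∞ fun p : ℂ × ℂ => Complex.normSq p.2 := by
    simp only [Complex.normSq_apply]
    exact (hre2.mul hre2).add (him2.mul him2)
  have hofr : ∀ {f : ℂ × ℂ → ℝ} {s : Set (ℂ × ℂ)}, ContDiffOn ℝ ∞ f s →
      ContDiffOn ℝ ∞ (fun p => (f p : ℂ)) s := fun hf => Complex.ofRealCLM.contDiff.comp_contDiffOn hf
  have hscale : ContDiffOn ℝ ∞ (fun p : ℂ × ℂ => (kmScale N M p.1 p.2 : ℂ)) U := by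
    refine hofr (him1.contDiffOn.div (contDiff_const.mul (him2.pow 2)).contDiffOn fun p hp => ?_)
    exact mul_ne_zero (mul_ne_zero hM hN) (pow_ne_zero 2 hp.2.ne')
  have hre2' : ContDiffOn ℝ ∞ (fun p : ℂ × ℂ => (p.2.re : ℂ)) U := hofr hre2.contDiffOn
  have hns' : ContDiffOn ℝ ∞ (fun p : ℂ × ℂ => (N : ℂ) * ((Complex.normSq p.2 : ℝ) : ℂ)) U :=
    contDiffOn_const.mul (hofr hns.contDiffOn)
  have hsq : ContDiffOn ℝ ∞ (fun p : ℂ × ℂ => kmSqCoef N p.2) U := by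
    rw [contDiffOn_pi]
    intro i
    fin_cases i
    · exact contDiffOn_const
    · exact hre2'.pow 2
    · exact hns'.pow 2
    · exact contDiffOn_const.mul hre2'
    · exact contDiffOn_const.mul hns'
    · exact (contDiffOn_const.mul hre2').mul hns'
  have hcoef : ContDiffOn ℝ ∞ (fun p : ℂ × ℂ => kmCoef N M p.1 p.2) U := by
    have h2 : ContDiffOn ℝ ∞ (fun p : ℂ × ℂ => (2 * π * I * conj p.1 / M : ℂ)) U := by
      simp only [div_eq_mul_inv]
      exact (contDiffOn_const.mul hconj.contDiffOn).mul contDiffOn_const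
    have h3 : ContDiffOn ℝ ∞ (fun _ : ℂ × ℂ => (![0, -(1 / (4 * N : ℂ)), 0, 0, 1, 0] :
        Fin 6 → ℂ)) U := contDiffOn_const
    have h4 : ContDiffOn ℝ ∞ (fun p : ℂ × ℂ => (-π * kmScale N M p.1 p.2 : ℂ)) U :=
      contDiffOn_const.mul hscale
    exact (h4.smul hsq).add (h2.smul h3)
  have hmaps : Set.MapsTo (fun p : ℂ × ℂ => kmCoef N M p.1 p.2) U triDomain :=
    fun p hp => kmCoef_mem N M hp.1 hp.2
  have hmain : ContDiffOn ℝ ∞ (fun p : ℂ × ℂ => (∑ i, kmScale N M p.1 p.2 * kmSqCoef N p.2 i *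
      ∑' n, w n * triMono n i * cexp (monoForm triMono n (kmCoef N M p.1 p.2))) -
      1 / (2 * π) * ∑' n, w n * cexp (monoForm triMono n (kmCoef N M p.1 p.2))) U := by
    refine (ContDiffOn.sum fun i _ => ?_).sub (contDiffOn_const.mul
      ((contDiffOn_triMono hw0).comp hcoef hmaps))
    exact (hscale.mul ((contDiffOn_pi.mp hsq) i)).mul
      ((contDiffOn_triMono (hwi i)).comp hcoef hmaps)
  refine hmain.congr fun p hp => ?_
  have hmem := hmaps hp
  have hs0 := summable_triMono hmem hw0
  have hsi := fun i => summable_triMono hmem (hwi i)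
  rw [← tsum_mul_left]
  simp only [← tsum_mul_left (a := _ * kmSqCoef N p.2 _)]
  rw [← Summable.tsum_finsetSum fun i _ => (hsi i).mul_left _,
    ← (summable_sum fun i _ => (hsi i).mul_left _).tsum_sub (hs0.mul_left _)]
  refine tsum_congr fun n => ?_
  rw [kmKer_eq, monoForm_apply triMono n (kmSqCoef N p.2), Finset.mul_sum, sub_mul, mul_sub,
    Finset.sum_mul, Finset.mul_sum]
  congr 1
  · exact Finset.sum_congr rfl fun i _ => by ring
  · ring

/-! ### The partial Fourier transform of the Kudla–Millson kernel -/

/-- The Kudla–Millson kernel after Poisson summation in the first variable. -/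
noncomputable def kapKer (N M : ℕ) (τ z : ℂ) (n : ℤ × ℤ × ℤ) : ℂ :=
  (n.1 - n.2.2 * conj τ) ^ 2 *
    cexp (-π * (N * z.im ^ 2 / (τ.im * M) : ℝ) * ((n.1 - n.2.2 * τ) * (n.1 - n.2.2 * conj τ)) +
      2 * π * I / M * (-n.1 * z.re * n.2.1 + n.1 * N * n.2.2 * z.re ^ 2 -
        conj τ * (n.2.1 - 2 * N * n.2.2 * z.re) ^ 2 / (4 * N)))

/-- The coefficients of the exponent of `kapKer`. -/
noncomputable def kapCoef (N M : ℕ) (τ z : ℂ) : Fin 6 → ℂ :=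
  (-π * (N * z.im ^ 2 / (τ.im * M) : ℝ) : ℂ) • ![1, 0, τ * conj τ, 0, -(τ + conj τ), 0] +
    (2 * π * I / M : ℂ) • ![0, -(conj τ / (4 * N)), -(conj τ * N * z.re ^ 2), -z.re,
      N * z.re ^ 2, conj τ * z.re]

theorem kapKer_eq (N M : ℕ) [NeZero N] (τ z : ℂ) (n : ℤ × ℤ × ℤ) : kapKer N M τ z n =
    (n.1 - n.2.2 * conj τ) ^ 2 * cexp (monoForm triMono n (kapCoef N M τ z)) := by
  have hN : (N : ℂ) ≠ 0 := by exact_mod_cast NeZero.ne N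
  rw [kapKer, kapCoef, map_add, map_smul, map_smul, monoForm_triMono, monoForm_triMono]
  congr 2
  simp
  field_simp
  ring

theorem kapCoef_mem (N M : ℕ) [NeZero N] [NeZero M] {τ z : ℂ} (hτ : 0 < τ.im) (hz : 0 < z.im) :
    kapCoef N M τ z ∈ triDomain := by
  have hN : (0 : ℝ) < N := by exact_mod_cast NeZero.pos N
  have hNC : (N : ℂ) ≠ 0 := by exact_mod_cast NeZero.ne N
  have hM : (0 : ℝ) < M := by exact_mod_cast NeZero.pos M
  refine mem_triDomain (p₁ := π * (N * z.im ^ 2 / (τ.im * M))) (p₂ := π * τ.im / (2 * N * M))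
    (p₃ := π * (N * z.im ^ 2 / (τ.im * M)) * τ.im ^ 2) (s := 0) (t := -τ.re)
    (u := -2 * N * z.re)
    (by have := Real.pi_pos; positivity) (by have := Real.pi_pos; positivity)
    (by have := Real.pi_pos; positivity) fun n => le_of_eq ?_
  have h1 : monoForm triMono n (kapCoef N M τ z) =
      ((-π * (N * z.im ^ 2 / (τ.im * M)) : ℝ) : ℂ) *
        ((n.1 - n.2.2 * τ) * (n.1 - n.2.2 * conj τ)) +
      ((2 * π / M * (-n.1 * z.re * n.2.1 + n.1 * N * n.2.2 * z.re ^ 2) : ℝ) : ℂ) * I -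
      ((2 * π / M * (n.2.1 - 2 * N * n.2.2 * z.re) ^ 2 / (4 * N) : ℝ) : ℂ) * (I * conj τ) := by
    rw [kapCoef, map_add, map_smul, map_smul, monoForm_triMono, monoForm_triMono]
    simp
    field_simp
    ring
  have h2 : (I * conj τ).re = τ.im := by simp
  have h3 : ((n.1 - n.2.2 * τ) * (n.1 - n.2.2 * conj τ)).re =
      (n.1 - n.2.2 * τ.re) ^ 2 + n.2.2 ^ 2 * τ.im ^ 2 := by
    simp [Complex.mul_re]
    ring
  rw [h1, Complex.sub_re, Complex.add_re, Complex.re_ofReal_mul, Complex.re_ofReal_mul,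
    Complex.re_ofReal_mul, h2, h3, Complex.I_re]
  field_simp
  ring

theorem summable_weight_kapKer (N M : ℕ) [NeZero N] [NeZero M] {τ z : ℂ} (hτ : 0 < τ.im)
    (hz : 0 < z.im) {w : ℤ × ℤ × ℤ → ℂ} {A : ℝ} (hw : ∀ n, ‖w n‖ ≤ A) :
    Summable fun n => w n * kapKer N M τ z n := by
  have hA : 0 ≤ A := (norm_nonneg _).trans (hw 0)
  have h := summable_triMono (kapCoef_mem N M hτ hz)
    (m := fun n => w n * (n.1 - n.2.2 * conj τ) ^ 2)
    (A := A * (2 * (1 + ‖τ‖ ^ 2))) (p := 1) (fun n => ?_)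
  · refine h.congr fun n => ?_
    rw [kapKer_eq]; ring
  · rw [norm_mul, pow_one, mul_assoc, norm_pow]
    refine mul_le_mul (hw n) ?_ (by positivity) hA
    have h1 : ‖(n.1 - n.2.2 * conj τ : ℂ)‖ ≤ |(n.1 : ℝ)| + |(n.2.2 : ℝ)| * ‖τ‖ := by
      refine (norm_sub_le _ _).trans (le_of_eq ?_)
      rw [norm_mul, Complex.norm_conj, Complex.norm_intCast, Complex.norm_intCast]
    have h2 := pow_le_pow_left₀ (norm_nonneg _) h1 2
    refine h2.trans ?_
    rw [triSize]
    have e1 := sq_abs (n.1 : ℝ)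
    have e2 := sq_abs (n.2.2 : ℝ)
    have e3 := sq_nonneg (|(n.1 : ℝ)| - |(n.2.2 : ℝ)| * ‖τ‖)
    have e4 : 0 ≤ ‖τ‖ ^ 2 * ((n.1 : ℝ) ^ 2 + (n.2.1 : ℝ) ^ 2 + 1) := by positivity
    have e5 := sq_nonneg (n.2.1 : ℝ)
    have e6 := sq_nonneg (n.2.2 : ℝ)
    nlinarith

/-! ### Poisson summation in the first variable -/

theorem tsum_fst {F : ℤ × ℤ × ℤ → ℂ} (hF : Summable F) :
    ∑' n, F n = ∑' q : ℤ × ℤ, ∑' a : ℤ, F (a, q.1, q.2) := by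
  rw [← (Equiv.prodComm (ℤ × ℤ) ℤ).tsum_eq]
  exact (((Equiv.prodComm (ℤ × ℤ) ℤ).summable_iff).mpr hF).tsum_prod

/-- The transposition of the first two factors of `ℤ × ℤ × ℤ`. -/
def midEquiv : (ℤ × ℤ) × ℤ ≃ ℤ × ℤ × ℤ where
  toFun q := (q.1.1, q.2, q.1.2)
  invFun n := ((n.1, n.2.2), n.2.1)
  left_inv _ := rfl
  right_inv _ := rfl

theorem tsum_mid {F : ℤ × ℤ × ℤ → ℂ} (hF : Summable F) :
    ∑' n, F n = ∑' q : ℤ × ℤ, ∑' b : ℤ, F (q.1, b, q.2) := by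
  rw [← midEquiv.tsum_eq]
  exact ((midEquiv.summable_iff).mpr hF).tsum_prod

theorem summable_slice_fst {F : ℤ × ℤ × ℤ → ℂ} (hF : Summable F) (b c : ℤ) :
    Summable fun a => F (a, b, c) :=
  hF.comp_injective (i := fun a => (a, b, c)) fun _ _ h => congrArg Prod.fst h

theorem summable_slice_mid {F : ℤ × ℤ × ℤ → ℂ} (hF : Summable F) (a c : ℤ) :
    Summable fun b => F (a, b, c) :=
  hF.comp_injective (i := fun b => (a, b, c)) fun _ _ h => congrArg (fun x => x.2.1) h

/-- Equal to M² times `kmScale`: the first variable runs in steps of M. -/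
noncomputable def poissonScale (N M : ℕ) (τ z : ℂ) : ℝ := M * τ.im / (N * z.im ^ 2)

/-- In the first variable the kernel is the polynomial of `tsum_sq_gaussian` times a Gaussian, with
shift (i + β)/M from `kmLin` and frequency ν = c τ̄ from the term ac of the quadratic form. -/
theorem tsum_kmKer_fst (N M : ℕ) [NeZero N] [NeZero M] {τ z : ℂ} (hτ : 0 < τ.im) (hz : 0 < z.im)
    (b c i : ℤ) : ∑' m : ℤ, kmKer N M τ z (i + M * m, b, c) =
      -(1 / (poissonScale N M τ z * Real.sqrt (poissonScale N M τ z)) : ℝ) *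
        ∑' n : ℤ, zexp M (n * i) * kapKer N M τ z (n, b, c) := by
  have hN : (0 : ℝ) < N := by exact_mod_cast NeZero.pos N
  have hM : (0 : ℝ) < M := by exact_mod_cast NeZero.pos M
  have hNC : (N : ℂ) ≠ 0 := by exact_mod_cast NeZero.ne N
  have hMC : (M : ℂ) ≠ 0 := by exact_mod_cast NeZero.ne M
  have hyC : (z.im : ℂ) ≠ 0 := by exact_mod_cast hz.ne'
  have hvC : (τ.im : ℂ) ≠ 0 := by exact_mod_cast hτ.ne'
  have hσ : 0 < poissonScale N M τ z := by rw [poissonScale]; positivity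
  set β : ℂ := -b * z.re + N * c * (z.re ^ 2 + z.im ^ 2) with hβ
  set ε : ℂ := -2 * π * I * conj τ * c * β / M - 2 * π * I * conj τ * b ^ 2 / (4 * N * M) with hε
  have hpois := tsum_sq_gaussian hσ ((i + β) / M) (c * conj τ)
  have hlin : ∀ m : ℤ, (kmLin N z (i + M * m, b, c) : ℂ) = M * (m + (i + β) / M) := by
    intro m
    rw [kmLin, Complex.normSq_apply]
    push_cast
    field_simp
    rw [hβ]; ring
  have hscale : (kmScale N M τ z : ℂ) * M ^ 2 = poissonScale N M τ z := by
    rw [kmScale, poissonScale]; push_cast; field_simp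
  have h1 : ∀ m : ℤ, kmKer N M τ z (i + M * m, b, c) = cexp ε *
      ((poissonScale N M τ z * (m + (i + β) / M) ^ 2 - 1 / (2 * π)) *
        cexp (-π * poissonScale N M τ z * (m + (i + β) / M) ^ 2 +
          2 * π * I * (c * conj τ) * (m + (i + β) / M))) := by
    intro m
    rw [kmKer, hlin, mul_left_comm, ← Complex.exp_add, ← hscale]
    congr 1
    · ring
    · congr 1
      rw [hε]
      push_cast
      field_simp
      ring
  have hτ2 : τ = conj τ + 2 * I * τ.im := by
    have := Complex.sub_conj τ
    push_cast at this
    linear_combination this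
  have h2 : ∀ n : ℤ, zexp M (n * i) * kapKer N M τ z (n, b, c) = cexp ε *
      ((n - c * conj τ) ^ 2 * cexp (2 * π * I * n * ((i + β) / M) -
        π * (n - c * conj τ) ^ 2 / poissonScale N M τ z)) := by
    intro n
    rw [kapKer, zexp, mul_left_comm, mul_left_comm (cexp ε), ← Complex.exp_add, ← Complex.exp_add]
    have e1 : (n : ℂ) - c * τ = n - c * conj τ - 2 * I * c * τ.im := by
      linear_combination -(c : ℂ) * hτ2
    dsimp only
    rw [e1]
    congr 2
    rw [hε, hβ, poissonScale]
    push_cast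
    field_simp
    ring_nf
  rw [tsum_congr h1, tsum_congr h2, tsum_mul_left, tsum_mul_left, hpois]
  push_cast
  exact mul_left_comm _ _ _

theorem tsum_weight_kmKer (N M : ℕ) [NeZero N] [NeZero M] {τ z : ℂ} (hτ : 0 < τ.im)
    (hz : 0 < z.im) {w : ℤ → ℤ → ℤ → ℂ} {A : ℝ} (hw : ∀ a b c, ‖w a b c‖ ≤ A)
    (hwa : ∀ a b c, w (a + M) b c = w a b c) :
    ∑' n : ℤ × ℤ × ℤ, w n.1 n.2.1 n.2.2 * kmKer N M τ z n =
      -(1 / (poissonScale N M τ z * Real.sqrt (poissonScale N M τ z)) : ℝ) *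
        ∑' n : ℤ × ℤ × ℤ, (∑ i ∈ Finset.range M, w i n.2.1 n.2.2 * zexp M (n.1 * i)) *
          kapKer N M τ z n := by
  have hS1 := summable_weight_kmKer N M hτ hz (w := fun n => w n.1 n.2.1 n.2.2) fun n => hw _ _ _
  have hS2 := summable_weight_kapKer N M hτ hz
    (w := fun n => ∑ i ∈ Finset.range M, w i n.2.1 n.2.2 * zexp M (n.1 * i)) (A := M * A)
    fun n => by
      refine (norm_sum_le _ _).trans ?_
      refine (Finset.sum_le_sum (g := fun _ => A) fun i _ => ?_).trans (by simp)
      rw [norm_mul, norm_zexp, mul_one]; exact hw _ _ _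
  have hS3 := summable_weight_kapKer N M hτ hz (w := fun _ => 1) (A := 1) (by simp)
  simp only [one_mul] at hS3
  rw [tsum_fst hS1, tsum_fst hS2, ← tsum_mul_left]
  refine tsum_congr fun q => ?_
  exact tsum_periodic_mul (w := fun a => w a q.1 q.2) (f := fun a => kmKer N M τ z (a, q.1, q.2))
    (g := fun n => kapKer N M τ z (n, q.1, q.2)) (summable_slice_fst hS1 q.1 q.2)
    (summable_slice_fst hS3 q.1 q.2) (fun a => hwa a _ _) fun i => tsum_kmKer_fst N M hτ hz _ _ i

/-! ### Poisson summation in the second variable -/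

theorem neg_one_div_im {τ : ℂ} (hτ : 0 < τ.im) : 0 < (-1 / τ).im := by
  have h0 : τ ≠ 0 := by rintro rfl; simp at hτ
  rw [neg_div, one_div, Complex.neg_im, Complex.inv_im, neg_div, neg_neg]
  exact div_pos hτ (Complex.normSq_pos.mpr h0)

/-- In b the kernel `kapKer` is a pure Gaussian, so plain Poisson summation suffices. At −1/τ the
factor (n − c τ̄)² becomes (c + n τ̄)²/τ̄², so the inversion amounts to replacing (n, c) by (c, −n).
-/
theorem tsum_kapKer_mid (N M : ℕ) [NeZero N] [NeZero M] {τ z : ℂ} (hτ : 0 < τ.im)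
    (n c k : ℤ) : ∑' m : ℤ, kapKer N M (-1 / τ) z (n, k + (2 * N * M : ℕ) * m, c) =
      ((conj τ) ^ 2)⁻¹ * (1 / (-2 * I * N * M / conj τ) ^ (1 / 2 : ℂ)) *
        ∑' m : ℤ, zexp (2 * N * M) (m * k) * kapKer N M τ z (c, m, -n) := by
  have hN : (0 : ℝ) < N := by exact_mod_cast NeZero.pos N
  have hM : (0 : ℝ) < M := by exact_mod_cast NeZero.pos M
  have hNC : (N : ℂ) ≠ 0 := by exact_mod_cast NeZero.ne N
  have hMC : (M : ℂ) ≠ 0 := by exact_mod_cast NeZero.ne M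
  have h0 : τ ≠ 0 := by rintro rfl; simp at hτ
  have h0' : conj τ ≠ 0 := by simpa using h0
  have hσ : 0 < (-2 * I * N * M / conj τ : ℂ).re := by
    have e1 : (-2 * I * N * M / conj τ : ℂ) = ((2 * N * M / Complex.normSq τ : ℝ) : ℂ) * (-I * τ) := by
      have h2 : (Complex.normSq τ : ℂ) = τ * conj τ := (Complex.mul_conj τ).symm
      push_cast
      rw [h2]
      field_simp
    rw [e1, Complex.re_ofReal_mul]
    have e2 : (-I * τ).re = τ.im := by simp
    rw [e2]
    have := Complex.normSq_pos.mpr h0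
    positivity
  set Φ : ℂ := -π * (N * z.im ^ 2 / (τ.im * M) : ℝ) * ((c + n * τ) * (c + n * conj τ)) -
    2 * π * I / M * (n * N * c * z.re ^ 2) with hΦ
  have hpois := tsum_gaussian hσ ((k - 2 * N * c * z.re) / (2 * N * M)) (-2 * N * n * z.re)
  have himinv : ((-1 / τ).im : ℂ) = τ.im / (τ * conj τ) := by
    rw [Complex.mul_conj, neg_div, one_div, Complex.neg_im, Complex.inv_im]
    push_cast
    ring
  have hvC : (τ.im : ℂ) ≠ 0 := by exact_mod_cast hτ.ne'
  have h1 : ∀ m : ℤ, kapKer N M (-1 / τ) z (n, k + (2 * N * M : ℕ) * m, c) =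
      ((conj τ) ^ 2)⁻¹ * (c + n * conj τ) ^ 2 * cexp Φ *
        cexp (-π * (-2 * I * N * M / conj τ) * (m + (k - 2 * N * c * z.re) / (2 * N * M)) ^ 2 +
          2 * π * I * (-2 * N * n * z.re) * (m + (k - 2 * N * c * z.re) / (2 * N * M))) := by
    intro m
    rw [kapKer, mul_assoc _ (cexp Φ), ← Complex.exp_add]
    have hc : conj (-1 / τ) = -1 / conj τ := by simp
    rw [hc]
    congr 1
    · field_simp
      ring
    · congr 1
      rw [hΦ]
      push_cast
      rw [himinv]
      field_simp
      ring
  have h2 : ∀ m : ℤ, zexp (2 * N * M) (m * k) * kapKer N M τ z (c, m, -n) =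
      (c + n * conj τ) ^ 2 * cexp Φ *
        cexp (2 * π * I * m * ((k - 2 * N * c * z.re) / (2 * N * M)) -
          π * (m - -2 * N * n * z.re) ^ 2 / (-2 * I * N * M / conj τ)) := by
    intro m
    rw [kapKer, zexp, mul_left_comm, ← Complex.exp_add, mul_assoc (_ ^ 2) (cexp Φ),
      ← Complex.exp_add]
    push_cast
    congr 1
    · ring
    · congr 1
      rw [hΦ]
      push_cast
      field_simp
      ring_nf
      rw [show (I ^ 2 : ℂ) = -1 from I_sq]
      ring
  rw [tsum_congr h1, tsum_congr h2, tsum_mul_left, tsum_mul_left, hpois]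
  ring

/-- The permutation `(c, m, -n) ↦ (n, m, c)` of coordinates. -/
def rotEquiv : ℤ × ℤ × ℤ ≃ ℤ × ℤ × ℤ where
  toFun n := (-n.2.2, n.2.1, n.1)
  invFun n := (n.2.2, n.2.1, -n.1)
  left_inv n := by simp
  right_inv n := by simp

theorem norm_sum_range_zexp_le {M P : ℕ} {f : ℕ → ℂ} {A : ℝ} (hf : ∀ i, ‖f i‖ ≤ A) (e : ℕ → ℤ) :
    ‖∑ i ∈ Finset.range M, f i * zexp P (e i)‖ ≤ M * A := by
  refine (norm_sum_le _ _).trans ?_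
  refine (Finset.sum_le_sum (g := fun _ => A) fun i _ => ?_).trans (by simp)
  rw [norm_mul, norm_zexp, mul_one]; exact hf i

theorem tsum_weight_kapKer (N M : ℕ) [NeZero N] [NeZero M] {τ z : ℂ} (hτ : 0 < τ.im)
    (hz : 0 < z.im) {W : ℤ → ℤ → ℤ → ℂ} {A : ℝ} (hW : ∀ a b c, ‖W a b c‖ ≤ A)
    (hWb : ∀ a b c, W a (b + (2 * N * M : ℕ)) c = W a b c) :
    ∑' n : ℤ × ℤ × ℤ, W n.1 n.2.1 n.2.2 * kapKer N M (-1 / τ) z n =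
      ((conj τ) ^ 2)⁻¹ * (1 / (-2 * I * N * M / conj τ) ^ (1 / 2 : ℂ)) *
        ∑' n : ℤ × ℤ × ℤ, (∑ k ∈ Finset.range (2 * N * M), W (-n.2.2) k n.1 *
          zexp (2 * N * M) (n.2.1 * k)) * kapKer N M τ z n := by
  have hS1 := summable_weight_kapKer N M (neg_one_div_im hτ) hz
    (w := fun n => W n.1 n.2.1 n.2.2) fun n => hW _ _ _
  have hS2 := summable_weight_kapKer N M hτ hz
    (w := fun n => ∑ k ∈ Finset.range (2 * N * M), W (-n.2.2) k n.1 *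
          zexp (2 * N * M) (n.2.1 * k)) (A := (2 * N * M : ℕ) * A)
    fun n => norm_sum_range_zexp_le (fun i => hW _ _ _) _
  have hS3 := summable_weight_kapKer N M hτ hz (w := fun _ => 1) (A := 1) (by simp)
  simp only [one_mul] at hS3
  have hS4 := (rotEquiv.symm.summable_iff).mpr hS2
  rw [tsum_mid hS1, ← rotEquiv.symm.tsum_eq (fun n : ℤ × ℤ × ℤ => _ * kapKer N M τ z n)]
  refine Eq.trans ?_ (congrArg _ (tsum_mid hS4).symm)
  rw [← tsum_mul_left]
  refine tsum_congr fun q => ?_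
  have := tsum_periodic_mul (w := fun b => W q.1 b q.2)
    (f := fun b => kapKer N M (-1 / τ) z (q.1, b, q.2))
    (g := fun m => kapKer N M τ z (q.2, m, -q.1)) (summable_slice_mid hS1 q.1 q.2)
    (summable_slice_mid hS3 q.2 (-q.1)) (fun b => hWb _ b _)
    fun i => tsum_kapKer_mid N M hτ q.1 q.2 i
  rw [this]
  congr 1
  refine tsum_congr fun m => ?_
  simp [rotEquiv]

/-! ### The transformation under `τ ↦ -1/τ` -/

/-- Summing over i inverts the transform in the variable c, which leaves the partial transforms in a
and b that the two Poisson steps produce. -/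
theorem sum_weightFourier (N M : ℕ) [NeZero M] {w : ℤ → ℤ → ℤ → ℂ}
    (hwc : ∀ a b c, w a b (c + M) = w a b c) (n m l : ℤ) :
    ∑ i ∈ Finset.range M, weightFourier N M w i m l * zexp M (n * i) =
      M * ∑ k ∈ Finset.range (2 * N * M), (∑ i ∈ Finset.range M, w i k n * zexp M (-l * i)) *
        zexp (2 * N * M) (m * k) := by
  have h1 : ∀ i : ℕ, weightFourier N M w i m l * zexp M (n * i) =
      ∑ b ∈ Finset.range (2 * N * M), ∑ a ∈ Finset.range M, ∑ c ∈ Finset.range M,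
        w a b c * zexp M (-l * a) * zexp (2 * N * M) (m * b) * zexp M (i * (n - c)) := by
    intro i
    rw [weightFourier, Finset.sum_mul]
    refine Finset.sum_congr rfl fun b _ => ?_
    rw [Finset.sum_mul]
    refine Finset.sum_congr rfl fun a _ => ?_
    rw [Finset.sum_mul]
    refine Finset.sum_congr rfl fun c _ => ?_
    rw [show -((a : ℤ) * l + c * i) = -l * a + -(c * i) by ring, zexp_add,
      show (i : ℤ) * (n - c) = n * i + -(c * i) by ring, zexp_add, mul_comm (b : ℤ) m]
    ring
  rw [Finset.sum_congr rfl fun i _ => h1 i, Finset.sum_comm, Finset.mul_sum]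
  refine Finset.sum_congr rfl fun b _ => ?_
  rw [Finset.sum_comm, Finset.sum_mul, Finset.mul_sum]
  refine Finset.sum_congr rfl fun a _ => ?_
  rw [Finset.sum_comm]
  have h2 : ∀ c : ℕ, ∑ i ∈ Finset.range M,
      w a b c * zexp M (-l * a) * zexp (2 * N * M) (m * b) * zexp M (i * (n - c)) =
      M * (zexp M (-l * a) * zexp (2 * N * M) (m * b)) *
        if (M : ℤ) ∣ n - c then w a b c else 0 := by
    intro c
    rw [← Finset.mul_sum, sum_zexp_mul]
    split_ifs
    · ring
    · simp
  rw [Finset.sum_congr rfl fun c _ => h2 c, ← Finset.mul_sum,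
    sum_range_ite_dvd (f := fun c => w a b c) (fun c => hwc a b c) n]
  ring

theorem norm_weightFourier_le (N M : ℕ) {w : ℤ → ℤ → ℤ → ℂ} {A : ℝ}
    (hw : ∀ a b c, ‖w a b c‖ ≤ A) (a b c : ℤ) :
    ‖weightFourier N M w a b c‖ ≤ (2 * N * M : ℕ) * (M * (M * A)) := by
  have key : ∀ (n : ℕ) (f : ℕ → ℂ) (B : ℝ), (∀ i, ‖f i‖ ≤ B) →
      ‖∑ i ∈ Finset.range n, f i‖ ≤ n * B := fun n f B hf =>
    (norm_sum_le _ _).trans ((Finset.sum_le_sum (g := fun _ => B) fun i _ => hf i).trans (by simp))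
  refine key _ _ _ fun b' => key _ _ _ fun a' => key _ _ _ fun c' => ?_
  rw [norm_mul, norm_mul, norm_zexp, norm_zexp, mul_one, mul_one]
  exact hw _ _ _

theorem weightFourier_add (N M : ℕ) [NeZero M] (w : ℤ → ℤ → ℤ → ℂ) (a b c : ℤ) :
    weightFourier N M w (a + M) b c = weightFourier N M w a b c := by
  unfold weightFourier
  refine Finset.sum_congr rfl fun b' _ => Finset.sum_congr rfl fun a' _ =>
    Finset.sum_congr rfl fun c' _ => ?_
  rw [zexp_congr (x := -((a' : ℤ) * c + c' * (a + M))) (y := -((a' : ℤ) * c + c' * a))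
    ⟨-c', by ring⟩]

/-- Poisson in a, inversion with Poisson in b, and Poisson in a undone on the other side. The factor
‖τ‖³ is the ratio of the Poisson constants, as `poissonScale` at −1/τ is divided by ‖τ‖² and enters
with exponent −3/2. -/
theorem kmSeries_inversion (N M : ℕ) [NeZero N] [NeZero M] {τ z : ℂ} (hτ : 0 < τ.im)
    (hz : 0 < z.im) {w : ℤ → ℤ → ℤ → ℂ} {A : ℝ} (hw : ∀ a b c, ‖w a b c‖ ≤ A)
    (hwa : ∀ a b c, w (a + M) b c = w a b c)
    (hwb : ∀ a b c, w a (b + (2 * N * M : ℕ)) c = w a b c)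
    (hwc : ∀ a b c, w a b (c + M) = w a b c) :
    ∑' n : ℤ × ℤ × ℤ, w n.1 n.2.1 n.2.2 * kmKer N M (-1 / τ) z n =
      (‖τ‖ : ℂ) ^ 3 / ((conj τ) ^ 2 * (-2 * I * N * M / conj τ) ^ (1 / 2 : ℂ) * M) *
        ∑' n : ℤ × ℤ × ℤ, weightFourier N M w n.1 n.2.1 n.2.2 * kmKer N M τ z n := by
  have hN : (0 : ℝ) < N := by exact_mod_cast NeZero.pos N
  have hM : (0 : ℝ) < M := by exact_mod_cast NeZero.pos M
  have h0 : τ ≠ 0 := by rintro rfl; simp at hτ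
  have hn0 : 0 < ‖τ‖ := norm_pos_iff.mpr h0
  have hMC : (M : ℂ) ≠ 0 := by exact_mod_cast NeZero.ne M
  have hs : 0 < poissonScale N M τ z := by rw [poissonScale]; positivity
  have hscale : poissonScale N M (-1 / τ) z = poissonScale N M τ z / ‖τ‖ ^ 2 := by
    rw [poissonScale, poissonScale, neg_div, one_div, Complex.neg_im, Complex.inv_im,
      Complex.normSq_eq_norm_sq]
    field_simp
  rw [tsum_weight_kmKer N M (neg_one_div_im hτ) hz hw hwa,
    tsum_weight_kmKer N M hτ hz (norm_weightFourier_le N M hw) fun a b c => weightFourier_add N M w a b c,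
    tsum_weight_kapKer N M hτ hz
      (W := fun n b c => ∑ i ∈ Finset.range M, w i b c * zexp M (n * i))
      (fun a b c => norm_sum_range_zexp_le (fun i => hw _ _ _) _)
      (fun a b c => Finset.sum_congr rfl fun i _ => by rw [hwb])]
  have h3 : ∀ n : ℤ × ℤ × ℤ, (∑ i ∈ Finset.range M, weightFourier N M w i n.2.1 n.2.2 *
      zexp M (n.1 * i)) * kapKer N M τ z n = M * ((∑ k ∈ Finset.range (2 * N * M),
        (∑ i ∈ Finset.range M, w i k n.1 * zexp M (-n.2.2 * i)) *
          zexp (2 * N * M) (n.2.1 * k)) * kapKer N M τ z n) := by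
    intro n
    rw [sum_weightFourier N M hwc, mul_assoc]
  rw [tsum_congr h3, tsum_mul_left, hscale, Real.sqrt_div hs.le, Real.sqrt_sq hn0.le]
  generalize (∑' n : ℤ × ℤ × ℤ, _ : ℂ) = X
  have hsC : ((Real.sqrt (poissonScale N M τ z) : ℝ) : ℂ) ≠ 0 := by
    exact_mod_cast (Real.sqrt_pos.mpr hs).ne'
  have hsC' : ((poissonScale N M τ z : ℝ) : ℂ) ≠ 0 := by exact_mod_cast hs.ne'
  have hnC : (‖τ‖ : ℂ) ≠ 0 := by exact_mod_cast hn0.ne'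
  push_cast
  field_simp

section

variable {N : ℕ} [NeZero N] {Δ r k : ℤ} {χ : MulChar (ZMod Δ.natAbs) ℤ}

/-! ### The twisted theta function as a series over `ℤ³` -/

theorem dualElt_injective (N : ℕ) [NeZero N] :
    Function.Injective fun n : ℤ × ℤ × ℤ => dualElt N n.1 n.2.1 n.2.2 := by
  rintro ⟨a, b, c⟩ ⟨a', b', c'⟩ h
  have hN : (N : ℝ) ≠ 0 := by exact_mod_cast NeZero.ne N
  have h' : dualVec N a b c = dualVec N a' b' c' := congrArg Subtype.val h
  have h00 := congrFun (congrFun h' 0) 0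
  have h01 := congrFun (congrFun h' 0) 1
  have h10 := congrFun (congrFun h' 1) 0
  simp [dualVec, hN] at h00 h01 h10
  exact Prod.ext (by exact_mod_cast h01) (Prod.ext (by exact_mod_cast h00) h10)

/-- The coordinates of the dual lattice. -/
noncomputable def dualEquiv (N : ℕ) [NeZero N] : ℤ × ℤ × ℤ ≃ dualLattice N :=
  Equiv.ofBijective _ ⟨dualElt_injective N, fun l => by
    obtain ⟨a, b, c, rfl⟩ := dualElt_surj N l
    exact ⟨(a, b, c), rfl⟩⟩

theorem summable_phi (N : ℕ) [NeZero N] {Δ : ℤ} (hΔ : Δ ≠ 0) (τ z : ℍ) :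
    Summable fun l : dualLattice N => phi N Δ l τ z := by
  have : NeZero Δ.natAbs := ⟨Int.natAbs_ne_zero.mpr hΔ⟩
  rw [← (dualEquiv N).summable_iff]
  have h := summable_weight_kmKer N Δ.natAbs τ.im_pos z.im_pos (w := fun _ => 1) (A := 1) (by simp)
  refine h.congr fun n => ?_
  rw [one_mul]
  exact (phi_dualElt N hΔ τ z n).symm

theorem exists_norm_twistWeight_le (N : ℕ) {Δ : ℤ} [NeZero Δ.natAbs] (r k : ℤ)
    (χ : MulChar (ZMod Δ.natAbs) ℤ) :
    ∃ A : ℝ, ∀ i a b c, ‖(twistWeight N r k χ i a b c : ℂ)‖ ≤ A := by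
  obtain ⟨A, hA⟩ := (Set.finite_range fun δ : (ZMod Δ.natAbs × ZMod Δ.natAbs) ×
    (ZMod Δ.natAbs × ZMod Δ.natAbs) => ‖(hermChar (N : ZMod Δ.natAbs) r k χ δ : ℂ)‖).bddAbove
  have hA' := fun δ => hA (Set.mem_range_self δ)
  refine ⟨A, fun i a b c => ?_⟩
  rw [twistWeight]
  split_ifs
  · exact hA' _
  · rw [Int.cast_zero, norm_zero]
    exact (norm_nonneg _).trans (hA' 0)

/-- The cosets ΔL + δ partition L' and the twisting coefficient is constant on each, so by absolute
convergence the sums merge into one over ℤ³. -/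
theorem twistedTheta_eq (hΔ : IsFundamentalDiscriminant Δ)
    (hχ : ∀ n, IsCoprime n Δ → χ (n : ZMod Δ.natAbs) = kroneckerSymbol Δ n)
    (h : Δ = r ^ 2 - 4 * N * k) {η : BaseGroup N} {a₀ i c₀ : ℤ}
    (hη : discRep η = dualElt N a₀ i c₀) (τ z : ℍ) :
    twistedTheta N Δ r τ z η = ∑' n : ℤ × ℤ × ℤ,
      (twistWeight N r k χ i n.1 n.2.1 n.2.2 : ℂ) * kmKer N Δ.natAbs τ z n := by
  have : NeZero Δ.natAbs := ⟨Int.natAbs_ne_zero.mpr hΔ.ne_zero⟩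
  have := discGroup_finite N hΔ.ne_zero
  have : Fintype (DiscGroup N Δ) := Fintype.ofFinite _
  set F : dualLattice N → ℂ := fun l => twistMap N Δ r η (QuotientAddGroup.mk l) * phi N Δ l τ z
  have hF : ∀ n, F (dualEquiv N n) =
      (twistWeight N r k χ i n.1 n.2.1 n.2.2 : ℂ) * kmKer N Δ.natAbs τ z n := by
    intro n
    change twistMap N Δ r η (QuotientAddGroup.mk (dualElt N n.1 n.2.1 n.2.2)) *
      phi N Δ (dualElt N n.1 n.2.1 n.2.2 : dualLattice N) τ z = _
    rw [twistMap_eq_twistWeight hΔ hχ h hη, phi_dualElt N hΔ.ne_zero]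
  obtain ⟨A, hA⟩ := exists_norm_twistWeight_le N r k χ
  have hS : Summable F := by
    rw [← (dualEquiv N).summable_iff]
    exact (summable_weight_kmKer N Δ.natAbs τ.im_pos z.im_pos (w := fun n =>
      (twistWeight N r k χ i n.1 n.2.1 n.2.2 : ℂ)) fun n => hA _ _ _ _).congr fun n => (hF n).symm
  rw [← tsum_congr hF, (dualEquiv N).tsum_eq F,
    ← (Equiv.sigmaFiberEquiv (QuotientAddGroup.mk : dualLattice N → DiscGroup N Δ)).tsum_eq F]
  refine Eq.trans ?_ (Summable.tsum_sigma ((Equiv.sigmaFiberEquiv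
    (QuotientAddGroup.mk : dualLattice N → DiscGroup N Δ)).summable_iff.mpr hS)).symm
  rw [tsum_fintype, twistedTheta, discInner, finsum_eq_sum_of_fintype]
  refine Finset.sum_congr rfl fun δ _ => ?_
  rw [Complex.conj_conj, thetaDelta, ← tsum_mul_left]
  refine tsum_congr fun l => ?_
  have h2 : (QuotientAddGroup.mk (l : dualLattice N) : DiscGroup N Δ) = δ := l.2
  change twistMap N Δ r η δ * _ = twistMap N Δ r η (QuotientAddGroup.mk (l : dualLattice N)) * _
  rw [h2]
  rfl

theorem contDiffOn_twistedTheta (hΔ : IsFundamentalDiscriminant Δ)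
    (hχ : ∀ n, IsCoprime n Δ → χ (n : ZMod Δ.natAbs) = kroneckerSymbol Δ n)
    (h : Δ = r ^ 2 - 4 * N * k) (η : BaseGroup N) :
    ContDiffOn ℝ ∞ (fun p : ℂ × ℂ => twistedTheta N Δ r (ofComplex p.1) (ofComplex p.2) η)
      {p : ℂ × ℂ | 0 < p.1.im ∧ 0 < p.2.im} := by
  have : NeZero Δ.natAbs := ⟨Int.natAbs_ne_zero.mpr hΔ.ne_zero⟩
  obtain ⟨a₀, i, c₀, hη⟩ := dualElt_surj N (discRep η)
  obtain ⟨A, hA⟩ := exists_norm_twistWeight_le N r k χ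
  refine (contDiffOn_kmSeries N Δ.natAbs (w := fun n =>
    (twistWeight N r k χ i n.1 n.2.1 n.2.2 : ℂ)) fun n => hA _ _ _ _).congr fun p hp => ?_
  rw [twistedTheta_eq hΔ hχ h hη, ofComplex_apply_of_im_pos hp.1, ofComplex_apply_of_im_pos hp.2]

/-! ### The transformation under `T` -/

theorem dvd_of_twistWeight_ne_zero {i a b c : ℤ}
    (hw : twistWeight N r k χ i a b c ≠ 0) :
    ∃ t m : ℤ, b = r * i + 2 * N * t ∧ a * c - binForm (N : ℤ) r k (t, i) = Δ * m := by
  obtain ⟨t, ht⟩ := twistWeight_ne_zero hw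
  rw [twistWeight_eq ht] at hw
  have h3 := (hermChar_ne_zero hw).1
  have h4 := hermDet_redPair Δ.natAbs N r k ((a, c), (t, i))
  rw [Int.cast_natCast] at h4
  obtain ⟨m, hm⟩ := intCast_zmod_natAbs_eq_zero.mp (h4.symm.trans h3)
  exact ⟨t, m, by rw [ht]; push_cast; ring, hm⟩

theorem disc_eq_of_dvd (h : Δ = r ^ 2 - 4 * N * k) {i a b c t m : ℤ}
    (hb : b = r * i + 2 * N * t) (hm : a * c - binForm (N : ℤ) r k (t, i) = Δ * m) :
    b ^ 2 - 4 * N * a * c = Δ * (i ^ 2 - 4 * N * m) := by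
  rw [hb]
  simp only [binForm] at hm
  linear_combination (-4 * N) * hm - i ^ 2 * h

theorem intCast_sign_mul_natAbs (Δ : ℤ) : (Δ : ℂ) = Δ.sign * Δ.natAbs := by
  have := congrArg (Int.cast : ℤ → ℂ) (Int.sign_mul_natAbs Δ)
  rw [Int.cast_mul, Int.cast_natCast] at this
  exact this.symm

theorem kmKer_add_one (N M : ℕ) (τ z : ℂ) (n : ℤ × ℤ × ℤ) : kmKer N M (τ + 1) z n =
    cexp (2 * π * I * (n.1 * n.2.2 - (n.2.1 : ℂ) ^ 2 / (4 * N)) / M) * kmKer N M τ z n := by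
  rw [kmKer, kmKer, mul_left_comm, ← Complex.exp_add]
  have : kmScale N M (τ + 1) z = kmScale N M τ z := by simp [kmScale]
  rw [this]
  congr 2
  rw [map_add, map_one]
  ring

theorem weilRepTilde_T (N : ℕ) [NeZero N] (hΔ : Δ ≠ 0) : weilRepTilde N Δ Mp2Z.T =
    Matrix.diagonal fun δ : BaseGroup N => expe (Δ.sign * quadForm N (discRep δ)) := by
  rw [weilRepTilde]
  split_ifs with h
  · rw [weilRep_T, Int.sign_eq_one_of_pos h]; simp
  · have h' : Δ < 0 := lt_of_le_of_ne (not_lt.mp h) hΔ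
    rw [Int.sign_eq_neg_one_of_neg h']
    change (weilRep N Mp2Z.T).map conj = _
    rw [weilRep_T, Matrix.diagonal_map (map_zero _)]
    congr 1
    funext δ
    simp [conj_expe]

theorem weilRepTilde_S (N : ℕ) [NeZero N] (hΔ : Δ ≠ 0) : weilRepTilde N Δ Mp2Z.S =
    Matrix.of fun δ' δ : BaseGroup N => eighthRoot Δ.sign / (Real.sqrt (2 * N) : ℂ) *
      expe (-(Δ.sign * bilForm N (discRep δ') (discRep δ))) := by
  rw [weilRepTilde]
  have hc : ((Nat.card (BaseGroup N) : ℕ) : ℝ) = 2 * N := by rw [card_baseGroup]; push_cast; rfl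
  split_ifs with h
  · rw [weilRep_S, Int.sign_eq_one_of_pos h, hc]; simp [eighthRoot]
  · have h' : Δ < 0 := lt_of_le_of_ne (not_lt.mp h) hΔ
    rw [Int.sign_eq_neg_one_of_neg h']
    change (weilRep N Mp2Z.S).map conj = _
    rw [weilRep_S, hc]
    ext δ' δ
    rw [Matrix.map_apply, Matrix.of_apply, Matrix.of_apply, map_mul, map_div₀, Complex.conj_ofReal,
      conj_expe, eighthRoot, ← Complex.exp_conj]
    congr 3
    · simp [Complex.conj_ofNat, neg_div]
    · simp

/-- On the support of the weight b² − 4Nac = Δ(i² − 4Nm), so the exponential picked up under τ ↦ τ +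
1 is −sgn(Δ)i²/4N modulo 1, the same for all terms. -/
theorem twistedTheta_T (hΔ : IsFundamentalDiscriminant Δ)
    (hχ : ∀ n, IsCoprime n Δ → χ (n : ZMod Δ.natAbs) = kroneckerSymbol Δ n)
    (h : Δ = r ^ 2 - 4 * N * k) (τ z : ℍ) :
    twistedTheta N Δ r (Mp2Z.T.mat • τ) z =
      (weilRepTilde N Δ Mp2Z.T).mulVec (twistedTheta N Δ r τ z) := by
  have hN : (N : ℂ) ≠ 0 := by exact_mod_cast NeZero.ne N
  have hM : (Δ.natAbs : ℂ) ≠ 0 := by exact_mod_cast Int.natAbs_ne_zero.mpr hΔ.ne_zero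
  funext η
  obtain ⟨a₀, i, c₀, hη⟩ := dualElt_surj N (discRep η)
  rw [weilRepTilde_T N hΔ.ne_zero, Matrix.mulVec_diagonal, twistedTheta_eq hΔ hχ h hη,
    twistedTheta_eq hΔ hχ h hη, ← tsum_mul_left]
  refine tsum_congr fun n => ?_
  have h1 : ((Mp2Z.T.mat • τ : ℍ) : ℂ) = τ + 1 := by
    rw [coe_smul_eq]; simp [autFactor, Mp2Z.T, ModularGroup.T]
  rw [h1, kmKer_add_one]
  by_cases hw : twistWeight N r k χ i n.1 n.2.1 n.2.2 = 0
  · rw [hw]; simp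
  obtain ⟨t, m, hb, hm⟩ := dvd_of_twistWeight_ne_zero hw
  have hd := disc_eq_of_dvd h hb hm
  have hs := intCast_sign_mul_natAbs Δ
  have hdC : ((n.2.1 : ℂ) ^ 2 - 4 * N * n.1 * n.2.2) = Δ.sign * Δ.natAbs * (i ^ 2 - 4 * N * m) := by
    rw [← hs]; exact_mod_cast hd
  have e1 : cexp (2 * π * I * (n.1 * n.2.2 - (n.2.1 : ℂ) ^ 2 / (4 * N)) / Δ.natAbs) =
      expe (Δ.sign * quadForm N (discRep η)) := by
    rw [hη]
    change _ = expe (Δ.sign * quadForm N (dualVec N a₀ i c₀))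
    rw [quadForm_dualVec, expe, Complex.exp_eq_exp_iff_exists_int]
    refine ⟨Δ.sign * m - Δ.sign * (a₀ * c₀), ?_⟩
    have e2 : (n.1 * n.2.2 - (n.2.1 : ℂ) ^ 2 / (4 * N)) / Δ.natAbs =
        -(Δ.sign * (i ^ 2 - 4 * N * m)) / (4 * N) := by
      field_simp
      linear_combination -hdC
    rw [mul_div_assoc, e2]
    push_cast
    field_simp
    ring
  rw [e1]
  ring

/-! ### The transformation under `S` -/

theorem inversion_sqrt (P : ℕ) [NeZero P] (τ : ℍ) :
    (-I * P / conj (τ : ℂ)) ^ (1 / 2 : ℂ) =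
      Real.sqrt P / ‖(τ : ℂ)‖ * ((τ : ℂ) ^ (1 / 2 : ℂ) * eighthRoot (-1)) := by
  have hP : (0 : ℝ) < P := by exact_mod_cast NeZero.pos P
  have hτ : (τ : ℂ) ≠ 0 := τ.ne_zero
  have hn : 0 < ‖(τ : ℂ)‖ := norm_pos_iff.mpr hτ
  have hc : conj (τ : ℂ) ≠ 0 := by simpa using hτ
  have hnC : (‖(τ : ℂ)‖ : ℂ) ≠ 0 := by exact_mod_cast hn.ne'
  have h1 := sqrt_factor 1 τ
  simp only [Nat.cast_one, div_one, Real.sqrt_one, Complex.ofReal_one] at h1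
  have e1 : (-I * P / conj (τ : ℂ)) = ((P / ‖(τ : ℂ)‖ ^ 2 : ℝ) : ℂ) * (-I * τ) := by
    push_cast
    rw [← Complex.mul_conj']
    field_simp
  have hne : -I * (τ : ℂ) ≠ 0 := mul_ne_zero (by simp) hτ
  have hr : 0 < (P / ‖(τ : ℂ)‖ ^ 2 : ℝ) := by positivity
  have e2 : ((P / ‖(τ : ℂ)‖ ^ 2 : ℝ) : ℂ) ^ (1 / 2 : ℂ) = Real.sqrt P / ‖(τ : ℂ)‖ := by
    have : (1 / 2 : ℂ) = ((1 / 2 : ℝ) : ℂ) := by push_cast; rfl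
    rw [this, ← Complex.ofReal_cpow hr.le, ← Real.sqrt_eq_rpow, Real.sqrt_div hP.le,
      Real.sqrt_sq hn.le]
    push_cast; rfl
  have e3 : ((P / ‖(τ : ℂ)‖ ^ 2 : ℝ) * (-I * τ) : ℂ) ^ (1 / 2 : ℂ) =
      ((P / ‖(τ : ℂ)‖ ^ 2 : ℝ) : ℂ) ^ (1 / 2 : ℂ) * (-I * τ) ^ (1 / 2 : ℂ) := by
    have hrC : ((P / ‖(τ : ℂ)‖ ^ 2 : ℝ) : ℂ) ≠ 0 := by exact_mod_cast hr.ne'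
    rw [Complex.cpow_def_of_ne_zero (mul_ne_zero hrC hne), Complex.log_ofReal_mul hr hne,
      Complex.cpow_def_of_ne_zero hrC, Complex.cpow_def_of_ne_zero hne, ← Complex.exp_add,
      Complex.ofReal_log hr.le]
    ring_nf
  rw [e1, e3, e2, h1, eighthRoot]
  push_cast
  ring_nf

/-- By `inversion_sqrt` the powers of M and the root e(−1/8) cancel, and ‖τ‖⁴/τ̄² = τ² divided by √τ
is the cube of √τ. -/
theorem inversion_constant (N M : ℕ) [NeZero N] [NeZero M] (s : ℤ) (τ : ℍ) :
    (‖(τ : ℂ)‖ : ℂ) ^ 3 / ((conj (τ : ℂ)) ^ 2 * (-2 * I * N * M / conj (τ : ℂ)) ^ (1 / 2 : ℂ) * M) *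
        (eighthRoot s * eighthRoot (-1) * M * (Real.sqrt M : ℂ)) =
      ((τ : ℂ) ^ (1 / 2 : ℂ)) ^ 3 * (eighthRoot s / (Real.sqrt (2 * N) : ℂ)) := by
  have hN : (0 : ℝ) < N := by exact_mod_cast NeZero.pos N
  have hM : (0 : ℝ) < M := by exact_mod_cast NeZero.pos M
  have hτ : (τ : ℂ) ≠ 0 := τ.ne_zero
  have hc : conj (τ : ℂ) ≠ 0 := by simpa using hτ
  have hn : 0 < ‖(τ : ℂ)‖ := norm_pos_iff.mpr hτ
  have hnC : (‖(τ : ℂ)‖ : ℂ) ≠ 0 := by exact_mod_cast hn.ne'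
  have hMC : (M : ℂ) ≠ 0 := by exact_mod_cast NeZero.ne M
  have h1 := inversion_sqrt (2 * N * M) τ
  have e1 : (-I * (2 * N * M : ℕ) / conj (τ : ℂ)) = -2 * I * N * M / conj (τ : ℂ) := by
    push_cast; ring
  rw [e1] at h1
  have h2 : ((τ : ℂ) ^ (1 / 2 : ℂ)) ^ 2 = τ := by
    rw [← Complex.cpow_nat_mul]; simp
  have h3 : ((τ : ℂ) ^ (1 / 2 : ℂ)) ≠ 0 := by
    intro h0; rw [h0] at h2; exact hτ (by rw [← h2]; simp)
  have h4 : (Real.sqrt (2 * N * M : ℕ) : ℂ) = (Real.sqrt (2 * N) : ℂ) * (Real.sqrt M : ℂ) := by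
    rw [← Complex.ofReal_mul, ← Real.sqrt_mul (by positivity)]; push_cast; rfl
  have h5 : (Real.sqrt (2 * N) : ℂ) ≠ 0 := by
    exact_mod_cast (Real.sqrt_pos.mpr (by positivity : (0 : ℝ) < 2 * N)).ne'
  have h6 : (Real.sqrt M : ℂ) ≠ 0 := by exact_mod_cast (Real.sqrt_pos.mpr hM).ne'
  have h7 : eighthRoot (-1) ≠ 0 := Complex.exp_ne_zero _
  have h8 : (‖(τ : ℂ)‖ : ℂ) ^ 2 = τ * conj (τ : ℂ) := (Complex.mul_conj' _).symm
  rw [h1, h4]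
  generalize (τ : ℂ) ^ (1 / 2 : ℂ) = ρ at *
  field_simp
  rw [show (‖(τ : ℂ)‖ : ℂ) ^ 4 = ((‖(τ : ℂ)‖ : ℂ) ^ 2) ^ 2 by ring, h8, ← h2]
  ring

/-- `kmSeries_inversion` replaces the weight by its Fourier transform, which
`weightFourier_twistWeight` expands in the weights of all components; the coefficients are the
entries of the Weil representation at S. -/
theorem twistedTheta_S (hΔ : IsFundamentalDiscriminant Δ)
    (hχ : ∀ n, IsCoprime n Δ → χ (n : ZMod Δ.natAbs) = kroneckerSymbol Δ n)
    (hprim : ∀ c : ZMod Δ.natAbs, ¬ IsUnit c → ∃ u : (ZMod Δ.natAbs)ˣ, u * c = c ∧ χ u = -1)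
    (h : Δ = r ^ 2 - 4 * N * k) (τ z : ℍ) :
    twistedTheta N Δ r (Mp2Z.S.mat • τ) z =
      Mp2Z.S.fac τ ^ 3 • (weilRepTilde N Δ Mp2Z.S).mulVec (twistedTheta N Δ r τ z) := by
  have : NeZero Δ.natAbs := ⟨Int.natAbs_ne_zero.mpr hΔ.ne_zero⟩
  have hNR : (N : ℝ) ≠ 0 := by exact_mod_cast NeZero.ne N
  have hN : (N : ℂ) ≠ 0 := by exact_mod_cast NeZero.ne N
  have hΔM : (Δ : ℤ) ∣ Δ.natAbs := Int.dvd_natAbs_self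
  obtain ⟨A, hA⟩ := exists_norm_twistWeight_le N r k χ
  have hS : ∀ j : ℤ, Summable fun n : ℤ × ℤ × ℤ =>
      (twistWeight N r k χ j n.1 n.2.1 n.2.2 : ℂ) * kmKer N Δ.natAbs τ z n := fun j =>
    summable_weight_kmKer N Δ.natAbs τ.im_pos z.im_pos (w := fun n =>
      (twistWeight N r k χ j n.1 n.2.1 n.2.2 : ℂ)) fun n => hA _ _ _ _
  funext η
  obtain ⟨a₀, i, c₀, hη⟩ := dualElt_surj N (discRep η)
  have h1 : ((Mp2Z.S.mat • τ : ℍ) : ℂ) = -1 / τ := by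
    rw [coe_smul_eq]; simp [autFactor, Mp2Z.S, ModularGroup.S]
  rw [twistedTheta_eq hΔ hχ h hη, h1, kmSeries_inversion N Δ.natAbs τ.im_pos z.im_pos
    (w := fun a b c => (twistWeight N r k χ i a b c : ℂ)) (fun a b c => hA i a b c)
    (fun a b c => by
      rw [twistWeight_congr (b' := b) (c' := c) (a' := a) (by simp) (by simp) (by simp)])
    (fun a b c => by
      rw [twistWeight_congr (b' := b) (c' := c) (a' := a) (by simp)
        (by rw [add_sub_cancel_left, Nat.cast_mul]; simp only [Nat.cast_mul, Nat.cast_ofNat]; exact mul_dvd_mul_left _ hΔM) (by simp)])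
    (fun a b c => by
      rw [twistWeight_congr (b' := b) (c' := c) (a' := a) (by simp) (by simp) (by simp)])]
  have h2 : ∀ n : ℤ × ℤ × ℤ, weightFourier N Δ.natAbs
      (fun a b c => (twistWeight N r k χ i a b c : ℂ)) n.1 n.2.1 n.2.2 * kmKer N Δ.natAbs τ z n =
      (eighthRoot Δ.sign * eighthRoot (-1) * Δ.natAbs * (Real.sqrt Δ.natAbs : ℂ)) *
        ∑ j ∈ Finset.range (2 * N), zexp (2 * N) (Δ.sign * i * j) *
          ((twistWeight N r k χ j n.1 n.2.1 n.2.2 : ℂ) * kmKer N Δ.natAbs τ z n) := by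
    intro n
    rw [weightFourier_twistWeight hΔ hχ hprim h, Finset.sum_mul, Finset.mul_sum]
    exact Finset.sum_congr rfl fun j _ => by ring
  rw [tsum_congr h2, tsum_mul_left, ← mul_assoc, inversion_constant,
    Summable.tsum_finsetSum (f := fun (j : ℕ) (n : ℤ × ℤ × ℤ) => zexp (2 * N) (Δ.sign * i * j) *
      ((twistWeight N r k χ j n.1 n.2.1 n.2.2 : ℂ) * kmKer N Δ.natAbs τ z n))
      fun j _ => (hS j).mul_left _]
  simp only [tsum_mul_left]
  rw [weilRepTilde_S N hΔ.ne_zero, Pi.smul_apply, smul_eq_mul, mul_assoc]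
  congr 1
  rw [Matrix.mulVec, dotProduct, ← (baseEquiv N).sum_comp, Finset.mul_sum, Finset.sum_range]
  refine Finset.sum_congr rfl fun j _ => ?_
  obtain ⟨a, c, n, hj⟩ := baseEquiv_out N j
  -- The chosen representative of the class of j has middle coordinate j + 2Nn, and the weight does
  -- not see the multiple of 2N.
  have h3 : ∀ m : ℤ × ℤ × ℤ, (twistWeight N r k χ ((j : ℕ) + 2 * N * n) m.1 m.2.1 m.2.2 : ℂ) =
      twistWeight N r k χ (j : ℕ) m.1 m.2.1 m.2.2 := fun m =>
    periodic_eq_of_dvd (n := 2 * N)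
      (f := fun x => (twistWeight N r k χ x m.1 m.2.1 m.2.2 : ℂ))
      (fun x => by rw [twistWeight_add_index hΔ hχ h]) ⟨n, by push_cast; ring⟩
  rw [twistedTheta_eq hΔ hχ h hj]
  simp only [h3]
  rw [Matrix.of_apply, ← mul_assoc]
  congr 2
  rw [hη, hj]
  change _ = expe (-(Δ.sign * bilForm N (dualVec N a₀ i c₀) (dualVec N a _ c)))
  rw [bilForm_dualVec, expe, zexp, Complex.exp_eq_exp_iff_exists_int]
  refine ⟨Δ.sign * (a₀ * c + c₀ * a - i * n), ?_⟩
  push_cast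
  field_simp
  ring

theorem isModular_twistedTheta (hΔ : IsFundamentalDiscriminant Δ)
    (hχ : ∀ n, IsCoprime n Δ → χ (n : ZMod Δ.natAbs) = kroneckerSymbol Δ n)
    (hprim : ∀ c : ZMod Δ.natAbs, ¬ IsUnit c → ∃ u : (ZMod Δ.natAbs)ˣ, u * c = c ∧ χ u = -1)
    (h : Δ = r ^ 2 - 4 * N * k) (z : ℍ) :
    IsModularOfWeight 3 (weilRepTilde N Δ) fun τ : ℍ => twistedTheta N Δ r τ z := by
  intro g
  have hg : g ∈ Subgroup.closure {Mp2Z.S, Mp2Z.T} := by rw [Mp2Z.closure_eq_top]; trivial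
  induction hg using Subgroup.closure_induction with
  | mem x hx =>
    intro τ
    rcases hx with rfl | rfl
    · exact_mod_cast twistedTheta_S hΔ hχ hprim h τ z
    · have h1 : Mp2Z.T.fac τ = 1 := rfl
      rw [h1, one_zpow, one_smul]
      exact twistedTheta_T hΔ hχ h τ z
  | one => intro τ; simp [Mp2Z.mat_one, Mp2Z.fac_one]
  | mul x y _ _ hx hy =>
    intro τ
    rw [Mp2Z.mat_mul, mul_smul, hx, hy, Mp2Z.fac_mul, map_mul, ← Matrix.mulVec_mulVec,
      Matrix.mulVec_smul, smul_smul, mul_zpow]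
  | inv x _ hx =>
    intro τ
    have h1 := hx (x.mat⁻¹ • τ)
    dsimp only at h1 ⊢
    rw [smul_inv_smul] at h1
    rw [Mp2Z.mat_inv, Mp2Z.fac_inv, h1, Matrix.mulVec_smul, Matrix.mulVec_mulVec, ← map_mul,
      inv_mul_cancel, map_one, Matrix.one_mulVec, smul_smul, inv_zpow,
      inv_mul_cancel₀ (zpow_ne_zero 3 (x.fac_ne_zero _)), one_smul]

end

section

/-! ### Invariance under `Γ₀(N)` -/

/-- The action of `(α, β; N γ, δ)` on the coordinates of the dual lattice. -/
def gammaAct (N : ℕ) (α β γ δ : ℤ) (n : ℤ × ℤ × ℤ) : ℤ × ℤ × ℤ :=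
  (N * n.2.2 * β ^ 2 - n.2.1 * β * δ + n.1 * δ ^ 2,
    -2 * N * n.2.2 * α * β + n.2.1 * (α * δ + N * β * γ) - 2 * N * n.1 * γ * δ,
    n.2.2 * α ^ 2 - n.2.1 * α * γ + N * n.1 * γ ^ 2)

theorem gammaAct_inv {N : ℕ} {α β γ δ : ℤ} (hdet : α * δ - N * β * γ = 1) (n : ℤ × ℤ × ℤ) :
    gammaAct N δ (-β) (-γ) α (gammaAct N α β γ δ n) = n := by
  have h2 : (α * δ - N * β * γ) ^ 2 = 1 := by rw [hdet]; ring
  refine Prod.ext ?_ (Prod.ext ?_ ?_)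
  · simp only [gammaAct]
    linear_combination n.1 * h2
  · simp only [gammaAct]
    linear_combination n.2.1 * h2
  · simp only [gammaAct]
    linear_combination n.2.2 * h2

/-- The action of a matrix in `Γ₀(N)` as a permutation. -/
def gammaEquiv {N : ℕ} {α β γ δ : ℤ} (hdet : α * δ - N * β * γ = 1) :
    ℤ × ℤ × ℤ ≃ ℤ × ℤ × ℤ where
  toFun := gammaAct N α β γ δ
  invFun := gammaAct N δ (-β) (-γ) α
  left_inv := gammaAct_inv hdet
  right_inv n := by
    have := gammaAct_inv (N := N) (α := δ) (β := -β) (γ := -γ) (δ := α)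
      (by linear_combination hdet) n
    simpa using this

theorem gammaAct_disc {N : ℕ} {α β γ δ : ℤ} (hdet : α * δ - N * β * γ = 1) (n : ℤ × ℤ × ℤ) :
    (gammaAct N α β γ δ n).2.1 ^ 2 -
      4 * N * (gammaAct N α β γ δ n).1 * (gammaAct N α β γ δ n).2.2 =
      n.2.1 ^ 2 - 4 * N * n.1 * n.2.2 := by
  have h2 : (α * δ - N * β * γ) ^ 2 = 1 := by rw [hdet]; ring
  simp only [gammaAct]
  linear_combination (n.2.1 ^ 2 - 4 * N * n.1 * n.2.2) * h2

/-- For every factorization N = N₁N₂ the substitution is integral of determinant αδ − Nβγ = 1, so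
each form [N₁a, b, N₂c] is carried to an equivalent one with the same N₁ and N₂. -/
theorem isRepresented_gammaAct {N : ℕ} {α β γ δ : ℤ} {n : ℤ × ℤ × ℤ} {x : ℤ}
    (h : IsRepresented N (gammaAct N α β γ δ n).1 (gammaAct N α β γ δ n).2.1
      (gammaAct N α β γ δ n).2.2 x) : IsRepresented N n.1 n.2.1 n.2.2 x := by
  obtain ⟨N₁, N₂, hN, X, Y, hx⟩ := h
  refine ⟨N₁, N₂, hN, δ * X - N₂ * γ * Y, α * Y - β * N₁ * X, ?_⟩
  rw [hx]
  simp only [gammaAct, ← hN]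
  push_cast
  ring

theorem gcd_gammaAct {N : ℕ} {Δ α β γ δ : ℤ} {n : ℤ × ℤ × ℤ}
    (h : Int.gcd (Int.gcd (gammaAct N α β γ δ n).1 (gammaAct N α β γ δ n).2.1)
      (Int.gcd (gammaAct N α β γ δ n).2.2 Δ) = 1) :
    Int.gcd (Int.gcd n.1 n.2.1) (Int.gcd n.2.2 Δ) = 1 := by
  set d : ℤ := (Int.gcd (Int.gcd n.1 n.2.1) (Int.gcd n.2.2 Δ) : ℤ) with hd
  have h12 : d ∣ Int.gcd n.1 n.2.1 := Int.gcd_dvd_left _ _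
  have h34 : d ∣ Int.gcd n.2.2 Δ := Int.gcd_dvd_right _ _
  have ha : d ∣ n.1 := h12.trans (Int.gcd_dvd_left _ _)
  have hb : d ∣ n.2.1 := h12.trans (Int.gcd_dvd_right _ _)
  have hc : d ∣ n.2.2 := h34.trans (Int.gcd_dvd_left _ _)
  have hD : d ∣ Δ := h34.trans (Int.gcd_dvd_right _ _)
  obtain ⟨a, ha⟩ := ha
  obtain ⟨b, hb⟩ := hb
  obtain ⟨c, hc⟩ := hc
  have h1 : d ∣ (1 : ℤ) := by
    have h' : ((1 : ℕ) : ℤ) = 1 := rfl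
    rw [← h', ← h]
    refine Int.dvd_coe_gcd (Int.dvd_coe_gcd ?_ ?_) (Int.dvd_coe_gcd ?_ hD)
    · exact ⟨N * c * β ^ 2 - b * β * δ + a * δ ^ 2, by simp only [gammaAct]; rw [ha, hb, hc]; ring⟩
    · exact ⟨-2 * N * c * α * β + b * (α * δ + N * β * γ) - 2 * N * a * γ * δ, by
        simp only [gammaAct]; rw [ha, hb, hc]; ring⟩
    · exact ⟨c * α ^ 2 - b * α * γ + N * a * γ ^ 2, by
        simp only [gammaAct]; rw [ha, hb, hc]; ring⟩
  exact Int.ofNat_inj.mp (Int.eq_one_of_dvd_one (Int.natCast_nonneg _) h1)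

theorem genusCharForm_gammaAct {N : ℕ} {Δ α β γ δ : ℤ} (hdet : α * δ - N * β * γ = 1)
    (n : ℤ × ℤ × ℤ) :
    genusCharForm N Δ (gammaAct N α β γ δ n).1 (gammaAct N α β γ δ n).2.1
      (gammaAct N α β γ δ n).2.2 = genusCharForm N Δ n.1 n.2.1 n.2.2 := by
  have hdet' : δ * α - N * (-β) * (-γ) = 1 := by linear_combination hdet
  have hinv := gammaAct_inv hdet n
  -- Equality of the predicates, not mere equivalence, is used so that the choice operator returns
  -- the same integer on both sides.
  have hrep : ∀ x, IsRepresented N (gammaAct N α β γ δ n).1 (gammaAct N α β γ δ n).2.1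
      (gammaAct N α β γ δ n).2.2 x = IsRepresented N n.1 n.2.1 n.2.2 x := fun x =>
    propext ⟨isRepresented_gammaAct, fun hx =>
      isRepresented_gammaAct (α := δ) (β := -β) (γ := -γ) (δ := α) (by rwa [hinv])⟩
  have hgcd : Int.gcd (Int.gcd (gammaAct N α β γ δ n).1 (gammaAct N α β γ δ n).2.1)
      (Int.gcd (gammaAct N α β γ δ n).2.2 Δ) = 1 ↔
      Int.gcd (Int.gcd n.1 n.2.1) (Int.gcd n.2.2 Δ) = 1 :=
    ⟨gcd_gammaAct, fun hx =>
      gcd_gammaAct (α := δ) (β := -β) (γ := -γ) (δ := α) (by rwa [hinv])⟩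
  unfold genusCharForm
  rw [gammaAct_disc hdet]
  simp only [hrep]
  split_ifs with h1 h2 h2
  · rfl
  · exact absurd ⟨h1.1, h1.2.1, hgcd.mp h1.2.2⟩ h2
  · exact absurd ⟨h2.1, h2.2.1, hgcd.mpr h2.2.2⟩ h1
  · rfl

variable {N : ℕ} [NeZero N] {Δ r k : ℤ} {χ : MulChar (ZMod Δ.natAbs) ℤ}

/-- Since αδ + Nβγ = 1 + 2Nβγ, b is preserved modulo 2N; since the discriminant is preserved, so is
the determinant of the hermitian form. The weight is then the genus character, which is invariant.
-/
theorem twistWeight_gammaAct (hΔ : IsFundamentalDiscriminant Δ)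
    (hχ : ∀ n, IsCoprime n Δ → χ (n : ZMod Δ.natAbs) = kroneckerSymbol Δ n)
    (h : Δ = r ^ 2 - 4 * N * k) {α β γ δ : ℤ} (hdet : α * δ - N * β * γ = 1) (i : ℤ)
    {n : ℤ × ℤ × ℤ} (hw : twistWeight N r k χ i n.1 n.2.1 n.2.2 ≠ 0) :
    twistWeight N r k χ i (gammaAct N α β γ δ n).1 (gammaAct N α β γ δ n).2.1
      (gammaAct N α β γ δ n).2.2 = twistWeight N r k χ i n.1 n.2.1 n.2.2 := by
  obtain ⟨t, m, hb, hm⟩ := dvd_of_twistWeight_ne_zero hw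
  obtain ⟨t', ht'⟩ : ∃ t', (gammaAct N α β γ δ n).2.1 = r * i + 2 * N * t' :=
    ⟨t - n.2.2 * α * β + n.2.1 * β * γ - n.1 * γ * δ, by
      simp only [gammaAct]
      linear_combination n.2.1 * hdet + hb⟩
  have hN : (4 * N : ℤ) ≠ 0 := by
    have := NeZero.ne N
    positivity
  have hm' : (gammaAct N α β γ δ n).1 * (gammaAct N α β γ δ n).2.2 -
      binForm (N : ℤ) r k (t', i) = Δ * m := by
    have hd := gammaAct_disc hdet n
    rw [disc_eq_of_dvd h hb hm, ht'] at hd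
    apply mul_left_cancel₀ hN
    simp only [binForm]
    linear_combination -hd - i ^ 2 * h
  rw [twistWeight_eq (t := t') (by rw [ht']; push_cast; ring),
    twistWeight_eq (t := t) (b := n.2.1) (by rw [hb]; push_cast; ring),
    hermChar_eq_genusCharForm hΔ hχ h ht' ⟨m, hm'⟩, hermChar_eq_genusCharForm hΔ hχ h hb ⟨m, hm⟩,
    genusCharForm_gammaAct hdet]

theorem twistWeight_gammaAct_eq (hΔ : IsFundamentalDiscriminant Δ)
    (hχ : ∀ n, IsCoprime n Δ → χ (n : ZMod Δ.natAbs) = kroneckerSymbol Δ n)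
    (h : Δ = r ^ 2 - 4 * N * k) {α β γ δ : ℤ} (hdet : α * δ - N * β * γ = 1) (i : ℤ)
    (n : ℤ × ℤ × ℤ) :
    twistWeight N r k χ i (gammaAct N α β γ δ n).1 (gammaAct N α β γ δ n).2.1
      (gammaAct N α β γ δ n).2.2 = twistWeight N r k χ i n.1 n.2.1 n.2.2 := by
  by_cases hw : twistWeight N r k χ i n.1 n.2.1 n.2.2 = 0
  · by_contra hne
    have h1 : twistWeight N r k χ i (gammaAct N α β γ δ n).1 (gammaAct N α β γ δ n).2.1
      (gammaAct N α β γ δ n).2.2 ≠ 0 := fun h0 => hne (h0.trans hw.symm)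
    have h2 := twistWeight_gammaAct hΔ hχ h (α := δ) (β := -β) (γ := -γ) (δ := α)
      (by linear_combination hdet) i h1
    rw [gammaAct_inv hdet] at h2
    exact hne h2.symm
  · exact twistWeight_gammaAct hΔ hχ h hdet i hw

/-! ### Equivariance of the kernel and of the invariant two-form -/

theorem im_smul_eq_div_normSq_autFactor (g : SL(2, ℤ)) (z : ℍ) :
    (g • z).im = z.im / Complex.normSq (autFactor g z) := by
  have := ModularGroup.im_smul_eq_div_normSq g z
  simpa [autFactor, UpperHalfPlane.denom] using this

/-- Equivariance of (λ, λ(z)). The factor |cz + d|² cancels against the change of Im z in `kmScale`.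
-/
theorem kmLin_gammaAct (N : ℕ) {g : SL(2, ℤ)} {γ : ℤ} (hγ : g 1 0 = N * γ) (z : ℍ)
    (n : ℤ × ℤ × ℤ) :
    kmLin N z (gammaAct N (g 0 0) (g 0 1) γ (g 1 1) n) =
      Complex.normSq (autFactor g z) * kmLin N ((g • z : ℍ) : ℂ) n := by
  have h0 : Complex.normSq (autFactor g z) ≠ 0 :=
    (Complex.normSq_pos.mpr (autFactor_ne_zero g z)).ne'
  have hre : ((g • z : ℍ) : ℂ).re = (((g 0 0 : ℂ) * z + g 0 1) * conj (autFactor g z)).re /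
      Complex.normSq (autFactor g z) := by
    rw [coe_smul_eq, Complex.div_re, Complex.mul_re, Complex.conj_re, Complex.conj_im]
    ring
  have hγR : (g 1 0 : ℝ) = N * γ := by exact_mod_cast congrArg (Int.cast : ℤ → ℝ) hγ
  have e1 : (autFactor g z).re = g 1 0 * (z : ℂ).re + g 1 1 := by simp [autFactor]
  have e2 : (autFactor g z).im = g 1 0 * (z : ℂ).im := by simp [autFactor]
  rw [kmLin, kmLin, hre, coe_smul_eq, Complex.normSq_div, mul_add, mul_sub]
  have e3 : Complex.normSq (autFactor g z) * (n.2.1 * ((((g 0 0 : ℂ) * z + g 0 1) *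
      conj (autFactor g z)).re / Complex.normSq (autFactor g z))) =
      n.2.1 * (((g 0 0 : ℂ) * z + g 0 1) * conj (autFactor g z)).re := by field_simp
  have e4 : Complex.normSq (autFactor g z) * (N * n.2.2 * (Complex.normSq ((g 0 0 : ℂ) * z + g 0 1) /
      Complex.normSq (autFactor g z))) = N * n.2.2 * Complex.normSq ((g 0 0 : ℂ) * z + g 0 1) := by
    field_simp
  rw [e3, e4, Complex.normSq_apply (autFactor g z), Complex.mul_re, Complex.conj_re,
    Complex.conj_im, e1, e2, hγR, Complex.normSq_apply, Complex.normSq_apply]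
  simp [gammaAct]
  ring

theorem kmKer_gammaAct (N M : ℕ) [NeZero N] {g : SL(2, ℤ)} {γ : ℤ} (hγ : g 1 0 = N * γ) (τ : ℂ)
    (z : ℍ) (n : ℤ × ℤ × ℤ) :
    kmKer N M τ z (gammaAct N (g 0 0) (g 0 1) γ (g 1 1) n) = kmKer N M τ ((g • z : ℍ) : ℂ) n := by
  have hN : (N : ℂ) ≠ 0 := by exact_mod_cast NeZero.ne N
  have h0 : Complex.normSq (autFactor g z) ≠ 0 :=
    (Complex.normSq_pos.mpr (autFactor_ne_zero g z)).ne'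
  have hdet : g 0 0 * g 1 1 - N * g 0 1 * γ = 1 := by
    have h := g.det_coe
    rw [Matrix.det_fin_two, hγ] at h
    linear_combination h
  have hdisc : (((gammaAct N (g 0 0) (g 0 1) γ (g 1 1) n).1 : ℂ) *
      (gammaAct N (g 0 0) (g 0 1) γ (g 1 1) n).2.2 -
      ((gammaAct N (g 0 0) (g 0 1) γ (g 1 1) n).2.1 : ℂ) ^ 2 / (4 * N)) =
      n.1 * n.2.2 - (n.2.1 : ℂ) ^ 2 / (4 * N) := by
    have := congrArg (Int.cast : ℤ → ℂ) (gammaAct_disc hdet n)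
    push_cast at this
    field_simp
    linear_combination -this
  have hsq : kmScale N M τ z * kmLin N z (gammaAct N (g 0 0) (g 0 1) γ (g 1 1) n) ^ 2 =
      kmScale N M τ ((g • z : ℍ) : ℂ) * kmLin N ((g • z : ℍ) : ℂ) n ^ 2 := by
    have hy := z.im_pos.ne'
    rw [kmLin_gammaAct N hγ, kmScale, kmScale, coe_im, coe_im, im_smul_eq_div_normSq_autFactor]
    field_simp
  have hsqC : (kmScale N M τ z : ℂ) *
      (kmLin N z (gammaAct N (g 0 0) (g 0 1) γ (g 1 1) n) : ℂ) ^ 2 =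
      kmScale N M τ ((g • z : ℍ) : ℂ) * (kmLin N ((g • z : ℍ) : ℂ) n : ℂ) ^ 2 := by
    exact_mod_cast congrArg (Complex.ofReal) hsq
  rw [kmKer, kmKer, mul_assoc (-π : ℂ), mul_assoc (-π : ℂ), hsqC, hdisc]

theorem twistedTheta_gamma0 (hΔ : IsFundamentalDiscriminant Δ)
    (hχ : ∀ n, IsCoprime n Δ → χ (n : ZMod Δ.natAbs) = kroneckerSymbol Δ n)
    (h : Δ = r ^ 2 - 4 * N * k) {g : SL(2, ℤ)} (hg : g ∈ CongruenceSubgroup.Gamma0 N) (τ z : ℍ) :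
    twistedTheta N Δ r τ (g • z) = twistedTheta N Δ r τ z := by
  obtain ⟨γ, hγ⟩ := (ZMod.intCast_zmod_eq_zero_iff_dvd _ _).mp (CongruenceSubgroup.Gamma0_mem.mp hg)
  have hdet : g 0 0 * g 1 1 - N * g 0 1 * γ = 1 := by
    have h := g.det_coe
    rw [Matrix.det_fin_two, hγ] at h
    linear_combination h
  funext η
  obtain ⟨a₀, i, c₀, hη⟩ := dualElt_surj N (discRep η)
  rw [twistedTheta_eq hΔ hχ h hη, twistedTheta_eq hΔ hχ h hη, ← (gammaEquiv hdet).tsum_eq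
    (fun n : ℤ × ℤ × ℤ => _ * kmKer N Δ.natAbs τ z n)]
  refine tsum_congr fun n => ?_
  change _ = (twistWeight N r k χ i (gammaAct N (g 0 0) (g 0 1) γ (g 1 1) n).1
    (gammaAct N (g 0 0) (g 0 1) γ (g 1 1) n).2.1
    (gammaAct N (g 0 0) (g 0 1) γ (g 1 1) n).2.2 : ℂ) *
      kmKer N Δ.natAbs τ z (gammaAct N (g 0 0) (g 0 1) γ (g 1 1) n)
  rw [twistWeight_gammaAct_eq hΔ hχ h hdet, kmKer_gammaAct N Δ.natAbs hγ]

theorem deriv_smul (g : SL(2, ℤ)) (z : ℍ) :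
    deriv (fun ζ : ℂ => ((g • ofComplex ζ : ℍ) : ℂ)) z = 1 / autFactor g z ^ 2 := by
  have h0 : (g 1 0 : ℂ) * z + g 1 1 ≠ 0 := autFactor_ne_zero g z
  have heq : (fun ζ : ℂ => ((g • ofComplex ζ : ℍ) : ℂ)) =ᶠ[nhds (z : ℂ)]
      fun ζ => ((g 0 0 : ℂ) * ζ + g 0 1) / ((g 1 0 : ℂ) * ζ + g 1 1) := by
    filter_upwards [(isOpen_lt continuous_const Complex.continuous_im).mem_nhds z.im_pos] with w hw
    rw [coe_smul_eq, autFactor, ofComplex_apply_of_im_pos hw]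
  have h1 : HasDerivAt (fun ζ : ℂ => (g 0 0 : ℂ) * ζ + g 0 1) (g 0 0 : ℂ) z := by
    simpa using ((hasDerivAt_id (z : ℂ)).const_mul (g 0 0 : ℂ)).add_const (g 0 1 : ℂ)
  have h2 : HasDerivAt (fun ζ : ℂ => (g 1 0 : ℂ) * ζ + g 1 1) (g 1 0 : ℂ) z := by
    simpa using ((hasDerivAt_id (z : ℂ)).const_mul (g 1 0 : ℂ)).add_const (g 1 1 : ℂ)
  rw [heq.deriv_eq, (h1.fun_div h2 h0).deriv, autFactor]
  congr 1
  linear_combination det_eq g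

theorem omegaForm_smul (g : SL(2, ℤ)) (z : ℍ) (u w : ℂ) :
    omegaForm (g • z) (deriv (fun ζ : ℂ => ((g • ofComplex ζ : ℍ) : ℂ)) z * u)
      (deriv (fun ζ : ℂ => ((g • ofComplex ζ : ℍ) : ℂ)) z * w) = omegaForm z u w := by
  have h0 := autFactor_ne_zero g z
  have h0' : conj (autFactor g z) ≠ 0 := by simpa using h0
  have hy : (z.im : ℂ) ≠ 0 := by exact_mod_cast z.im_pos.ne'
  rw [deriv_smul, omegaForm, omegaForm, im_smul_eq_div_normSq_autFactor]
  push_cast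
  rw [← Complex.mul_conj]
  simp only [map_mul, map_div₀, map_one, map_pow]
  field_simp

end

end TwistedKM

theorem proposition4p1 (N : ℕ) [NeZero N] (Δ r : ℤ)
    (hΔ : TwistedKM.IsFundamentalDiscriminant Δ) (hr : Δ ≡ r ^ 2 [ZMOD 4 * N]) :
    -- all the theta series converge absolutely
    (∀ (δ : TwistedKM.DiscGroup N Δ) (τ z : ℍ),
      Summable fun l : TwistedKM.discCoset δ =>
        TwistedKM.phi N Δ (l : TwistedKM.dualLattice N) τ z) ∧
    -- the twisted theta function is smooth in both variables
    (∀ h : TwistedKM.BaseGroup N,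
      ContDiffOn ℝ ∞
        (fun p : ℂ × ℂ => TwistedKM.twistedTheta N Δ r (ofComplex p.1) (ofComplex p.2) h)
        {p : ℂ × ℂ | 0 < p.1.im ∧ 0 < p.2.im}) ∧
    -- it is modular of weight 3/2 in the first variable
    (∀ z : ℍ, TwistedKM.IsModularOfWeight 3 (TwistedKM.weilRepTilde N Δ)
      fun τ : ℍ => TwistedKM.twistedTheta N Δ r τ z) ∧
    -- it is automorphic of weight 0 in the second variable
    (∀ γ ∈ CongruenceSubgroup.Gamma0 N, ∀ τ z : ℍ,
      TwistedKM.twistedTheta N Δ r τ (γ • z) = TwistedKM.twistedTheta N Δ r τ z) ∧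
    -- as a two-form it is invariant under pullback
    (∀ γ ∈ CongruenceSubgroup.Gamma0 N, ∀ (τ z : ℍ) (u w : ℂ),
      TwistedKM.twistedThetaForm N Δ r τ (γ • z)
          (deriv (fun ζ : ℂ => ((γ • ofComplex ζ : ℍ) : ℂ)) z * u)
          (deriv (fun ζ : ℂ => ((γ • ofComplex ζ : ℍ) : ℂ)) z * w) =
        TwistedKM.twistedThetaForm N Δ r τ z u w) := by

  -- The integer k' completes N and r to the form Nt² + rth + k'h² of discriminant Δ, on which the
  -- whole arithmetic rests.
  obtain ⟨k', hk'⟩ := hr.dvd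
  have h : Δ = r ^ 2 - 4 * N * k' := by linear_combination -hk'
  obtain ⟨χ, hχ, hprim⟩ := hΔ.exists_char
  refine ⟨fun δ τ z => (TwistedKM.summable_phi N hΔ.ne_zero τ z).subtype _,
    TwistedKM.contDiffOn_twistedTheta hΔ hχ h, TwistedKM.isModular_twistedTheta hΔ hχ hprim h,
    fun γ hγ τ z => TwistedKM.twistedTheta_gamma0 hΔ hχ h hγ τ z, fun γ hγ τ z u w => ?_⟩
  funext η
  rw [TwistedKM.twistedThetaForm, TwistedKM.twistedThetaForm,
    TwistedKM.twistedTheta_gamma0 hΔ hχ h hγ, TwistedKM.omegaForm_smul]
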